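/- **Setting.** Let $P$ be a probability distribution on $\mathcal X\times\mathcal Y$, let $D\subseteq\mathbb R$ be a convex set of predictions and let $\ell\colon\mathcal Y\times D\to\mathbb R$ be a measurable loss such that, for each $y\in\mathcal Y$, the map $\hat y\mapsto \ell(y,\hat y)$ is $\alpha$-strongly convex and $L$-Lipschitz on $D$, where $\alpha,L>0$. Put $\eta=\alpha/L^2$. Let $\mathcal F$ be a countable family of measurable functions $f\colon\mathcal X\to D$ and $\pi$ a prior distribution on $\mathcal F$. For a predictor $h\colon\mathcal X\to D$ and $z=(x,y)$ write $\ell_h(z)=\ell(y,h(x))$. Assume that $\sup_{f,f'\in\mathcal F}|\ell_f(z)-\ell_{f'}(z)|\le B$ for $P$-almost every $z$, and that $f^*\in\mathcal F$ is a risk minimizer over $\mathcal F$: $\mathbb E_{Z\sim P}[\ell_f(Z)-\ell_{f^*}(Z)]\ge 0$ for all $f\in\mathcal F$. For an integer $m\geq 1$, the $\eta$-generalized expected Bayesian redundancy is $$\mathrm{BR}(m)=\inf_{\rho}\Big\{\mathbb E_{Z}\big[\mathbb E_{f\sim\rho}[\ell_f(Z)]-\ell_{f^*}(Z)\big]+\frac{D(\rho\,\|\,\pi)}{\eta(m+1)}\Big\},$$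 where $\rho$ ranges over the probability distributions on $\mathcal F$ and $D(\cdot\|\cdot)$ is the Kullback–Leibler divergence. **Algorithm PM-CB.** The progressive mixture rule (with prior $\pi$ and learning rate $\eta$) maps a sample $z_1,\dots,z_m$ to the predictor $\frac1{m+1}\sum_{t=0}^m \mathbb E_{f\sim p_t}[f(\cdot)]$, where $p_t(f)\propto \pi(f)\exp(-\eta\sum_{s\le t}\ell_f(z_s))$. Let $0<\delta<1$, $K=\lceil\log(3/\delta)\rceil$, and let $n\geq 1$ be divisible by $4K$. PM-CB receives independent samples $\mathbf Z_1,\dots,\mathbf Z_{2K}$, each of $n/(4K)$ i.i.d. points from $P$, and $\mathbf Z_{\mathrm{II}}$, of $n/2$ i.i.d. points from $P$. 1. For $j=1,\dots,K$, let $\hat f_j$ be the output of the progressive mixture rule on $\mathbf Z_j$. 2. (ConfidenceBoost with ERM over the convex hull.) For $j=1,\dots,K$, let $\hat g_j$ be an empirical risk minimizer over $\mathrm{conv}\{\hat f_1,\dots,\hat f_K\}$ on $\mathbf Z_{K+j}$, where the same ERM rule (a function of $\hat f_1,\dots,\hat f_K$ and of the sample, with an arbitrary measurable way of breaking ties) is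 used for each $j$. Return an empirical risk minimizer $\hat f$ over $\{\hat g_1,\dots,\hat g_K\}$ on $\mathbf Z_{\mathrm{II}}$, with ties broken arbitrarily. **Theorem.** For every $\delta_0<1$ there is a constant $C$, depending on $\delta_0$ only, such that in every such setting, for all $\delta\in(0,\delta_0]$ and all $n\ge 1$ divisible by $4K$, with probability at least $1-\delta$ the output $\hat f$ of PM-CB satisfies $$\mathbb E_{Z\sim P}\big[\ell_{\hat f}(Z)-\ell_{f^*}(Z)\big]\le e\cdot \mathrm{BR}\Big(\frac{n}{4\lceil\log(3/\delta)\rceil}\Big)+C\left(\frac{\big(\log\frac1\delta\big)^2}{\eta n}+\frac{B\log\frac1\delta}{n}\right).$$ -/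

import Mathlib

open MeasureTheory

universe u v w

noncomputable section

/-- The loss `ℓ_h(z) = ℓ(y, h(x))` of a predictor `h` at the point `z = (x, y)`. -/
def predLoss {X : Type u} {Y : Type v} (ℓ : Y → ℝ → ℝ) (h : X → ℝ) (z : X × Y) : ℝ :=
  ℓ z.2 (h z.1)

/-- The excess risk `E_Z [ℓ_h(Z) - ℓ_{h'}(Z)]` of `h` over the comparator `h'`. -/
def excessRisk {X : Type u} {Y : Type v} [MeasurableSpace X] [MeasurableSpace Y]
    (ℓ : Y → ℝ → ℝ) (P : Measure (X × Y)) (h h' : X → ℝ) : ℝ :=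
  ∫ z, (predLoss ℓ h z - predLoss ℓ h' z) ∂P

/-- `h` is an empirical risk minimizer over the class `G` on the sample `S`. -/
def IsERM {X : Type u} {Y : Type v} (ℓ : Y → ℝ → ℝ) (G : Set (X → ℝ)) {N : ℕ}
    (S : Fin N → X × Y) (h : X → ℝ) : Prop :=
  h ∈ G ∧ ∀ g ∈ G, (∑ t, predLoss ℓ h (S t)) / N ≤ (∑ t, predLoss ℓ g (S t)) / N

/-- `A` is ERM, with some rule for breaking ties, over the class `cls g` built from the finitely
many predictors `g`: it returns an empirical risk minimizer whenever there is one. -/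
def IsERMRule {X : Type u} {Y : Type v} (ℓ : Y → ℝ → ℝ) {k N : ℕ}
    (cls : (Fin k → X → ℝ) → Set (X → ℝ))
    (A : (Fin k → X → ℝ) → (Fin N → X × Y) → X → ℝ) : Prop :=
  ∀ (g : Fin k → X → ℝ) (S : Fin N → X × Y),
    (∃ h, IsERM ℓ (cls g) S h) → IsERM ℓ (cls g) S (A g S)

/-- The exponential weights distribution on experts after the first `t` points of the sample:
its density with respect to the prior is proportional to `exp (-η ∑_{s < t} ℓ_{f_i}(z_s))`. -/
def expWeights {X : Type u} {Y : Type v} {ι : Type w} [MeasurableSpace ι]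
    (ℓ : Y → ℝ → ℝ) (f : ι → X → ℝ) (prior : Measure ι) (η : ℝ) {m : ℕ}
    (S : Fin m → X × Y) (t : ℕ) : Measure ι :=
  prior.tilted fun i => -η * ∑ s : Fin m with s.val < t, predLoss ℓ (f i) (S s)

/-- The progressive mixture rule with learning rate `η`: the average over `t = 0, …, m` of the
posterior mean predictors after `t` points. -/
def progMix {X : Type u} {Y : Type v} {ι : Type w} [MeasurableSpace ι]
    (ℓ : Y → ℝ → ℝ) (f : ι → X → ℝ) (prior : Measure ι) (η : ℝ) {m : ℕ}
    (S : Fin m → X × Y) (x : X) : ℝ :=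
  (∑ t ∈ Finset.range (m + 1), ∫ i, f i x ∂(expWeights ℓ f prior η S t)) / (m + 1)

/-- ConfidenceBoost: run the learner `A` on each of the `K` samples `S j`, then select among the
`K` resulting predictors with `erm` on the fresh sample `T`. -/
def confidenceBoost {X : Type u} {Y : Type v} {K m N : ℕ}
    (A : (Fin m → X × Y) → X → ℝ) (erm : (Fin K → X → ℝ) → (Fin N → X × Y) → X → ℝ)
    (S : Fin K → Fin m → X × Y) (T : Fin N → X × Y) : X → ℝ :=
  erm (fun j => A (S j)) T

/-- PM-CB: the progressive mixture rule on each of the first `K` samples, then ConfidenceBoost of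
`ermHull` (ERM over the convex hull of the `K` progressive mixtures) on the last `K` samples and
the sample `T`. -/
def pmcb {X : Type u} {Y : Type v} {ι : Type w} [MeasurableSpace ι]
    (ℓ : Y → ℝ → ℝ) (f : ι → X → ℝ) (prior : Measure ι) (η : ℝ) {K m N : ℕ}
    (ermHull : (Fin K → X → ℝ) → (Fin m → X × Y) → X → ℝ)
    (ermFin : (Fin K → X → ℝ) → (Fin N → X × Y) → X → ℝ)
    (S : Fin (K + K) → Fin m → X × Y) (T : Fin N → X × Y) : X → ℝ :=
  confidenceBoost (ermHull fun j => progMix ℓ f prior η (S (Fin.castAdd K j))) ermFin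
    (fun j => S (Fin.natAdd K j)) T

/-- The law of the input of PM-CB: `2K` independent samples of `m` i.i.d. points, and an
independent sample of `N` i.i.d. points. -/
def sampleLaw {X : Type u} {Y : Type v} [MeasurableSpace X] [MeasurableSpace Y]
    (P : Measure (X × Y)) (K m N : ℕ) :
    Measure ((Fin (K + K) → Fin m → X × Y) × (Fin N → X × Y)) :=
  (Measure.pi fun _ => Measure.pi fun _ => P).prod (Measure.pi fun _ => P)

/-- The `η`-generalized expected Bayesian redundancy at sample size `n`, with comparator `fstar`.
The distributions `ρ` with infinite divergence from the prior do not affect the infimum. -/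
def bayesRedundancy {X : Type u} {Y : Type v} {ι : Type w} [MeasurableSpace X]
    [MeasurableSpace Y] [MeasurableSpace ι]
    (ℓ : Y → ℝ → ℝ) (P : Measure (X × Y)) (f : ι → X → ℝ) (fstar : X → ℝ)
    (prior : Measure ι) (η : ℝ) (n : ℕ) : ℝ :=
  ⨅ ρ : {ρ : ProbabilityMeasure ι // InformationTheory.klDiv (ρ : Measure ι) prior ≠ ⊤},
    ((∫ z, ((∫ i, predLoss ℓ (f i) z ∂(ρ.1 : Measure ι)) - predLoss ℓ fstar z) ∂P)
      + (InformationTheory.klDiv (ρ.1 : Measure ι) prior).toReal / (η * (n + 1)))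

/-- The number `⌈log (3 / δ)⌉` of runs. -/
def numRuns (δ : ℝ) : ℕ := ⌈Real.log (3 / δ)⌉₊

end

/-!
After the predictions are multiplied by `α / L` and the losses by `η = α / L ^ 2`, the loss is
`1`-strongly convex and `1`-Lipschitz (`NormLoss`), hence bounded by `1 / 2` once the loss of the
risk minimizer is subtracted. The parameters, and the bound `B`, disappear. What has to be shown is
that the excess risk is at most `e` times the redundancy plus a constant times `K ^ 2 / n`, with
`K = ⌈log (3 / δ)⌉`.

**A single progressive mixture.** The heart of the matter is `exists_regret_tail`: for each mixing
distribution `ρ`, with divergence `Λ` from the prior, the regret `m + 1` times `R(f̂) - R(ρ)` of a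
progressive mixture `f̂` exceeds `e Λ + s₀` with probability at most `1 / e`, where `s₀` is a universal
constant. Since the regret may be negative, this does not follow from a bound in expectation. It is
proved along the path of the posterior means.

The exponential weights analysis (`regret_le`) gives two bounds on an event of large probability.
The regret is at most `M_m + Λ + 1` minus half the spread of the posterior means around their
average, where `M` is the martingale of the differences between the loss of `ρ` and of the posterior
means. The regret is also at most a combination with positive weights (`facet`) of the values of `M`
at the end, at a time of the second half and at a time of the last fifth, plus `2 Λ` and a constant;
this uses a second supermartingale (`mixMart`) and the strong convexity of the loss. Since `2 ≤ e`, a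
path of large regret has nonnegative combinations at all these times.

For a random walk this event has probability less than `1 / e`. For Gaussian steps this is
`exists_gaussian_facets_lt`: the reversed running means form a walk independent of the last mean, and
the reflection principle together with the convexity of the Gaussian tail reduce the event to a planar
wedge of measure `1 / 2 - arctan 0.445 / π < 1 / e`. The central limit theorem for block sums
transfers this to bounded independent steps (`exists_facetsGe_le`). The martingale `M` is compared
with such a walk as follows. By Freedman's inequality, a large `M` forces a large variance of the gain
of the final predictor, of some order `θ ^ 16`, while `M` and hence the spread of the posterior means
are of smaller order (`exists_atScale`). So the average predictor has nearly its final form already at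
an early stopping time (`scaleTime`). After this time `M` is, up to smaller terms, the sum of the
independent gains of the average predictor at this time (`facetsGe_of_scaleTime`).

**Boosting.** All of `K` independent runs exceed this bound with probability at most `exp (-K) ≤ δ / 3`
(`pi_forall_mem_le`). In the second stage, empirical risk minimization over the convex hull of the `K`
results has expected excess risk `2 K / (m + 1)` over the minimum on the hull
(`integral_risk_hull_erm_le`): the leave-one-out change at a point is bounded by its leverage in a
space of dimension `K`. Markov's inequality and independence show that one of the `K` minimizers is
good up to the factor `e`, except with probability `δ / 3`. In the last stage (`selection_tail`), the
margin of the risk minimizer over the hull bounds the variance of the loss differences by their mean,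
and Bernstein's inequality shows that the selection loses at most a factor `3` and
`32 log (6 K / δ)` over the sample size. The sum of these errors is `add_stage_errors`.
-/

set_option linter.unusedSectionVars false

open ProbabilityTheory

/-! ### Normalized losses -/

/-- A loss `ℓ z v` of the prediction `v ∈ D` at the observation `z`, normalized so that it is
`1`-strongly convex and `1`-Lipschitz in `v`. Both properties are expressed through the quadratic
minorants at the points of `D`; the bound `1 / 2` is what they leave of a loss that vanishes
somewhere on `D`. -/
structure NormLoss {Z : Type*} [MeasurableSpace Z] (D : Set ℝ) (ℓ : Z → ℝ → ℝ) : Prop where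
  convex : Convex ℝ D
  meas : Measurable (Function.uncurry ℓ)
  tangent : ∀ z, ∀ g ∈ D, ∃ q : ℝ, |q| ≤ 1 ∧
    ∀ v ∈ D, ℓ z g + q * (v - g) + (v - g) ^ 2 / 2 ≤ ℓ z v
  bdd : ∀ z, ∀ v ∈ D, |ℓ z v| ≤ 1 / 2

theorem exp_sub_half_sq_le {d : ℝ} (hd : 0 ≤ d) : Real.exp (d - d ^ 2 / 2) ≤ 1 + d := by
  have h := Real.le_log_one_add_of_nonneg hd
  rw [← Real.le_log_iff_exp_le (by linarith)]
  refine le_trans ?_ h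
  rw [le_div_iff₀ (by linarith)]
  nlinarith [pow_nonneg hd 3]

theorem exp_half_sq_sub_le {d : ℝ} (hd : 0 ≤ d) (hd2 : d ≤ 2) :
    Real.exp (d ^ 2 / 2 - d) ≤ 1 - d + d ^ 2 := by
  set y := d - d ^ 2 / 2 with hy
  have hy0 : 0 ≤ y := by rw [hy]; nlinarith
  have h := Real.quadratic_le_exp_of_nonneg hy0
  have e : d ^ 2 / 2 - d = -y := by rw [hy]; ring
  rw [e, Real.exp_neg, inv_le_iff_one_le_mul₀ (Real.exp_pos _)]
  have hp : 0 ≤ 1 - d + d ^ 2 := by nlinarith [sq_nonneg (d - 1)]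
  refine le_trans ?_ (mul_le_mul_of_nonneg_left h hp)
  have : (1 - d + d ^ 2) * (1 + y + y ^ 2 / 2) =
      1 + d ^ 3 * (1 / 2 + 5 / 8 * d - 5 / 8 * d ^ 2 + d ^ 3 / 8) := by rw [hy]; ring
  rw [this]
  have h3 : 0 ≤ 1 / 2 + 5 / 8 * d - 5 / 8 * d ^ 2 + d ^ 3 / 8 := by
    nlinarith [mul_nonneg hd (sub_nonneg.2 hd2), mul_nonneg hd (sq_nonneg (d - 2)),
      sq_nonneg (d - 2)]
  nlinarith [mul_nonneg (pow_nonneg hd 3) h3]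

/-- The linear function `1 - x` dominates `exp (-x - d² / 2)` on the range of slopes left by the
two quadratic minorants of a normalized loss. -/
theorem exp_neg_le_one_sub {d x : ℝ} (hd : 0 ≤ d) (hd2 : d ≤ 2) (hx1 : -d ≤ x)
    (hx2 : x ≤ d - d ^ 2) : Real.exp (-x - d ^ 2 / 2) ≤ 1 - x := by
  rcases eq_or_lt_of_le hd2 with rfl | hlt
  · have : x = -2 := by norm_num at hx2; linarith
    subst this
    have := exp_sub_half_sq_le hd
    norm_num at this ⊢
  have hw : 0 < 2 * d - d ^ 2 ∨ d = 0 := by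
    rcases eq_or_lt_of_le hd with h | h
    · exact Or.inr h.symm
    · left; nlinarith
  rcases hw with hw | rfl
  swap
  · have : x = 0 := by norm_num at hx1 hx2; linarith
    subst this; simp
  -- `x` is a convex combination of the end points `-d` and `d - d ^ 2`
  set t := (x + d) / (2 * d - d ^ 2) with ht
  have ht0 : 0 ≤ t := div_nonneg (by linarith) hw.le
  have ht1 : t ≤ 1 := by rw [ht, div_le_one hw]; linarith
  have hxt : x = (1 - t) * (-d) + t * (d - d ^ 2) := by
    have : t * (2 * d - d ^ 2) = x + d := by rw [ht, div_mul_cancel₀ _ hw.ne']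
    linarith
  have hc := convexOn_exp.2 (Set.mem_univ (d - d ^ 2 / 2)) (Set.mem_univ (d ^ 2 / 2 - d))
    (sub_nonneg.2 ht1) ht0 (by ring)
  simp only [smul_eq_mul] at hc
  have e : -x - d ^ 2 / 2 = (1 - t) * (d - d ^ 2 / 2) + t * (d ^ 2 / 2 - d) := by
    rw [hxt]; ring
  rw [e]
  refine hc.trans ?_
  have h1 := mul_le_mul_of_nonneg_left (exp_sub_half_sq_le hd) (sub_nonneg.2 ht1)
  have h2 := mul_le_mul_of_nonneg_left (exp_half_sq_sub_le hd hd2) ht0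
  nlinarith

/-- The cumulant remainder `exp (-x) - 1 + x` is even-dominated: on `|x| ≤ a` it is at most its
value at `-a`. -/
theorem exp_neg_sub_le_of_abs_le {x a : ℝ} (h : |x| ≤ a) :
    Real.exp (-x) - 1 + x ≤ Real.exp a - 1 - a := by
  have ha : 0 ≤ a := (abs_nonneg x).trans h
  obtain ⟨h1, h2⟩ := abs_le.1 h
  have hs : Real.exp (-a) - 1 + a ≤ Real.exp a - 1 - a := by
    have := Real.self_le_sinh_iff.2 ha
    rw [Real.sinh_eq] at this; linarith
  rcases eq_or_lt_of_le ha with rfl | hpos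
  · have : x = 0 := by linarith
    subst this; simp
  set t := (x + a) / (2 * a) with ht
  have ht0 : 0 ≤ t := div_nonneg (by linarith) (by linarith)
  have ht1 : t ≤ 1 := by rw [ht, div_le_one (by linarith)]; linarith
  have hxt : x = (1 - t) * (-a) + t * a := by
    have : t * (2 * a) = x + a := by rw [ht]; field_simp
    linarith
  have hc := convexOn_exp.2 (Set.mem_univ a) (Set.mem_univ (-a))
    (sub_nonneg.2 ht1) ht0 (by ring)
  simp only [smul_eq_mul] at hc
  have e : -x = (1 - t) * a + t * (-a) := by rw [hxt]; ring
  rw [e]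
  nlinarith

namespace NormLoss

variable {Z : Type*} [MeasurableSpace Z] {D : Set ℝ} {ℓ : Z → ℝ → ℝ}

/-- The quadratic minorant at `v` bounds the loss difference by a function of the distance that is at
most `1 / 2`. -/
theorem sub_le (h : NormLoss D ℓ) (z : Z) {v g : ℝ} (hv : v ∈ D) (hg : g ∈ D) :
    ℓ z v - ℓ z g ≤ |v - g| - (v - g) ^ 2 / 2 := by
  obtain ⟨q, hq, hq'⟩ := h.tangent z v hv
  have h1 := hq' g hg
  have h2 : -(q * (g - v)) ≤ |v - g| := by
    calc -(q * (g - v)) ≤ |q * (g - v)| := neg_le_abs _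
      _ = |q| * |v - g| := by rw [abs_mul, abs_sub_comm]
      _ ≤ 1 * |v - g| := by gcongr
      _ = _ := one_mul _
  nlinarith

theorem abs_sub_le (h : NormLoss D ℓ) (z : Z) {v g : ℝ} (hv : v ∈ D) (hg : g ∈ D) :
    |ℓ z v - ℓ z g| ≤ |v - g| - |v - g| ^ 2 / 2 := by
  rw [sq_abs]
  refine abs_sub_le_iff.2 ⟨h.sub_le z hv hg, ?_⟩
  have := h.sub_le z hg hv
  rwa [abs_sub_comm, ← neg_sub v g, neg_sq] at this

theorem dist_le_two (h : NormLoss D ℓ) (z : Z) {v g : ℝ} (hv : v ∈ D) (hg : g ∈ D) :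
    |v - g| ≤ 2 := by
  have h1 := (abs_nonneg _).trans (h.abs_sub_le z hv hg)
  by_contra hc
  push Not at hc
  nlinarith

theorem lip (h : NormLoss D ℓ) (z : Z) {v g : ℝ} (hv : v ∈ D) (hg : g ∈ D) :
    |ℓ z v - ℓ z g| ≤ |v - g| :=
  (h.abs_sub_le z hv hg).trans (by nlinarith [sq_nonneg |v - g|])

theorem abs_sub_le_half (h : NormLoss D ℓ) (z : Z) {v g : ℝ} (hv : v ∈ D) (hg : g ∈ D) :
    |ℓ z v - ℓ z g| ≤ 1 / 2 :=
  (h.abs_sub_le z hv hg).trans (by nlinarith [sq_nonneg (|v - g| - 1)])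

/-- Exp-concavity of a normalized loss, with the supporting line of `exp (-ℓ)` at `g`. -/
theorem exp_le (h : NormLoss D ℓ) (z : Z) {g : ℝ} (hg : g ∈ D) :
    ∃ q : ℝ, ∀ v ∈ D, Real.exp (-(ℓ z v - ℓ z g)) ≤ 1 - q * (v - g) := by
  obtain ⟨q, hq, hq'⟩ := h.tangent z g hg
  refine ⟨q, fun v hv => ?_⟩
  have h1 := hq' v hv
  have h2 := h.sub_le z hv hg
  have h3 : -|v - g| ≤ q * (v - g) := by
    have : |q * (v - g)| ≤ |v - g| := by
      rw [abs_mul]; exact mul_le_of_le_one_left (abs_nonneg _) hq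
    exact (abs_le.1 this).1
  have h4 := exp_neg_le_one_sub (abs_nonneg (v - g)) (h.dist_le_two z hv hg) h3
    (by rw [sq_abs]; linarith)
  refine le_trans (Real.exp_le_exp.2 ?_) h4
  rw [sq_abs]; linarith

/-- The exponential of minus a loss difference, to second order in the distance of the predictions. It
makes `logIncr` the increment of a supermartingale. -/
theorem exp_cumulant_le (h : NormLoss D ℓ) (z : Z) {v g : ℝ} (hv : v ∈ D) (hg : g ∈ D) :
    Real.exp (-(ℓ z v - ℓ z g)) ≤ 1 - (ℓ z v - ℓ z g) + (v - g) ^ 2 / 2 := by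
  have h1 := exp_neg_sub_le_of_abs_le (h.abs_sub_le z hv hg)
  have h2 := exp_sub_half_sq_le (abs_nonneg (v - g))
  rw [← sq_abs (v - g)]
  linarith

end NormLoss

/-- The mean of a real function with values in a convex set lies in this set, which need not be
closed. -/
theorem integral_mem_of_convex {ι : Type*} [MeasurableSpace ι] (μ : Measure ι)
    [IsProbabilityMeasure μ] {D : Set ℝ} (hD : Convex ℝ D) {g : ι → ℝ} (hg : Integrable g μ)
    (hgD : ∀ i, g i ∈ D) : ∫ i, g i ∂μ ∈ D := by
  by_contra hc
  have hoc := hD.ordConnected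
  have hne : ∀ i, g i ≠ ∫ i, g i ∂μ := fun i hi => hc (hi ▸ hgD i)
  obtain ⟨i₁, h1⟩ : ∃ i, g i ≤ ∫ i, g i ∂μ := exists_le_integral hg
  obtain ⟨i₂, h2⟩ : ∃ i, ∫ i, g i ∂μ ≤ g i := exists_integral_le hg
  exact hc (hoc.out (hgD i₁) (hgD i₂) ⟨h1, h2⟩)

/-! ### Sequences of independent observations -/

section Sequences

variable {Z : Type*} [MeasurableSpace Z]

/-- The law of an infinite sequence of independent observations with distribution `P`. -/
noncomputable def seqLaw (P : Measure Z) : Measure (ℕ → Z) := Measure.infinitePi fun _ => P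

instance (P : Measure Z) [IsProbabilityMeasure P] : IsProbabilityMeasure (seqLaw P) := by
  unfold seqLaw; infer_instance

/-- The sequence that starts with `z` and goes on with `S`. -/
def seqCons (z : Z) (S : ℕ → Z) : ℕ → Z
  | 0 => z
  | n + 1 => S n

/-- The sequence that agrees with `S` before time `t` and goes on with `S'`. -/
def seqSplice (t : ℕ) (S S' : ℕ → Z) : ℕ → Z := fun i => if i < t then S i else S' (i - t)

@[simp] theorem seqCons_zero (z : Z) (S : ℕ → Z) : seqCons z S 0 = z := rfl
@[simp] theorem seqCons_succ (z : Z) (S : ℕ → Z) (n : ℕ) : seqCons z S (n + 1) = S n := rfl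

theorem seqSplice_zero (S S' : ℕ → Z) : seqSplice 0 S S' = S' := by
  ext i; simp [seqSplice]

theorem seqSplice_of_lt {t i : ℕ} (h : i < t) (S S' : ℕ → Z) : seqSplice t S S' i = S i := by
  simp [seqSplice, h]

theorem seqSplice_add (t i : ℕ) (S S' : ℕ → Z) : seqSplice t S S' (t + i) = S' i := by
  simp [seqSplice]

theorem seqSplice_succ_cons (t : ℕ) (z : Z) (S S' : ℕ → Z) :
    seqSplice (t + 1) (seqCons z S) S' = seqCons z (seqSplice t S S') := by
  ext i
  cases i with
  | zero => simp [seqSplice]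
  | succ i => simp [seqSplice]

theorem measurable_seqCons : Measurable fun p : Z × (ℕ → Z) => seqCons p.1 p.2 := by
  refine measurable_pi_lambda _ fun i => ?_
  cases i with
  | zero => exact measurable_fst
  | succ i => exact (measurable_pi_apply i).comp measurable_snd

theorem measurable_seqSplice (t : ℕ) (S : ℕ → Z) : Measurable fun S' => seqSplice t S S' := by
  refine measurable_pi_lambda _ fun i => ?_
  unfold seqSplice
  split_ifs
  · exact measurable_const
  · exact measurable_pi_apply _

/-- An observation followed by an independent sequence of observations is again such a sequence. -/
theorem map_seqCons (P : Measure Z) [IsProbabilityMeasure P] :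
    (P.prod (seqLaw P)).map (fun p => seqCons p.1 p.2) = seqLaw P := by
  refine Measure.eq_infinitePi _ fun s t ht => ?_
  classical
  obtain ⟨N, hN⟩ := s.exists_nat_subset_range
  set t' : ℕ → Set Z := fun n => if n ∈ s then t n else Set.univ with ht'
  have hmeas : ∀ n, MeasurableSet (t' n) := fun n => by
    rw [ht']; dsimp only; split_ifs
    · exact ht n
    · exact MeasurableSet.univ
  have h1 : Set.pi (s : Set ℕ) t = Set.pi (Finset.range (N + 1) : Set ℕ) t' := by
    ext x
    simp only [Set.mem_pi, Finset.mem_coe, Finset.mem_range, ht']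
    constructor
    · intro h i _
      split_ifs with hi
      · exact h i hi
      · trivial
    · intro h i hi
      have := h i (by have := Finset.mem_range.1 (hN hi); omega)
      rwa [if_pos hi] at this
  have h2 : ∏ i ∈ s, P (t i) = ∏ i ∈ Finset.range (N + 1), P (t' i) := by
    have hs : s ⊆ Finset.range (N + 1) := fun i hi => by
      have := Finset.mem_range.1 (hN hi); simp; omega
    rw [← Finset.prod_subset hs (f := fun i => P (t' i))]
    · exact Finset.prod_congr rfl fun i hi => by simp [ht', hi]
    · intro i _ hi; simp [ht', hi]
  rw [h1, h2, Measure.map_apply measurable_seqCons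
    (MeasurableSet.pi (Finset.countable_toSet _) fun i _ => hmeas i)]
  have h3 : (fun p : Z × (ℕ → Z) => seqCons p.1 p.2) ⁻¹' Set.pi (Finset.range (N + 1) : Set ℕ) t'
      = t' 0 ×ˢ Set.pi (Finset.range N : Set ℕ) fun n => t' (n + 1) := by
    ext p
    simp only [Set.mem_preimage, Set.mem_pi, Finset.mem_coe, Finset.mem_range, Set.mem_prod]
    constructor
    · intro h
      exact ⟨h 0 (by omega), fun i hi => h (i + 1) (by omega)⟩
    · rintro ⟨h0, h⟩ i hi
      cases i with
      | zero => exact h0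
      | succ i => exact h i (by omega)
  rw [h3, Measure.prod_prod, seqLaw, Measure.infinitePi_pi _ (fun i _ => hmeas _),
    Finset.prod_range_succ', mul_comm]

/-- Conditioning on the first observation. -/
theorem seqLaw_apply_cons (P : Measure Z) [IsProbabilityMeasure P] {B : Set (ℕ → Z)}
    (hB : MeasurableSet B) :
    seqLaw P B = ∫⁻ z, seqLaw P {S | seqCons z S ∈ B} ∂P := by
  conv_lhs => rw [← map_seqCons P]
  rw [Measure.map_apply measurable_seqCons hB,
    Measure.prod_apply (measurable_seqCons hB)]
  rfl

/-- **Ville's inequality** for a nonnegative supermartingale in the first observations of an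
independent sequence. -/
theorem ville (P : Measure Z) [IsProbabilityMeasure P] {c : ENNReal} (hc : c ≠ 0) (hc' : c ≠ ⊤)
    (m : ℕ) (F : ℕ → (ℕ → Z) → ENNReal) (hF : ∀ t, Measurable (F t))
    (had : ∀ t S S', (∀ i < t, S i = S' i) → F t S = F t S')
    (hsup : ∀ t S, ∫⁻ z, F (t + 1) (Function.update S t z) ∂P ≤ F t S) (S₀ : ℕ → Z) :
    seqLaw P {S | ∃ t ≤ m, c ≤ F t S} ≤ F 0 S₀ / c := by
  induction m generalizing F S₀ with
  | zero =>
    by_cases h : c ≤ F 0 S₀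
    · exact prob_le_one.trans ((ENNReal.le_div_iff_mul_le (Or.inl hc) (Or.inl hc')).2 (by simpa))
    · have : {S | ∃ t ≤ 0, c ≤ F t S} = ∅ := by
        ext S
        simp only [Nat.le_zero, exists_eq_left, Set.mem_ofPred_eq, Set.mem_empty_iff_false,
          iff_false]
        rwa [had 0 S S₀ (by simp)]
      rw [this]
      simp
  | succ m ih =>
    by_cases h : c ≤ F 0 S₀
    · exact prob_le_one.trans ((ENNReal.le_div_iff_mul_le (Or.inl hc) (Or.inl hc')).2 (by simpa))
    have hset : {S | ∃ t ≤ m + 1, c ≤ F t S} = {S | ∃ t ≤ m, c ≤ F (t + 1) S} := by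
      ext S
      constructor
      · rintro ⟨t, ht, h'⟩
        cases t with
        | zero => rw [had 0 S S₀ (by simp)] at h'; exact absurd h' h
        | succ t => exact ⟨t, by omega, h'⟩
      · rintro ⟨t, ht, h'⟩; exact ⟨t + 1, by omega, h'⟩
    have hms : MeasurableSet {S | ∃ t ≤ m, c ≤ F (t + 1) S} := by
      have : {S | ∃ t ≤ m, c ≤ F (t + 1) S} = ⋃ t ∈ Finset.range (m + 1), {S | c ≤ F (t + 1) S} := by
        ext S; simp
      rw [this]
      exact Finset.measurableSet_biUnion _ fun t _ => measurableSet_le measurable_const (hF _)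
    rw [hset, seqLaw_apply_cons P hms]
    calc ∫⁻ z, seqLaw P {S | seqCons z S ∈ {S | ∃ t ≤ m, c ≤ F (t + 1) S}} ∂P
        ≤ ∫⁻ z, F 1 (Function.update S₀ 0 z) / c ∂P := by
          refine lintegral_mono fun z => ?_
          have := ih (fun t S => F (t + 1) (seqCons z S))
            (fun t => (hF _).comp (measurable_seqCons.comp
              (measurable_const.prodMk measurable_id)))
            (fun t S S' hS => had _ _ _ fun i hi => by
              cases i with
              | zero => rfl
              | succ i => exact hS i (by omega))
            (fun t S => by
              have h' := hsup (t + 1) (seqCons z S)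
              refine le_trans (le_of_eq (lintegral_congr fun z' => had _ _ _ fun i hi => ?_)) h'
              cases i with
              | zero => simp [Function.update]
              | succ i => simp [Function.update])
            S₀
          refine this.trans (le_of_eq ?_)
          congr 1
          refine had _ _ _ fun i hi => ?_
          have : i = 0 := by omega
          subst this; simp
      _ = (∫⁻ z, F 1 (Function.update S₀ 0 z) ∂P) / c := by
          simp_rw [div_eq_mul_inv]
          refine lintegral_mul_const _ ?_
          exact (hF 1).comp (measurable_update S₀)
      _ ≤ F 0 S₀ / c := by gcongr; exact hsup 0 S₀

/-- The strong Markov property of an independent sequence: an event that can only happen after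
a stopping rule `W` has been met, and that has probability at most `p` given the past at any such
time, has probability at most `p`. -/
theorem seqLaw_le_of_stopping (P : Measure Z) [IsProbabilityMeasure P] (p : ENNReal) (m : ℕ)
    (W : ℕ → Set (ℕ → Z)) (hW : ∀ t S S', (∀ i < t, S i = S' i) → S ∈ W t → S' ∈ W t)
    (B : Set (ℕ → Z)) (hB : MeasurableSet B) (hBW : ∀ S ∈ B, ∃ t ≤ m, S ∈ W t)
    (hp : ∀ t ≤ m, ∀ S ∈ W t, seqLaw P {S' | seqSplice t S S' ∈ B} ≤ p) : seqLaw P B ≤ p := by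
  induction m generalizing W B with
  | zero =>
    by_cases h : ∃ S, S ∈ W 0
    · obtain ⟨S, hS⟩ := h
      simpa [seqSplice_zero] using hp 0 le_rfl S hS
    · have : B = ∅ := by
        ext S
        simp only [Set.mem_empty_iff_false, iff_false]
        intro hS
        obtain ⟨t, ht, h'⟩ := hBW S hS
        obtain rfl : t = 0 := by omega
        exact h ⟨S, h'⟩
      simp [this]
  | succ m ih =>
    by_cases h : ∃ S, S ∈ W 0
    · obtain ⟨S, hS⟩ := h
      simpa [seqSplice_zero] using hp 0 (by omega) S hS
    · rw [seqLaw_apply_cons P hB]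
      calc ∫⁻ z, seqLaw P {S | seqCons z S ∈ B} ∂P ≤ ∫⁻ _, p ∂P := by
            refine lintegral_mono fun z => ?_
            refine ih (fun t => {S | seqCons z S ∈ W (t + 1)}) ?_ _
              ((measurable_seqCons.comp (measurable_const.prodMk measurable_id)) hB) ?_ ?_
            · intro t S S' hS
              refine hW _ _ _ fun i hi => ?_
              cases i with
              | zero => rfl
              | succ i => exact hS i (by omega)
            · intro S hS
              obtain ⟨t, ht, h'⟩ := hBW _ hS
              cases t with
              | zero => exact absurd ⟨_, h'⟩ h
              | succ t => exact ⟨t, by omega, h'⟩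
            · intro t ht S hS
              have := hp (t + 1) (by omega) _ hS
              simpa [seqSplice_succ_cons] using this
        _ = p := by simp

/-- Sums of the centred observations `φ s S (S s)` before time `t`, where `φ s S` depends on the
observations before time `s` only. -/
noncomputable def centSum (P : Measure Z) (φ : ℕ → (ℕ → Z) → Z → ℝ) (t : ℕ) (S : ℕ → Z) : ℝ :=
  ∑ s ∈ Finset.range t, (φ s S (S s) - ∫ z, φ s S z ∂P)

/-- The predictable quadratic variation of `centSum`. -/
noncomputable def quadVar (P : Measure Z) (φ : ℕ → (ℕ → Z) → Z → ℝ) (t : ℕ) (S : ℕ → Z) : ℝ :=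
  ∑ s ∈ Finset.range t, ∫ z, (φ s S z - ∫ z', φ s S z' ∂P) ^ 2 ∂P

/-- A predictable family of functions bounded by `1`. -/
structure Predictable (φ : ℕ → (ℕ → Z) → Z → ℝ) : Prop where
  meas : ∀ t, Measurable fun p : (ℕ → Z) × Z => φ t p.1 p.2
  adapted : ∀ t S S', (∀ i < t, S i = S' i) → φ t S = φ t S'
  bdd : ∀ t S z, |φ t S z| ≤ 1

variable {P : Measure Z} [IsProbabilityMeasure P] {φ : ℕ → (ℕ → Z) → Z → ℝ}

theorem Predictable.meas_section (h : Predictable φ) (t : ℕ) (S : ℕ → Z) : Measurable (φ t S) :=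
  (h.meas t).comp measurable_prodMk_left

/-- The integrability criterion used throughout: a bounded measurable function. -/
theorem integrable_of_abs_le {g : Z → ℝ} (hg : Measurable g) {c : ℝ} (hc : ∀ z, |g z| ≤ c) :
    Integrable g P :=
  Integrable.of_bound hg.aestronglyMeasurable c (Filter.Eventually.of_forall hc)

theorem abs_integral_le_of_abs_le {g : Z → ℝ} {c : ℝ} (hc : ∀ z, |g z| ≤ c) :
    |∫ z, g z ∂P| ≤ c := by
  have := norm_integral_le_of_norm_le_const (μ := P) (f := g) (C := c)
    (Filter.Eventually.of_forall hc)
  simpa using this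

theorem Predictable.measurable_integral (h : Predictable φ) (t : ℕ) :
    Measurable fun S => ∫ z, φ t S z ∂P :=
  ((h.meas t).stronglyMeasurable.integral_prod_right (ν := P)).measurable

theorem Predictable.measurable_centSum (h : Predictable φ) (t : ℕ) :
    Measurable (centSum P φ t) := by
  unfold centSum
  refine Finset.measurable_sum _ fun s _ => ?_
  exact ((h.meas s).comp (measurable_id.prodMk (measurable_pi_apply s))).sub
    (h.measurable_integral s)

theorem Predictable.measurable_quadVar (h : Predictable φ) (t : ℕ) :
    Measurable (quadVar P φ t) := by
  unfold quadVar
  refine Finset.measurable_sum _ fun s _ => ?_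
  have : Measurable fun p : (ℕ → Z) × Z => (φ s p.1 p.2 - ∫ z', φ s p.1 z' ∂P) ^ 2 :=
    ((h.meas s).sub ((h.measurable_integral s).comp measurable_fst)).pow_const 2
  exact (this.stronglyMeasurable.integral_prod_right (ν := P)).measurable

theorem Predictable.centSum_congr (h : Predictable φ) (t : ℕ) {S S' : ℕ → Z}
    (hS : ∀ i < t, S i = S' i) : centSum P φ t S = centSum P φ t S' := by
  unfold centSum
  refine Finset.sum_congr rfl fun s hs => ?_
  have hs := Finset.mem_range.1 hs
  rw [h.adapted s S S' fun i hi => hS i (hi.trans hs), hS s hs]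

theorem Predictable.quadVar_congr (h : Predictable φ) (t : ℕ) {S S' : ℕ → Z}
    (hS : ∀ i < t, S i = S' i) : quadVar P φ t S = quadVar P φ t S' := by
  unfold quadVar
  refine Finset.sum_congr rfl fun s hs => ?_
  have hs := Finset.mem_range.1 hs
  rw [h.adapted s S S' fun i hi => hS i (hi.trans hs)]

/-- **Freedman's inequality**, uniform in time. -/
theorem Predictable.freedman (h : Predictable φ) {κ : ℝ} (hκ : 0 ≤ κ) (hκ' : κ ≤ 1 / 2) (c : ℝ)
    (m : ℕ) :
    seqLaw P {S | ∃ t ≤ m, c ≤ κ * centSum P φ t S - κ ^ 2 * quadVar P φ t S} ≤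
      ENNReal.ofReal (Real.exp (-c)) := by
  obtain ⟨S₀⟩ : Nonempty (ℕ → Z) := by
    have : Nonempty Z := nonempty_of_isProbabilityMeasure P
    infer_instance
  have hexp : ENNReal.ofReal (Real.exp c) ≠ 0 := by simp [Real.exp_pos]
  have key := ville P hexp ENNReal.ofReal_ne_top m
    (fun t S => ENNReal.ofReal (Real.exp (κ * centSum P φ t S - κ ^ 2 * quadVar P φ t S)))
    (fun t => (((h.measurable_centSum (P := P) t).const_mul κ).sub
      ((h.measurable_quadVar (P := P) t).const_mul (κ ^ 2))).exp.ennreal_ofReal)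
    (fun t S S' hS => by rw [h.centSum_congr t hS, h.quadVar_congr t hS]) ?_ S₀
  · have e : {S | ∃ t ≤ m, c ≤ κ * centSum P φ t S - κ ^ 2 * quadVar P φ t S} =
        {S | ∃ t ≤ m, ENNReal.ofReal (Real.exp c) ≤
          ENNReal.ofReal (Real.exp (κ * centSum P φ t S - κ ^ 2 * quadVar P φ t S))} := by
      ext S
      simp only [Set.mem_ofPred_eq]
      refine exists_congr fun t => and_congr_right fun _ => ?_
      rw [ENNReal.ofReal_le_ofReal_iff (Real.exp_pos _).le, Real.exp_le_exp]
    rw [e]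
    refine key.trans (le_of_eq ?_)
    simp only [centSum, quadVar, Finset.range_zero, Finset.sum_empty, mul_zero, sub_zero,
      Real.exp_zero, ENNReal.ofReal_one]
    rw [one_div, Real.exp_neg, ENNReal.ofReal_inv_of_pos (Real.exp_pos _)]
  · intro t S
    set a := ∫ z, φ t S z ∂P with ha
    set E := Real.exp (κ * centSum P φ t S - κ ^ 2 * quadVar P φ t S) with hE
    set v := ∫ z, (φ t S z - a) ^ 2 ∂P with hv
    have hφm := h.meas_section t S
    have hab : |a| ≤ 1 := abs_integral_le_of_abs_le (h.bdd t S)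
    have hb : ∀ z, |φ t S z - a| ≤ 2 := fun z =>
      (abs_sub _ _).trans (by linarith [h.bdd t S z])
    have hval : ∀ z, Real.exp (κ * centSum P φ (t + 1) (Function.update S t z) -
        κ ^ 2 * quadVar P φ (t + 1) (Function.update S t z)) =
        E * Real.exp (-(κ ^ 2 * v)) * Real.exp (κ * (φ t S z - a)) := by
      intro z
      have hS : ∀ i < t, Function.update S t z i = S i := fun i hi => by
        simp [Function.update, hi.ne]
      have h1 : centSum P φ (t + 1) (Function.update S t z) =
          centSum P φ t S + (φ t S z - a) := by
        rw [← h.centSum_congr t hS]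
        unfold centSum
        rw [Finset.sum_range_succ, h.adapted t _ S hS]
        simp [ha]
      have h2 : quadVar P φ (t + 1) (Function.update S t z) = quadVar P φ t S + v := by
        rw [← h.quadVar_congr t hS]
        unfold quadVar
        rw [Finset.sum_range_succ, h.adapted t _ S hS]
      rw [h1, h2, hE, ← Real.exp_add, ← Real.exp_add]
      congr 1; ring
    simp_rw [hval]
    have hint1 : Integrable (fun z => φ t S z - a) P := integrable_of_abs_le (hφm.sub_const a) hb
    have hint2 : Integrable (fun z => (φ t S z - a) ^ 2) P :=
      integrable_of_abs_le (c := 4) ((hφm.sub_const a).pow_const 2) fun z => by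
        rw [abs_pow]; nlinarith [hb z, abs_nonneg (φ t S z - a)]
    have hint4 : Integrable (fun z => 1 + κ * (φ t S z - a)) P :=
      (integrable_const 1).add (hint1.const_mul κ)
    have hint3 : Integrable (fun z => Real.exp (κ * (φ t S z - a))) P :=
      integrable_of_abs_le (c := Real.exp 1)
        (Real.measurable_exp.comp ((hφm.sub_const a).const_mul κ)) fun z => by
          rw [abs_of_pos (Real.exp_pos _), Real.exp_le_exp]
          nlinarith [abs_le.1 (hb z)]
    rw [← ofReal_integral_eq_lintegral_ofReal (hint3.const_mul _)
      (Filter.Eventually.of_forall fun z => by positivity)]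
    refine ENNReal.ofReal_le_ofReal ?_
    rw [integral_const_mul]
    have hle : ∫ z, Real.exp (κ * (φ t S z - a)) ∂P ≤ Real.exp (κ ^ 2 * v) := by
      calc ∫ z, Real.exp (κ * (φ t S z - a)) ∂P
          ≤ ∫ z, (1 + κ * (φ t S z - a) + κ ^ 2 * (φ t S z - a) ^ 2) ∂P := by
            refine integral_mono hint3 (hint4.add (hint2.const_mul _)) fun z => ?_
            have hy : |κ * (φ t S z - a)| ≤ 1 := by
              rw [abs_mul, abs_of_nonneg hκ]; nlinarith [hb z, abs_nonneg (φ t S z - a)]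
            have := (abs_le.1 (Real.abs_exp_sub_one_sub_id_le hy)).2
            simp only
            nlinarith
        _ = 1 + κ ^ 2 * v := by
            rw [integral_add hint4 (hint2.const_mul _),
              integral_add (integrable_const 1) (hint1.const_mul κ), integral_const_mul,
              integral_const_mul, integral_sub (integrable_of_abs_le hφm (h.bdd t S))
              (integrable_const a)]
            simp [ha, hv]
        _ ≤ _ := by linarith [Real.add_one_le_exp (κ ^ 2 * v)]
    calc E * Real.exp (-(κ ^ 2 * v)) * ∫ z, Real.exp (κ * (φ t S z - a)) ∂P
        ≤ E * Real.exp (-(κ ^ 2 * v)) * Real.exp (κ ^ 2 * v) := by gcongr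
      _ = E := by rw [mul_assoc, ← Real.exp_add]; simp

end Sequences

/-! ### Exponential weights for a normalized loss -/

/-- Countably many measurable experts with values in `D`, and a normalized loss on `D`. -/
structure Experts {Z ι : Type*} [MeasurableSpace Z] (D : Set ℝ) (ℓ : Z → ℝ → ℝ)
    (f : ι → Z → ℝ) : Prop where
  loss : NormLoss D ℓ
  meas : ∀ i, Measurable (f i)
  mem : ∀ i z, f i z ∈ D

/-- The risk of the predictor `h`. -/
noncomputable def risk {Z : Type*} [MeasurableSpace Z] (P : Measure Z) (ℓ : Z → ℝ → ℝ)
    (h : Z → ℝ) : ℝ := ∫ z, ℓ z (h z) ∂P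

/-- The squared `L²` distance of two predictors. -/
noncomputable def sqDist {Z : Type*} [MeasurableSpace Z] (P : Measure Z) (g h : Z → ℝ) : ℝ :=
  ∫ z, (g z - h z) ^ 2 ∂P

/-- The cumulative loss of the expert `i` before time `t`. -/
def cumLoss {Z ι : Type*} (ℓ : Z → ℝ → ℝ) (f : ι → Z → ℝ) (t : ℕ) (S : ℕ → Z) (i : ι) : ℝ :=
  ∑ s ∈ Finset.range t, ℓ (S s) (f i (S s))

/-- The normalizing constant of the exponential weights at time `t`. -/
noncomputable def partFun {Z ι : Type*} [MeasurableSpace ι] (ℓ : Z → ℝ → ℝ) (f : ι → Z → ℝ)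
    (π : Measure ι) (t : ℕ) (S : ℕ → Z) : ℝ := ∫ i, Real.exp (-cumLoss ℓ f t S i) ∂π

/-- The posterior mean predictor at time `t`. -/
noncomputable def mixMean {Z ι : Type*} [MeasurableSpace ι] (ℓ : Z → ℝ → ℝ) (f : ι → Z → ℝ)
    (π : Measure ι) (t : ℕ) (S : ℕ → Z) (z : Z) : ℝ :=
  ∫ i, f i z ∂(π.tilted fun i => -cumLoss ℓ f t S i)

section LossBasics

variable {Z : Type*} [MeasurableSpace Z] {D : Set ℝ} {ℓ : Z → ℝ → ℝ} {P : Measure Z}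
  [IsProbabilityMeasure P]

theorem NormLoss.meas_comp (h : NormLoss D ℓ) {g : Z → ℝ} (hg : Measurable g) :
    Measurable fun z => ℓ z (g z) :=
  h.meas.comp (measurable_id.prodMk hg)

theorem NormLoss.integrable (h : NormLoss D ℓ) {g : Z → ℝ} (hg : Measurable g)
    (hgD : ∀ z, g z ∈ D) : Integrable (fun z => ℓ z (g z)) P :=
  integrable_of_abs_le (h.meas_comp hg) fun z => h.bdd z _ (hgD z)

theorem NormLoss.integrable_sq_sub (h : NormLoss D ℓ) {g g' : Z → ℝ} (hg : Measurable g)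
    (hgD : ∀ z, g z ∈ D) (hg' : Measurable g') (hgD' : ∀ z, g' z ∈ D) :
    Integrable (fun z => (g z - g' z) ^ 2) P :=
  integrable_of_abs_le (c := 4) ((hg.sub hg').pow_const 2) fun z => by
    have := h.dist_le_two z (hgD z) (hgD' z)
    rw [abs_pow]; nlinarith [abs_nonneg (g z - g' z)]

theorem sqDist_nonneg (g h : Z → ℝ) : 0 ≤ sqDist P g h := integral_nonneg fun _ => sq_nonneg _

end LossBasics

namespace Experts

variable {Z ι : Type*} [MeasurableSpace Z] [MeasurableSpace ι] [Countable ι]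
  [DiscreteMeasurableSpace ι] {D : Set ℝ} {ℓ : Z → ℝ → ℝ} {f : ι → Z → ℝ}
  {π : Measure ι} [IsProbabilityMeasure π] {P : Measure Z} [IsProbabilityMeasure P]

theorem abs_cumLoss_le (h : Experts D ℓ f) (t : ℕ) (S : ℕ → Z) (i : ι) :
    |cumLoss ℓ f t S i| ≤ t := by
  unfold cumLoss
  refine (Finset.abs_sum_le_sum_abs _ _).trans ?_
  calc ∑ s ∈ Finset.range t, |ℓ (S s) (f i (S s))| ≤ ∑ s ∈ Finset.range t, (1 : ℝ) :=
        Finset.sum_le_sum fun s _ => (h.loss.bdd _ _ (h.mem i _)).trans (by norm_num)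
    _ = t := by simp

theorem integrable_exp_cumLoss (h : Experts D ℓ f) (t : ℕ) (S : ℕ → Z) :
    Integrable (fun i => Real.exp (-cumLoss ℓ f t S i)) π :=
  integrable_of_abs_le (c := Real.exp t) (measurable_of_countable _) fun i => by
    rw [abs_of_pos (Real.exp_pos _), Real.exp_le_exp]
    linarith [(abs_le.1 (h.abs_cumLoss_le t S i)).1]

theorem isProbabilityMeasure_posterior (h : Experts D ℓ f) (t : ℕ) (S : ℕ → Z) :
    IsProbabilityMeasure (π.tilted fun i => -cumLoss ℓ f t S i) :=
  isProbabilityMeasure_tilted (h.integrable_exp_cumLoss t S)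

theorem partFun_pos (h : Experts D ℓ f) (t : ℕ) (S : ℕ → Z) : 0 < partFun ℓ f π t S :=
  integral_exp_pos (h.integrable_exp_cumLoss t S)

theorem integrable_expert (h : Experts D ℓ f) (μ : Measure ι) [IsProbabilityMeasure μ] (z : Z) :
    Integrable (fun i => f i z) μ := by
  obtain ⟨i₀⟩ : Nonempty ι := nonempty_of_isProbabilityMeasure μ
  refine integrable_of_abs_le (c := |f i₀ z| + 2) (measurable_of_countable _) fun i => ?_
  have := h.loss.dist_le_two z (h.mem i z) (h.mem i₀ z)
  calc |f i z| = |f i₀ z + (f i z - f i₀ z)| := by ring_nf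
    _ ≤ |f i₀ z| + |f i z - f i₀ z| := abs_add_le _ _
    _ ≤ _ := by linarith

theorem mixMean_mem (h : Experts D ℓ f) (t : ℕ) (S : ℕ → Z) (z : Z) :
    mixMean ℓ f π t S z ∈ D := by
  have := h.isProbabilityMeasure_posterior (π := π) t S
  exact integral_mem_of_convex _ h.loss.convex (h.integrable_expert _ z) fun i => h.mem i z

theorem measurable_cumLoss (h : Experts D ℓ f) (t : ℕ) (i : ι) :
    Measurable fun S => cumLoss ℓ f t S i :=
  Finset.measurable_sum _ fun s _ => (h.loss.meas_comp (h.meas i)).comp (measurable_pi_apply s)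

theorem measurable_mixMean (h : Experts D ℓ f) (t : ℕ) :
    Measurable fun p : (ℕ → Z) × Z => mixMean ℓ f π t p.1 p.2 := by
  have e : ∀ p : (ℕ → Z) × Z, mixMean ℓ f π t p.1 p.2 =
      ∫ i, (Real.exp (-cumLoss ℓ f t p.1 i) / ∫ i, Real.exp (-cumLoss ℓ f t p.1 i) ∂π) *
        f i p.2 ∂π := fun p => by
    rw [mixMean, integral_tilted]; rfl
  simp_rw [e]
  have h1 : Measurable fun q : ((ℕ → Z) × Z) × ι => Real.exp (-cumLoss ℓ f t q.1.1 q.2) :=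
    measurable_from_prod_countable_left fun i =>
      ((h.measurable_cumLoss t i).comp measurable_fst).neg.exp
  have h2 : Measurable fun q : ((ℕ → Z) × Z) × ι => f q.2 q.1.2 :=
    measurable_from_prod_countable_left fun i => (h.meas i).comp measurable_snd
  have h3 : Measurable fun p : (ℕ → Z) × Z => ∫ i, Real.exp (-cumLoss ℓ f t p.1 i) ∂π :=
    (h1.stronglyMeasurable.integral_prod_right (ν := π)).measurable
  exact (((h1.div (h3.comp measurable_fst)).mul h2).stronglyMeasurable.integral_prod_right
    (ν := π)).measurable

theorem measurable_mixMean_section (h : Experts D ℓ f) (t : ℕ) (S : ℕ → Z) :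
    Measurable (mixMean ℓ f π t S) := by
  have h1 : Measurable fun z : Z => (S, z) := measurable_prodMk_left
  have h2 := (h.measurable_mixMean (π := π) t).comp h1
  have h3 : (fun p : (ℕ → Z) × Z => mixMean ℓ f π t p.1 p.2) ∘ (fun z : Z => (S, z)) =
    mixMean ℓ f π t S := by
    funext z
    rw [Function.comp_apply]
  rwa [h3] at h2

omit [MeasurableSpace Z] [Countable ι] [DiscreteMeasurableSpace ι] [IsProbabilityMeasure π] in
theorem cumLoss_congr (t : ℕ) {S S' : ℕ → Z} (hS : ∀ i < t, S i = S' i) :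
    cumLoss ℓ f t S = cumLoss ℓ f t S' := by
  ext i
  exact Finset.sum_congr rfl fun s hs => by rw [hS s (Finset.mem_range.1 hs)]

omit [MeasurableSpace Z] [Countable ι] [DiscreteMeasurableSpace ι] [IsProbabilityMeasure π] in
theorem mixMean_congr (t : ℕ) {S S' : ℕ → Z} (hS : ∀ i < t, S i = S' i) :
    mixMean ℓ f π t S = mixMean ℓ f π t S' := by
  ext z
  unfold mixMean
  rw [cumLoss_congr t hS]

/-- One step of the exponential weights: by exp-concavity, the normalizing constant decreases at
least by the factor `exp (-ℓ)` of the posterior mean. -/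
theorem partFun_succ_le (h : Experts D ℓ f) (t : ℕ) (S : ℕ → Z) :
    partFun ℓ f π (t + 1) S ≤
      partFun ℓ f π t S * Real.exp (-ℓ (S t) (mixMean ℓ f π t S (S t))) := by
  have := h.isProbabilityMeasure_posterior (π := π) t S
  set μ := π.tilted fun i => -cumLoss ℓ f t S i with hμ
  set g := mixMean ℓ f π t S (S t) with hg
  have hpos := h.partFun_pos (π := π) t S
  have e : ∫ i, Real.exp (-ℓ (S t) (f i (S t))) ∂μ =
      partFun ℓ f π (t + 1) S / partFun ℓ f π t S := by
    rw [hμ, integral_exp_tilted]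
    congr 1
    refine integral_congr_ae (Filter.Eventually.of_forall fun i => ?_)
    simp only [Pi.add_apply, cumLoss, Finset.sum_range_succ]
    congr 1; ring
  have hle : ∫ i, Real.exp (-ℓ (S t) (f i (S t))) ∂μ ≤ Real.exp (-ℓ (S t) g) := by
    obtain ⟨q, hq⟩ := h.loss.exp_le (S t) (h.mixMean_mem (π := π) t S (S t))
    have hfi := h.integrable_expert μ (S t)
    calc ∫ i, Real.exp (-ℓ (S t) (f i (S t))) ∂μ
        ≤ ∫ i, Real.exp (-ℓ (S t) g) * (1 - q * (f i (S t) - g)) ∂μ := by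
          refine integral_mono ?_ (((integrable_const 1).sub
            ((hfi.sub (integrable_const g)).const_mul q)).const_mul _) fun i => ?_
          · refine integrable_of_abs_le (c := Real.exp (1 / 2)) (measurable_of_countable _)
              fun i => ?_
            rw [abs_of_pos (Real.exp_pos _), Real.exp_le_exp]
            linarith [(abs_le.1 (h.loss.bdd (S t) _ (h.mem i (S t)))).1]
          · have := hq _ (h.mem i (S t))
            calc Real.exp (-ℓ (S t) (f i (S t)))
                = Real.exp (-ℓ (S t) g) * Real.exp (-(ℓ (S t) (f i (S t)) - ℓ (S t) g)) := by
                  rw [← Real.exp_add]; congr 1; ring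
              _ ≤ _ := by gcongr
      _ = Real.exp (-ℓ (S t) g) := by
          have h0 : ∫ i, (f i (S t) - g) ∂μ = 0 := by
            rw [integral_sub hfi (integrable_const g)]
            simp [hg, mixMean, hμ]
          have hi : Integrable (fun i => q * (f i (S t) - g)) μ :=
            (hfi.sub (integrable_const g)).const_mul q
          rw [integral_const_mul, integral_sub (integrable_const 1) hi, integral_const_mul, h0]
          simp
  rw [e, div_le_iff₀ hpos] at hle
  linarith

/-- The increments of the log normalizing constants are bounded by minus the losses of the posterior
means. -/
theorem log_partFun_le (h : Experts D ℓ f) (S : ℕ → Z) {t' t : ℕ} (ht : t' ≤ t) :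
    Real.log (partFun ℓ f π t S) ≤ Real.log (partFun ℓ f π t' S) -
      ∑ s ∈ Finset.Ico t' t, ℓ (S s) (mixMean ℓ f π s S (S s)) := by
  induction t, ht using Nat.le_induction with
  | base => simp
  | succ t ht ih =>
    have h1 := Real.log_le_log (h.partFun_pos (t + 1) S) (h.partFun_succ_le (π := π) t S)
    rw [Real.log_mul (h.partFun_pos t S).ne' (Real.exp_pos _).ne', Real.log_exp] at h1
    rw [Finset.sum_Ico_succ_top ht]
    linarith

/-- The Gibbs variational inequality for the normalizing constant. -/
theorem neg_log_partFun_le (h : Experts D ℓ f) (ρ : Measure ι) [IsProbabilityMeasure ρ]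
    (hρ : InformationTheory.klDiv ρ π ≠ ⊤) (t : ℕ) (S : ℕ → Z) :
    -Real.log (partFun ℓ f π t S) ≤
      ∫ i, cumLoss ℓ f t S i ∂ρ + (InformationTheory.klDiv ρ π).toReal := by
  have := h.isProbabilityMeasure_posterior (π := π) t S
  obtain ⟨hac, hint⟩ := InformationTheory.klDiv_ne_top_iff.1 hρ
  have hc : Integrable (fun i => -cumLoss ℓ f t S i) ρ :=
    integrable_of_abs_le (c := t) (measurable_of_countable _) fun i => by
      rw [abs_neg]; exact h.abs_cumLoss_le t S i
  have hexp := h.integrable_exp_cumLoss (π := π) t S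
  have h1 := integral_llr_tilted_right hac hc hexp hint
  have h2 := InformationTheory.toReal_klDiv hac hint
  have h3 := InformationTheory.toReal_klDiv
    (hac.trans (absolutelyContinuous_tilted hexp)) (integrable_llr_tilted_right hac hc hint hexp)
  have h4 : 0 ≤ (InformationTheory.klDiv ρ (π.tilted fun i => -cumLoss ℓ f t S i)).toReal :=
    ENNReal.toReal_nonneg
  simp only [probReal_univ] at h2 h3
  rw [integral_neg] at h1
  unfold partFun
  linarith

/-- The logarithmic increment at time `s` of the supermartingale of the expert `i`. -/
noncomputable def logIncr (P : Measure Z) (ℓ : Z → ℝ → ℝ) (f : ι → Z → ℝ) (i : ι) (g : Z → ℝ)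
    (z : Z) : ℝ :=
  -(ℓ z (f i z) - ℓ z (g z)) + (risk P ℓ (f i) - risk P ℓ g) - sqDist P (f i) g / 2

/-- `logIncr` is a supermartingale increment: the quadratic gap between the exponential and the linear
loss difference is absorbed by the squared distance of the predictions. -/
theorem integral_exp_logIncr_le (h : Experts D ℓ f) (i : ι) {g : Z → ℝ} (hg : Measurable g)
    (hgD : ∀ z, g z ∈ D) :
    ∫⁻ z, ENNReal.ofReal (Real.exp (logIncr P ℓ f i g z)) ∂P ≤ 1 := by
  have hi1 := h.loss.integrable (P := P) (h.meas i) (h.mem i)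
  have hi2 := h.loss.integrable (P := P) hg hgD
  have hi3 := h.loss.integrable_sq_sub (P := P) (h.meas i) (h.mem i) hg hgD
  set c := (risk P ℓ (f i) - risk P ℓ g) - sqDist P (f i) g / 2 with hc
  have hpt : ∀ z, Real.exp (logIncr P ℓ f i g z) ≤
      Real.exp c * (1 - (ℓ z (f i z) - ℓ z (g z)) + (f i z - g z) ^ 2 / 2) := by
    intro z
    have e : logIncr P ℓ f i g z = c + -(ℓ z (f i z) - ℓ z (g z)) := by
      rw [logIncr, hc]; ring
    rw [e, Real.exp_add]
    gcongr
    exact h.loss.exp_cumulant_le z (h.mem i z) (hgD z)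
  have hint : Integrable (fun z => Real.exp c *
      (1 - (ℓ z (f i z) - ℓ z (g z)) + (f i z - g z) ^ 2 / 2)) P :=
    (((integrable_const 1).sub (hi1.sub hi2)).add (hi3.div_const 2)).const_mul _
  calc ∫⁻ z, ENNReal.ofReal (Real.exp (logIncr P ℓ f i g z)) ∂P
      ≤ ∫⁻ z, ENNReal.ofReal (Real.exp c *
        (1 - (ℓ z (f i z) - ℓ z (g z)) + (f i z - g z) ^ 2 / 2)) ∂P :=
        lintegral_mono fun z => ENNReal.ofReal_le_ofReal (hpt z)
    _ = ENNReal.ofReal (∫ z, Real.exp c *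
        (1 - (ℓ z (f i z) - ℓ z (g z)) + (f i z - g z) ^ 2 / 2) ∂P) :=
        (ofReal_integral_eq_lintegral_ofReal hint (Filter.Eventually.of_forall fun z =>
          (Real.exp_pos _).le.trans (hpt z))).symm
    _ = ENNReal.ofReal (Real.exp c * (1 - c)) := by
        have ha : Integrable (fun z => 1 - (ℓ z (f i z) - ℓ z (g z))) P :=
          (integrable_const 1).sub (hi1.sub hi2)
        have hb : Integrable (fun z => ℓ z (f i z) - ℓ z (g z)) P := hi1.sub hi2
        rw [integral_const_mul, integral_add ha (hi3.div_const 2),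
          integral_sub (integrable_const 1) hb, integral_sub hi1 hi2, integral_div]
        simp only [integral_const, probReal_univ, smul_eq_mul, one_mul, hc, risk, sqDist]
        congr 2; ring
    _ ≤ 1 := by
        rw [← ENNReal.ofReal_one]
        refine ENNReal.ofReal_le_ofReal ?_
        have h1 := Real.add_one_le_exp (-c)
        calc Real.exp c * (1 - c) ≤ Real.exp c * Real.exp (-c) := by gcongr; linarith
          _ = 1 := by rw [← Real.exp_add]; simp

/-- The mixture over the prior of the exponential supermartingales that compare the experts with
the posterior means. -/
noncomputable def mixMart (P : Measure Z) (ℓ : Z → ℝ → ℝ) (f : ι → Z → ℝ) (π : Measure ι) (t : ℕ)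
    (S : ℕ → Z) : ENNReal :=
  ∫⁻ i, ENNReal.ofReal
    (Real.exp (∑ s ∈ Finset.range t, logIncr P ℓ f i (mixMean ℓ f π s S) (S s))) ∂π

theorem measurable_risk_mixMean (h : Experts D ℓ f) (t : ℕ) :
    Measurable fun S => risk P ℓ (mixMean ℓ f π t S) := by
  have : Measurable fun p : (ℕ → Z) × Z => ℓ p.2 (mixMean ℓ f π t p.1 p.2) :=
    h.loss.meas.comp (measurable_snd.prodMk (h.measurable_mixMean t))
  exact (this.stronglyMeasurable.integral_prod_right (ν := P)).measurable

theorem measurable_logIncr (h : Experts D ℓ f) (s : ℕ) (i : ι) :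
    Measurable fun p : (ℕ → Z) × Z => logIncr P ℓ f i (mixMean ℓ f π s p.1) p.2 := by
  have h1 : Measurable fun p : (ℕ → Z) × Z => ℓ p.2 (mixMean ℓ f π s p.1 p.2) :=
    h.loss.meas.comp (measurable_snd.prodMk (h.measurable_mixMean s))
  have h2 : Measurable fun p : (ℕ → Z) × Z => ℓ p.2 (f i p.2) :=
    (h.loss.meas_comp (h.meas i)).comp measurable_snd
  have h3 : Measurable fun S : ℕ → Z => sqDist P (f i) (mixMean ℓ f π s S) := by
    have : Measurable fun p : (ℕ → Z) × Z => (f i p.2 - mixMean ℓ f π s p.1 p.2) ^ 2 :=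
      (((h.meas i).comp measurable_snd).sub (h.measurable_mixMean s)).pow_const 2
    exact (this.stronglyMeasurable.integral_prod_right (ν := P)).measurable
  unfold logIncr
  exact ((h2.sub h1).neg.add (measurable_const.sub
    ((h.measurable_risk_mixMean s).comp measurable_fst))).sub ((h3.comp measurable_fst).div_const 2)

theorem ville_mixMart (h : Experts D ℓ f) {c : ℝ} (hc : 0 < c) (m : ℕ) :
    seqLaw P {S | ∃ t ≤ m, ENNReal.ofReal c ≤ mixMart P ℓ f π t S} ≤ ENNReal.ofReal c⁻¹ := by
  obtain ⟨S₀⟩ : Nonempty (ℕ → Z) := by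
    have : Nonempty Z := nonempty_of_isProbabilityMeasure P
    infer_instance
  have hm : ∀ t, Measurable fun q : (ℕ → Z) × ι => ENNReal.ofReal
      (Real.exp (∑ s ∈ Finset.range t, logIncr P ℓ f q.2 (mixMean ℓ f π s q.1) (q.1 s))) :=
    fun t => measurable_from_prod_countable_left fun i =>
      (Finset.measurable_sum _ fun s _ => (h.measurable_logIncr s i).comp
        (measurable_id.prodMk (measurable_pi_apply s))).exp.ennreal_ofReal
  have key := ville P (c := ENNReal.ofReal c) (by simpa using hc) ENNReal.ofReal_ne_top m
    (mixMart P ℓ f π) (fun t => (hm t).lintegral_prod_right') ?_ ?_ S₀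
  · refine key.trans (le_of_eq ?_)
    simp [mixMart, ENNReal.ofReal_inv_of_pos hc]
  · intro t S S' hS
    unfold mixMart
    refine lintegral_congr fun i => ?_
    congr 2
    refine Finset.sum_congr rfl fun s hs => ?_
    have hs := Finset.mem_range.1 hs
    rw [mixMean_congr s fun i hi => hS i (hi.trans hs), hS s hs]
  · intro t S
    have e : ∀ z, mixMart P ℓ f π (t + 1) (Function.update S t z) =
        ∫⁻ i, ENNReal.ofReal
          (Real.exp (∑ s ∈ Finset.range t, logIncr P ℓ f i (mixMean ℓ f π s S) (S s))) *
          ENNReal.ofReal (Real.exp (logIncr P ℓ f i (mixMean ℓ f π t S) z)) ∂π := by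
      intro z
      unfold mixMart
      refine lintegral_congr fun i => ?_
      rw [← ENNReal.ofReal_mul (Real.exp_pos _).le, ← Real.exp_add, Finset.sum_range_succ]
      have hS : ∀ s ≤ t, mixMean ℓ f π s (Function.update S t z) = mixMean ℓ f π s S :=
        fun s hs => mixMean_congr s fun i hi => by
          simp [Function.update, (lt_of_lt_of_le hi hs).ne]
      rw [hS t le_rfl, Function.update_self]
      congr 3
      refine Finset.sum_congr rfl fun s hs => ?_
      have hs := Finset.mem_range.1 hs
      rw [hS s hs.le, Function.update_of_ne hs.ne]
    simp_rw [e]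
    rw [lintegral_lintegral_swap]
    · unfold mixMart
      refine lintegral_mono fun i => ?_
      rw [lintegral_const_mul' _ _ ENNReal.ofReal_ne_top]
      exact mul_le_of_le_one_right' (h.integral_exp_logIncr_le i
        (h.measurable_mixMean_section (π := π) t S) (h.mixMean_mem t S))
    · refine Measurable.aemeasurable ?_
      refine measurable_from_prod_countable_left fun i => ?_
      have := measurable_const (a := ENNReal.ofReal (Real.exp (∑ s ∈ Finset.range t,
        logIncr P ℓ f i (mixMean ℓ f π s S) (S s)))) |>.mul (((h.measurable_logIncr (P := P) (π := π) t i).comp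
        (measurable_prodMk_left (x := S))).exp.ennreal_ofReal)
      exact this

/-- By Jensen's inequality for the posterior, a bound on `mixMart` controls the normalizing
constant from above in terms of the risk of the posterior mean. -/
theorem log_le_of_mixMart_lt (h : Experts D ℓ f) {c : ℝ} (hc : 0 < c) {t : ℕ} {S : ℕ → Z}
    (hS : mixMart P ℓ f π t S < ENNReal.ofReal c) :
    Real.log (partFun ℓ f π t S) + ∑ s ∈ Finset.range t,
      (ℓ (S s) (mixMean ℓ f π s S (S s)) - risk P ℓ (mixMean ℓ f π s S) +
        risk P ℓ (mixMean ℓ f π t S) -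
        sqDist P (mixMean ℓ f π t S) (mixMean ℓ f π s S) / 2) ≤ Real.log c := by
  have := h.isProbabilityMeasure_posterior (π := π) t S
  set μ := π.tilted fun i => -cumLoss ℓ f t S i with hμ
  set G : ℕ → Z → ℝ := fun s => mixMean ℓ f π s S with hG
  have hGm : ∀ s, Measurable (G s) := fun s => h.measurable_mixMean_section (π := π) s S
  have hGD : ∀ s z, G s z ∈ D := fun s z => h.mixMean_mem s S z
  set V : ι → ℝ := fun i => ∑ s ∈ Finset.range t,
    (ℓ (S s) (G s (S s)) + (risk P ℓ (f i) - risk P ℓ (G s)) - sqDist P (f i) (G s) / 2) with hV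
  set A := ∑ s ∈ Finset.range t, (ℓ (S s) (G s (S s)) - risk P ℓ (G s) + risk P ℓ (G t) -
    sqDist P (G t) (G s) / 2) with hA
  have hriskb : ∀ g : Z → ℝ, (∀ z, g z ∈ D) → |risk P ℓ g| ≤ 1 / 2 := fun g hg =>
    abs_integral_le_of_abs_le fun z => h.loss.bdd z _ (hg z)
  have hsqb : ∀ g g' : Z → ℝ, (∀ z, g z ∈ D) → (∀ z, g' z ∈ D) → |sqDist P g g'| ≤ 4 :=
    fun g g' hg hg' => abs_integral_le_of_abs_le fun z => by
      have := h.loss.dist_le_two z (hg z) (hg' z)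
      rw [abs_pow]; nlinarith [abs_nonneg (g z - g' z)]
  -- pointwise Jensen inequality, integrated over the posterior
  have hJ : ∀ s, risk P ℓ (G t) - sqDist P (G t) (G s) / 2 ≤
      ∫ i, (risk P ℓ (f i) - sqDist P (f i) (G s) / 2) ∂μ := by
    intro s
    have hint : ∀ i, Integrable (fun z => ℓ z (f i z) - (f i z - G s z) ^ 2 / 2) P := fun i =>
      (h.loss.integrable (h.meas i) (h.mem i)).sub
        ((h.loss.integrable_sq_sub (h.meas i) (h.mem i) (hGm s) (hGD s)).div_const 2)
    have hbd : ∀ i z, |ℓ z (f i z) - (f i z - G s z) ^ 2 / 2| ≤ 3 := fun i z => by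
      have h1 := h.loss.bdd z _ (h.mem i z)
      have h2 := h.loss.dist_le_two z (h.mem i z) (hGD s z)
      have h3 : (f i z - G s z) ^ 2 ≤ 4 := by
        rw [← sq_abs]; nlinarith [abs_nonneg (f i z - G s z)]
      rw [abs_le] at h1 ⊢
      constructor <;> nlinarith [sq_nonneg (f i z - G s z)]
    have e1 : ∀ i, risk P ℓ (f i) - sqDist P (f i) (G s) / 2 =
        ∫ z, (ℓ z (f i z) - (f i z - G s z) ^ 2 / 2) ∂P := fun i => by
      rw [integral_sub (h.loss.integrable (h.meas i) (h.mem i))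
        ((h.loss.integrable_sq_sub (h.meas i) (h.mem i) (hGm s) (hGD s)).div_const 2),
        integral_div, risk, sqDist]
    have e2 : risk P ℓ (G t) - sqDist P (G t) (G s) / 2 =
        ∫ z, (ℓ z (G t z) - (G t z - G s z) ^ 2 / 2) ∂P := by
      rw [integral_sub (h.loss.integrable (hGm t) (hGD t))
        ((h.loss.integrable_sq_sub (hGm t) (hGD t) (hGm s) (hGD s)).div_const 2),
        integral_div, risk, sqDist]
    have hmeas : Measurable fun q : Z × ι => ℓ q.1 (f q.2 q.1) - (f q.2 q.1 - G s q.1) ^ 2 / 2 :=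
      measurable_from_prod_countable_left fun i => (h.loss.meas_comp (h.meas i)).sub
        ((((h.meas i).sub (hGm s)).pow_const 2).div_const 2)
    have hmeas' : Measurable fun q : ι × Z => ℓ q.2 (f q.1 q.2) - (f q.1 q.2 - G s q.2) ^ 2 / 2 :=
      hmeas.comp measurable_swap
    simp_rw [e1]
    rw [e2, integral_integral_swap]
    · refine integral_mono
        (integrable_of_abs_le (c := 3) ((h.loss.meas_comp (hGm t)).sub
          ((((hGm t).sub (hGm s)).pow_const 2).div_const 2)) fun z => ?_)
        (integrable_of_abs_le (c := 3)
          (hmeas.stronglyMeasurable.integral_prod_right (ν := μ)).measurable fun z =>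
          abs_integral_le_of_abs_le fun i => hbd i z) fun z => ?_
      · have h1 := h.loss.bdd z _ (hGD t z)
        have h2 := h.loss.dist_le_two z (hGD t z) (hGD s z)
        have h3 : (G t z - G s z) ^ 2 ≤ 4 := by
          rw [← sq_abs]; nlinarith [abs_nonneg (G t z - G s z)]
        rw [abs_le] at h1 ⊢
        constructor <;> nlinarith [sq_nonneg (G t z - G s z)]
      · obtain ⟨q, -, hq⟩ := h.loss.tangent z (G t z) (hGD t z)
        have hfi := h.integrable_expert μ z
        have h0 : ∫ i, f i z ∂μ = G t z := rfl
        have hi : Integrable (fun i => (q - (G t z - G s z)) * (f i z - G t z)) μ :=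
          (hfi.sub (integrable_const _)).const_mul _
        calc ℓ z (G t z) - (G t z - G s z) ^ 2 / 2
            = ∫ i, (ℓ z (G t z) - (G t z - G s z) ^ 2 / 2 +
                (q - (G t z - G s z)) * (f i z - G t z)) ∂μ := by
              rw [integral_add (integrable_const _) hi, integral_const_mul,
                integral_sub hfi (integrable_const _), h0]
              simp
          _ ≤ _ := by
              refine integral_mono ((integrable_const _).add hi)
                (integrable_of_abs_le (c := 3) (measurable_of_countable _) fun i => hbd i z)
                fun i => ?_
              have := hq _ (h.mem i z)
              simp only
              nlinarith
    · exact integrable_of_abs_le (c := 3) hmeas' fun q => hbd q.1 q.2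
  have hVi : Integrable V μ := by
    refine integrable_of_abs_le (c := t * 4) (measurable_of_countable _) fun i => ?_
    rw [hV]
    refine (Finset.abs_sum_le_sum_abs _ _).trans ?_
    calc _ ≤ ∑ s ∈ Finset.range t, (4 : ℝ) := Finset.sum_le_sum fun s _ => by
          have h1 := abs_le.1 (h.loss.bdd (S s) _ (hGD s (S s)))
          have h2 := abs_le.1 (hriskb _ (h.mem i))
          have h3 := abs_le.1 (hriskb _ (hGD s))
          have h4 := abs_le.1 (hsqb _ _ (h.mem i) (hGD s))
          have h5 := sqDist_nonneg (P := P) (f i) (G s)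
          rw [abs_le]; constructor <;> linarith
      _ = _ := by simp
  have hAV : A ≤ ∫ i, V i ∂μ := by
    rw [hV, integral_finsetSum]
    · rw [hA]
      refine Finset.sum_le_sum fun s _ => ?_
      have h1 := hJ s
      have h2 : Integrable (fun i => risk P ℓ (f i) - sqDist P (f i) (G s) / 2) μ :=
        integrable_of_abs_le (c := 3) (measurable_of_countable _) fun i => by
          have h2 := abs_le.1 (hriskb _ (h.mem i))
          have h4 := abs_le.1 (hsqb _ _ (h.mem i) (hGD s))
          rw [abs_le]; constructor <;> linarith
      have e : ∀ i, ℓ (S s) (G s (S s)) + (risk P ℓ (f i) - risk P ℓ (G s)) -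
          sqDist P (f i) (G s) / 2 = (ℓ (S s) (G s (S s)) - risk P ℓ (G s)) +
          (risk P ℓ (f i) - sqDist P (f i) (G s) / 2) := fun i => by ring
      simp_rw [e]
      rw [integral_add (integrable_const _) h2]
      simp only [integral_const, probReal_univ, smul_eq_mul, one_mul]
      linarith
    · intro s _
      refine integrable_of_abs_le (c := 4) (measurable_of_countable _) fun i => ?_
      have h1 := abs_le.1 (h.loss.bdd (S s) _ (hGD s (S s)))
      have h2 := abs_le.1 (hriskb _ (h.mem i))
      have h3 := abs_le.1 (hriskb _ (hGD s))
      have h4 := abs_le.1 (hsqb _ _ (h.mem i) (hGD s))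
      have h5 := sqDist_nonneg (P := P) (f i) (G s)
      rw [abs_le]; constructor <;> linarith
  have hexpV : Integrable (fun i => Real.exp (V i)) μ := by
    refine integrable_of_abs_le (c := Real.exp (t * 4)) (measurable_of_countable _) fun i => ?_
    rw [abs_of_pos (Real.exp_pos _), Real.exp_le_exp, hV]
    calc _ ≤ ∑ s ∈ Finset.range t, (4 : ℝ) := Finset.sum_le_sum fun s _ => by
          have h1 := abs_le.1 (h.loss.bdd (S s) _ (hGD s (S s)))
          have h2 := abs_le.1 (hriskb _ (h.mem i))
          have h3 := abs_le.1 (hriskb _ (hGD s))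
          have h5 := sqDist_nonneg (P := P) (f i) (G s)
          linarith
      _ = _ := by simp
  have hjen : Real.exp A ≤ ∫ i, Real.exp (V i) ∂μ := by
    have h1 := convexOn_exp.map_integral_le (μ := μ) Real.continuous_exp.continuousOn isClosed_univ
      (Filter.Eventually.of_forall fun i => Set.mem_univ (V i)) hVi hexpV
    exact (Real.exp_le_exp.2 hAV).trans h1
  have hlog : partFun ℓ f π t S * ∫ i, Real.exp (V i) ∂μ =
      ∫ i, Real.exp (∑ s ∈ Finset.range t, logIncr P ℓ f i (G s) (S s)) ∂π := by
    rw [hμ, integral_exp_tilted]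
    change partFun ℓ f π t S * (_ / partFun ℓ f π t S) = _
    rw [mul_div_cancel₀ _ (h.partFun_pos t S).ne']
    refine integral_congr_ae (Filter.Eventually.of_forall fun i => ?_)
    simp only [Pi.add_apply, hV, cumLoss, logIncr]
    rw [← Finset.sum_neg_distrib, ← Finset.sum_add_distrib]
    congr 1
    refine Finset.sum_congr rfl fun s _ => ?_
    ring
  have hlt : ∫ i, Real.exp (∑ s ∈ Finset.range t, logIncr P ℓ f i (G s) (S s)) ∂π ≤ c := by
    rw [integral_eq_lintegral_of_nonneg_ae (Filter.Eventually.of_forall fun i =>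
      (Real.exp_pos _).le) (measurable_of_countable _).aestronglyMeasurable]
    exact ENNReal.toReal_le_of_le_ofReal hc.le hS.le
  rw [← hlog] at hlt
  have hpos := h.partFun_pos (π := π) t S
  have h1 : partFun ℓ f π t S * Real.exp A ≤ c :=
    (mul_le_mul_of_nonneg_left hjen hpos.le).trans hlt
  have h2 := Real.log_le_log (mul_pos hpos (Real.exp_pos A)) h1
  rwa [Real.log_mul hpos.ne' (Real.exp_pos A).ne', Real.log_exp] at h2

end Experts

/-! ### The path of the progressive mixture -/

/-- If `t r_t - Y_t` is bounded by a constant up to an error `Q t`, where `Y` are the partial sums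
of `r`, then the averages `Y_t / t` grow slowly. -/
theorem partialSum_div_le {r Q : ℕ → ℝ} {d : ℝ} {t₁ k : ℕ} (h1 : 0 < t₁) (hk : t₁ ≤ k)
    (h : ∀ t < k, t * r t ≤ (∑ s ∈ Finset.range t, r s) + Q t + d) :
    (∑ s ∈ Finset.range k, r s) / k ≤ (∑ s ∈ Finset.range t₁, r s) / t₁ + d * (1 / t₁ - 1 / k) +
      ∑ t ∈ Finset.range k, if t₁ ≤ t then Q t / (t * (t + 1)) else 0 := by
  induction k, hk using Nat.le_induction with
  | base =>
    rw [Finset.sum_eq_zero (s := Finset.range t₁)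
      (f := fun t => if t₁ ≤ t then Q t / (t * (t + 1)) else 0)]
    · simp
    · intro t ht
      rw [if_neg (by have := Finset.mem_range.1 ht; omega)]
  | succ k hk ih =>
    have ih := ih fun t ht => h t (by omega)
    have hk0 : (0 : ℝ) < k := by exact_mod_cast h1.trans_le hk
    have hk' := h k (by omega)
    rw [Finset.sum_range_succ _ k, Finset.sum_range_succ _ k, if_pos hk]
    set Y := ∑ s ∈ Finset.range k, r s
    have e1 : (Y + r k) / ((k + 1 : ℕ) : ℝ) = Y / k + (k * r k - Y) / (k * (k + 1)) := by
      push_cast; field_simp; ring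
    have e2 : d * (1 / (t₁ : ℝ) - 1 / ((k + 1 : ℕ) : ℝ)) =
        d * (1 / t₁ - 1 / k) + d / (k * (k + 1)) := by
      push_cast; field_simp; ring
    rw [e1, e2]
    have : (k * r k - Y) / (k * (k + 1)) ≤ d / (k * (k + 1)) + Q k / (k * (k + 1)) := by
      rw [← add_div]; gcongr; linarith
    linarith

/-- The linear programming bound for the final regret `x` by three values of the noise path `M`.
The weights `0.36`, `0.25` and `0.39` leave room for the variation `Q` of the path because
`0.25 ≤ (t / n)²` from `t₁` on and `0.25 + 0.39 ≤ (t / n)²` from `t₂` on. -/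
theorem le_three_times {r Q M : ℕ → ℝ} {x lam c : ℝ} {m t₁ t₂ : ℕ} (hQ : ∀ t, 0 ≤ Q t)
    (hr : r m ≤ 1) (hlam : 0 ≤ lam) (hc : 0 ≤ c)
    (ha : ∀ t ≤ m, ∑ s ∈ Finset.range t, r s ≤ M t + lam)
    (hb : ∀ t ≤ m, t * r t - ∑ s ∈ Finset.range t, r s - Q t + ∑ s ∈ Finset.range m, r s ≤
      M m + lam + c)
    (hx : x ≤ ∑ s ∈ Finset.range (m + 1), r s - (∑ t ∈ Finset.range (m + 1), Q t) / (m + 1))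
    (h1 : m + 1 ≤ 2 * t₁) (h1' : t₁ ≤ m) (h2 : 4 * (m + 1) ≤ 5 * t₂) (h2' : t₂ ≤ m) :
    x ≤ 36 / 100 * M m + 1 / 4 * ((m + 1) / t₁) * M t₁ + 39 / 100 * ((m + 1) / t₂) * M t₂ +
      2 * lam + c + 1 := by
  set n : ℝ := m + 1 with hn
  have hn0 : 0 < n := by positivity
  have hncast : ((m + 1 : ℕ) : ℝ) = n := by push_cast; rfl
  set Y := ∑ s ∈ Finset.range (m + 1), r s with hY
  have hYm : Y = ∑ s ∈ Finset.range m, r s + r m := Finset.sum_range_succ _ _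
  set d := M m + lam + c + 1 - Y with hd
  have hd0 : 0 ≤ d := by have := ha m le_rfl; rw [hd]; linarith
  have hstep : ∀ t < m + 1, t * r t ≤ (∑ s ∈ Finset.range t, r s) + Q t + d := fun t ht => by
    have := hb t (by omega); rw [hd]; linarith
  have h10 : 0 < t₁ := by omega
  have h20 : 0 < t₂ := by omega
  have k1 := partialSum_div_le h10 (by omega : t₁ ≤ m + 1) hstep
  have k2 := partialSum_div_le h20 (by omega : t₂ ≤ m + 1) hstep
  rw [hncast] at k1 k2
  have t1p : (0 : ℝ) < t₁ := by exact_mod_cast h10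
  have t2p : (0 : ℝ) < t₂ := by exact_mod_cast h20
  set a₁ := n / t₁ with ha1
  set a₂ := n / t₂ with ha2
  have ha1' : a₁ ≤ 2 := by
    rw [ha1, div_le_iff₀ t1p]; rw [hn]; exact_mod_cast h1
  have ha2' : a₂ ≤ 5 / 4 := by
    rw [ha2, div_le_iff₀ t2p]
    have : (4 : ℝ) * n ≤ 5 * t₂ := by rw [hn]; exact_mod_cast h2
    linarith
  have ha1p : 0 < a₁ := by positivity
  have ha2p : 0 < a₂ := by positivity
  set q₁ := ∑ t ∈ Finset.range (m + 1), if t₁ ≤ t then Q t / (t * (t + 1)) else 0 with hq1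
  set q₂ := ∑ t ∈ Finset.range (m + 1), if t₂ ≤ t then Q t / (t * (t + 1)) else 0 with hq2
  have hq : 1 / 4 * (n * q₁) + 39 / 100 * (n * q₂) ≤ (∑ t ∈ Finset.range (m + 1), Q t) / n := by
    rw [hq1, hq2, Finset.mul_sum, Finset.mul_sum, Finset.mul_sum, Finset.mul_sum,
      ← Finset.sum_add_distrib, Finset.sum_div]
    refine Finset.sum_le_sum fun t ht => ?_
    have hQt := hQ t
    have main : ∀ b : ℝ, 0 < t → b * n ^ 2 ≤ t ^ 2 →
        b * (n * (Q t / (t * (t + 1)))) ≤ Q t / n := by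
      intro b ht0 hbn
      have ht0' : (0 : ℝ) < t := by exact_mod_cast ht0
      have : b * (n * (Q t / (t * (t + 1)))) = (b * n * Q t) / (t * (t + 1)) := by ring
      rw [this, div_le_div_iff₀ (by positivity) hn0]
      have h3 : b * n ^ 2 ≤ t * (t + 1) := by linarith
      linarith [mul_le_mul_of_nonneg_left h3 hQt]
    have c2 : t₂ ≤ t → 64 / 100 * n ^ 2 ≤ (t : ℝ) ^ 2 := fun h => by
      have h3 : 4 * n ≤ 5 * t := by
        rw [hn]; exact_mod_cast h2.trans (by omega)
      have := pow_le_pow_left₀ (by positivity) h3 2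
      linarith [mul_pow 4 n 2, mul_pow 5 (t : ℝ) 2]
    have c1 : t₁ ≤ t → 1 / 4 * n ^ 2 ≤ (t : ℝ) ^ 2 := fun h => by
      have h3 : n ≤ 2 * t := by
        rw [hn]; exact_mod_cast h1.trans (by omega)
      have := pow_le_pow_left₀ (by positivity) h3 2
      linarith [mul_pow 2 (t : ℝ) 2]
    by_cases e2 : t₂ ≤ t
    · have hm := main (64 / 100) (by omega) (c2 e2)
      have h0 : 0 ≤ n * (Q t / (t * (t + 1))) := by positivity
      rw [if_pos e2]
      split_ifs <;> linarith
    · rw [if_neg e2]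
      split_ifs with e1
      · have := main (1 / 4) (by omega) (c1 e1); linarith
      · simp; positivity
  have l1 : Y ≤ a₁ * (∑ s ∈ Finset.range t₁, r s) + d * (a₁ - 1) + n * q₁ := by
    have := mul_le_mul_of_nonneg_left k1 hn0.le
    have e1 : n * (Y / n) = Y := mul_div_cancel₀ _ hn0.ne'
    have e2 : n * ((∑ s ∈ Finset.range t₁, r s) / t₁ + d * (1 / t₁ - 1 / n) + q₁) =
        a₁ * (∑ s ∈ Finset.range t₁, r s) + d * (a₁ - 1) + n * q₁ := by
      rw [ha1]; field_simp
    linarith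
  have l2 : Y ≤ a₂ * (∑ s ∈ Finset.range t₂, r s) + d * (a₂ - 1) + n * q₂ := by
    have := mul_le_mul_of_nonneg_left k2 hn0.le
    have e1 : n * (Y / n) = Y := mul_div_cancel₀ _ hn0.ne'
    have e2 : n * ((∑ s ∈ Finset.range t₂, r s) / t₂ + d * (1 / t₂ - 1 / n) + q₂) =
        a₂ * (∑ s ∈ Finset.range t₂, r s) + d * (a₂ - 1) + n * q₂ := by
      rw [ha2]; field_simp
    linarith
  have m1 := mul_le_mul_of_nonneg_left (ha t₁ h1') ha1p.le
  have m2 := mul_le_mul_of_nonneg_left (ha t₂ h2') ha2p.le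
  have hbeta : 1 / 4 * a₁ + 39 / 100 * a₂ ≤ 1 := by linarith
  have hlast := mul_nonneg (sub_nonneg.2 hbeta) hd0
  have hll := mul_le_mul_of_nonneg_right hbeta hlam
  have final : Y ≤ 1 / 4 * (a₁ * (M t₁ + lam)) + 39 / 100 * (a₂ * (M t₂ + lam)) +
      36 / 100 * (M m + lam + c + 1) + (∑ t ∈ Finset.range (m + 1), Q t) / n := by
    have : d = M m + lam + c + 1 - Y := hd
    linarith
  linarith

theorem sum_sq_sub_pairs (a : ℕ → ℝ) (n : ℕ) :
    ∑ t ∈ Finset.range n, ∑ s ∈ Finset.range t, (a t - a s) ^ 2 =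
      n * ∑ t ∈ Finset.range n, a t ^ 2 - (∑ t ∈ Finset.range n, a t) ^ 2 := by
  induction n with
  | zero => simp
  | succ n ih =>
    rw [Finset.sum_range_succ, ih, Finset.sum_range_succ _ n, Finset.sum_range_succ _ n]
    have : ∑ s ∈ Finset.range n, (a n - a s) ^ 2 = n * a n ^ 2 -
        2 * a n * ∑ s ∈ Finset.range n, a s + ∑ s ∈ Finset.range n, a s ^ 2 := by
      simp_rw [sub_sq]
      rw [Finset.sum_add_distrib, Finset.sum_sub_distrib, ← Finset.mul_sum]
      simp
    rw [this]; push_cast; ring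

/-- The variance of finitely many numbers through their pairwise distances. -/
theorem sum_sq_sub_mean (a : ℕ → ℝ) {n : ℕ} (hn : 0 < n) :
    ∑ t ∈ Finset.range n, (a t - (∑ s ∈ Finset.range n, a s) / n) ^ 2 =
      (∑ t ∈ Finset.range n, ∑ s ∈ Finset.range t, (a t - a s) ^ 2) / n := by
  have hn' : (n : ℝ) ≠ 0 := by positivity
  rw [sum_sq_sub_pairs]
  simp_rw [sub_sq]
  rw [Finset.sum_add_distrib, Finset.sum_sub_distrib, ← Finset.sum_mul, ← Finset.mul_sum]
  simp only [Finset.sum_const, Finset.card_range, nsmul_eq_mul]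
  field_simp
  ring

theorem average_mem {D : Set ℝ} (hD : Convex ℝ D) {n : ℕ} (hn : 0 < n) {a : ℕ → ℝ}
    (ha : ∀ t, a t ∈ D) : (∑ t ∈ Finset.range n, a t) / n ∈ D := by
  have := hD.sum_mem (t := Finset.range n) (w := fun _ => (n : ℝ)⁻¹) (z := a)
    (fun _ _ => by positivity) (by simp [hn.ne']) fun i _ => ha i
  simpa [← Finset.mul_sum, div_eq_inv_mul] using this

/-- The average of the posterior mean predictors before time `n`. -/
noncomputable def mixAvg {Z ι : Type*} [MeasurableSpace ι] (ℓ : Z → ℝ → ℝ) (f : ι → Z → ℝ)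
    (π : Measure ι) (n : ℕ) (S : ℕ → Z) (z : Z) : ℝ :=
  (∑ t ∈ Finset.range n, mixMean ℓ f π t S z) / n

/-- The mean loss of an expert drawn from `ρ`. -/
noncomputable def meanLoss {Z ι : Type*} [MeasurableSpace ι] (ℓ : Z → ℝ → ℝ) (f : ι → Z → ℝ)
    (ρ : Measure ι) (z : Z) : ℝ := ∫ i, ℓ z (f i z) ∂ρ

/-- The loss gain of the posterior mean at time `t` over an expert drawn from `ρ`. -/
noncomputable def mixGain {Z ι : Type*} [MeasurableSpace ι] (ℓ : Z → ℝ → ℝ) (f : ι → Z → ℝ)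
    (π ρ : Measure ι) (t : ℕ) (S : ℕ → Z) (z : Z) : ℝ :=
  meanLoss ℓ f ρ z - ℓ z (mixMean ℓ f π t S z)

namespace Experts

variable {Z ι : Type*} [MeasurableSpace Z] [MeasurableSpace ι] [Countable ι]
  [DiscreteMeasurableSpace ι] {D : Set ℝ} {ℓ : Z → ℝ → ℝ} {f : ι → Z → ℝ}
  {π : Measure ι} [IsProbabilityMeasure π] {P : Measure Z} [IsProbabilityMeasure P]

theorem abs_meanLoss_le (h : Experts D ℓ f) (ρ : Measure ι) [IsProbabilityMeasure ρ] (z : Z) :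
    |meanLoss ℓ f ρ z| ≤ 1 / 2 :=
  abs_integral_le_of_abs_le fun i => h.loss.bdd z _ (h.mem i z)

theorem measurable_meanLoss (h : Experts D ℓ f) (ρ : Measure ι) [IsProbabilityMeasure ρ] :
    Measurable (meanLoss ℓ f ρ) := by
  have : Measurable fun q : Z × ι => ℓ q.1 (f q.2 q.1) :=
    measurable_from_prod_countable_left fun i => h.loss.meas_comp (h.meas i)
  exact (this.stronglyMeasurable.integral_prod_right (ν := ρ)).measurable

theorem integrable_meanLoss (h : Experts D ℓ f) (ρ : Measure ι) [IsProbabilityMeasure ρ] :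
    Integrable (meanLoss ℓ f ρ) P :=
  integrable_of_abs_le (h.measurable_meanLoss ρ) (h.abs_meanLoss_le ρ)

theorem predictable_mixGain (h : Experts D ℓ f) (ρ : Measure ι) [IsProbabilityMeasure ρ] :
    Predictable (mixGain ℓ f π ρ) where
  meas t := ((h.measurable_meanLoss ρ).comp measurable_snd).sub
    (h.loss.meas.comp (measurable_snd.prodMk (h.measurable_mixMean t)))
  adapted t S S' hS := by
    ext z
    rw [mixGain, mixGain, mixMean_congr t hS]
  bdd t S z := by
    have h1 := h.abs_meanLoss_le ρ z
    have h2 := h.loss.bdd z _ (h.mixMean_mem (π := π) t S z)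
    exact (abs_sub _ _).trans (by linarith)

theorem integral_mixGain (h : Experts D ℓ f) (ρ : Measure ι) [IsProbabilityMeasure ρ] (t : ℕ)
    (S : ℕ → Z) : ∫ z, mixGain ℓ f π ρ t S z ∂P =
      ∫ z, meanLoss ℓ f ρ z ∂P - risk P ℓ (mixMean ℓ f π t S) := by
  unfold mixGain
  rw [integral_sub (h.integrable_meanLoss ρ)
    (h.loss.integrable (h.measurable_mixMean_section t S) (h.mixMean_mem t S))]
  rfl

theorem mixAvg_mem (h : Experts D ℓ f) {n : ℕ} (hn : 0 < n) (S : ℕ → Z) (z : Z) :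
    mixAvg ℓ f π n S z ∈ D :=
  average_mem h.loss.convex hn fun t => h.mixMean_mem t S z

theorem measurable_mixAvg (h : Experts D ℓ f) (n : ℕ) :
    Measurable fun p : (ℕ → Z) × Z => mixAvg ℓ f π n p.1 p.2 :=
  (Finset.measurable_sum _ fun t _ => h.measurable_mixMean t).div_const _

theorem measurable_mixAvg_section (h : Experts D ℓ f) (n : ℕ) (S : ℕ → Z) :
    Measurable (mixAvg ℓ f π n S) :=
  (Finset.measurable_sum _ fun t _ => h.measurable_mixMean_section t S).div_const _

/-- The spread of the posterior means around their average is the sum, over all times, of the squared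
distances to the earlier posterior means. -/
theorem sum_sqDist_mixAvg (h : Experts D ℓ f) {n : ℕ} (hn : 0 < n) (S : ℕ → Z) :
    ∑ t ∈ Finset.range n, sqDist P (mixMean ℓ f π t S) (mixAvg ℓ f π n S) =
      (∑ t ∈ Finset.range n, ∑ s ∈ Finset.range t,
        sqDist P (mixMean ℓ f π t S) (mixMean ℓ f π s S)) / n := by
  have hm : ∀ t, Measurable (mixMean ℓ f π t S) := fun t => h.measurable_mixMean_section t S
  have hD : ∀ t z, mixMean ℓ f π t S z ∈ D := fun t z => h.mixMean_mem t S z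
  unfold sqDist
  rw [← integral_finsetSum _ fun t _ => h.loss.integrable_sq_sub (hm t) (hD t)
    (h.measurable_mixAvg_section n S) (h.mixAvg_mem hn S)]
  have : ∀ t, ∑ s ∈ Finset.range t, ∫ z, (mixMean ℓ f π t S z - mixMean ℓ f π s S z) ^ 2 ∂P =
      ∫ z, ∑ s ∈ Finset.range t, (mixMean ℓ f π t S z - mixMean ℓ f π s S z) ^ 2 ∂P := fun t =>
    (integral_finsetSum _ fun s _ => h.loss.integrable_sq_sub (hm t) (hD t) (hm s) (hD s)).symm
  simp_rw [this]
  rw [← integral_finsetSum _ fun t _ => integrable_finsetSum _ fun s _ =>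
    h.loss.integrable_sq_sub (hm t) (hD t) (hm s) (hD s), ← integral_div]
  refine integral_congr_ae (Filter.Eventually.of_forall fun z => ?_)
  exact sum_sq_sub_mean (fun t => mixMean ℓ f π t S z) hn

/-- The gain from averaging: by strong convexity the risk of the average is smaller than the
average of the risks by half the variance of the path. -/
theorem risk_mixAvg_le (h : Experts D ℓ f) {n : ℕ} (hn : 0 < n) (S : ℕ → Z) :
    n * risk P ℓ (mixAvg ℓ f π n S) + (∑ t ∈ Finset.range n,
      sqDist P (mixMean ℓ f π t S) (mixAvg ℓ f π n S)) / 2 ≤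
      ∑ t ∈ Finset.range n, risk P ℓ (mixMean ℓ f π t S) := by
  have hm : ∀ t, Measurable (mixMean ℓ f π t S) := fun t => h.measurable_mixMean_section t S
  have hD : ∀ t z, mixMean ℓ f π t S z ∈ D := fun t z => h.mixMean_mem t S z
  have ha := h.measurable_mixAvg_section (π := π) n S
  have haD := h.mixAvg_mem (π := π) hn S
  unfold risk sqDist
  rw [← integral_finsetSum _ fun t _ => h.loss.integrable_sq_sub (hm t) (hD t) ha haD,
    ← integral_finsetSum _ fun t _ => h.loss.integrable (hm t) (hD t), ← integral_const_mul,
    ← integral_div, ← integral_add ((h.loss.integrable ha haD).const_mul _)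
      ((integrable_finsetSum _ fun t _ =>
        h.loss.integrable_sq_sub (hm t) (hD t) ha haD).div_const 2)]
  refine integral_mono (((h.loss.integrable ha haD).const_mul _).add
      ((integrable_finsetSum _ fun t _ =>
        h.loss.integrable_sq_sub (hm t) (hD t) ha haD).div_const 2))
    (integrable_finsetSum _ fun t _ => h.loss.integrable (hm t) (hD t)) fun z => ?_
  obtain ⟨q, -, hq⟩ := h.loss.tangent z _ (haD z)
  have h1 : ∑ t ∈ Finset.range n, (mixMean ℓ f π t S z - mixAvg ℓ f π n S z) = 0 := by
    rw [Finset.sum_sub_distrib, mixAvg]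
    have : (n : ℝ) ≠ 0 := by positivity
    simp; field_simp; simp
  have h2 := Finset.sum_le_sum fun t (_ : t ∈ Finset.range n) => hq _ (hD t z)
  simp only [Finset.sum_add_distrib, ← Finset.mul_sum, ← Finset.sum_div, h1] at h2
  simp only [Finset.sum_const, Finset.card_range, nsmul_eq_mul, mul_zero, add_zero] at h2
  exact h2

/-- The two consequences of the exponential weights analysis for a path on which the
supermartingale `mixMart` stays small: the regret is bounded by the noise `centSum` at the end, with a
gain from the spread of the path, and by a combination of the noise at three times. -/
theorem regret_le (h : Experts D ℓ f) (ρ : Measure ι) [IsProbabilityMeasure ρ]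
    (hρ : InformationTheory.klDiv ρ π ≠ ⊤) {c : ℝ} (hc : 1 ≤ c) (m : ℕ) (S : ℕ → Z)
    (hS : ∀ t ≤ m, mixMart P ℓ f π t S < ENNReal.ofReal c) :
    ((m + 1) * (risk P ℓ (mixAvg ℓ f π (m + 1) S) - ∫ z, meanLoss ℓ f ρ z ∂P) ≤
      centSum P (mixGain ℓ f π ρ) m S + (InformationTheory.klDiv ρ π).toReal + 1 -
        (∑ t ∈ Finset.range (m + 1),
          sqDist P (mixMean ℓ f π t S) (mixAvg ℓ f π (m + 1) S)) / 2) ∧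
    ∀ t₁ t₂ : ℕ, m + 1 ≤ 2 * t₁ → t₁ ≤ m → 4 * (m + 1) ≤ 5 * t₂ → t₂ ≤ m →
      (m + 1) * (risk P ℓ (mixAvg ℓ f π (m + 1) S) - ∫ z, meanLoss ℓ f ρ z ∂P) ≤
        36 / 100 * centSum P (mixGain ℓ f π ρ) m S +
        1 / 4 * ((m + 1) / t₁) * centSum P (mixGain ℓ f π ρ) t₁ S +
        39 / 100 * ((m + 1) / t₂) * centSum P (mixGain ℓ f π ρ) t₂ S +
        2 * (InformationTheory.klDiv ρ π).toReal + Real.log c + 1 := by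
  set Rρ := ∫ z, meanLoss ℓ f ρ z ∂P with hRρ
  set lam := (InformationTheory.klDiv ρ π).toReal with hlam
  have hlam0 : 0 ≤ lam := ENNReal.toReal_nonneg
  set G : ℕ → Z → ℝ := fun t => mixMean ℓ f π t S with hG
  set r : ℕ → ℝ := fun t => risk P ℓ (G t) - Rρ with hr
  set M : ℕ → ℝ := fun t => centSum P (mixGain ℓ f π ρ) t S with hM
  set Q : ℕ → ℝ := fun t => ∑ s ∈ Finset.range t, sqDist P (G t) (G s) / 2 with hQ
  have hGD : ∀ t z, G t z ∈ D := fun t z => h.mixMean_mem t S z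
  have hgain : ∀ t, ∑ s ∈ Finset.range t, (meanLoss ℓ f ρ (S s) - ℓ (S s) (G s (S s))) =
      M t - ∑ s ∈ Finset.range t, r s := by
    intro t
    simp only [hM, centSum]
    rw [← Finset.sum_sub_distrib]
    refine Finset.sum_congr rfl fun s _ => ?_
    rw [h.integral_mixGain ρ s S, mixGain]
    simp only [hr, hG, hRρ]; ring
  have hcum : ∀ t, ∫ i, cumLoss ℓ f t S i ∂ρ = ∑ s ∈ Finset.range t, meanLoss ℓ f ρ (S s) := by
    intro t
    unfold cumLoss meanLoss
    exact integral_finsetSum _ fun s _ => integrable_of_abs_le (c := 1 / 2)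
      (measurable_of_countable _) fun i => h.loss.bdd _ _ (h.mem i _)
  have hU0 : Real.log (partFun ℓ f π 0 S) = 0 := by simp [partFun, cumLoss]
  -- the usual exponential weights bound, at each time `t`
  have ha : ∀ t ≤ m, ∑ s ∈ Finset.range t, r s ≤ M t + lam := by
    intro t _
    have h1 := h.log_partFun_le (π := π) S (Nat.zero_le t)
    have h2 := h.neg_log_partFun_le ρ hρ t S
    rw [hU0, ← Finset.range_eq_Ico] at h1
    rw [hcum] at h2
    have h3 := hgain t
    rw [Finset.sum_sub_distrib] at h3
    linarith
  -- up to time `t`, the normalizing constant is bounded through the risk of the posterior mean at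
  -- time `t` instead, which is better when the risks decrease
  have hb : ∀ t ≤ m, t * r t - ∑ s ∈ Finset.range t, r s - Q t + ∑ s ∈ Finset.range m, r s ≤
      M m + lam + Real.log c := by
    intro t ht
    have h1 := h.log_partFun_le (π := π) S ht
    have h2 := h.neg_log_partFun_le ρ hρ m S
    have h3 := h.log_le_of_mixMart_lt (by linarith) (hS t ht)
    rw [hcum] at h2
    have h4 := hgain m
    rw [Finset.sum_sub_distrib, ← Finset.sum_range_add_sum_Ico
      (fun s => ℓ (S s) (G s (S s))) ht] at h4
    have h5 : ∑ s ∈ Finset.range t, (ℓ (S s) (mixMean ℓ f π s S (S s)) -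
        risk P ℓ (mixMean ℓ f π s S) + risk P ℓ (mixMean ℓ f π t S) -
        sqDist P (mixMean ℓ f π t S) (mixMean ℓ f π s S) / 2) =
        ∑ s ∈ Finset.range t, ℓ (S s) (G s (S s)) - ∑ s ∈ Finset.range t, r s + t * r t - Q t := by
      have : (t : ℝ) * r t = ∑ s ∈ Finset.range t, r t := by simp
      rw [this, hQ, ← Finset.sum_sub_distrib, ← Finset.sum_add_distrib, ← Finset.sum_sub_distrib]
      refine Finset.sum_congr rfl fun s _ => ?_
      simp only [hr, hG]; ring
    rw [h5] at h3
    linarith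
  have hrb : r m ≤ 1 := by
    have h1 : |risk P ℓ (G m)| ≤ 1 / 2 := abs_integral_le_of_abs_le fun z => h.loss.bdd z _ (hGD m z)
    have h2 : |Rρ| ≤ 1 / 2 := abs_integral_le_of_abs_le fun z => h.abs_meanLoss_le ρ z
    simp only [hr]
    linarith [(abs_le.1 h1).2, (abs_le.1 h2).1]
  have hQ0 : ∀ t, 0 ≤ Q t := fun t =>
    Finset.sum_nonneg fun s _ => div_nonneg (sqDist_nonneg _ _) zero_le_two
  have hsum := h.sum_sqDist_mixAvg (P := P) (π := π) (Nat.succ_pos m) S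
  have hrisk := h.risk_mixAvg_le (P := P) (π := π) (Nat.succ_pos m) S
  have hQs : (∑ t ∈ Finset.range (m + 1), sqDist P (G t) (mixAvg ℓ f π (m + 1) S)) / 2 =
      (∑ t ∈ Finset.range (m + 1), Q t) / (m + 1) := by
    have hsum' : ∑ t ∈ Finset.range (m + 1), sqDist P (G t) (mixAvg ℓ f π (m + 1) S) =
      (∑ t ∈ Finset.range (m + 1), ∑ s ∈ Finset.range t, sqDist P (G t) (G s)) / (m + 1 : ℕ) := hsum
    rw [hsum', hQ]
    simp only [← Finset.sum_div]
    push_cast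
    ring
  have hrs : ∑ t ∈ Finset.range (m + 1), r t =
      ∑ t ∈ Finset.range (m + 1), risk P ℓ (G t) - (m + 1) * Rρ := by
    simp only [hr, Finset.sum_sub_distrib]; simp
  have hx : (m + 1) * (risk P ℓ (mixAvg ℓ f π (m + 1) S) - Rρ) ≤
      ∑ s ∈ Finset.range (m + 1), r s - (∑ t ∈ Finset.range (m + 1), Q t) / (m + 1) := by
    rw [← hQs, hrs]
    simp only [Nat.succ_eq_add_one, Nat.cast_add, Nat.cast_one] at hrisk
    linarith
  refine ⟨?_, fun t₁ t₂ h1 h1' h2 h2' => ?_⟩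
  · have h1 := ha m le_rfl
    rw [Finset.sum_range_succ] at hx
    have e : ∑ t ∈ Finset.range (m + 1), sqDist P (mixMean ℓ f π t S) (mixAvg ℓ f π (m + 1) S) / 2
      = (∑ t ∈ Finset.range (m + 1), sqDist P (G t) (mixAvg ℓ f π (m + 1) S)) / 2 := by
      rw [Finset.sum_div]
    rw [← hQs] at hx
    linarith
  · exact le_three_times hQ0 hrb hlam0 (Real.log_nonneg hc) ha hb hx h1 h1' h2 h2'

end Experts

/-! ### A Gaussian wedge -/

/-- The alternating Taylor polynomial of degree `7` of `arctan` is a lower bound. -/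
theorem arctan_lower {x : ℝ} (hx : 0 ≤ x) :
    x - x ^ 3 / 3 + x ^ 5 / 5 - x ^ 7 / 7 ≤ Real.arctan x := by
  set g : ℝ → ℝ := fun x => Real.arctan x - (x - x ^ 3 / 3 + x ^ 5 / 5 - x ^ 7 / 7) with hg
  have hd : ∀ y, HasDerivAt g (1 / (1 + y ^ 2) - (1 - y ^ 2 + y ^ 4 - y ^ 6)) y := by
    intro y
    have h1 := Real.hasDerivAt_arctan y
    have h2 : HasDerivAt (fun x : ℝ => x - x ^ 3 / 3 + x ^ 5 / 5 - x ^ 7 / 7)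
        (1 - y ^ 2 + y ^ 4 - y ^ 6) y := by
      have := (((hasDerivAt_id y).sub ((hasDerivAt_pow 3 y).div_const 3)).add
        ((hasDerivAt_pow 5 y).div_const 5)).sub ((hasDerivAt_pow 7 y).div_const 7)
      convert! this using 1
      push_cast; ring
    exact h1.sub h2
  have hmono : MonotoneOn g (Set.Ici 0) := by
    refine monotoneOn_of_deriv_nonneg (convex_Ici 0)
      (fun y _ => (hd y).continuousAt.continuousWithinAt)
      (fun y _ => (hd y).differentiableAt.differentiableWithinAt) fun y _ => ?_
    rw [(hd y).deriv]
    have : 1 / (1 + y ^ 2) - (1 - y ^ 2 + y ^ 4 - y ^ 6) = y ^ 8 / (1 + y ^ 2) := by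
      field_simp; ring
    rw [this]; positivity
  have := hmono Set.self_mem_Ici hx hx
  simp only [hg] at this
  norm_num at this
  linarith

/-- The numerical inequality behind the confidence level `1 - 1 / e` of a single run; its two sides
differ by about `0.001`. -/
theorem half_sub_arctan_lt : 1 / 2 - Real.arctan (89 / 200) / Real.pi < Real.exp (-1) := by
  have h1 := arctan_lower (x := 89 / 200) (by norm_num)
  have h2 := Real.pi_lt_d4
  have h3 := Real.exp_one_lt_d9
  have h4 := Real.pi_pos
  have h5 : (0.36787944 : ℝ) < Real.exp (-1) := by
    rw [Real.exp_neg, lt_inv_comm₀ (by norm_num) (Real.exp_pos 1)]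
    refine h3.trans ?_
    norm_num
  have h6 : (0.4186 : ℝ) ≤ Real.arctan (89 / 200) := by
    refine le_trans ?_ h1; norm_num
  have h7 : (0.1322 : ℝ) < Real.arctan (89 / 200) / Real.pi := by
    rw [lt_div_iff₀ h4]; nlinarith
  linarith

/-- The radial integral of the planar Gaussian density. -/
theorem lintegral_mul_exp_neg_sq :
    ∫⁻ r in Set.Ioi (0 : ℝ), ENNReal.ofReal (r * Real.exp (-(r ^ 2 / 2))) = 1 := by
  have hd : ∀ x ∈ Set.Ici (0 : ℝ), HasDerivAt (fun r : ℝ => -Real.exp (-(r ^ 2 / 2)))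
      (x * Real.exp (-(x ^ 2 / 2))) x := by
    intro x _
    have h1 : HasDerivAt (fun r : ℝ => -(r ^ 2 / 2)) (-x) x := by
      have := ((hasDerivAt_pow 2 x).div_const 2).neg
      convert! this using 1; push_cast; ring
    have := h1.exp.neg
    convert! this using 1; ring
  have hpos : ∀ x ∈ Set.Ioi (0 : ℝ), 0 ≤ x * Real.exp (-(x ^ 2 / 2)) := fun x hx =>
    mul_nonneg (le_of_lt hx) (Real.exp_pos _).le
  have hlim : Filter.Tendsto (fun r : ℝ => -Real.exp (-(r ^ 2 / 2))) Filter.atTop (nhds 0) := by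
    rw [← neg_zero]
    refine Filter.Tendsto.neg (Real.tendsto_exp_atBot.comp ?_)
    refine Filter.tendsto_neg_atTop_atBot.comp ?_
    exact (Filter.tendsto_pow_atTop two_ne_zero).atTop_div_const two_pos
  have hi := integrableOn_Ioi_deriv_of_nonneg' hd hpos hlim
  have he := integral_Ioi_of_hasDerivAt_of_nonneg' hd hpos hlim
  rw [← ofReal_integral_eq_lintegral_ofReal hi
    ((ae_restrict_iff' measurableSet_Ioi).2 (Filter.Eventually.of_forall hpos)), he]
  simp

/-- The standard Gaussian measure of the planar wedge `c |y| ≤ z`, by polar coordinates. -/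
theorem gaussian_wedge_le {c : ℝ} :
    ((gaussianReal 0 1).prod (gaussianReal 0 1)) {p : ℝ × ℝ | c * |p.2| ≤ p.1} ≤
      ENNReal.ofReal (1 / 2 - Real.arctan c / Real.pi) := by
  set β := Real.pi / 2 - Real.arctan c with hβ
  have hβ0 : 0 < β := by rw [hβ]; linarith [Real.arctan_lt_pi_div_two c]
  have hpi := Real.pi_pos
  have hms : MeasurableSet {p : ℝ × ℝ | c * |p.2| ≤ p.1} :=
    measurableSet_le ((measurable_snd.abs).const_mul c) measurable_fst
  have hpdf : ∀ r φ : ℝ, gaussianPDF 0 1 (r * Real.cos φ) * gaussianPDF 0 1 (r * Real.sin φ) =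
      ENNReal.ofReal (Real.exp (-(r ^ 2 / 2)) / (2 * Real.pi)) := by
    intro r φ
    rw [gaussianPDF, gaussianPDF, ← ENNReal.ofReal_mul (gaussianPDFReal_nonneg _ _ _)]
    congr 1
    simp only [gaussianPDFReal, NNReal.coe_one, mul_one, sub_zero]
    have := Real.sin_sq_add_cos_sq φ
    have e : -(r * Real.cos φ) ^ 2 / 2 + -(r * Real.sin φ) ^ 2 / 2 = -(r ^ 2 / 2) := by
      linear_combination (-(r ^ 2) / 2) * this
    rw [mul_mul_mul_comm, ← mul_inv, Real.mul_self_sqrt (by positivity), ← Real.exp_add, e]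
    ring
  rw [gaussianReal_of_var_ne_zero _ one_ne_zero, prod_withDensity (measurable_gaussianPDF _ _)
    (measurable_gaussianPDF _ _), withDensity_apply _ hms, ← lintegral_indicator hms,
    ← Measure.volume_eq_prod, ← lintegral_comp_polarCoord_symm]
  calc _ ≤ ∫⁻ p in polarCoord.target, (Set.Icc (-β) β).indicator (fun _ => (1 : ENNReal)) p.2 *
        ENNReal.ofReal (p.1 * (Real.exp (-(p.1 ^ 2 / 2)) / (2 * Real.pi))) := by
        refine lintegral_mono_ae ((ae_restrict_iff' polarCoord.open_target.measurableSet).2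
          (Filter.Eventually.of_forall fun p hp => ?_))
        rw [polarCoord_target] at hp
        obtain ⟨hr, hφ1, hφ2⟩ := hp
        have hr : 0 < p.1 := hr
        by_cases hw : polarCoord.symm p ∈ {p : ℝ × ℝ | c * |p.2| ≤ p.1}
        · rw [Set.indicator_of_mem hw]
          have hφ : p.2 ∈ Set.Icc (-β) β := by
            simp only [polarCoord_symm_apply, Set.mem_ofPred_eq, abs_mul, abs_of_pos hr] at hw
            rw [← mul_assoc, mul_comm c, mul_assoc] at hw
            have hw := le_of_mul_le_mul_left hw hr
            rw [Set.mem_Icc, ← abs_le, ← not_lt]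
            intro hlt
            have hs : |Real.sin p.2| = Real.sin |p.2| := by
              rw [← Real.abs_sin_eq_sin_abs_of_abs_le_pi (abs_le.2 ⟨hφ1.le, hφ2.le⟩)]
            rw [hs, ← Real.cos_abs] at hw
            have hlt2 : |p.2| < Real.pi := abs_lt.2 ⟨hφ1, hφ2⟩
            have hcos : Real.cos (|p.2| + Real.arctan c) < 0 :=
              Real.cos_neg_of_pi_div_two_lt_of_lt (by linarith)
                (by linarith [Real.arctan_lt_pi_div_two c])
            rw [Real.cos_add] at hcos
            have hca := Real.cos_arctan_pos c
            have hsa : Real.sin (Real.arctan c) = c * Real.cos (Real.arctan c) := by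
              conv_rhs => rw [← Real.tan_arctan c, Real.arctan_tan
                (Real.neg_pi_div_two_lt_arctan c) (Real.arctan_lt_pi_div_two c),
                Real.tan_mul_cos hca.ne']
            rw [hsa] at hcos
            nlinarith
          rw [Set.indicator_of_mem hφ, one_mul, polarCoord_symm_apply, smul_eq_mul]
          dsimp only
          rw [hpdf, ENNReal.ofReal_mul hr.le]
        · rw [Set.indicator_of_notMem hw]; simp
    _ ≤ ∫⁻ p in Set.Ioi (0 : ℝ) ×ˢ (Set.univ : Set ℝ),
        ENNReal.ofReal (p.1 * (Real.exp (-(p.1 ^ 2 / 2)) / (2 * Real.pi))) *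
        (Set.Icc (-β) β).indicator (fun _ => (1 : ENNReal)) p.2 := by
        rw [polarCoord_target]
        simp_rw [mul_comm (ENNReal.ofReal _)]
        exact lintegral_mono_set (Set.prod_mono le_rfl (Set.subset_univ _))
    _ = (∫⁻ r in Set.Ioi (0 : ℝ), ENNReal.ofReal (r * (Real.exp (-(r ^ 2 / 2)) / (2 * Real.pi)))) *
        ∫⁻ φ : ℝ, (Set.Icc (-β) β).indicator (fun _ => (1 : ENNReal)) φ := by
        rw [Measure.volume_eq_prod, ← Measure.prod_restrict, Measure.restrict_univ]
        exact lintegral_prod_mul (f := fun r : ℝ => ENNReal.ofReal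
            (r * (Real.exp (-(r ^ 2 / 2)) / (2 * Real.pi))))
          (g := (Set.Icc (-β) β).indicator (fun _ => (1 : ENNReal)))
          (by fun_prop : Measurable fun r : ℝ => ENNReal.ofReal
            (r * (Real.exp (-(r ^ 2 / 2)) / (2 * Real.pi)))).aemeasurable
          (measurable_const.indicator measurableSet_Icc).aemeasurable
    _ = ENNReal.ofReal (1 / 2 - Real.arctan c / Real.pi) := by
        have e : ∀ r : ℝ, ENNReal.ofReal (r * (Real.exp (-(r ^ 2 / 2)) / (2 * Real.pi))) =
            ENNReal.ofReal (1 / (2 * Real.pi)) *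
              ENNReal.ofReal (r * Real.exp (-(r ^ 2 / 2))) := fun r => by
          rw [← ENNReal.ofReal_mul (by positivity)]; congr 1; ring
        simp_rw [e]
        rw [lintegral_const_mul' _ _ ENNReal.ofReal_ne_top, lintegral_mul_exp_neg_sq, mul_one,
          lintegral_indicator measurableSet_Icc]
        simp only [lintegral_const, MeasurableSet.univ, Measure.restrict_apply, Set.univ_inter,
          Real.volume_Icc, one_mul]
        rw [← ENNReal.ofReal_mul (by positivity)]
        congr 1
        rw [hβ]; field_simp; ring

/-- The tail of the standard Gaussian distribution is convex on the half-line. -/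
theorem gaussian_tail_convex {a b p q : ℝ} (ha : 0 ≤ a) (hb : 0 ≤ b) (hp : 0 ≤ p) (hq : 0 ≤ q)
    (hpq : p + q = 1) : gaussianReal 0 1 {z | p * a + q * b ≤ z} ≤
      ENNReal.ofReal p * gaussianReal 0 1 {z | a ≤ z} +
        ENNReal.ofReal q * gaussianReal 0 1 {z | b ≤ z} := by
  set φ := gaussianPDFReal 0 1 with hφ
  have hcont : Continuous φ := by
    rw [hφ]; unfold gaussianPDFReal; fun_prop
  have hint : Integrable φ := integrable_gaussianPDFReal 0 1
  have hφ0 : ∀ x, 0 ≤ φ x := gaussianPDFReal_nonneg 0 1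
  set T : ℝ → ℝ := fun a => ∫ x in Set.Ioi a, φ x with hT
  have hTval : ∀ a, gaussianReal 0 1 {z | a ≤ z} = ENNReal.ofReal (T a) := by
    intro a
    rw [gaussianReal_apply_eq_integral _ one_ne_zero, hT]
    congr 1
    exact integral_Ici_eq_integral_Ioi
  set g : ℝ → ℝ := fun a => ∫ x in (0 : ℝ)..a, φ x with hg
  have hTg : ∀ a, T a = T 0 - g a := by
    intro a
    have := intervalIntegral.integral_Ioi_sub_Ioi' (f := φ) (μ := volume) (a := 0) (b := a)
      hint.integrableOn hint.integrableOn
    simp only [hT, hg]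
    linarith
  have hgd : ∀ x, HasDerivAt g (φ x) x := fun x =>
    intervalIntegral.integral_hasDerivAt_right (hcont.intervalIntegrable _ _)
      hcont.stronglyMeasurable.stronglyMeasurableAtFilter hcont.continuousAt
  have hconc : ConcaveOn ℝ (Set.Ici 0) g := by
    refine AntitoneOn.concaveOn_of_deriv (convex_Ici 0)
      (fun x _ => (hgd x).continuousAt.continuousWithinAt)
      (fun x _ => (hgd x).differentiableAt.differentiableWithinAt) ?_
    intro x hx y hy hxy
    rw [interior_Ici] at hx hy
    rw [(hgd x).deriv, (hgd y).deriv]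
    have hx : 0 < x := hx
    simp only [hφ, gaussianPDFReal, sub_zero, NNReal.coe_one, mul_one]
    gcongr
  have key := hconc.2 ha hb hp hq hpq
  simp only [smul_eq_mul] at key
  have hT0 : ∀ a, 0 ≤ T a := fun a => integral_nonneg fun x => hφ0 x
  rw [hTval, hTval, hTval, ← ENNReal.ofReal_mul hp, ← ENNReal.ofReal_mul hq,
    ← ENNReal.ofReal_add (mul_nonneg hp (hT0 _)) (mul_nonneg hq (hT0 _))]
  refine ENNReal.ofReal_le_ofReal ?_
  rw [hTg, hTg a, hTg b]
  have : p * (T 0 - g a) + q * (T 0 - g b) = (p + q) * T 0 - (p * g a + q * g b) := by ring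
  rw [this, hpq]
  linarith

theorem gaussian_tail_le {t : ℝ} (ht : 0 ≤ t) :
    gaussianReal 0 1 {z | t < z} ≤ ENNReal.ofReal (Real.exp (-(t ^ 2 / 2))) := by
  have h1 := measure_ge_le_exp_mul_mgf (μ := gaussianReal 0 1) (X := id) t ht
    (by simpa using integrable_exp_mul_gaussianReal t)
  rw [mgf_gaussianReal (p := gaussianReal 0 1) (X := id) (μ := 0) (v := 1) (by simp)] at h1
  have h2 : Real.exp (-t * t) * Real.exp (0 * t + (1 : NNReal) * t ^ 2 / 2) =
      Real.exp (-(t ^ 2 / 2)) := by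
    rw [← Real.exp_add]; congr 1; push_cast; ring
  rw [h2] at h1
  calc gaussianReal 0 1 {z | t < z} ≤ gaussianReal 0 1 {z | t ≤ id z} :=
        measure_mono fun z (hz : t < z) => hz.le
    _ ≤ _ := by
      rw [← ENNReal.ofReal_toReal (measure_ne_top (gaussianReal 0 1) _)]
      exact ENNReal.ofReal_le_ofReal h1

/-! ### Random walks with Gaussian steps -/

theorem seqLaw_map_neg {ν : Measure ℝ} [IsProbabilityMeasure ν] (hν : ν.map (fun x => -x) = ν) :
    (seqLaw ν).map (fun S i => -S i) = seqLaw ν := by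
  have := Measure.infinitePi_map_pi (μ := fun _ : ℕ => ν) (f := fun _ (x : ℝ) => -x)
    (fun _ => measurable_neg)
  simp only [hν] at this
  exact this

theorem measurable_weightedSum (a : ℕ → ℝ) (K : ℕ) :
    Measurable fun S : ℕ → ℝ => ∑ i ∈ Finset.range K, a i * S i :=
  Finset.measurable_sum _ fun i _ => (measurable_pi_apply i).const_mul _

theorem seqLaw_symm {ν : Measure ℝ} [IsProbabilityMeasure ν] (hν : ν.map (fun x => -x) = ν)
    (K : ℕ) (a : ℕ → ℝ) (x : ℝ) :
    seqLaw ν {S | x < ∑ i ∈ Finset.range K, a i * S i} =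
      seqLaw ν {S | ∑ i ∈ Finset.range K, a i * S i < -x} := by
  have hneg : Measurable fun (S : ℕ → ℝ) (i : ℕ) => -S i :=
    measurable_pi_lambda _ fun i => (measurable_pi_apply i).neg
  conv_lhs => rw [← seqLaw_map_neg hν]
  rw [Measure.map_apply hneg (measurableSet_lt measurable_const (measurable_weightedSum a K))]
  congr 1
  ext S
  simp only [Set.mem_preimage, Set.mem_ofPred_eq, mul_neg, Finset.sum_neg_distrib]
  rw [lt_neg]

/-- A symmetric sum is positive with probability at most one half. -/
theorem two_mul_seqLaw_pos_le {ν : Measure ℝ} [IsProbabilityMeasure ν]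
    (hν : ν.map (fun x => -x) = ν) (K : ℕ) (a : ℕ → ℝ) :
    2 * seqLaw ν {S | 0 < ∑ i ∈ Finset.range K, a i * S i} ≤ 1 := by
  rw [two_mul]
  nth_rw 2 [seqLaw_symm hν K a 0]
  rw [← measure_union]
  · exact prob_le_one
  · rw [Set.disjoint_left]
    intro S h1 h2
    rw [Set.mem_ofPred_eq] at h1 h2
    linarith
  · exact measurableSet_lt (measurable_weightedSum a K) measurable_const

theorem measurableSet_exists_le_weightedSum (K : ℕ) (a : ℕ → ℝ) (x : ℝ) : MeasurableSet
    {S : ℕ → ℝ | ∃ k ≤ K, x ≤ ∑ i ∈ Finset.range k, a i * S i} := by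
  have : {S : ℕ → ℝ | ∃ k ≤ K, x ≤ ∑ i ∈ Finset.range k, a i * S i} =
      ⋃ k ∈ Finset.range (K + 1), {S | x ≤ ∑ i ∈ Finset.range k, a i * S i} := by
    ext S; simp
  rw [this]
  exact Finset.measurableSet_biUnion _ fun k _ =>
    measurableSet_le measurable_const (measurable_weightedSum a k)

/-- A discrete **reflection principle**: for a walk with independent symmetric steps, up to an
overshoot of at most `ε`, the maximum exceeds a level with twice the probability of the end
point. -/
theorem reflection_le {ν : Measure ℝ} [IsProbabilityMeasure ν] (hν : ν.map (fun x => -x) = ν)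
    {ε : ℝ} (hε : 0 ≤ ε) (K : ℕ) (a : ℕ → ℝ) {x : ℝ} (hx : 0 < x) :
    2 * seqLaw ν {S | x + ε < ∑ i ∈ Finset.range K, a i * S i ∧ ∀ i < K, a i * S i ≤ ε} ≤
      seqLaw ν {S | ∃ k ≤ K, x ≤ ∑ i ∈ Finset.range k, a i * S i} := by
  have hm1 : ∀ (K : ℕ) (a : ℕ → ℝ) (x : ℝ), MeasurableSet
      {S : ℕ → ℝ | x < ∑ i ∈ Finset.range K, a i * S i ∧ ∀ i < K, a i * S i ≤ ε} := by
    intro K a x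
    refine (measurableSet_lt measurable_const (measurable_weightedSum a K)).inter ?_
    have : {S : ℕ → ℝ | ∀ i < K, a i * S i ≤ ε} = ⋂ i ∈ Finset.range K, {S | a i * S i ≤ ε} := by
      ext S; simp
    change MeasurableSet {S : ℕ → ℝ | ∀ i < K, a i * S i ≤ ε}
    rw [this]
    exact Finset.measurableSet_biInter _ fun i _ =>
      measurableSet_le ((measurable_pi_apply i).const_mul _) measurable_const
  induction K generalizing a x with
  | zero =>
    have : {S : ℕ → ℝ | x + ε < ∑ i ∈ Finset.range 0, a i * S i ∧ ∀ i < 0, a i * S i ≤ ε} = ∅ := by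
      ext S
      simp only [Finset.range_zero, Finset.sum_empty, Set.mem_ofPred_eq,
        Set.mem_empty_iff_false, iff_false, not_and]
      intro h; linarith
    rw [this]; simp
  | succ K ih =>
    rw [seqLaw_apply_cons _ (hm1 _ _ _),
      seqLaw_apply_cons _ (measurableSet_exists_le_weightedSum _ _ _),
      ← lintegral_const_mul' _ _ (by norm_num)]
    refine lintegral_mono fun z => ?_
    have hsum : ∀ (k : ℕ) (S : ℕ → ℝ), ∑ i ∈ Finset.range (k + 1), a i * seqCons z S i =
        ∑ i ∈ Finset.range k, a (i + 1) * S i + a 0 * z := fun k S => by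
      rw [Finset.sum_range_succ']; rfl
    simp only [Set.mem_ofPred_eq, hsum]
    by_cases h1 : a 0 * z ≤ ε
    swap
    · have : {S : ℕ → ℝ | x + ε < ∑ i ∈ Finset.range K, a (i + 1) * S i + a 0 * z ∧
          ∀ i < K + 1, a i * seqCons z S i ≤ ε} = ∅ := by
        ext S
        simp only [Set.mem_ofPred_eq, Set.mem_empty_iff_false, iff_false, not_and]
        exact fun _ h => h1 (h 0 (by omega))
      rw [this]; simp
    by_cases h2 : x ≤ a 0 * z
    · have e : {S : ℕ → ℝ | ∃ k ≤ K + 1, x ≤ ∑ i ∈ Finset.range k, a i * seqCons z S i} =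
          Set.univ := by
        ext S
        simp only [Set.mem_ofPred_eq, Set.mem_univ, iff_true]
        refine ⟨0 + 1, by omega, ?_⟩
        rw [hsum]; simpa using h2
      rw [e, measure_univ]
      refine le_trans ?_ (two_mul_seqLaw_pos_le hν K fun i => a (i + 1))
      gcongr
      intro h
      linarith [h.1]
    · push Not at h2
      refine le_trans ?_ ((ih (fun i => a (i + 1)) (x := x - a 0 * z) (by linarith)).trans ?_)
      · gcongr 2 * ?_
        refine measure_mono ?_
        rintro S ⟨hS1, hS2⟩
        exact ⟨by linarith, fun i hi => hS2 (i + 1) (by omega)⟩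
      · refine measure_mono ?_
        rintro S ⟨k, hk, hS⟩
        refine ⟨k + 1, by omega, ?_⟩
        rw [hsum]; linarith

theorem gaussian_map_neg : (gaussianReal 0 1).map (fun x => -x) = gaussianReal 0 1 := by
  rw [gaussianReal_map_neg, neg_zero]

theorem seqLaw_gaussian_map_sum (K : ℕ) (a : ℕ → ℝ) :
    (seqLaw (gaussianReal 0 1)).map (fun S => ∑ i ∈ Finset.range K, a i * S i) =
      (gaussianReal 0 1).map fun y => √(∑ i ∈ Finset.range K, a i ^ 2) * y := by
  induction K generalizing a with
  | zero => simp
  | succ K ih =>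
    have ih := ih fun i => a (i + 1)
    conv_lhs => rw [← map_seqCons]
    rw [Measure.map_map (measurable_weightedSum a _) measurable_seqCons]
    have e : ((fun S : ℕ → ℝ => ∑ i ∈ Finset.range (K + 1), a i * S i) ∘
        fun p : ℝ × (ℕ → ℝ) => seqCons p.1 p.2) =
        (fun p : ℝ × ℝ => p.1 + p.2) ∘ (Prod.map (fun z => a 0 * z)
          (fun S : ℕ → ℝ => ∑ i ∈ Finset.range K, a (i + 1) * S i)) := by
      ext p
      simp only [Function.comp_apply, Prod.map_fst, Prod.map_snd]
      rw [Finset.sum_range_succ', add_comm]; rfl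
    have hadd : Measurable fun p : ℝ × ℝ => p.1 + p.2 := measurable_fst.add measurable_snd
    rw [e, ← Measure.map_map hadd
      ((measurable_const_mul _).prodMap (measurable_weightedSum _ _)),
      ← Measure.map_prod_map _ _ (measurable_const_mul _) (measurable_weightedSum _ _), ih,
      gaussianReal_map_const_mul, gaussianReal_map_const_mul, gaussianReal_map_const_mul]
    change Measure.conv _ _ = _
    rw [gaussianReal_conv_gaussianReal]
    congr 1
    · ring
    · ext
      push_cast
      have h1 : 0 ≤ ∑ i ∈ Finset.range K, a (i + 1) ^ 2 := Finset.sum_nonneg fun _ _ => sq_nonneg _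
      have h2 : 0 ≤ ∑ i ∈ Finset.range (K + 1), a i ^ 2 := Finset.sum_nonneg fun _ _ => sq_nonneg _
      simp only [mul_one]
      rw [Real.sq_sqrt h1, Real.sq_sqrt h2, Finset.sum_range_succ', add_comm]

/-- The probability that an independent Gaussian variable `S 0` stays above `r` times the maximum
of a Gaussian walk, in terms of the end point of the walk. -/
theorem above_max_le (K : ℕ) (a : ℕ → ℝ) {r ε : ℝ} (hr : 0 < r) (hε : 0 < ε) :
    seqLaw (gaussianReal 0 1)
        {S | ∀ k ≤ K, r * ∑ i ∈ Finset.range k, a i * S (i + 1) ≤ S 0} ≤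
      ((gaussianReal 0 1).prod (gaussianReal 0 1)) {p : ℝ × ℝ | 0 ≤ p.1 ∧
        √(∑ i ∈ Finset.range K, a i ^ 2) * |p.2| ≤ p.1 / r + 2 * ε} +
      2 * ∑ i ∈ Finset.range K, gaussianReal 0 1 {z | ε < a i * z} := by
  set γ := gaussianReal 0 1 with hγ
  set V := ∑ i ∈ Finset.range K, a i ^ 2 with hV
  have hV0 : 0 ≤ √V := Real.sqrt_nonneg _
  set E := ∑ i ∈ Finset.range K, γ {z | ε < a i * z} with hE
  have hbig : seqLaw γ {S | ∃ i < K, ε < a i * S i} ≤ E := by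
    have : {S : ℕ → ℝ | ∃ i < K, ε < a i * S i} =
        ⋃ i ∈ Finset.range K, {S | ε < a i * S i} := by ext S; simp
    rw [this]
    refine (measure_biUnion_finset_le _ _).trans (le_of_eq (Finset.sum_congr rfl fun i _ => ?_))
    have h1 := Measure.infinitePi_map_eval (μ := fun _ : ℕ => γ) i
    have h2 : MeasurableSet {z : ℝ | ε < a i * z} :=
      measurableSet_lt measurable_const (measurable_const_mul _)
    calc seqLaw γ {S | ε < a i * S i}
        = ((Measure.infinitePi fun _ : ℕ => γ).map fun x => x i) {z : ℝ | ε < a i * z} := by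
          rw [Measure.map_apply (measurable_pi_apply i) h2]; rfl
      _ = _ := by rw [h1]
  -- for a fixed value `z` of the variable `S 0`, the reflection principle for the walk
  have hfix : ∀ z : ℝ, 0 ≤ z → seqLaw γ {S | ∀ k ≤ K, r * ∑ i ∈ Finset.range k, a i * S i ≤ z} ≤
      γ {y | √V * |y| ≤ z / r + 2 * ε} + 2 * E := by
    intro z hz
    set x := z / r + ε with hx
    have hx0 : 0 < x := by positivity
    set A := {S : ℕ → ℝ | ∀ k ≤ K, r * ∑ i ∈ Finset.range k, a i * S i ≤ z} with hA
    set B := {S : ℕ → ℝ | x + ε < ∑ i ∈ Finset.range K, a i * S i ∧ ∀ i < K, a i * S i ≤ ε} with hB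
    set C := {S : ℕ → ℝ | |∑ i ∈ Finset.range K, a i * S i| ≤ x + ε} with hC
    have h1 : seqLaw γ A + 2 * seqLaw γ B ≤ 1 := by
      refine (add_le_add_right (reflection_le gaussian_map_neg hε.le K a hx0) _).trans ?_
      rw [← measure_union _ (measurableSet_exists_le_weightedSum _ _ _)]
      · exact prob_le_one
      · rw [Set.disjoint_left]
        rintro S hS ⟨k, hk, hS'⟩
        have := hS k hk
        have h2 : r * x = z + r * ε := by rw [hx]; field_simp
        nlinarith [mul_le_mul_of_nonneg_left hS' hr.le, mul_pos hr hε]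
    have h2 : 1 ≤ seqLaw γ C + 2 * (seqLaw γ B + E) := by
      have e : (Set.univ : Set (ℕ → ℝ)) ⊆ C ∪
          ({S | x + ε < ∑ i ∈ Finset.range K, a i * S i} ∪
           {S | ∑ i ∈ Finset.range K, a i * S i < -(x + ε)}) := by
        intro S _
        by_cases h : |∑ i ∈ Finset.range K, a i * S i| ≤ x + ε
        · exact Or.inl h
        · right
          rw [not_le, lt_abs] at h
          rcases h with h | h
          · exact Or.inl h
          · exact Or.inr (by rw [Set.mem_ofPred_eq]; linarith)
      have h3 : seqLaw γ {S | x + ε < ∑ i ∈ Finset.range K, a i * S i} ≤ seqLaw γ B + E := by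
        refine le_trans ?_ (add_le_add_right hbig _)
        refine le_trans (measure_mono ?_) (measure_union_le _ _)
        intro S hS
        by_cases h : ∀ i < K, a i * S i ≤ ε
        · exact Or.inl ⟨hS, h⟩
        · push Not at h
          exact Or.inr h
      calc (1 : ENNReal) = seqLaw γ Set.univ := measure_univ.symm
        _ ≤ _ := measure_mono e
        _ ≤ _ := (measure_union_le _ _).trans (add_le_add_right (measure_union_le _ _) _)
        _ ≤ seqLaw γ C + 2 * (seqLaw γ B + E) := by
            rw [← seqLaw_symm gaussian_map_neg, two_mul]
            gcongr
    have h3 : seqLaw γ C = γ {y | √V * |y| ≤ z / r + 2 * ε} := by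
      have hm : MeasurableSet {w : ℝ | |w| ≤ x + ε} :=
        measurableSet_le measurable_id.abs measurable_const
      have : seqLaw γ C = ((seqLaw γ).map fun S => ∑ i ∈ Finset.range K, a i * S i)
          {w : ℝ | |w| ≤ x + ε} := by
        rw [Measure.map_apply (measurable_weightedSum a K) hm]; rfl
      rw [this, hγ, seqLaw_gaussian_map_sum, Measure.map_apply (measurable_const_mul _) hm]
      congr 1
      ext y
      simp only [Set.mem_preimage, Set.mem_ofPred_eq, abs_mul, ← hV, abs_of_nonneg hV0, hx]
      rw [add_assoc, ← two_mul]
    rw [← h3]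
    have h4 : seqLaw γ A + 2 * seqLaw γ B ≤ (seqLaw γ C + 2 * E) + 2 * seqLaw γ B := by
      refine h1.trans (h2.trans (le_of_eq ?_))
      ring
    exact (ENNReal.add_le_add_iff_right (ENNReal.mul_ne_top (by norm_num) (measure_ne_top _ _))).1 h4
  have hmA : MeasurableSet {S : ℕ → ℝ | ∀ k ≤ K, r * ∑ i ∈ Finset.range k, a i * S (i + 1) ≤ S 0} := by
    have : {S : ℕ → ℝ | ∀ k ≤ K, r * ∑ i ∈ Finset.range k, a i * S (i + 1) ≤ S 0} =
        ⋂ k ∈ Finset.range (K + 1), {S | r * ∑ i ∈ Finset.range k, a i * S (i + 1) ≤ S 0} := by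
      ext S; simp
    rw [this]
    refine Finset.measurableSet_biInter _ fun k _ => measurableSet_le ?_ (measurable_pi_apply 0)
    fun_prop
  have hmP : MeasurableSet {p : ℝ × ℝ | 0 ≤ p.1 ∧ √V * |p.2| ≤ p.1 / r + 2 * ε} :=
    (measurableSet_le measurable_const measurable_fst).inter
      (measurableSet_le (measurable_snd.abs.const_mul _) ((measurable_fst.div_const _).add_const _))
  rw [seqLaw_apply_cons _ hmA, Measure.prod_apply hmP]
  calc _ ≤ ∫⁻ z, (γ (Prod.mk z ⁻¹' {p : ℝ × ℝ | 0 ≤ p.1 ∧ √V * |p.2| ≤ p.1 / r + 2 * ε}) +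
        2 * E) ∂γ := by
        refine lintegral_mono fun z => ?_
        simp only [Set.mem_ofPred_eq, seqCons_succ, seqCons_zero]
        by_cases hz : 0 ≤ z
        · refine (hfix z hz).trans (le_of_eq ?_)
          congr 2
          ext y; simp [hz]
        · have : {S : ℕ → ℝ | ∀ k ≤ K, r * ∑ i ∈ Finset.range k, a i * S i ≤ z} = ∅ := by
            ext S
            simp only [Set.mem_ofPred_eq, Set.mem_empty_iff_false, iff_false]
            intro h
            have := h 0 (Nat.zero_le _)
            simp at this
            exact hz this
          rw [this]; simp
    _ = _ := by
        rw [lintegral_add_right _ measurable_const]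
        simp

/-- The standard deviations of the normalized steps of the reversed walk of running means of
`10 q` standard Gaussian variables. -/
noncomputable def stepSd (q i : ℕ) : ℝ :=
  √(10 * q / ((10 * q - i - 1) * (10 * q - i)))

/-- The variances of the reversed walk of running means telescope. -/
theorem sum_stepSd_sq {q : ℕ} (hq : 0 < q) {K : ℕ} (hK : K < 10 * q) :
    ∑ i ∈ Finset.range K, stepSd q i ^ 2 = 10 * q / (10 * q - K) - 1 := by
  have hq' : (0 : ℝ) < q := by exact_mod_cast hq
  induction K with
  | zero => simp; field_simp; simp
  | succ K ih =>
    have hK' : ((K : ℝ) + 1) < 10 * q := by exact_mod_cast hK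
    have h1 : (0 : ℝ) < 10 * q - K - 1 := by linarith
    have h2 : (0 : ℝ) < 10 * q - K := by linarith
    rw [Finset.sum_range_succ, ih (by omega), stepSd, Real.sq_sqrt (by positivity)]
    push_cast
    have h3 : (10 * q - (K + 1) : ℝ) = 10 * q - K - 1 := by ring
    rw [h3]
    field_simp
    ring

/-- The steps of the reversed walk become small as the mesh is refined. -/
theorem stepSd_sq_le {q i : ℕ} (hq : 0 < q) (hi : i < 5 * q) : stepSd q i ^ 2 ≤ 2 / (5 * q) := by
  have hq' : (0 : ℝ) < q := by exact_mod_cast hq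
  have hi' : ((i : ℝ) + 1) ≤ 5 * q := by exact_mod_cast hi
  have h1 : (5 : ℝ) * q ≤ 10 * q - i - 1 := by linarith
  have h2 : (5 : ℝ) * q ≤ 10 * q - i := by linarith
  rw [stepSd, Real.sq_sqrt (by
    exact div_nonneg (by positivity) (mul_nonneg (by linarith) (by linarith)))]
  calc 10 * (q : ℝ) / ((10 * q - i - 1) * (10 * q - i)) ≤ 10 * q / ((5 * q) * (5 * q)) :=
        div_le_div_of_nonneg_left (by positivity) (by positivity)
          (mul_le_mul h1 h2 (by positivity) (by linarith))
    _ = 2 / (5 * q) := by field_simp; norm_num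

/-- A fourth power bound, which makes the error of the discrete reflection principle summable over
the steps. -/
theorem gaussian_step_tail {a ε : ℝ} (ha : 0 ≤ a) (hε : 0 < ε) :
    gaussianReal 0 1 {z | ε < a * z} ≤ ENNReal.ofReal (8 * (a ^ 2) ^ 2 / ε ^ 4) := by
  rcases eq_or_lt_of_le ha with rfl | ha
  · have : {z : ℝ | ε < 0 * z} = ∅ := by ext z; simp [hε.le]
    rw [this]; simp
  have e : {z : ℝ | ε < a * z} = {z | ε / a < z} := by
    ext z; simp only [Set.mem_ofPred_eq]; rw [div_lt_iff₀ ha, mul_comm]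
  rw [e]
  refine (gaussian_tail_le (by positivity)).trans (ENNReal.ofReal_le_ofReal ?_)
  set y := (ε / a) ^ 2 / 2 with hy
  have hy0 : 0 < y := by positivity
  have h1 := Real.quadratic_le_exp_of_nonneg hy0.le
  have h2 : y ^ 2 / 2 ≤ Real.exp y := by nlinarith
  rw [Real.exp_neg]
  calc (Real.exp y)⁻¹ ≤ (y ^ 2 / 2)⁻¹ := inv_anti₀ (by positivity) h2
    _ = 8 * (a ^ 2) ^ 2 / ε ^ 4 := by rw [hy]; field_simp; norm_num

/-- A wedge with slope `89 / 200`, slightly enlarged, still has Gaussian measure less than `1 / e`. -/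
theorem exists_wedge_margin : ∃ ε : ℝ, 0 < ε ∧
    ((gaussianReal 0 1).prod (gaussianReal 0 1)) {p : ℝ × ℝ | 0 ≤ p.1 ∧
      |p.2| ≤ p.1 / (89 / 200) + 4 * ε} < ENNReal.ofReal (Real.exp (-1)) := by
  set μ := (gaussianReal 0 1).prod (gaussianReal 0 1)
  set s : ℕ → Set (ℝ × ℝ) := fun k => {p | 0 ≤ p.1 ∧ |p.2| ≤ p.1 / (89 / 200) + 4 * (1 / ((k : ℝ) + 1))}
    with hs
  have hms : ∀ k, MeasurableSet (s k) := fun k =>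
    (measurableSet_le measurable_const measurable_fst).inter
      (measurableSet_le measurable_snd.abs ((measurable_fst.div_const _).add_const _))
  have hanti : Antitone s := by
    intro k l hkl p hp
    refine ⟨hp.1, hp.2.trans ?_⟩
    have : (1 : ℝ) / (l + 1) ≤ 1 / (k + 1) :=
      one_div_le_one_div_of_le (by positivity) (by exact_mod_cast Nat.succ_le_succ hkl)
    linarith
  have hlim := tendsto_measure_iInter_atTop (μ := μ) (fun k => (hms k).nullMeasurableSet) hanti
    ⟨0, measure_ne_top _ _⟩
  have hsub : μ (⋂ k, s k) < ENNReal.ofReal (Real.exp (-1)) := by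
    refine lt_of_le_of_lt (measure_mono (t := {p : ℝ × ℝ | 89 / 200 * |p.2| ≤ p.1}) ?_)
      (lt_of_le_of_lt (gaussian_wedge_le)
        ((ENNReal.ofReal_lt_ofReal_iff (Real.exp_pos _)).2 half_sub_arctan_lt))
    intro p hp
    rw [Set.mem_iInter] at hp
    have h0 : Filter.Tendsto (fun k : ℕ => p.1 / (89 / 200) + 4 * (1 / ((k : ℝ) + 1)))
        Filter.atTop (nhds (p.1 / (89 / 200) + 4 * 0)) :=
      (tendsto_one_div_add_atTop_nhds_zero_nat.const_mul 4).const_add _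
    have h1 := ge_of_tendsto' h0 fun k => (hp k).2
    rw [Set.mem_ofPred_eq]
    rw [mul_zero, add_zero, le_div_iff₀ (by norm_num)] at h1
    linarith
  obtain ⟨k, hk⟩ := ((tendsto_order.1 hlim).2 _ hsub).exists
  exact ⟨1 / ((k : ℝ) + 1), by positivity, hk⟩

/-- A Gaussian variable stays above the weighted maxima of a Gaussian walk over two time intervals
with probability less than `1 / e`. -/
theorem exists_gaussian_walk_lt : ∃ q : ℕ, 0 < q ∧ seqLaw (gaussianReal 0 1)
    {S | ∀ k₁ ≤ 5 * q, ∀ k₂ ≤ 2 * q,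
      1 / 4 * ∑ i ∈ Finset.range k₁, stepSd q i * S (i + 1) +
      39 / 100 * ∑ i ∈ Finset.range k₂, stepSd q i * S (i + 1) ≤ S 0} <
    ENNReal.ofReal (Real.exp (-1)) := by
  obtain ⟨ε, hε, hlt⟩ := exists_wedge_margin
  set γ := gaussianReal 0 1 with hγ
  set Ψ := (γ.prod γ) {p : ℝ × ℝ | 0 ≤ p.1 ∧ |p.2| ≤ p.1 / (89 / 200) + 4 * ε} with hΨ
  -- the error term of the discrete reflection principle vanishes as the mesh is refined
  have hlim : Filter.Tendsto (fun q : ℕ => Ψ + 2 * ENNReal.ofReal (7 / ε ^ 4 * (1 / ((q : ℝ) + 1))))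
      Filter.atTop (nhds (Ψ + 2 * ENNReal.ofReal (7 / ε ^ 4 * 0))) :=
    tendsto_const_nhds.add (ENNReal.Tendsto.const_mul
      (ENNReal.tendsto_ofReal (tendsto_one_div_add_atTop_nhds_zero_nat.const_mul _))
      (Or.inr (by norm_num)))
  rw [mul_zero, ENNReal.ofReal_zero, mul_zero, add_zero] at hlim
  obtain ⟨q', hq'⟩ := ((tendsto_order.1 hlim).2 _ hlt).exists
  set q := q' + 1 with hq
  have hq0 : 0 < q := by omega
  have hqr : (0 : ℝ) < q := by exact_mod_cast hq0
  have hqe : (q : ℝ) = q' + 1 := by rw [hq]; push_cast; ring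
  refine ⟨q, hq0, lt_of_le_of_lt ?_ hq'⟩
  set a := stepSd q with ha
  have ha0 : ∀ i, 0 ≤ a i := fun i => Real.sqrt_nonneg _
  have herr : ∀ K ≤ 5 * q, ∑ i ∈ Finset.range K, γ {z | ε < a i * z} ≤
      ENNReal.ofReal (7 / ε ^ 4 * (1 / ((q' : ℝ) + 1))) := by
    intro K hK
    calc _ ≤ ∑ i ∈ Finset.range K, ENNReal.ofReal (8 * (2 / (5 * q)) ^ 2 / ε ^ 4) := by
          refine Finset.sum_le_sum fun i hi => (gaussian_step_tail (ha0 i) hε).trans ?_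
          have := stepSd_sq_le hq0 (lt_of_lt_of_le (Finset.mem_range.1 hi) hK)
          gcongr
      _ = ENNReal.ofReal (K * (8 * (2 / (5 * q)) ^ 2 / ε ^ 4)) := by
          rw [Finset.sum_const, Finset.card_range, nsmul_eq_mul, ENNReal.ofReal_mul (by positivity),
            ENNReal.ofReal_natCast]
      _ ≤ _ := by
          refine ENNReal.ofReal_le_ofReal ?_
          have hKr : (K : ℝ) ≤ 5 * q := by exact_mod_cast hK
          rw [← hqe]
          calc (K : ℝ) * (8 * (2 / (5 * q)) ^ 2 / ε ^ 4)
              ≤ (5 * q) * (8 * (2 / (5 * q)) ^ 2 / ε ^ 4) := by gcongr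
            _ = 32 / 5 / ε ^ 4 * (1 / q) := by field_simp; norm_num
            _ ≤ 7 / ε ^ 4 * (1 / q) := by gcongr; norm_num
  -- the walk has standard deviation `1` after `5 q` steps and `1 / 2` after `2 q` steps, so that the
  -- slopes `89 / 200` and `89 / 100` lead to the same wedge
  have hV1 : ∑ i ∈ Finset.range (5 * q), a i ^ 2 = 1 := by
    rw [ha, sum_stepSd_sq hq0 (by omega)]; push_cast; field_simp; norm_num
  have hV2 : ∑ i ∈ Finset.range (2 * q), a i ^ 2 = (1 / 2) ^ 2 := by
    rw [ha, sum_stepSd_sq hq0 (by omega)]; push_cast; field_simp; norm_num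
  have H1 : seqLaw γ {S | ∀ k ≤ 5 * q, 89 / 200 * ∑ i ∈ Finset.range k, a i * S (i + 1) ≤ S 0} ≤
      Ψ + 2 * ENNReal.ofReal (7 / ε ^ 4 * (1 / ((q' : ℝ) + 1))) := by
    refine (above_max_le (5 * q) a (by norm_num) hε).trans ?_
    rw [hV1]
    gcongr
    · refine measure_mono ?_
      rintro p ⟨h1, h2⟩
      refine ⟨h1, ?_⟩
      rw [Real.sqrt_one, one_mul] at h2
      linarith
    · exact herr _ le_rfl
  have H2 : seqLaw γ {S | ∀ k ≤ 2 * q, 89 / 100 * ∑ i ∈ Finset.range k, a i * S (i + 1) ≤ S 0} ≤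
      Ψ + 2 * ENNReal.ofReal (7 / ε ^ 4 * (1 / ((q' : ℝ) + 1))) := by
    refine (above_max_le (2 * q) a (by norm_num) hε).trans ?_
    rw [hV2, Real.sqrt_sq (by norm_num)]
    gcongr
    · refine measure_mono ?_
      rintro p ⟨h1, h2⟩
      refine ⟨h1, ?_⟩
      have : p.1 / (89 / 200) = 2 * (p.1 / (89 / 100)) := by ring
      rw [this]; linarith
    · exact herr _ (by omega)
  -- convexity of the Gaussian tail, conditionally on the walk, with the weights `50 / 89` and
  -- `39 / 89`, for which `1 / 4` and `39 / 100` are the weighted slopes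
  have hmeas : ∀ (r : ℝ) (K : ℕ), MeasurableSet
      {S : ℕ → ℝ | ∀ k ≤ K, r * ∑ i ∈ Finset.range k, a i * S (i + 1) ≤ S 0} := by
    intro r K
    have : {S : ℕ → ℝ | ∀ k ≤ K, r * ∑ i ∈ Finset.range k, a i * S (i + 1) ≤ S 0} =
        ⋂ k ∈ Finset.range (K + 1), {S | r * ∑ i ∈ Finset.range k, a i * S (i + 1) ≤ S 0} := by
      ext S; simp
    rw [this]
    refine Finset.measurableSet_biInter _ fun k _ => measurableSet_le ?_ (measurable_pi_apply 0)
    fun_prop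
  have hmeas2 : MeasurableSet {S : ℕ → ℝ | ∀ k₁ ≤ 5 * q, ∀ k₂ ≤ 2 * q,
      1 / 4 * ∑ i ∈ Finset.range k₁, a i * S (i + 1) +
      39 / 100 * ∑ i ∈ Finset.range k₂, a i * S (i + 1) ≤ S 0} := by
    have : {S : ℕ → ℝ | ∀ k₁ ≤ 5 * q, ∀ k₂ ≤ 2 * q,
        1 / 4 * ∑ i ∈ Finset.range k₁, a i * S (i + 1) +
        39 / 100 * ∑ i ∈ Finset.range k₂, a i * S (i + 1) ≤ S 0} =
        ⋂ k₁ ∈ Finset.range (5 * q + 1), ⋂ k₂ ∈ Finset.range (2 * q + 1),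
        {S | 1 / 4 * ∑ i ∈ Finset.range k₁, a i * S (i + 1) +
        39 / 100 * ∑ i ∈ Finset.range k₂, a i * S (i + 1) ≤ S 0} := by
      ext S; simp
    rw [this]
    refine Finset.measurableSet_biInter _ fun k _ => Finset.measurableSet_biInter _ fun k' _ =>
      measurableSet_le ?_ (measurable_pi_apply 0)
    fun_prop
  have hslice : ∀ {B : Set (ℕ → ℝ)}, MeasurableSet B →
      seqLaw γ B = ∫⁻ S, γ {z | seqCons z S ∈ B} ∂(seqLaw γ) := by
    intro B hB
    conv_lhs => rw [← map_seqCons]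
    rw [Measure.map_apply measurable_seqCons hB,
      Measure.prod_apply_symm (measurable_seqCons hB)]
    rfl
  have hmain : seqLaw γ {S | ∀ k₁ ≤ 5 * q, ∀ k₂ ≤ 2 * q,
      1 / 4 * ∑ i ∈ Finset.range k₁, a i * S (i + 1) +
      39 / 100 * ∑ i ∈ Finset.range k₂, a i * S (i + 1) ≤ S 0} ≤
      ENNReal.ofReal (50 / 89) *
        seqLaw γ {S | ∀ k ≤ 5 * q, 89 / 200 * ∑ i ∈ Finset.range k, a i * S (i + 1) ≤ S 0} +
      ENNReal.ofReal (39 / 89) *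
        seqLaw γ {S | ∀ k ≤ 2 * q, 89 / 100 * ∑ i ∈ Finset.range k, a i * S (i + 1) ≤ S 0} := by
    rw [hslice hmeas2, hslice (hmeas _ _), hslice (hmeas _ _),
      ← lintegral_const_mul' _ _ ENNReal.ofReal_ne_top,
      ← lintegral_const_mul' _ _ ENNReal.ofReal_ne_top]
    have hms1 : Measurable fun S : ℕ → ℝ => γ {z | seqCons z S ∈
        {S : ℕ → ℝ | ∀ k ≤ 5 * q, 89 / 200 * ∑ i ∈ Finset.range k, a i * S (i + 1) ≤ S 0}} := by
      have := measurable_measure_prodMk_right (μ := γ) (measurable_seqCons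
        (hmeas (89 / 200) (5 * q)))
      exact this
    rw [← lintegral_add_left (hms1.const_mul _)]
    refine lintegral_mono fun S => ?_
    simp only [Set.mem_ofPred_eq, seqCons_succ, seqCons_zero]
    obtain ⟨k₁, hk₁, hmax₁⟩ := Finset.exists_max_image (Finset.range (5 * q + 1))
      (fun k => ∑ i ∈ Finset.range k, a i * S i) ⟨0, by simp⟩
    obtain ⟨k₂, hk₂, hmax₂⟩ := Finset.exists_max_image (Finset.range (2 * q + 1))
      (fun k => ∑ i ∈ Finset.range k, a i * S i) ⟨0, by simp⟩
    set V₁ := ∑ i ∈ Finset.range k₁, a i * S i with hV₁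
    set V₂ := ∑ i ∈ Finset.range k₂, a i * S i with hV₂
    have hV10 : 0 ≤ V₁ := by simpa using hmax₁ 0 (by simp)
    have hV20 : 0 ≤ V₂ := by simpa using hmax₂ 0 (by simp)
    have hconv := gaussian_tail_convex (a := 89 / 200 * V₁) (b := 89 / 100 * V₂) (p := 50 / 89)
      (q := 39 / 89) (by positivity) (by positivity) (by norm_num) (by norm_num) (by norm_num)
    refine le_trans (measure_mono ?_) (hconv.trans ?_)
    · intro z hz
      have := hz k₁ (by have := Finset.mem_range.1 hk₁; omega) k₂
        (by have := Finset.mem_range.1 hk₂; omega)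
      rw [Set.mem_ofPred_eq]
      linarith
    · gcongr
      · intro h k hk
        have := hmax₁ k (Finset.mem_range.2 (by omega))
        linarith
      · intro h k hk
        have := hmax₂ k (Finset.mem_range.2 (by omega))
        linarith
  refine hmain.trans ?_
  calc _ ≤ ENNReal.ofReal (50 / 89) * (Ψ + 2 * ENNReal.ofReal (7 / ε ^ 4 * (1 / ((q' : ℝ) + 1)))) +
        ENNReal.ofReal (39 / 89) * (Ψ + 2 * ENNReal.ofReal (7 / ε ^ 4 * (1 / ((q' : ℝ) + 1)))) := by
        gcongr
    _ = _ := by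
        rw [← add_mul, ← ENNReal.ofReal_add (by norm_num) (by norm_num)]
        norm_num

/-! ### Running means of Gaussian vectors -/

/-- The first `n` terms of a sequence of independent observations are a sample of size `n`. -/
theorem seqLaw_map_fin {Z : Type*} [MeasurableSpace Z] (P : Measure Z) [IsProbabilityMeasure P]
    (n : ℕ) : (seqLaw P).map (fun S (i : Fin n) => S i) = Measure.pi fun _ => P := by
  have hm : Measurable fun (S : ℕ → Z) (i : Fin n) => S i :=
    measurable_pi_lambda _ fun i => measurable_pi_apply _
  refine (Measure.pi_eq fun s hs => ?_).symm
  rw [Measure.map_apply hm (MeasurableSet.univ_pi hs)]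
  set t : ℕ → Set Z := fun i => if h : i < n then s ⟨i, h⟩ else Set.univ with ht
  have e : (fun (S : ℕ → Z) (i : Fin n) => S i) ⁻¹' Set.univ.pi s =
      Set.pi (Finset.range n : Set ℕ) t := by
    ext S
    simp only [Set.mem_preimage, Set.mem_pi, Set.mem_univ, true_implies, Finset.coe_range,
      Set.mem_Iio, ht]
    constructor
    · intro h i hi; rw [dif_pos hi]; exact h ⟨i, hi⟩
    · intro h i; have := h i i.2; rwa [dif_pos i.2] at this
  rw [e, seqLaw, Measure.infinitePi_pi]
  · rw [Finset.prod_range]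
    refine Finset.prod_congr rfl fun i _ => ?_
    simp [ht]
  · intro i hi
    rw [ht]; dsimp only; rw [dif_pos (Finset.mem_range.1 hi)]; exact hs _

/-- Orthonormal linear combinations of independent standard Gaussian variables are again
independent standard Gaussian variables. -/
theorem gaussian_pi_map_orthonormal {J n : ℕ} (e : Fin n → Fin J → ℝ)
    (he : ∀ i j, ∑ l, e i l * e j l = if i = j then 1 else 0) :
    (Measure.pi fun _ : Fin J => gaussianReal 0 1).map (fun x i => ∑ l, e i l * x l) =
      Measure.pi fun _ : Fin n => gaussianReal 0 1 := by
  set μ := Measure.pi fun _ : Fin J => gaussianReal 0 1 with hμ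
  have hid : ∀ l : Fin J, HasGaussianLaw (fun x : Fin J → ℝ => x l) μ := by
    intro l
    constructor
    have := (measurePreserving_eval (fun _ : Fin J => gaussianReal 0 1) l).map_eq
    rw [show (fun x : Fin J → ℝ => x l) = Function.eval l from rfl, this]
    infer_instance
  have hind : iIndepFun (fun (l : Fin J) (x : Fin J → ℝ) => x l) μ :=
    iIndepFun_pi (X := fun _ (x : ℝ) => x) fun l => aemeasurable_id
  have hjoint : HasGaussianLaw (fun x : Fin J → ℝ => fun l => x l) μ :=
    iIndepFun.hasGaussianLaw hid hind
  let Λ : (Fin J → ℝ) →L[ℝ] (Fin n → ℝ) :=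
    ContinuousLinearMap.pi fun i => ∑ l, e i l • ContinuousLinearMap.proj (R := ℝ) l
  have hΛ : ∀ x i, Λ x i = ∑ l, e i l * x l := by
    intro x i; simp [Λ]
  have hmap : HasGaussianLaw (fun x : Fin J → ℝ => fun i => ∑ l, e i l * x l) μ := by
    have h := hjoint.map_fun Λ
    have e1 : (fun x : Fin J → ℝ => Λ (fun l => x l)) = fun x i => ∑ l, e i l * x l := by
      ext x i; exact hΛ x i
    rwa [e1] at h
  have hcov0 : ∀ l l' : Fin J, cov[fun x : Fin J → ℝ => x l, fun x => x l'; μ] =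
      if l = l' then 1 else 0 := by
    intro l l'
    split_ifs with h
    · subst h
      rw [covariance_self (measurable_pi_apply l).aemeasurable]
      have := (measurePreserving_eval (fun _ : Fin J => gaussianReal 0 1) l)
      have h2 := variance_map (μ := μ) (Y := fun x : Fin J → ℝ => x l) (X := id)
        aemeasurable_id (measurable_pi_apply l).aemeasurable
      rw [show (fun x : Fin J → ℝ => x l) = Function.eval l from rfl, this.map_eq,
        variance_id_gaussianReal] at h2
      rw [show (fun x : Fin J → ℝ => x l) = id ∘ Function.eval l from rfl, ← h2]
      simp
    · exact (hind.indepFun h).covariance_eq_zero (hid l).memLp_two (hid l').memLp_two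
  have hcov : ∀ i j : Fin n, cov[fun x : Fin J → ℝ => ∑ l, e i l * x l,
      fun x => ∑ l, e j l * x l; μ] = if i = j then 1 else 0 := by
    intro i j
    rw [covariance_fun_sum_fun_sum (fun l => (hid l).memLp_two.const_mul _)
      (fun l => (hid l).memLp_two.const_mul _)]
    simp_rw [covariance_const_mul_left, covariance_const_mul_right, hcov0]
    rw [← he i j]
    refine Finset.sum_congr rfl fun l _ => ?_
    simp
  have hindT := hmap.iIndepFun_of_covariance_eq_zero (X := fun i (x : Fin J → ℝ) => ∑ l, e i l * x l)
    fun i j hij => by rw [hcov, if_neg hij]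
  have hmeas : ∀ i : Fin n, Measurable fun x : Fin J → ℝ => ∑ l, e i l * x l := by
    intro i; fun_prop
  rw [(iIndepFun_iff_map_fun_eq_pi_map fun i => (hmeas i).aemeasurable).1 hindT]
  congr 1
  ext1 i
  rw [(hmap.eval i).map_eq_gaussianReal]
  have h1 : Var[fun x : Fin J → ℝ => ∑ l, e i l * x l; μ] = 1 := by
    rw [← covariance_self (hmeas i).aemeasurable, hcov, if_pos rfl]
  have h0 : ∫ x : Fin J → ℝ, ∑ l, e i l * x l ∂μ = 0 := by
    rw [integral_finsetSum _ fun l _ => (hid l).integrable.const_mul _]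
    refine Finset.sum_eq_zero fun l _ => ?_
    rw [integral_const_mul]
    have := integral_comp_eval (μ := fun _ : Fin J => gaussianReal 0 1) (i := l) (f := fun x : ℝ => x)
      measurable_id.aestronglyMeasurable
    rw [this, integral_id_gaussianReal, mul_zero]
  rw [h1, h0]
  simp

/-- The sum of the first `k` terms of a finite sequence. -/
def prefixSum {J : ℕ} (x : Fin J → ℝ) (k : ℕ) : ℝ := ∑ l, if l.val < k then x l else 0

theorem sum_fin_ite_lt {J a : ℕ} (h : a ≤ J) : ∑ l : Fin J, (if l.val < a then (1 : ℝ) else 0) = a := by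
  rw [Fin.sum_univ_eq_sum_range (fun l => if l < a then (1 : ℝ) else 0) J, Finset.sum_ite,
    Finset.sum_const_zero, add_zero, Finset.sum_const, nsmul_eq_mul, mul_one]
  congr 1
  rw [Finset.card_eq_of_equiv_fin]
  have : (Finset.range J).filter (fun l => l < a) = Finset.range a := by
    ext l; simp; omega
  rw [this]
  simpa using (Finset.equivFin (Finset.range a))

/-- The inner product of two running means, as linear forms. -/
theorem sum_mean_mul_mean {J a b : ℕ} (ha : 0 < a) (hab : a ≤ b) (hb : b ≤ J) :
    ∑ l : Fin J, (if l.val < a then (1 : ℝ) / a else 0) * (if l.val < b then (1 : ℝ) / b else 0) =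
      1 / b := by
  have ha' : (0 : ℝ) < a := by exact_mod_cast ha
  have : ∀ l : Fin J, (if l.val < a then (1 : ℝ) / a else 0) * (if l.val < b then (1 : ℝ) / b else 0)
      = (1 / a * (1 / b)) * (if l.val < a then (1 : ℝ) else 0) := by
    intro l
    split_ifs with h1 h2
    · ring
    · omega
    · ring
    · ring
  simp_rw [this]
  rw [← Finset.mul_sum, sum_fin_ite_lt (hab.trans hb)]
  field_simp

/-- For a suitable number `J` of independent standard Gaussian steps, the three-term combinations
of the endpoint and of two earlier running means are all nonnegative with probability less than
`1 / e`. -/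
theorem exists_gaussian_facets_lt : ∃ J : ℕ, 0 < J ∧
    (Measure.pi fun _ : Fin J => gaussianReal 0 1)
      {x | ∀ i ≤ J, J ≤ 2 * i → ∀ j ≤ J, 4 * J ≤ 5 * j →
        0 ≤ 36 / 100 * prefixSum x J + 1 / 4 * (J / i) * prefixSum x i +
          39 / 100 * (J / j) * prefixSum x j} < ENNReal.ofReal (Real.exp (-1)) := by
  obtain ⟨q, hq, hlt⟩ := exists_gaussian_walk_lt
  set J := 10 * q with hJ
  refine ⟨J, by omega, lt_of_le_of_lt ?_ hlt⟩
  set γ := gaussianReal 0 1 with hγ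
  -- running means as linear forms; their reversed increments are orthogonal to each other and to the
  -- last mean
  set p : ℕ → Fin J → ℝ := fun a l => if l.val < a then (1 : ℝ) / a else 0 with hp
  have hpp : ∀ a b, 0 < a → a ≤ b → b ≤ J → ∑ l, p a l * p b l = 1 / b := fun a b => sum_mean_mul_mean
  have hpp' : ∀ a b, 0 < a → a ≤ b → b ≤ J → ∑ l, p b l * p a l = 1 / b := fun a b h1 h2 h3 => by
    rw [← hpp a b h1 h2 h3]; exact Finset.sum_congr rfl fun l _ => mul_comm _ _
  set e' : ℕ → Fin J → ℝ := fun k l => match k with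
    | 0 => √J * p J l
    | k + 1 => √((J - k - 1 : ℕ) * ((J - k - 1 : ℕ) + 1)) * (p (J - k - 1 + 1) l - p (J - k - 1) l)
    with he'
  have hJr : (0 : ℝ) < J := by exact_mod_cast (by omega : 0 < J)
  have hexp : ∀ a b c d : ℕ, ∑ l, (p a l - p b l) * (p c l - p d l) =
      ∑ l, p a l * p c l - ∑ l, p a l * p d l - ∑ l, p b l * p c l + ∑ l, p b l * p d l := by
    intro a b c d
    rw [← Finset.sum_sub_distrib, ← Finset.sum_sub_distrib, ← Finset.sum_add_distrib]
    exact Finset.sum_congr rfl fun l _ => by ring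
  have horth_lt : ∀ k l : ℕ, l < k → k ≤ 5 * q → ∑ s, e' k s * e' l s = 0 := by
    intro k l hlk hk
    obtain ⟨k, rfl⟩ : ∃ k', k = k' + 1 := ⟨k - 1, by omega⟩
    cases l with
    | zero =>
      have : ∀ s, e' (k + 1) s * e' 0 s = √((J - k - 1 : ℕ) * ((J - k - 1 : ℕ) + 1)) * √J *
          (p (J - k - 1 + 1) s * p J s - p (J - k - 1) s * p J s) := by
        intro s; simp only [he']; ring
      simp_rw [this]
      rw [← Finset.mul_sum, Finset.sum_sub_distrib, hpp _ _ (by omega) (by omega) le_rfl,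
        hpp _ _ (by omega) (by omega) le_rfl, sub_self, mul_zero]
    | succ l =>
      have : ∀ s, e' (k + 1) s * e' (l + 1) s = √((J - k - 1 : ℕ) * ((J - k - 1 : ℕ) + 1)) *
          √((J - l - 1 : ℕ) * ((J - l - 1 : ℕ) + 1)) *
          ((p (J - k - 1 + 1) s - p (J - k - 1) s) * (p (J - l - 1 + 1) s - p (J - l - 1) s)) := by
        intro s; simp only [he']; ring
      simp_rw [this]
      rw [← Finset.mul_sum, hexp, hpp _ _ (by omega) (by omega) (by omega),
        hpp _ _ (by omega) (by omega) (by omega), hpp _ _ (by omega) (by omega) (by omega),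
        hpp _ _ (by omega) (by omega) (by omega)]
      ring
  have horth_self : ∀ k : ℕ, k ≤ 5 * q → ∑ s, e' k s * e' k s = 1 := by
    intro k hk
    cases k with
    | zero =>
      have : ∀ s, e' 0 s * e' 0 s = (√J * √J) * (p J s * p J s) := by
        intro s; simp only [he']; ring
      simp_rw [this]
      rw [← Finset.mul_sum, hpp _ _ (by omega) le_rfl le_rfl, Real.mul_self_sqrt hJr.le]
      field_simp
    | succ k =>
      set i := J - k - 1 with hi
      have hi0 : 0 < i := by omega
      have hir : (0 : ℝ) < i := by exact_mod_cast hi0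
      have : ∀ s, e' (k + 1) s * e' (k + 1) s = (√(i * (i + 1)) * √(i * (i + 1))) *
          ((p (i + 1) s - p i s) * (p (i + 1) s - p i s)) := by
        intro s; simp only [he', ← hi]; ring
      simp_rw [this]
      rw [← Finset.mul_sum, hexp, Real.mul_self_sqrt (by positivity),
        hpp _ _ (by omega) (by omega) (by omega), hpp' _ _ (by omega) (by omega) (by omega),
        hpp _ _ (by omega) (by omega) (by omega), hpp _ _ (by omega) (by omega) (by omega)]
      push_cast
      field_simp
      ring
  have hmap := gaussian_pi_map_orthonormal (J := J) (n := 5 * q + 1) (fun k => e' k) (by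
    intro k l
    rcases lt_trichotomy k l with h | h | h
    · rw [if_neg h.ne, ← horth_lt l k h (by omega)]
      exact Finset.sum_congr rfl fun s _ => mul_comm _ _
    · subst h; rw [if_pos rfl]; exact horth_self _ (by omega)
    · rw [if_neg h.ne']; exact horth_lt k l h (by omega))
  set E : Set (ℕ → ℝ) := {S | ∀ k₁ ≤ 5 * q, ∀ k₂ ≤ 2 * q,
      1 / 4 * ∑ i ∈ Finset.range k₁, stepSd q i * S (i + 1) +
      39 / 100 * ∑ i ∈ Finset.range k₂, stepSd q i * S (i + 1) ≤ S 0} with hE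
  have hEm : MeasurableSet E := by
    have : E = ⋂ k₁ ∈ Finset.range (5 * q + 1), ⋂ k₂ ∈ Finset.range (2 * q + 1),
        {S | 1 / 4 * ∑ i ∈ Finset.range k₁, stepSd q i * S (i + 1) +
        39 / 100 * ∑ i ∈ Finset.range k₂, stepSd q i * S (i + 1) ≤ S 0} := by
      ext S; simp [hE]
    rw [this]
    refine Finset.measurableSet_biInter _ fun k _ => Finset.measurableSet_biInter _ fun k' _ =>
      measurableSet_le ?_ (measurable_pi_apply 0)
    fun_prop
  set ext0 : (Fin (5 * q + 1) → ℝ) → ℕ → ℝ := fun y i => if h : i < 5 * q + 1 then y ⟨i, h⟩ else 0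
    with hext
  have hextm : Measurable ext0 := by
    refine measurable_pi_lambda _ fun i => ?_
    simp only [hext]
    split_ifs
    · exact measurable_pi_apply _
    · exact measurable_const
  -- the event depends only on the first `5 q + 1` coordinates
  have hpi : seqLaw γ E = (Measure.pi fun _ : Fin (5 * q + 1) => γ) (ext0 ⁻¹' E) := by
    have hm : Measurable fun (S : ℕ → ℝ) (i : Fin (5 * q + 1)) => S i :=
      measurable_pi_lambda _ fun i => measurable_pi_apply _
    rw [← seqLaw_map_fin, Measure.map_apply hm (hextm hEm)]
    congr 1
    ext S
    simp only [hE, Set.mem_preimage, Set.mem_ofPred_eq]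
    refine forall₂_congr fun k₁ h₁ => forall₂_congr fun k₂ h₂ => ?_
    have : ∀ k ≤ 5 * q, ∑ i ∈ Finset.range k, stepSd q i * ext0 (fun i => S i) (i + 1) =
        ∑ i ∈ Finset.range k, stepSd q i * S (i + 1) := by
      intro k hk
      refine Finset.sum_congr rfl fun i hi => ?_
      rw [hext]; dsimp only; rw [dif_pos (by have := Finset.mem_range.1 hi; omega)]
    rw [this k₁ h₁, this k₂ (by omega)]
    rw [hext]; dsimp only; rw [dif_pos (by omega)]
  rw [hpi, ← hmap, Measure.map_apply (by fun_prop) (hextm hEm)]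
  refine measure_mono ?_
  intro x hx
  simp only [hE, Set.mem_preimage, Set.mem_ofPred_eq]
  rw [Set.mem_ofPred_eq] at hx
  intro k₁ h₁ k₂ h₂
  set A : ℕ → ℝ := fun a => ∑ l, p a l * x l with hA
  have hAW : ∀ a, 0 < a → prefixSum x a = a * A a := by
    intro a ha
    have ha' : (0 : ℝ) < a := by exact_mod_cast ha
    rw [prefixSum, hA]; dsimp only
    rw [Finset.mul_sum]
    refine Finset.sum_congr rfl fun l _ => ?_
    rw [hp]; dsimp only
    split_ifs
    · field_simp
    · ring
  have hstep : ∀ k < 5 * q, stepSd q k * ext0 (fun i => ∑ l, e' i l * x l) (k + 1) =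
      √J * (A (J - k) - A (J - (k + 1))) := by
    intro k hk
    rw [hext]; dsimp only; rw [dif_pos (by omega)]
    set i := J - k - 1 with hi
    have hi0 : 0 < i := by omega
    have hir : (0 : ℝ) < i := by exact_mod_cast hi0
    have hi1 : J - k = i + 1 := by omega
    have hi2 : J - (k + 1) = i := by omega
    have hq1 : (10 * q : ℝ) - k = i + 1 := by
      have : (J : ℝ) = i + 1 + k := by exact_mod_cast (by omega : J = i + 1 + k)
      rw [hJ] at this; push_cast at this; linarith
    have hs : stepSd q k = √J / √(i * (i + 1)) := by
      rw [stepSd, ← Real.sqrt_div hJr.le, hq1]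
      congr 1
      rw [hJ]; push_cast; ring
    have hsum : ∑ l, e' (k + 1) l * x l = √(i * (i + 1)) * (A (i + 1) - A i) := by
      rw [hA]; dsimp only
      rw [← Finset.sum_sub_distrib, Finset.mul_sum]
      refine Finset.sum_congr rfl fun l _ => ?_
      simp only [he', ← hi]; ring
    rw [hsum, hs, hi1, hi2]
    have : 0 < √((i : ℝ) * (i + 1)) := Real.sqrt_pos.2 (by positivity)
    field_simp
  have htel : ∀ k ≤ 5 * q, ∑ i ∈ Finset.range k, stepSd q i *
      ext0 (fun i => ∑ l, e' i l * x l) (i + 1) = √J * (A J - A (J - k)) := by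
    intro k hk
    rw [Finset.sum_congr rfl fun i hi => hstep i (lt_of_lt_of_le (Finset.mem_range.1 hi) hk),
      ← Finset.mul_sum]
    congr 1
    have := Finset.sum_range_sub' (fun i => A (J - i)) k
    simpa using this
  have h0 : ext0 (fun i => ∑ l, e' i l * x l) 0 = √J * A J := by
    rw [hext]; dsimp only; rw [dif_pos (by omega), hA]; dsimp only
    rw [Finset.mul_sum]
    refine Finset.sum_congr rfl fun l _ => ?_
    simp only [he']; ring
  rw [htel k₁ h₁, htel k₂ (by omega), h0]
  have hx' := hx (J - k₁) (by omega) (by omega) (J - k₂) (by omega) (by omega)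
  have hp1 : (0 : ℝ) < (J - k₁ : ℕ) := by exact_mod_cast (by omega : 0 < J - k₁)
  have hp2 : (0 : ℝ) < (J - k₂ : ℕ) := by exact_mod_cast (by omega : 0 < J - k₂)
  rw [hAW _ (by omega), hAW _ (by omega), hAW _ (by omega)] at hx'
  have e1 : 1 / 4 * ((J : ℝ) / (J - k₁ : ℕ)) * ((J - k₁ : ℕ) * A (J - k₁)) =
      J * (1 / 4 * A (J - k₁)) := by field_simp
  have e2 : 39 / 100 * ((J : ℝ) / (J - k₂ : ℕ)) * ((J - k₂ : ℕ) * A (J - k₂)) =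
      J * (39 / 100 * A (J - k₂)) := by field_simp
  rw [e1, e2] at hx'
  have hx2 : 0 ≤ 36 / 100 * A J + 1 / 4 * A (J - k₁) + 39 / 100 * A (J - k₂) := by
    by_contra hneg
    push Not at hneg
    have := mul_neg_of_pos_of_neg hJr hneg
    linarith
  have hs : 0 ≤ √(J : ℝ) := Real.sqrt_nonneg _
  have := mul_nonneg hs hx2
  linarith

/-! ### Block sums and the central limit theorem -/

/-- Independent samples of size `h`, joined together, form a sample of size `J * h`. -/
theorem pi_seqLaw_map_join {Z : Type*} [MeasurableSpace Z] (P : Measure Z) [IsProbabilityMeasure P]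
    (J h : ℕ) :
    (Measure.pi fun _ : Fin J => seqLaw P).map
      (fun y (i : Fin (J * h)) => y i.divNat (i.modNat : ℕ)) = Measure.pi fun _ => P := by
  have hm : Measurable fun (y : Fin J → ℕ → Z) (i : Fin (J * h)) => y i.divNat (i.modNat : ℕ) :=
    measurable_pi_lambda _ fun i => (measurable_pi_apply _).comp (measurable_pi_apply _)
  refine (Measure.pi_eq fun s hs => ?_).symm
  rw [Measure.map_apply hm (MeasurableSet.univ_pi hs)]
  have e : (fun (y : Fin J → ℕ → Z) (i : Fin (J * h)) => y i.divNat (i.modNat : ℕ)) ⁻¹'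
      Set.univ.pi s = Set.univ.pi fun j => (fun (S : ℕ → Z) (r : Fin h) => S r) ⁻¹'
        Set.univ.pi fun r => s (finProdFinEquiv (j, r)) := by
    ext y
    simp only [Set.mem_preimage, Set.mem_pi, Set.mem_univ, true_implies]
    constructor
    · intro H j r
      have := H (finProdFinEquiv (j, r))
      have h1 := finProdFinEquiv.symm_apply_apply (j, r)
      have h2 : (finProdFinEquiv (j, r)).divNat = j := congrArg Prod.fst h1
      have h3 : (finProdFinEquiv (j, r)).modNat = r := congrArg Prod.snd h1
      rwa [h2, h3] at this
    · intro H i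
      have := H i.divNat i.modNat
      have h1 : finProdFinEquiv (i.divNat, i.modNat) = i := finProdFinEquiv.apply_symm_apply i
      rwa [h1] at this
  have hm' : Measurable fun (S : ℕ → Z) (r : Fin h) => S r :=
    measurable_pi_lambda _ fun i => measurable_pi_apply _
  rw [e, Measure.pi_pi, ← finProdFinEquiv.prod_comp, Fintype.prod_prod_type]
  refine Finset.prod_congr rfl fun j _ => ?_
  rw [← Measure.map_apply hm' (MeasurableSet.univ_pi fun r => hs _), seqLaw_map_fin, Measure.pi_pi]

/-- The sums over consecutive blocks of length `h` are independent and identically distributed. -/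
theorem seqLaw_map_blockSum (ν : Measure ℝ) [IsProbabilityMeasure ν] (J h : ℕ) (r : ℝ) :
    (seqLaw ν).map (fun x (l : Fin J) => r * ∑ s ∈ Finset.range h, x (l * h + s)) =
      Measure.pi fun _ => (seqLaw ν).map fun x => r * ∑ s ∈ Finset.range h, x s := by
  have hφ : Measurable fun (x : ℕ → ℝ) => r * ∑ s ∈ Finset.range h, x s := by fun_prop
  have h1 := Measure.pi_map_pi (μ := fun _ : Fin J => seqLaw ν)
    (f := fun _ (x : ℕ → ℝ) => r * ∑ s ∈ Finset.range h, x s) fun _ => hφ.aemeasurable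
  rw [← h1]
  set ψ : (Fin (J * h) → ℝ) → Fin J → ℝ := fun x l =>
    r * ∑ s : Fin h, x (finProdFinEquiv (l, s)) with hψ
  have hψm : Measurable ψ := by rw [hψ]; fun_prop
  have e1 : (fun (x : ℕ → ℝ) (l : Fin J) => r * ∑ s ∈ Finset.range h, x (l * h + s)) =
      ψ ∘ fun x (i : Fin (J * h)) => x i := by
    ext x l
    simp only [hψ, Function.comp_apply]
    rw [Finset.sum_range]
    congr 1
    refine Finset.sum_congr rfl fun s _ => ?_
    congr 1
    simp only [finProdFinEquiv, Equiv.coe_fn_mk]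
    ring
  have e2 : (fun (y : Fin J → ℕ → ℝ) (l : Fin J) => r * ∑ s ∈ Finset.range h, y l s) =
      ψ ∘ fun y (i : Fin (J * h)) => y i.divNat (i.modNat : ℕ) := by
    ext y l
    simp only [hψ, Function.comp_apply]
    rw [Finset.sum_range]
    congr 1
    refine Finset.sum_congr rfl fun s _ => ?_
    have h1 := finProdFinEquiv.symm_apply_apply (l, s)
    have h2 : (finProdFinEquiv (l, s)).divNat = l := congrArg Prod.fst h1
    have h3 : (finProdFinEquiv (l, s)).modNat = s := congrArg Prod.snd h1
    rw [h2, h3]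
  have hm1 : Measurable fun (x : ℕ → ℝ) (i : Fin (J * h)) => x i :=
    measurable_pi_lambda _ fun i => measurable_pi_apply _
  have hm2 : Measurable fun (y : Fin J → ℕ → ℝ) (i : Fin (J * h)) => y i.divNat (i.modNat : ℕ) :=
    measurable_pi_lambda _ fun i => (measurable_pi_apply _).comp (measurable_pi_apply _)
  rw [e1, e2, ← Measure.map_map hψm hm1, ← Measure.map_map hψm hm2, seqLaw_map_fin,
    pi_seqLaw_map_join]

theorem norm_pow_sub_pow_le_mul {a b : ℂ} (ha : ‖a‖ ≤ 1) (hb : ‖b‖ ≤ 1) (n : ℕ) :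
    ‖a ^ n - b ^ n‖ ≤ n * ‖a - b‖ := by
  induction n with
  | zero => simp
  | succ n ih =>
    have e : a ^ (n + 1) - b ^ (n + 1) = a * (a ^ n - b ^ n) + (a - b) * b ^ n := by ring
    rw [e]
    refine (norm_add_le _ _).trans ?_
    rw [norm_mul, norm_mul, norm_pow]
    have h1 : ‖b‖ ^ n ≤ 1 := pow_le_one₀ (norm_nonneg _) hb
    have h2 : ‖a‖ * ‖a ^ n - b ^ n‖ ≤ 1 * (n * ‖a - b‖) := by gcongr
    have h3 : ‖a - b‖ * ‖b‖ ^ n ≤ ‖a - b‖ * 1 := by gcongr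
    push_cast
    linarith

/-- Second order expansion of the characteristic function of a centered bounded variable, with an
error term that involves the distribution only through the variance. -/
theorem norm_charFun_sub_le {ν : Measure ℝ} [IsProbabilityMeasure ν]
    (hb : ∀ᵐ x ∂ν, |x| ≤ 2) (h0 : ∫ x, x ∂ν = 0) {u : ℝ} (hu : |u| ≤ 1 / 2) :
    ‖charFun ν u - ((1 - u ^ 2 * (∫ x, x ^ 2 ∂ν) / 2 : ℝ) : ℂ)‖ ≤
      6 * |u| ^ 3 * ∫ x, x ^ 2 ∂ν := by
  have hi1 : Integrable (fun x : ℝ => x) ν :=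
    Integrable.of_bound measurable_id.aestronglyMeasurable 2 (by simpa using hb)
  have hi2 : Integrable (fun x : ℝ => x ^ 2) ν := by
    refine Integrable.of_bound (by fun_prop) 4 ?_
    filter_upwards [hb] with x hx
    rw [Real.norm_eq_abs, abs_pow]
    nlinarith [abs_nonneg x]
  set q : ℝ → ℂ := fun x => ((1 - u ^ 2 * x ^ 2 / 2 : ℝ) : ℂ) + ((u * x : ℝ) : ℂ) * Complex.I with hq
  have hir : Integrable (fun x : ℝ => (1 - u ^ 2 * x ^ 2 / 2 : ℝ)) ν :=
    (integrable_const 1).sub ((hi2.const_mul (u ^ 2)).div_const 2)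
  have hir' : Integrable (fun x : ℝ => ((1 - u ^ 2 * x ^ 2 / 2 : ℝ) : ℂ)) ν := hir.ofReal
  have hii : Integrable (fun x : ℝ => ((u * x : ℝ) : ℂ) * Complex.I) ν :=
    ((hi1.const_mul u).ofReal (𝕜 := ℂ)).mul_const _
  have hqi : Integrable q ν := hir'.add hii
  have hqint : ∫ x, q x ∂ν = ((1 - u ^ 2 * (∫ x, x ^ 2 ∂ν) / 2 : ℝ) : ℂ) := by
    change ∫ x, (((1 - u ^ 2 * x ^ 2 / 2 : ℝ) : ℂ) + ((u * x : ℝ) : ℂ) * Complex.I) ∂ν = _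
    rw [integral_add hir' hii, integral_complex_ofReal, integral_mul_const,
      integral_complex_ofReal, integral_const_mul, h0]
    have : ∫ x, (1 - u ^ 2 * x ^ 2 / 2 : ℝ) ∂ν = 1 - u ^ 2 * (∫ x, x ^ 2 ∂ν) / 2 := by
      rw [integral_sub (f := fun _ => (1 : ℝ)) (integrable_const 1)
        ((hi2.const_mul (u ^ 2)).div_const 2), integral_div, integral_const_mul]
      simp
    rw [this]; simp
  have hei : Integrable (fun x : ℝ => Complex.exp (u * x * Complex.I)) ν := by
    refine Integrable.of_bound (by fun_prop) 1 (Filter.Eventually.of_forall fun x => ?_)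
    rw [← Complex.ofReal_mul, Complex.norm_exp_ofReal_mul_I]
  rw [charFun_apply_real, ← hqint, ← integral_sub hei hqi]
  refine (norm_integral_le_integral_norm _).trans ?_
  rw [← integral_const_mul]
  refine integral_mono_ae (hei.sub hqi).norm (hi2.const_mul _) ?_
  filter_upwards [hb] with x hx
  have h1 := Complex.norm_exp_sub_sum_le_norm_mul_exp (u * x * Complex.I) 3
  have e : ∑ m ∈ Finset.range 3, (u * x * Complex.I) ^ m / m.factorial = q x := by
    simp only [Finset.sum_range_succ, Finset.range_zero, Finset.sum_empty, hq]
    push_cast [Nat.factorial]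
    rw [mul_pow _ Complex.I 2, Complex.I_sq]
    ring
  rw [e] at h1
  have hn : ‖(u * x * Complex.I : ℂ)‖ = |u| * |x| := by simp
  rw [hn] at h1
  refine h1.trans ?_
  have hux : |u| * |x| ≤ 1 := by nlinarith [abs_nonneg u, abs_nonneg x]
  have h3 : Real.exp (|u| * |x|) ≤ 3 := by
    refine (Real.exp_le_exp.2 hux).trans ?_
    linarith [Real.exp_one_lt_d9]
  calc (|u| * |x|) ^ 3 * Real.exp (|u| * |x|) ≤ (|u| * |x|) ^ 3 * 3 := by gcongr
    _ = |u| ^ 3 * (|x| * |x| ^ 2) * 3 := by ring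
    _ ≤ |u| ^ 3 * (2 * |x| ^ 2) * 3 := by gcongr
    _ = 6 * |u| ^ 3 * x ^ 2 := by rw [sq_abs]; ring

/-- The law of the normalized sum of `h` independent observations with variance `v`. -/
noncomputable def normSumLaw (ν : Measure ℝ) [IsProbabilityMeasure ν] (v : ℝ) (h : ℕ) :
    ProbabilityMeasure ℝ :=
  ⟨(seqLaw ν).map fun x => (√(h * v))⁻¹ * ∑ s ∈ Finset.range h, x s,
    Measure.isProbabilityMeasure_map (by fun_prop)⟩

theorem charFun_normSumLaw (ν : Measure ℝ) [IsProbabilityMeasure ν] (v : ℝ) (h : ℕ) (t : ℝ) :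
    charFun (normSumLaw ν v h : Measure ℝ) t = charFun ν ((√(h * v))⁻¹ * t) ^ h := by
  have hind : iIndepFun (fun (i : ℕ) (x : ℕ → ℝ) => x i) (seqLaw ν) :=
    iIndepFun_infinitePi (X := fun _ (x : ℝ) => x) fun _ => measurable_id
  change charFun ((seqLaw ν).map fun x => (√(h * v))⁻¹ * ∑ s ∈ Finset.range h, x s) t = _
  rw [charFun_map_mul_comp (by fun_prop), (hind.restrict _).charFun_map_fun_finsetSum_eq_prod
    fun i _ => (measurable_pi_apply i).aemeasurable]
  have : ∀ i : ℕ, (seqLaw ν).map (fun x => x i) = ν := fun i =>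
    Measure.infinitePi_map_eval (fun _ : ℕ => ν) i
  simp [this]

open Filter Topology in
/-- Central limit theorem for triangular arrays of uniformly bounded variables. -/
theorem tendsto_normSumLaw (ν : ℕ → Measure ℝ) [∀ k, IsProbabilityMeasure (ν k)] (v : ℕ → ℝ)
    (h : ℕ → ℕ) (hb : ∀ k, ∀ᵐ x ∂(ν k), |x| ≤ 2) (h0 : ∀ k, ∫ x, x ∂(ν k) = 0)
    (hv : ∀ k, ∫ x, x ^ 2 ∂(ν k) = v k) (hlim : Tendsto (fun k => h k * v k) atTop atTop) :
    Tendsto (fun k => normSumLaw (ν k) (v k) (h k)) atTop (𝓝 ⟨gaussianReal 0 1, inferInstance⟩) := by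
  refine ProbabilityMeasure.tendsto_of_tendsto_charFun fun t => ?_
  have hv4 : ∀ k, v k ≤ 4 := by
    intro k
    rw [← hv k]
    have : ∫ x, x ^ 2 ∂(ν k) ≤ ∫ x, (4 : ℝ) ∂(ν k) := by
      refine integral_mono_of_nonneg (ae_of_all _ fun x => sq_nonneg x) (integrable_const _) ?_
      filter_upwards [hb k] with x hx
      nlinarith [abs_nonneg x, sq_abs x]
    simpa using this
  have hv0 : ∀ k, 0 ≤ v k := fun k => by
    rw [← hv k]; exact integral_nonneg fun x => sq_nonneg x
  have hhlim : Tendsto h atTop atTop := by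
    have h1 : Tendsto (fun k => (h k : ℝ) * 4) atTop atTop :=
      tendsto_atTop_mono (fun k => mul_le_mul_of_nonneg_left (hv4 k) (Nat.cast_nonneg _)) hlim
    have h2 : Tendsto (fun k => (h k : ℝ)) atTop atTop :=
      (tendsto_mul_const_atTop_of_pos (by norm_num : (0 : ℝ) < 4)).1 h1
    exact tendsto_natCast_atTop_iff.1 h2
  change Tendsto _ _ (𝓝 (charFun (gaussianReal 0 1) t))
  have hsqrt : Tendsto (fun k => √(h k * v k)) atTop atTop := Real.tendsto_sqrt_atTop.comp hlim
  have hinv : Tendsto (fun k => (√(h k * v k))⁻¹) atTop (𝓝 0) := tendsto_inv_atTop_zero.comp hsqrt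
  have hu : Tendsto (fun k => |(√(h k * v k))⁻¹ * t|) atTop (𝓝 0) := by
    have := (hinv.mul_const t).abs
    simpa using this
  have hexp : Tendsto (fun k => (((1 - t ^ 2 / 2 / h k : ℝ) : ℂ)) ^ h k) atTop
      (𝓝 (charFun (gaussianReal 0 1) t)) := by
    have h1 := (Real.tendsto_one_add_div_pow_exp (-(t ^ 2 / 2))).comp hhlim
    have h2 : charFun (gaussianReal 0 1) t = ((Real.exp (-(t ^ 2 / 2)) : ℝ) : ℂ) := by
      rw [charFun_gaussianReal]; push_cast; congr 1; simp
    rw [h2]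
    refine ((Complex.continuous_ofReal.tendsto _).comp h1).congr fun k => ?_
    simp only [Function.comp_apply]
    push_cast
    congr 1
    ring
  have hdiff : Tendsto (fun k => charFun (normSumLaw (ν k) (v k) (h k) : Measure ℝ) t -
      (((1 - t ^ 2 / 2 / h k : ℝ) : ℂ)) ^ h k) atTop (𝓝 0) := by
    refine squeeze_zero_norm' (a := fun k => 6 * t ^ 2 * |(√(h k * v k))⁻¹ * t|) ?_ ?_
    · have hev1 : ∀ᶠ k in atTop, |(√(h k * v k))⁻¹ * t| ≤ 1 / 2 :=
        (hu.eventually_lt_const (by norm_num : (0 : ℝ) < 1 / 2)).mono fun k hk => hk.le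
      have hev2 : ∀ᶠ k in atTop, t ^ 2 / 2 ≤ (h k : ℝ) :=
        (tendsto_natCast_atTop_atTop.comp hhlim).eventually_ge_atTop _
      have hev3 : ∀ᶠ k in atTop, 0 < (h k : ℝ) * v k := hlim.eventually_gt_atTop 0
      filter_upwards [hev1, hev2, hev3] with k hk1 hk2 hk3
      set u := (√(h k * v k))⁻¹ * t with hu'
      have hh0 : (0 : ℝ) < h k := by
        rcases Nat.eq_zero_or_pos (h k) with h0 | h0
        · rw [h0] at hk3; simp at hk3
        · exact_mod_cast h0
      have hu2 : u ^ 2 * v k = t ^ 2 / h k := by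
        have hvk : 0 < v k := (pos_iff_pos_of_mul_pos hk3).1 hh0
        rw [hu', mul_pow, inv_pow, Real.sq_sqrt hk3.le]
        field_simp
      have h1 := norm_charFun_sub_le (hb k) (h0 k) hk1
      rw [hv k, hu2] at h1
      rw [charFun_normSumLaw]
      refine (norm_pow_sub_pow_le_mul (norm_charFun_le_one _) ?_ _).trans ?_
      · rw [Complex.norm_real, Real.norm_eq_abs, abs_le]
        have : t ^ 2 / 2 / h k ≤ 1 := (div_le_one hh0).2 hk2
        have : 0 ≤ t ^ 2 / 2 / h k := by positivity
        constructor <;> linarith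
      · have e : (1 - t ^ 2 / h k / 2 : ℝ) = 1 - t ^ 2 / 2 / h k := by ring
        rw [e] at h1
        calc (h k : ℝ) * ‖charFun (ν k) u - ((1 - t ^ 2 / 2 / h k : ℝ) : ℂ)‖
            ≤ h k * (6 * |u| ^ 3 * v k) := by gcongr
          _ = 6 * h k * |u| * (u ^ 2 * v k) := by rw [← sq_abs u]; ring
          _ = 6 * t ^ 2 * |u| := by rw [hu2]; field_simp
    · simpa using hu.const_mul (6 * t ^ 2)
  have := hdiff.add hexp
  simpa using this

/-! ### Three-point combinations of a random walk -/

theorem prefixSum_eq_range {J : ℕ} (g : ℕ → ℝ) {i : ℕ} (hi : i ≤ J) :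
    prefixSum (fun l : Fin J => g l) i = ∑ l ∈ Finset.range i, g l := by
  rw [prefixSum, Fin.sum_univ_eq_sum_range (fun l => if l < i then g l else 0) J,
    Finset.sum_ite, Finset.sum_const_zero, add_zero]
  congr 1
  ext l; simp; omega

/-- The running sums of the block sums are values of the walk itself. -/
theorem prefixSum_block {J : ℕ} (x : ℕ → ℝ) (h : ℕ) (r : ℝ) {i : ℕ} (hi : i ≤ J) :
    prefixSum (fun l : Fin J => r * ∑ s ∈ Finset.range h, x (l * h + s)) i =
      r * ∑ s ∈ Finset.range (i * h), x s := by
  rw [prefixSum_eq_range (fun l => r * ∑ s ∈ Finset.range h, x (l * h + s)) hi, ← Finset.mul_sum]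
  congr 1
  clear hi
  induction i with
  | zero => simp
  | succ i ih => rw [Finset.sum_range_succ, ih, Nat.succ_mul, Finset.sum_range_add]

theorem abs_prefixSum_le {J : ℕ} (x : Fin J → ℝ) (i : ℕ) : |prefixSum x i| ≤ ∑ l, |x l| := by
  rw [prefixSum]
  refine (Finset.abs_sum_le_sum_abs _ _).trans (Finset.sum_le_sum fun l _ => ?_)
  split_ifs
  · exact le_rfl
  · simp

/-- The weighted combination of the endpoint of a walk and of two of its earlier values that
bounds the regret. -/
noncomputable def facet (m : ℕ) (N : ℕ → ℝ) (t₁ t₂ : ℕ) : ℝ :=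
  36 / 100 * N m + 1 / 4 * ((m + 1) / t₁) * N t₁ + 39 / 100 * ((m + 1) / t₂) * N t₂

/-- All the weighted combinations of the walk `N`, with the second time in the second half of the time
interval and the third in its last fifth, are at least `-b`. -/
def FacetsGe (m : ℕ) (N : ℕ → ℝ) (b : ℝ) : Prop :=
  ∀ t₁ t₂, m + 1 ≤ 2 * t₁ → t₁ ≤ m → 4 * (m + 1) ≤ 5 * t₂ → t₂ ≤ m → -b ≤ facet m N t₁ t₂

/-- The weights of a three-point combination hardly change when the times are measured in blocks after
an early time `T`. -/
theorem time_ratio_sub_le {J m T h i t : ℕ} {ε : ℝ} (hJ : 0 < J) (hT : 4 * J + 4 ≤ T)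
    (hε : (T : ℝ) ≤ ε * (m + 1)) (hi : J ≤ 2 * i) (hiJ : i ≤ J) (ht : t = T + i * h)
    (htm : m + 1 ≤ 2 * t) (hJh : J * h ≤ m - T) (hJh' : m - T ≤ J * h + J) (hTm : T ≤ m) :
    |((m + 1 : ℝ) / t) - J / i| ≤ 8 * ε := by
  have hi0 : (0 : ℝ) < i := by exact_mod_cast (by omega : 0 < i)
  have ht0 : (0 : ℝ) < t := by exact_mod_cast (by omega : 0 < t)
  have hJr : (0 : ℝ) < J := by exact_mod_cast hJ
  have h1 : (J : ℝ) ≤ 2 * i := by exact_mod_cast hi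
  have h2 : (m + 1 : ℝ) ≤ 2 * t := by exact_mod_cast htm
  have h3 : (J : ℝ) * h + T ≤ m := by exact_mod_cast (by omega : J * h + T ≤ m)
  have h4 : (m : ℝ) ≤ J * h + J + T := by exact_mod_cast (by omega : m ≤ J * h + J + T)
  have h5 : 4 * (J : ℝ) + 4 ≤ T := by exact_mod_cast hT
  have h6 : (i : ℝ) ≤ J := by exact_mod_cast hiJ
  have hte : (t : ℝ) = T + i * h := by rw [ht]; push_cast; ring
  have e : ((m + 1 : ℝ) / t) - J / i = (i * (m + 1 - J * h) - J * T) / (i * t) := by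
    rw [hte]
    have : (T : ℝ) + i * h ≠ 0 := by rw [← hte]; exact ht0.ne'
    field_simp
    ring
  rw [e, abs_div, abs_of_pos (mul_pos hi0 ht0), div_le_iff₀ (mul_pos hi0 ht0)]
  have hup : i * ((m : ℝ) + 1 - J * h) ≤ J * (T + 1 + J) := by
    apply mul_le_mul h6 (by linarith) (by linarith) hJr.le
  have hlo : 0 ≤ i * ((m : ℝ) + 1 - J * h) := mul_nonneg hi0.le (by linarith)
  have hJT : 0 ≤ (J : ℝ) * T := by positivity
  have hb : (J : ℝ) * (T + 1 + J) ≤ 8 * ε * (i * t) := by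
    calc (J : ℝ) * (T + 1 + J) ≤ (2 * i) * (2 * T) := by
          apply mul_le_mul h1 (by linarith) (by positivity) (by positivity)
      _ ≤ (2 * i) * (2 * (ε * (2 * t))) := by
          have hm : (0 : ℝ) < m + 1 := by positivity
          have hε0 : 0 ≤ ε := by
            by_contra hneg
            push Not at hneg
            have := mul_neg_of_neg_of_pos hneg hm
            linarith
          have : ε * (m + 1) ≤ ε * (2 * t) := by gcongr
          have : (T : ℝ) ≤ ε * (2 * t) := by linarith
          gcongr
      _ = 8 * ε * (i * t) := by ring
  rw [abs_le]
  have : (J : ℝ) * T ≤ J * (T + 1 + J) := by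
    apply mul_le_mul_of_nonneg_left _ hJr.le; linarith
  constructor <;> linarith

/-- Passage from a walk to its values at the ends of `J` blocks. -/
theorem facets_block {J m T h : ℕ} {x : ℕ → ℝ} {η v ε ζ : ℝ} (hx : ∀ s, |x s| ≤ 2) (hJ : 0 < J)
    (hh : h = (m - T) / J) (hT : 4 * J + 4 ≤ T) (h4 : 4 * T ≤ m + 1)
    (hε : (T : ℝ) ≤ ε * (m + 1)) (hη : 0 ≤ η) (hv : 0 < v)
    (hF : FacetsGe m (fun t => ∑ s ∈ Finset.range (t - T), x s) (η * √((m + 1) * v)))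
    (hζ1 : 8 * ε ≤ ζ) (hζ2 : η * √(2 * J) + 2 * J * √(2 * J) / √((m + 1) * v) ≤ ζ)
    {G : Fin J → ℝ} (hG : G = fun l : Fin J => (√(h * v))⁻¹ * ∑ s ∈ Finset.range h, x (l * h + s)) :
    ∀ i ≤ J, J ≤ 2 * i → ∀ j ≤ J, 4 * J ≤ 5 * j →
      -(ζ * (1 + ∑ l, |G l|)) ≤ 36 / 100 * prefixSum G J + 1 / 4 * (J / i) * prefixSum G i +
          39 / 100 * (J / j) * prefixSum G j := by
  intro i hiJ hi j hjJ hj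
  have hdm := Nat.div_add_mod (m - T) J
  have hml := Nat.mod_lt (m - T) hJ
  rw [← hh] at hdm
  have hTm : T ≤ m := by omega
  have hJh : J * h ≤ m - T := by omega
  have hJh' : m - T ≤ J * h + J := by omega
  have hih : i * h ≤ J * h := Nat.mul_le_mul_right _ hiJ
  have hjh : j * h ≤ J * h := Nat.mul_le_mul_right _ hjJ
  have hih2 : J * h ≤ 2 * (i * h) := by rw [← mul_assoc]; exact Nat.mul_le_mul_right _ hi
  have hjh2 : 4 * (J * h) ≤ 5 * (j * h) := by
    rw [← mul_assoc, ← mul_assoc]; exact Nat.mul_le_mul_right _ hj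
  set t₁ := T + i * h with ht₁
  set t₂ := T + j * h with ht₂
  have h1 := hF t₁ t₂ (by omega) (by omega) (by omega) (by omega)
  have hr1 := time_ratio_sub_le hJ hT hε hi hiJ ht₁ (by omega) hJh hJh' hTm
  have hr2 := time_ratio_sub_le hJ hT hε (by omega) hjJ ht₂ (by omega) hJh hJh' hTm
  -- the block length is a fixed proportion of the whole
  have hhr : ((m : ℝ) + 1) ≤ 2 * J * h := by
    exact_mod_cast (by rw [mul_assoc]; omega : m + 1 ≤ 2 * J * h)
  have hm0 : (0 : ℝ) < m + 1 := by positivity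
  have hJr : (0 : ℝ) < J := by exact_mod_cast hJ
  have hh0 : (0 : ℝ) < h := by
    by_contra hneg
    push Not at hneg
    have := mul_nonpos_of_nonneg_of_nonpos (by positivity : (0 : ℝ) ≤ 2 * J) hneg
    linarith
  set a := √(h * v) with ha
  have ha0 : 0 < a := Real.sqrt_pos.2 (by positivity)
  have hab : √((m + 1) * v) ≤ √(2 * J) * a := by
    rw [ha, ← Real.sqrt_mul (by positivity)]
    apply Real.sqrt_le_sqrt
    nlinarith
  have hb0 : 0 < √((m + 1) * v) := Real.sqrt_pos.2 (by positivity)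
  have hN : ∀ k ≤ J, ∑ s ∈ Finset.range (k * h), x s = a * prefixSum G k := by
    intro k hk
    rw [hG, prefixSum_block x h _ hk]
    field_simp
  set W := prefixSum G with hW
  set A := ∑ l, |G l| with hA
  have hA0 : 0 ≤ A := Finset.sum_nonneg fun _ _ => abs_nonneg _
  have hWi : |W i| ≤ A := abs_prefixSum_le G i
  have hWj : |W j| ≤ A := abs_prefixSum_le G j
  -- the steps after the last full block
  obtain ⟨r, hr, hNm⟩ : ∃ r : ℝ, |r| ≤ 2 * J ∧ ∑ s ∈ Finset.range (m - T), x s = a * W J + r := by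
    refine ⟨∑ s ∈ Finset.range ((m - T) % J), x (J * h + s), ?_, ?_⟩
    · refine (Finset.abs_sum_le_sum_abs _ _).trans ?_
      refine (Finset.sum_le_sum fun s _ => hx _).trans ?_
      rw [Finset.sum_const, Finset.card_range, nsmul_eq_mul, mul_comm]
      have : (((m - T) % J : ℕ) : ℝ) ≤ J := by exact_mod_cast hml.le
      linarith
    · conv_lhs => rw [← hdm]
      rw [Finset.sum_range_add, hN J le_rfl]
  rw [facet] at h1
  have e1 : t₁ - T = i * h := by omega
  have e2 : t₂ - T = j * h := by omega
  simp only [e1, e2, hN i hiJ, hN j hjJ, hNm] at h1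
  have hda : η * √((m + 1) * v) + 36 / 100 * (2 * J) ≤ ζ * a := by
    have h6 : (2 * J : ℝ) ≤ (2 * J * √(2 * J) / √((m + 1) * v)) * a := by
      rw [div_mul_eq_mul_div, le_div_iff₀ hb0]
      have := mul_le_mul_of_nonneg_left hab (by positivity : (0 : ℝ) ≤ 2 * J)
      linarith
    have h7 : η * √((m + 1) * v) ≤ η * √(2 * J) * a := by
      rw [mul_assoc]; gcongr
    have h8 := mul_le_mul_of_nonneg_right hζ2 ha0.le
    rw [add_mul] at h8
    linarith
  have hq1 : |((m + 1 : ℝ) / t₁ - J / i) * W i| ≤ ζ * A := by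
    rw [abs_mul]; exact mul_le_mul (hr1.trans hζ1) hWi (abs_nonneg _) ((abs_nonneg _).trans (hr1.trans hζ1))
  have hq2 : |((m + 1 : ℝ) / t₂ - J / j) * W j| ≤ ζ * A := by
    rw [abs_mul]; exact mul_le_mul (hr2.trans hζ1) hWj (abs_nonneg _) ((abs_nonneg _).trans (hr2.trans hζ1))
  have hζ0 : 0 ≤ ζ := (abs_nonneg _).trans (hr1.trans hζ1)
  rw [abs_le] at hr hq1 hq2
  have key : -(ζ * (1 + A)) * a ≤ (36 / 100 * W J + 1 / 4 * (J / i) * W i +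
          39 / 100 * (J / j) * W j) * a := by
    have e3 : 36 / 100 * (a * W J + r) + 1 / 4 * (((m : ℝ) + 1) / t₁) * (a * W i) +
        39 / 100 * ((m + 1) / t₂) * (a * W j) =
        (36 / 100 * W J + 1 / 4 * (J / i) * W i + 39 / 100 * (J / j) * W j) * a + 36 / 100 * r +
        (1 / 4 * (((m + 1 : ℝ) / t₁ - J / i) * W i) + 39 / 100 * (((m + 1 : ℝ) / t₂ - J / j) * W j)) * a
        := by ring
    rw [e3] at h1
    have h9 : (1 / 4 * (((m + 1 : ℝ) / t₁ - J / i) * W i) +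
        39 / 100 * (((m + 1 : ℝ) / t₂ - J / j) * W j)) * a ≤ (ζ * A) * a := by
      have : 0 ≤ ζ * A := by positivity
      gcongr
      linarith
    have h10 : -(ζ * (1 + A)) * a = -(ζ * a) - ζ * A * a := by ring
    rw [h10]
    linarith
  exact le_of_mul_le_mul_right key ha0

/-- The inequalities of `exists_gaussian_facets_lt` for the running sums of `J` numbers, up to an error
of `ζ` times `1 + ∑ |x l|`, which covers the errors made in passing from a walk to blocks. -/
def blockFacets (J : ℕ) (ζ : ℝ) : Set (Fin J → ℝ) :=
  {x | ∀ i ≤ J, J ≤ 2 * i → ∀ j ≤ J, 4 * J ≤ 5 * j →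
      -(ζ * (1 + ∑ l, |x l|)) ≤ 36 / 100 * prefixSum x J + 1 / 4 * (J / i) * prefixSum x i +
          39 / 100 * (J / j) * prefixSum x j}

theorem continuous_prefixSum {J : ℕ} (k : ℕ) : Continuous fun x : Fin J → ℝ => prefixSum x k := by
  unfold prefixSum
  refine continuous_finsetSum _ fun l _ => ?_
  split_ifs
  · exact continuous_apply l
  · exact continuous_const

theorem isClosed_blockFacets (J : ℕ) (ζ : ℝ) : IsClosed (blockFacets J ζ) := by
  have hk := fun k => continuous_prefixSum (J := J) k
  simp only [blockFacets, Set.ofPred_forall]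
  refine isClosed_iInter fun i => isClosed_iInter fun _ => isClosed_iInter fun _ =>
    isClosed_iInter fun j => isClosed_iInter fun _ => isClosed_iInter fun _ => isClosed_le ?_ ?_
  · fun_prop
  · exact (((hk J).const_mul _).add ((hk i).const_mul _)).add ((hk j).const_mul _)

/-- The bound for Gaussian steps is stable: the sets `blockFacets J ζ` decrease to the set of
`exists_gaussian_facets_lt` as `ζ` tends to `0`. -/
theorem exists_blockFacets_lt : ∃ J : ℕ, 0 < J ∧ ∃ ζ : ℝ, 0 < ζ ∧
    (Measure.pi fun _ : Fin J => gaussianReal 0 1) (blockFacets J ζ) <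
      ENNReal.ofReal (Real.exp (-1)) := by
  obtain ⟨J, hJ, hlt⟩ := exists_gaussian_facets_lt
  refine ⟨J, hJ, ?_⟩
  set μ := Measure.pi fun _ : Fin J => gaussianReal 0 1
  set s : ℕ → Set (Fin J → ℝ) := fun k => blockFacets J (1 / ((k : ℝ) + 1)) with hs
  have hanti : Antitone s := by
    intro k l hkl x hx i hi hi' j hj hj'
    have h1 := hx i hi hi' j hj hj'
    have h2 : (1 : ℝ) / (l + 1) ≤ 1 / (k + 1) :=
      one_div_le_one_div_of_le (by positivity) (by exact_mod_cast Nat.succ_le_succ hkl)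
    have h3 : 0 ≤ 1 + ∑ l, |x l| := by positivity
    have := mul_le_mul_of_nonneg_right h2 h3
    linarith
  have hlim := tendsto_measure_iInter_atTop (μ := μ)
    (fun k => (isClosed_blockFacets J _).measurableSet.nullMeasurableSet) hanti
    ⟨0, measure_ne_top _ _⟩
  have hsub : μ (⋂ k, s k) < ENNReal.ofReal (Real.exp (-1)) := by
    refine lt_of_le_of_lt (measure_mono ?_) hlt
    intro x hx i hi hi' j hj hj'
    rw [Set.mem_iInter] at hx
    have h0 : Filter.Tendsto (fun k : ℕ => -(1 / ((k : ℝ) + 1) * (1 + ∑ l, |x l|)))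
        Filter.atTop (nhds (-(0 * (1 + ∑ l, |x l|)))) :=
      (tendsto_one_div_add_atTop_nhds_zero_nat.mul_const _).neg
    have := le_of_tendsto' h0 fun k => hx k i hi hi' j hj hj'
    simpa using this
  obtain ⟨k, hk⟩ := ((tendsto_order.1 hlim).2 _ hsub).exists
  exact ⟨1 / ((k : ℝ) + 1), by positivity, hk⟩

theorem measurableSet_facetsGe (m : ℕ) (T : ℕ) (b : ℝ) :
    MeasurableSet {x : ℕ → ℝ | FacetsGe m (fun t => ∑ s ∈ Finset.range (t - T), x s) b} := by
  simp only [FacetsGe, Set.ofPred_forall]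
  refine MeasurableSet.iInter fun t₁ => MeasurableSet.iInter fun t₂ => MeasurableSet.iInter fun _ =>
    MeasurableSet.iInter fun _ => MeasurableSet.iInter fun _ => MeasurableSet.iInter fun _ =>
    measurableSet_le measurable_const ?_
  unfold facet
  fun_prop

open Filter Topology in
/-- For bounded centered independent steps with enough total variance, all the weighted combinations
of the walk started at time `T` exceed a small negative multiple of its standard deviation with
probability less than `1 / e`, uniformly in the law of the steps. -/
theorem exists_facetsGe_le : ∃ p : ℝ, 0 < p ∧ p < Real.exp (-1) ∧ ∃ ε : ℝ, 0 < ε ∧ ∃ η : ℝ, 0 < η ∧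
    ∃ σ : ℝ, ∀ (ν : Measure ℝ) [IsProbabilityMeasure ν] (m T : ℕ), (∀ᵐ x ∂ν, |x| ≤ 2) →
      ∫ x, x ∂ν = 0 → m + 1 ≤ T ^ 2 → (T : ℝ) ≤ ε * (m + 1) →
      σ ≤ (m + 1) * ∫ x, x ^ 2 ∂ν →
      seqLaw ν {x | FacetsGe m (fun t => ∑ s ∈ Finset.range (t - T), x s)
        (η * √((m + 1) * ∫ x, x ^ 2 ∂ν))} ≤ ENNReal.ofReal p := by
  obtain ⟨J, hJ, ζ, hζ, hlt⟩ := exists_blockFacets_lt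
  have hJr : (0 : ℝ) < J := by exact_mod_cast hJ
  set γJ := (Measure.pi fun _ : Fin J => gaussianReal 0 1) (blockFacets J ζ) with hγJ
  obtain ⟨q, hq1, hq2⟩ := exists_between hlt
  have hqtop : q ≠ ⊤ := (hq2.trans ENNReal.ofReal_lt_top).ne
  have hq0 : 0 < q := lt_of_le_of_lt zero_le hq1
  refine ⟨q.toReal, ENNReal.toReal_pos hq0.ne' hqtop, ?_, ?_⟩
  · have := (ENNReal.toReal_lt_toReal hqtop ENNReal.ofReal_ne_top).2 hq2
    rwa [ENNReal.toReal_ofReal (Real.exp_pos _).le] at this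
  rw [ENNReal.ofReal_toReal hqtop]
  set s2 := √(2 * (J : ℝ)) with hs2
  have hs2p : 0 < s2 := Real.sqrt_pos.2 (by positivity)
  refine ⟨min (ζ / 8) (1 / 4), by positivity, ζ / 2 / s2, by positivity, ?_⟩
  set ε := min (ζ / 8) (1 / 4) with hεdef
  set η := ζ / 2 / s2 with hηdef
  -- otherwise there are laws with total variances tending to infinity that violate the bound, and the
  -- central limit theorem for their block sums contradicts the bound for Gaussian steps
  by_contra hcon
  push Not at hcon
  choose ν hν m T hb h0 hT hε hσ hgt using fun k : ℕ => hcon ((k : ℝ))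
  set v : ℕ → ℝ := fun k => ∫ x, x ^ 2 ∂(ν k) with hv
  set h : ℕ → ℕ := fun k => (m k - T k) / J with hh
  have hv4 : ∀ k, v k ≤ 4 := by
    intro k
    have : ∫ x, x ^ 2 ∂(ν k) ≤ ∫ x, (4 : ℝ) ∂(ν k) := by
      refine integral_mono_of_nonneg (ae_of_all _ fun x => sq_nonneg x) (integrable_const _) ?_
      filter_upwards [hb k] with x hx
      nlinarith [abs_nonneg x, sq_abs x]
    simpa using this
  have hv0 : ∀ k, 0 ≤ v k := fun k => integral_nonneg fun x => sq_nonneg x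
  have h4T : ∀ k, 4 * T k ≤ m k + 1 := by
    intro k
    have h1 : (T k : ℝ) ≤ 1 / 4 * (m k + 1) :=
      (hε k).trans (mul_le_mul_of_nonneg_right (min_le_right _ _) (by positivity))
    have h2 : (4 * T k : ℝ) ≤ m k + 1 := by linarith
    exact_mod_cast h2
  have hTJ : ∀ k : ℕ, 4 * (4 * J + 4) ^ 2 ≤ k → 4 * J + 4 ≤ T k := by
    intro k hk
    have h1 : (k : ℝ) ≤ (m k + 1) * 4 := (hσ k).trans (by
      apply mul_le_mul_of_nonneg_left (hv4 k); positivity)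
    have h2 : k ≤ (m k + 1) * 4 := by exact_mod_cast h1
    have h3 := hT k
    exact (Nat.pow_le_pow_iff_left (by norm_num : (2 : ℕ) ≠ 0)).1 (by omega)
  have hmh : ∀ k, 4 * (4 * J + 4) ^ 2 ≤ k → ((m k : ℝ) + 1) ≤ 2 * J * h k := by
    intro k hk
    have hdm := Nat.div_add_mod (m k - T k) J
    have hml := Nat.mod_lt (m k - T k) hJ
    have h1 := hTJ k hk
    have h2 := h4T k
    have h3 : (m k - T k) / J = h k := rfl
    rw [h3] at hdm
    have : m k + 1 ≤ 2 * (J * h k) := by omega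
    have h5 : ((m k + 1 : ℕ) : ℝ) ≤ ((2 * (J * h k) : ℕ) : ℝ) := by exact_mod_cast this
    push_cast at h5
    linarith
  have hlim : Tendsto (fun k => h k * v k) atTop atTop := by
    have h1 : Tendsto (fun k : ℕ => (k : ℝ) / (2 * J)) atTop atTop :=
      tendsto_natCast_atTop_atTop.atTop_div_const (by positivity)
    refine tendsto_atTop_mono' _ ?_ h1
    filter_upwards [eventually_ge_atTop (4 * (4 * J + 4) ^ 2)] with k hk
    rw [div_le_iff₀ (by positivity)]
    refine (hσ k).trans ?_
    have := mul_le_mul_of_nonneg_right (hmh k hk) (hv0 k)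
    have e : h k * v k * (2 * J) = 2 * J * h k * v k := by ring
    rw [e]; exact this
  have hclt := tendsto_normSumLaw ν v h hb h0 (fun _ => rfl) hlim
  have hpi : Tendsto (fun k => ProbabilityMeasure.pi fun _ : Fin J => normSumLaw (ν k) (v k) (h k))
      atTop (𝓝 (ProbabilityMeasure.pi fun _ : Fin J => ⟨gaussianReal 0 1, inferInstance⟩)) :=
    (ProbabilityMeasure.continuous_pi.tendsto _).comp (tendsto_pi_nhds.2 fun _ => hclt)
  -- the portmanteau theorem for the closed set `blockFacets J ζ`
  have hport := ProbabilityMeasure.limsup_measure_closed_le_of_tendsto hpi (isClosed_blockFacets J ζ)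
  have hev := eventually_lt_of_limsup_lt (lt_of_le_of_lt hport hq1)
  have hev2 : ∀ᶠ k : ℕ in atTop, 2 * J * s2 / √((m k + 1) * v k) ≤ ζ / 2 ∧ 0 < v k := by
    have h1 : Tendsto (fun k : ℕ => (m k + 1) * v k) atTop atTop :=
      tendsto_atTop_mono hσ tendsto_natCast_atTop_atTop
    have h2 : Tendsto (fun k : ℕ => √((m k + 1) * v k)) atTop atTop :=
      Real.tendsto_sqrt_atTop.comp h1
    have h3 : Tendsto (fun k : ℕ => 2 * J * s2 / √((m k + 1) * v k)) atTop (𝓝 0) :=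
      h2.const_div_atTop _
    filter_upwards [h3.eventually_lt_const (by positivity : (0 : ℝ) < ζ / 2),
      h1.eventually_gt_atTop 0] with k hk1 hk2
    exact ⟨hk1.le, (pos_iff_pos_of_mul_pos hk2).1 (by positivity)⟩
  obtain ⟨k, hk1, hk2, hk3⟩ := (hev.and (hev2.and (eventually_ge_atTop (4 * (4 * J + 4) ^ 2)))).exists
  refine absurd (hgt k) (not_lt.2 ?_)
  refine le_trans ?_ hk1.le
  change _ ≤ (Measure.pi fun _ : Fin J => (normSumLaw (ν k) (v k) (h k) : Measure ℝ)) _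
  have hlaw : (Measure.pi fun _ : Fin J => (normSumLaw (ν k) (v k) (h k) : Measure ℝ)) =
      (seqLaw (ν k)).map fun x (l : Fin J) => (√(h k * v k))⁻¹ *
        ∑ s ∈ Finset.range (h k), x (l * h k + s) := (seqLaw_map_blockSum (ν k) J (h k) _).symm
  rw [hlaw, Measure.map_apply (by fun_prop) (isClosed_blockFacets J ζ).measurableSet]
  refine measure_mono_ae ?_
  have hae : ∀ᵐ x ∂(seqLaw (ν k)), ∀ s, |x s| ≤ 2 := by
    rw [ae_all_iff]
    intro s
    have hmp := measurePreserving_eval_infinitePi (fun _ : ℕ => ν k) s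
    exact hmp.quasiMeasurePreserving.ae (hb k)
  filter_upwards [hae] with x hx hxF
  exact facets_block hx hJ rfl (hTJ k hk3) (h4T k) (hε k) (by positivity) hk2.2 hxF
    (by have : ε ≤ ζ / 8 := min_le_left _ _; linarith)
    (by
      have : η * s2 = ζ / 2 := by rw [hηdef]; field_simp
      rw [this]; linarith [hk2.1]) rfl

/-! ### The scale of the noise -/

/-- A path on which the noise is controlled by its quadratic variation at all dyadic scales. -/
def FreedmanGood {Z : Type*} [MeasurableSpace Z] (P : Measure Z) (φ : ℕ → (ℕ → Z) → Z → ℝ)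
    (c : ℝ) (m : ℕ) (S : ℕ → Z) : Prop :=
  ∀ k : ℕ, 1 ≤ k → ∀ t ≤ m, centSum P φ t S ≤ quadVar P φ t S / 2 ^ k + (c + k) * 2 ^ k

/-- Freedman's inequality at all the exponents `2 ^ (-k)` simultaneously. -/
theorem Predictable.not_freedmanGood_le {Z : Type*} [MeasurableSpace Z] {P : Measure Z}
    [IsProbabilityMeasure P] {φ : ℕ → (ℕ → Z) → Z → ℝ} (h : Predictable φ) (c : ℝ) (m : ℕ) :
    seqLaw P {S | ¬ FreedmanGood P φ c m S} ≤ ENNReal.ofReal (Real.exp (-c)) := by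
  have hsub : {S | ¬ FreedmanGood P φ c m S} ⊆ ⋃ k : ℕ, {S | ∃ t ≤ m,
      c + (k + 1 : ℕ) ≤ (1 / 2 ^ (k + 1) : ℝ) * centSum P φ t S -
        (1 / 2 ^ (k + 1) : ℝ) ^ 2 * quadVar P φ t S} := by
    intro S hS
    rw [Set.mem_ofPred_eq, FreedmanGood] at hS
    push Not at hS
    obtain ⟨k, hk, t, ht, hlt⟩ := hS
    obtain ⟨k, rfl⟩ : ∃ k', k = k' + 1 := ⟨k - 1, by omega⟩
    refine Set.mem_iUnion.2 ⟨k, t, ht, ?_⟩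
    have hp : (0 : ℝ) < 2 ^ (k + 1) := by positivity
    have e : (1 / 2 ^ (k + 1) : ℝ) * centSum P φ t S - (1 / 2 ^ (k + 1) : ℝ) ^ 2 * quadVar P φ t S =
        (centSum P φ t S - quadVar P φ t S / 2 ^ (k + 1)) / 2 ^ (k + 1) := by
      field_simp
    rw [e, le_div_iff₀ hp]
    linarith
  refine (measure_mono hsub).trans ((measure_iUnion_le _).trans ?_)
  have hk : ∀ k : ℕ, seqLaw P {S | ∃ t ≤ m,
      c + (k + 1 : ℕ) ≤ (1 / 2 ^ (k + 1) : ℝ) * centSum P φ t S -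
        (1 / 2 ^ (k + 1) : ℝ) ^ 2 * quadVar P φ t S} ≤
      ENNReal.ofReal (Real.exp (-c)) * 2⁻¹ ^ (k + 1) := by
    intro k
    refine (h.freedman (by positivity) ?_ _ m).trans ?_
    · exact one_div_le_one_div_of_le (by norm_num) (le_self_pow₀ (by norm_num) (by omega))
    · rw [neg_add, Real.exp_add, ENNReal.ofReal_mul (Real.exp_pos _).le]
      gcongr
      have h2 : (2⁻¹ : ENNReal) = ENNReal.ofReal (1 / 2) := by
        rw [one_div, ENNReal.ofReal_inv_of_pos (by norm_num)]; simp
      rw [h2, ← ENNReal.ofReal_pow (by norm_num)]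
      refine ENNReal.ofReal_le_ofReal ?_
      have h3 : Real.exp (-1) ≤ 1 / 2 := by
        rw [Real.exp_neg, one_div]
        exact inv_anti₀ (by norm_num) (by linarith [Real.add_one_le_exp 1])
      calc Real.exp (-((k + 1 : ℕ) : ℝ)) = Real.exp (-1) ^ (k + 1) := by
            rw [← Real.exp_nat_mul]; congr 1; ring
        _ ≤ (1 / 2) ^ (k + 1) := pow_le_pow_left₀ (Real.exp_pos _).le h3 _
  refine (ENNReal.tsum_le_tsum hk).trans ?_
  rw [ENNReal.tsum_mul_left]
  have : ∑' k : ℕ, (2⁻¹ : ENNReal) ^ (k + 1) = 1 := by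
    rw [ENNReal.tsum_geometric_add_one, ENNReal.one_sub_inv_two, inv_inv]
    exact ENNReal.inv_mul_cancel (by norm_num) (by norm_num)
  rw [this, mul_one]

/-- The variance of `u`. -/
noncomputable def centVar {Z : Type*} [MeasurableSpace Z] (P : Measure Z) (u : Z → ℝ) : ℝ :=
  ∫ z, (u z - ∫ z', u z' ∂P) ^ 2 ∂P

section CentVar

variable {Z : Type*} [MeasurableSpace Z] {P : Measure Z} [IsProbabilityMeasure P]

theorem centVar_nonneg (u : Z → ℝ) : 0 ≤ centVar P u := integral_nonneg fun _ => sq_nonneg _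

theorem integrable_sq_of_abs_le {u : Z → ℝ} (hu : Measurable u) {c : ℝ} (hc : ∀ z, |u z| ≤ c) :
    Integrable (fun z => u z ^ 2) P :=
  integrable_of_abs_le (c := c ^ 2) (hu.pow_const 2) fun z => by
    rw [abs_pow]; exact pow_le_pow_left₀ (abs_nonneg _) (hc z) 2

theorem abs_sub_integral_le {u : Z → ℝ} {c : ℝ} (hc : ∀ z, |u z| ≤ c) (z : Z) :
    |u z - ∫ z', u z' ∂P| ≤ 2 * c := by
  have h1 := hc z
  have h2 : |∫ z', u z' ∂P| ≤ c := abs_integral_le_of_abs_le hc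
  calc |u z - ∫ z', u z' ∂P| ≤ |u z| + |∫ z', u z' ∂P| := abs_sub _ _
    _ ≤ 2 * c := by linarith

theorem centVar_le_integral_sq {u : Z → ℝ} (hu : Measurable u) {c : ℝ} (hc : ∀ z, |u z| ≤ c) :
    centVar P u ≤ ∫ z, u z ^ 2 ∂P := by
  have hi := integrable_of_abs_le (P := P) hu hc
  have hi2 := integrable_sq_of_abs_le (P := P) hu hc
  set a := ∫ z', u z' ∂P with ha
  have : centVar P u = ∫ z, u z ^ 2 ∂P - a ^ 2 := by
    have e : ∀ z, (u z - a) ^ 2 = u z ^ 2 - (2 * a * u z - a ^ 2) := fun z => by ring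
    have hi3 : Integrable (fun z => 2 * a * u z - a ^ 2) P :=
      (hi.const_mul (2 * a)).sub (integrable_const _)
    rw [centVar]
    simp_rw [← ha, e]
    rw [integral_sub hi2 hi3, integral_sub (hi.const_mul _) (integrable_const _),
      integral_const_mul, ← ha]
    simp; ring
  rw [this]; linarith [sq_nonneg a]

/-- The variance is stable under small changes of the function in `L²`. -/
theorem centVar_le_two_mul {u w : Z → ℝ} (hu : Measurable u) (hw : Measurable w) {c c' : ℝ}
    (hc : ∀ z, |u z| ≤ c) (hc' : ∀ z, |w z| ≤ c') :
    centVar P u ≤ 2 * centVar P w + 2 * ∫ z, (u z - w z) ^ 2 ∂P := by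
  have hd : Measurable fun z => u z - w z := hu.sub hw
  have hdc : ∀ z, |u z - w z| ≤ c + c' := fun z =>
    (abs_sub _ _).trans (add_le_add (hc z) (hc' z))
  have h1 := centVar_le_integral_sq (P := P) hd hdc
  have hiu := integrable_of_abs_le (P := P) hu hc
  have hiw := integrable_of_abs_le (P := P) hw hc'
  have he : ∫ z, (u z - w z) ∂P = ∫ z, u z ∂P - ∫ z, w z ∂P := integral_sub hiu hiw
  have h2 : centVar P u ≤ 2 * centVar P w + 2 * centVar P fun z => u z - w z := by
    unfold centVar
    rw [← integral_const_mul, ← integral_const_mul]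
    have j1 : Integrable (fun z => (w z - ∫ z', w z' ∂P) ^ 2) P :=
      integrable_sq_of_abs_le (hw.sub_const _) (abs_sub_integral_le hc')
    have j2 : Integrable (fun z => ((u z - w z) - ∫ z', (u z' - w z') ∂P) ^ 2) P :=
      integrable_sq_of_abs_le (hd.sub_const _) (abs_sub_integral_le hdc)
    have j3 : Integrable (fun z => (u z - ∫ z', u z' ∂P) ^ 2) P :=
      integrable_sq_of_abs_le (hu.sub_const _) (abs_sub_integral_le hc)
    rw [← integral_add (j1.const_mul 2) (j2.const_mul 2)]
    refine integral_mono j3 ((j1.const_mul 2).add (j2.const_mul 2)) fun z => ?_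
    simp only [he]
    nlinarith [sq_nonneg ((w z - ∫ z', w z' ∂P) - (u z - w z - (∫ z', u z' ∂P - ∫ z', w z' ∂P)))]
  linarith

end CentVar

/-- If the noise `A` is large, so is the variance `q` of the final predictor, and `A` is of smaller
order than `√q`, up to a small power. -/
theorem exists_scale {A q c θ₀ : ℝ} (hc : 0 ≤ c) (h2 : 2 ≤ θ₀) (hcθ : c ≤ θ₀)
    (hA : ∀ k : ℕ, 1 ≤ k → A ≤ (2 * q + 4 * A) / 2 ^ k + (c + k) * 2 ^ k)
    (hbig : (2 * θ₀) ^ 16 + 32 * (c + 3) ≤ 2 * A) :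
    ∃ j : ℕ, 1 ≤ j ∧ θ₀ ≤ 2 ^ j ∧ (2 ^ j : ℝ) ^ 16 ≤ q ∧ q ≤ 2 ^ 16 * (2 ^ j) ^ 16 ∧
      A ≤ 2 ^ 19 * (2 ^ j) ^ 9 := by
  have hA0 : 0 ≤ A := by
    have : 0 ≤ (2 * θ₀) ^ 16 := by positivity
    linarith
  have hq : (2 * θ₀) ^ 16 ≤ q := by
    have := hA 3 (by norm_num)
    norm_num at this
    linarith
  have hq1 : 1 ≤ q := le_trans (one_le_pow₀ (by linarith)) hq
  obtain ⟨j, hj1, hj2⟩ := exists_nat_pow_near hq1 (by norm_num : (1 : ℝ) < 2 ^ 16)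
  have e1 : ((2 : ℝ) ^ 16) ^ j = (2 ^ j) ^ 16 := by rw [← pow_mul, ← pow_mul, mul_comm]
  have e2 : ((2 : ℝ) ^ 16) ^ (j + 1) = (2 * 2 ^ j) ^ 16 := by rw [pow_succ, e1]; ring
  rw [e1] at hj1
  rw [e2] at hj2
  set θ : ℝ := 2 ^ j with hθ
  have hθ0 : θ₀ ≤ θ := by
    have := lt_of_pow_lt_pow_left₀ 16 (by positivity) (lt_of_le_of_lt hq hj2)
    linarith
  have hj0 : 1 ≤ j := by
    by_contra hj
    have : j = 0 := by omega
    rw [hθ, this] at hθ0; norm_num at hθ0; linarith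
  have hθ2 : 2 ≤ θ := h2.trans hθ0
  have hq2 : q ≤ 2 ^ 16 * θ ^ 16 := by rw [← mul_pow]; exact hj2.le
  refine ⟨j, hj0, hθ0, hj1, hq2, ?_⟩
  have h7 := hA (7 * j) (by omega)
  have e7 : (2 : ℝ) ^ (7 * j) = θ ^ 7 := by rw [hθ, ← pow_mul, mul_comm]
  rw [e7] at h7
  push_cast at h7
  have hjθ : (j : ℝ) ≤ θ := by
    rw [hθ]; exact_mod_cast (Nat.lt_two_pow_self).le
  have hθ7 : (8 : ℝ) ≤ θ ^ 7 := by
    calc (8 : ℝ) ≤ 2 ^ 7 := by norm_num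
      _ ≤ θ ^ 7 := by gcongr
  have hθp : 0 < θ := by linarith
  have k1 : (2 * q + 4 * A) / θ ^ 7 ≤ 2 ^ 17 * θ ^ 9 + A / 2 := by
    rw [div_le_iff₀ (by positivity)]
    have : 4 * A ≤ A / 2 * θ ^ 7 := by nlinarith
    have e : (2 ^ 17 * θ ^ 9 + A / 2) * θ ^ 7 = 2 * (2 ^ 16 * θ ^ 16) + A / 2 * θ ^ 7 := by ring
    rw [e]; linarith
  have k2 : (c + 7 * j) * θ ^ 7 ≤ 8 * θ ^ 9 := by
    have : c + 7 * j ≤ 8 * θ := by linarith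
    calc (c + 7 * j) * θ ^ 7 ≤ (8 * θ) * θ ^ 7 := by gcongr
      _ = 8 * θ ^ 8 * 1 := by ring
      _ ≤ 8 * θ ^ 8 * θ := by gcongr; linarith
      _ = 8 * θ ^ 9 := by ring
  have hp : (0 : ℝ) ≤ θ ^ 9 := by positivity
  nlinarith

/-- A time `n / w` at which `w ^ 4` is of the order of the variance `Q` has `w` of order `θ ^ 4`: the scale
`θ` of the end of the path can be read off at that time. -/
theorem time_scale {A q Q w θ : ℝ} (hθ : 2 ^ 30 ≤ θ) (hq1 : θ ^ 16 ≤ q) (hq2 : q ≤ 2 ^ 16 * θ ^ 16)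
    (hA : A ≤ 2 ^ 19 * θ ^ 9) (hw : 0 ≤ w) (hQ1 : q / 2 - 2 * (A * w) ≤ Q)
    (hQ2 : Q ≤ 2 * q + 4 * (A * w)) (hW1 : w ^ 4 ≤ Q) (hW2 : Q ≤ 2 ^ 26 * w ^ 4) :
    w ≤ 32 * θ ^ 4 ∧ θ ^ 4 ≤ 2 ^ 7 * w ∧ θ ^ 16 / 4 ≤ Q := by
  have hθ0 : 0 < θ := lt_of_lt_of_le (by norm_num) hθ
  have hw32 : w ≤ 32 * θ ^ 4 := by
    by_contra hcon
    push Not at hcon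
    have h1 : (32 * θ ^ 4) ^ 4 < w ^ 4 := pow_lt_pow_left₀ hcon (by positivity) (by norm_num)
    have h2 : (32 * θ ^ 4) ^ 3 * w ≤ w ^ 4 := by
      have : (32 * θ ^ 4) ^ 3 ≤ w ^ 3 := pow_le_pow_left₀ (by positivity) hcon.le 3
      calc (32 * θ ^ 4) ^ 3 * w ≤ w ^ 3 * w := by gcongr
        _ = w ^ 4 := by ring
    have h3 : A * w ≤ 2 ^ 19 * θ ^ 9 * w := by gcongr
    have h4 : (2 : ℝ) ^ 19 * θ ^ 9 * w ≤ θ ^ 12 * w := by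
      have : (2 : ℝ) ^ 19 ≤ θ ^ 3 := by
        calc (2 : ℝ) ^ 19 ≤ (2 ^ 30) ^ 3 := by norm_num
          _ ≤ θ ^ 3 := by gcongr
      calc (2 : ℝ) ^ 19 * θ ^ 9 * w ≤ θ ^ 3 * θ ^ 9 * w := by gcongr
        _ = θ ^ 12 * w := by ring
    have e1 : (32 * θ ^ 4) ^ 4 = 2 ^ 20 * θ ^ 16 := by ring
    have e2 : (32 * θ ^ 4) ^ 3 * w = 2 ^ 15 * (θ ^ 12 * w) := by ring
    rw [e1] at h1
    rw [e2] at h2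
    have h5 : 0 ≤ θ ^ 12 * w := by positivity
    have h6 : 0 < θ ^ 16 := by positivity
    norm_num at *
    linarith
  have hQ : θ ^ 16 / 4 ≤ Q := by
    have h1 : A * w ≤ 2 ^ 19 * θ ^ 9 * (32 * θ ^ 4) := by gcongr
    have h2 : (2 : ℝ) ^ 19 * θ ^ 9 * (32 * θ ^ 4) ≤ θ ^ 16 / 8 := by
      have : (2 : ℝ) ^ 27 ≤ θ ^ 3 := by
        calc (2 : ℝ) ^ 27 ≤ (2 ^ 30) ^ 3 := by norm_num
          _ ≤ θ ^ 3 := by gcongr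
      calc (2 : ℝ) ^ 19 * θ ^ 9 * (32 * θ ^ 4) = 2 ^ 27 * θ ^ 13 / 8 := by ring
        _ ≤ θ ^ 3 * θ ^ 13 / 8 := by gcongr
        _ = θ ^ 16 / 8 := by ring
    linarith
  refine ⟨hw32, ?_, hQ⟩
  have h1 : (θ ^ 4) ^ 4 ≤ (2 ^ 7 * w) ^ 4 := by
    have e1 : (θ ^ 4) ^ 4 = θ ^ 16 := by ring
    have e2 : (2 ^ 7 * w) ^ 4 = 4 * (2 ^ 26 * w ^ 4) := by ring
    rw [e1, e2]; linarith
  exact le_of_pow_le_pow_left₀ (by norm_num) (by positivity) h1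

/-- At a time of order `n / θ ^ 4`, the quantities `(n / t) ^ 4` and `Q` agree up to constants. -/
theorem exists_time {A q θ n : ℝ} (hθ : 2 ^ 30 ≤ θ) (hn : θ ^ 16 ≤ n) (hq1 : θ ^ 16 ≤ q)
    (hq2 : q ≤ 2 ^ 16 * θ ^ 16) (hA : A ≤ 2 ^ 19 * θ ^ 9) :
    ∃ t : ℕ, 1 ≤ t ∧ θ ^ 4 / 3 ≤ n / t ∧ n / t ≤ θ ^ 4 / 2 ∧
      ∀ Q, q / 2 - 2 * (A * (n / t)) ≤ Q → Q ≤ 2 * q + 4 * (A * (n / t)) →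
        (n / t) ^ 4 ≤ Q ∧ Q ≤ 2 ^ 26 * (n / t) ^ 4 ∧ θ ^ 16 / 4 ≤ Q := by
  have hθ0 : 0 < θ := lt_of_lt_of_le (by norm_num) hθ
  have hθ1 : 1 ≤ θ := le_trans (by norm_num) hθ
  have hn0 : 0 < n := lt_of_lt_of_le (by positivity) hn
  have hn4 : θ ^ 4 ≤ n := le_trans (pow_le_pow_right₀ hθ1 (by norm_num)) hn
  set t := ⌈2 * n / θ ^ 4⌉₊ with ht
  have ht1 : 2 * n / θ ^ 4 ≤ t := Nat.le_ceil _
  have ht2 : (t : ℝ) ≤ 3 * n / θ ^ 4 := by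
    have h1 : (t : ℝ) < 2 * n / θ ^ 4 + 1 := Nat.ceil_lt_add_one (by positivity)
    have h2 : 1 ≤ n / θ ^ 4 := (one_le_div (by positivity)).2 hn4
    have h3 : 3 * n / θ ^ 4 = 2 * n / θ ^ 4 + n / θ ^ 4 := by ring
    linarith
  have ht0 : (0 : ℝ) < t := lt_of_lt_of_le (by positivity) ht1
  have hw1 : θ ^ 4 / 3 ≤ n / t := by
    rw [div_le_div_iff₀ (by norm_num) ht0]
    rw [le_div_iff₀ (by positivity)] at ht2
    linarith
  have hw2 : n / t ≤ θ ^ 4 / 2 := by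
    rw [div_le_div_iff₀ ht0 (by norm_num)]
    rw [div_le_iff₀ (by positivity)] at ht1
    linarith
  refine ⟨t, by exact_mod_cast ht0, hw1, hw2, fun Q hQ1 hQ2 => ?_⟩
  set w := n / t with hw
  have hw0 : 0 ≤ w := by positivity
  have hAw : A * w ≤ θ ^ 16 / 8 := by
    have h1 : A * w ≤ 2 ^ 19 * θ ^ 9 * (θ ^ 4 / 2) := by gcongr
    have : (2 : ℝ) ^ 21 ≤ θ ^ 3 := by
      calc (2 : ℝ) ^ 21 ≤ (2 ^ 30) ^ 3 := by norm_num
        _ ≤ θ ^ 3 := by gcongr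
    calc A * w ≤ 2 ^ 19 * θ ^ 9 * (θ ^ 4 / 2) := h1
      _ = 2 ^ 21 * θ ^ 13 / 8 := by ring
      _ ≤ θ ^ 3 * θ ^ 13 / 8 := by gcongr
      _ = θ ^ 16 / 8 := by ring
  have h16 : 0 < θ ^ 16 := by positivity
  have hQ : θ ^ 16 / 4 ≤ Q := by linarith
  refine ⟨?_, ?_, hQ⟩
  · have : w ^ 4 ≤ (θ ^ 4 / 2) ^ 4 := pow_le_pow_left₀ hw0 hw2 4
    have e : (θ ^ 4 / 2) ^ 4 = θ ^ 16 / 16 := by ring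
    linarith
  · have : (θ ^ 4 / 3) ^ 4 ≤ w ^ 4 := pow_le_pow_left₀ (by positivity) hw1 4
    have e : (θ ^ 4 / 3) ^ 4 = θ ^ 16 / 81 := by ring
    rw [e] at this
    norm_num at *
    linarith

/-! ### Freezing the average predictor -/

/-- The facet bound for sums of independent centred values of a bounded function. -/
theorem seqLaw_facets_le {p ε η σ : ℝ} (hfresh : ∀ (ν : Measure ℝ) [IsProbabilityMeasure ν]
      (m T : ℕ), (∀ᵐ x ∂ν, |x| ≤ 2) →
      ∫ x, x ∂ν = 0 → m + 1 ≤ T ^ 2 → (T : ℝ) ≤ ε * (m + 1) →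
      σ ≤ (m + 1) * ∫ x, x ^ 2 ∂ν →
      seqLaw ν {x | FacetsGe m (fun t => ∑ s ∈ Finset.range (t - T), x s)
        (η * √((m + 1) * ∫ x, x ^ 2 ∂ν))} ≤ ENNReal.ofReal p)
    {Z : Type*} [MeasurableSpace Z] {P : Measure Z} [IsProbabilityMeasure P] {u : Z → ℝ}
    (hu : Measurable u) (hu1 : ∀ z, |u z| ≤ 1) {m T : ℕ} (h1 : m + 1 ≤ T ^ 2)
    (h2 : (T : ℝ) ≤ ε * (m + 1)) (h3 : σ ≤ (m + 1) * centVar P u) :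
    seqLaw P {S | FacetsGe m (fun t => ∑ s ∈ Finset.range (t - T), (u (S s) - ∫ z, u z ∂P))
      (η * √((m + 1) * centVar P u))} ≤ ENNReal.ofReal p := by
  set a := ∫ z, u z ∂P with ha
  set g : Z → ℝ := fun z => u z - a with hg
  have hgm : Measurable g := hu.sub_const _
  have : IsProbabilityMeasure (P.map g) := Measure.isProbabilityMeasure_map hgm.aemeasurable
  have hvar : ∫ x, x ^ 2 ∂(P.map g) = centVar P u := by
    rw [integral_map hgm.aemeasurable (by fun_prop)]; rfl
  have hmean : ∫ x, x ∂(P.map g) = 0 := by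
    rw [integral_map hgm.aemeasurable (by fun_prop)]
    change ∫ z, (u z - a) ∂P = 0
    rw [integral_sub (integrable_of_abs_le hu hu1) (integrable_const _)]
    simp [ha]
  have hb : ∀ᵐ x ∂(P.map g), |x| ≤ 2 := by
    rw [ae_map_iff hgm.aemeasurable (measurableSet_le (by fun_prop) (by fun_prop))]
    refine Filter.Eventually.of_forall fun z => ?_
    have := abs_sub_integral_le (P := P) hu1 z
    simpa using this
  have key := hfresh (P.map g) m T hb hmean h1 h2 (by rw [hvar]; exact h3)
  rw [hvar] at key
  have hlaw : seqLaw (P.map g) = (seqLaw P).map fun S i => g (S i) :=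
    (Measure.infinitePi_map_pi (μ := fun _ : ℕ => P) (f := fun _ => g) fun _ => hgm).symm
  rw [hlaw, Measure.map_apply (by fun_prop) (measurableSet_facetsGe m T _)] at key
  exact key

namespace Experts

variable {Z ι : Type*} [MeasurableSpace Z] [MeasurableSpace ι] [Countable ι]
  [DiscreteMeasurableSpace ι] {D : Set ℝ} {ℓ : Z → ℝ → ℝ} {f : ι → Z → ℝ}
  {π : Measure ι} [IsProbabilityMeasure π] {P : Measure Z} [IsProbabilityMeasure P]

/-- The loss gain of the predictor `g` over an expert drawn from `ρ`. -/
noncomputable def predGain (ℓ : Z → ℝ → ℝ) (f : ι → Z → ℝ) (ρ : Measure ι) (g : Z → ℝ) (z : Z) : ℝ :=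
  meanLoss ℓ f ρ z - ℓ z (g z)

theorem measurable_predGain (h : Experts D ℓ f) (ρ : Measure ι) [IsProbabilityMeasure ρ]
    {g : Z → ℝ} (hg : Measurable g) : Measurable (predGain ℓ f ρ g) :=
  (h.measurable_meanLoss ρ).sub (h.loss.meas_comp hg)

theorem abs_predGain_le (h : Experts D ℓ f) (ρ : Measure ι) [IsProbabilityMeasure ρ]
    {g : Z → ℝ} (hgD : ∀ z, g z ∈ D) (z : Z) : |predGain ℓ f ρ g z| ≤ 1 := by
  have h1 := h.abs_meanLoss_le ρ z
  have h2 := h.loss.bdd z _ (hgD z)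
  exact (abs_sub _ _).trans (by linarith)

theorem integral_loss_sub_sq_le (h : Experts D ℓ f) {g g' : Z → ℝ}
    (hg : Measurable g) (hgD : ∀ z, g z ∈ D) (hg' : Measurable g') (hgD' : ∀ z, g' z ∈ D) :
    ∫ z, (ℓ z (g z) - ℓ z (g' z)) ^ 2 ∂P ≤ sqDist P g g' := by
  refine integral_mono_of_nonneg (Filter.Eventually.of_forall fun z => sq_nonneg _)
    (h.loss.integrable_sq_sub hg hgD hg' hgD') (Filter.Eventually.of_forall fun z => ?_)
  exact sq_le_sq.2 (h.loss.lip z (hgD z) (hgD' z))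

/-- Nearby predictors have gains of comparable variance. -/
theorem centVar_predGain_le (h : Experts D ℓ f) (ρ : Measure ι) [IsProbabilityMeasure ρ]
    {g g' : Z → ℝ} (hg : Measurable g) (hgD : ∀ z, g z ∈ D) (hg' : Measurable g')
    (hgD' : ∀ z, g' z ∈ D) :
    centVar P (predGain ℓ f ρ g) ≤ 2 * centVar P (predGain ℓ f ρ g') + 2 * sqDist P g g' := by
  have h1 := centVar_le_two_mul (P := P) (h.measurable_predGain ρ hg) (h.measurable_predGain ρ hg')
    (h.abs_predGain_le ρ hgD) (h.abs_predGain_le ρ hgD')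
  have h2 := h.integral_loss_sub_sq_le (P := P) hg hgD hg' hgD'
  have e : ∫ z, (predGain ℓ f ρ g z - predGain ℓ f ρ g' z) ^ 2 ∂P =
      ∫ z, (ℓ z (g z) - ℓ z (g' z)) ^ 2 ∂P := by
    refine integral_congr_ae (Filter.Eventually.of_forall fun z => ?_)
    simp only [predGain]; ring
  rw [e] at h1
  linarith

theorem centVar_predGain_le_one (h : Experts D ℓ f) (ρ : Measure ι) [IsProbabilityMeasure ρ]
    {g : Z → ℝ} (hg : Measurable g) (hgD : ∀ z, g z ∈ D) : centVar P (predGain ℓ f ρ g) ≤ 1 := by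
  refine (centVar_le_integral_sq (h.measurable_predGain ρ hg) (h.abs_predGain_le ρ hgD)).trans ?_
  have : ∫ z, predGain ℓ f ρ g z ^ 2 ∂P ≤ ∫ z, (1 : ℝ) ∂P := by
    refine integral_mono_of_nonneg (Filter.Eventually.of_forall fun z => sq_nonneg _)
      (integrable_const _) (Filter.Eventually.of_forall fun z => ?_)
    exact (sq_le_one_iff_abs_le_one _).2 (h.abs_predGain_le ρ hgD z)
  simpa using this

theorem sqDist_le_two_mul (h : Experts D ℓ f) {a b c : Z → ℝ}
    (ha : Measurable a) (haD : ∀ z, a z ∈ D) (hb : Measurable b) (hbD : ∀ z, b z ∈ D)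
    (hc : Measurable c) (hcD : ∀ z, c z ∈ D) :
    sqDist P a c ≤ 2 * sqDist P a b + 2 * sqDist P b c := by
  have i1 := h.loss.integrable_sq_sub (P := P) ha haD hb hbD
  have i2 := h.loss.integrable_sq_sub (P := P) hb hbD hc hcD
  unfold sqDist
  rw [← integral_const_mul, ← integral_const_mul, ← integral_add (i1.const_mul 2) (i2.const_mul 2)]
  refine integral_mono (h.loss.integrable_sq_sub ha haD hc hcD)
    ((i1.const_mul 2).add (i2.const_mul 2)) fun z => ?_
  simp only
  nlinarith [sq_nonneg ((a z - b z) - (b z - c z))]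

theorem sqDist_comm (a b : Z → ℝ) : sqDist P a b = sqDist P b a := by
  unfold sqDist
  exact integral_congr_ae (Filter.Eventually.of_forall fun z => by simp only; ring)

/-- The average of the posterior means is close to a predictor to which most of them are close. -/
theorem sqDist_mixAvg_le (h : Experts D ℓ f) {t : ℕ} (ht : 0 < t) (S : ℕ → Z) {g : Z → ℝ}
    (hg : Measurable g) (hgD : ∀ z, g z ∈ D) :
    t * sqDist P (mixAvg ℓ f π t S) g ≤
      ∑ s ∈ Finset.range t, sqDist P (mixMean ℓ f π s S) g := by
  have hi : ∀ s, Integrable (fun z => (mixMean ℓ f π s S z - g z) ^ 2) P := fun s =>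
    h.loss.integrable_sq_sub (h.measurable_mixMean_section s S) (h.mixMean_mem s S) hg hgD
  unfold sqDist
  rw [← integral_const_mul, ← integral_finsetSum _ fun s _ => hi s]
  refine integral_mono ((h.loss.integrable_sq_sub (h.measurable_mixAvg_section t S)
    (h.mixAvg_mem ht S) hg hgD).const_mul _) (integrable_finsetSum _ fun s _ => hi s) fun z => ?_
  have ht' : (0 : ℝ) < t := by exact_mod_cast ht
  have e : mixAvg ℓ f π t S z - g z = (∑ s ∈ Finset.range t, (mixMean ℓ f π s S z - g z)) / t := by
    rw [mixAvg, Finset.sum_sub_distrib]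
    simp; field_simp
  have h1 := sq_sum_le_card_mul_sum_sq (s := Finset.range t)
    (f := fun s => mixMean ℓ f π s S z - g z)
  rw [Finset.card_range] at h1
  simp only
  rw [e, div_pow]
  have : (t : ℝ) * ((∑ s ∈ Finset.range t, (mixMean ℓ f π s S z - g z)) ^ 2 / t ^ 2) =
      (∑ s ∈ Finset.range t, (mixMean ℓ f π s S z - g z)) ^ 2 / t := by field_simp
  rw [this, div_le_iff₀ ht', mul_comm]
  exact h1

/-- The noise before time `t` has a quadratic variation that is controlled by a fixed predictor `g` and
by the distances of the posterior means from it. -/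
theorem quadVar_mixGain_le (h : Experts D ℓ f) (ρ : Measure ι) [IsProbabilityMeasure ρ] (t : ℕ)
    (S : ℕ → Z) {g : Z → ℝ} (hg : Measurable g) (hgD : ∀ z, g z ∈ D) :
    quadVar P (mixGain ℓ f π ρ) t S ≤ 2 * (t * centVar P (predGain ℓ f ρ g)) +
      2 * ∑ s ∈ Finset.range t, sqDist P (mixMean ℓ f π s S) g := by
  have : quadVar P (mixGain ℓ f π ρ) t S =
      ∑ s ∈ Finset.range t, centVar P (predGain ℓ f ρ (mixMean ℓ f π s S)) := rfl
  rw [this]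
  refine (Finset.sum_le_sum fun s _ => h.centVar_predGain_le ρ (h.measurable_mixMean_section s S)
    (h.mixMean_mem s S) hg hgD).trans ?_
  rw [Finset.sum_add_distrib, Finset.sum_const, Finset.card_range, nsmul_eq_mul, Finset.mul_sum]
  linarith

theorem mixAvg_congr (t : ℕ) {S S' : ℕ → Z} (hS : ∀ i < t, S i = S' i) :
    mixAvg ℓ f π t S = mixAvg ℓ f π t S' := by
  ext z
  unfold mixAvg
  congr 1
  refine Finset.sum_congr rfl fun s hs => ?_
  rw [mixMean_congr s fun i hi => hS i (hi.trans (Finset.mem_range.1 hs))]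

/-- The difference between the gains of the later posterior means and the gain of a fixed predictor
`g`, along sequences that start with `S` up to time `t`. -/
noncomputable def gainDiff (ℓ : Z → ℝ → ℝ) (f : ι → Z → ℝ) (π : Measure ι) (t : ℕ) (S : ℕ → Z)
    (g : Z → ℝ) (i : ℕ) (S' : ℕ → Z) (z : Z) : ℝ :=
  ℓ z (g z) - ℓ z (mixMean ℓ f π (t + i) (seqSplice t S S') z)

theorem predictable_gainDiff (h : Experts D ℓ f) (t : ℕ) (S : ℕ → Z) {g : Z → ℝ}
    (hg : Measurable g) (hgD : ∀ z, g z ∈ D) : Predictable (gainDiff ℓ f π t S g) where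
  meas i := by
    have h1 : Measurable fun p : (ℕ → Z) × Z => mixMean ℓ f π (t + i) (seqSplice t S p.1) p.2 := by
      have h2 : Measurable fun p : (ℕ → Z) × Z => (seqSplice t S p.1, p.2) :=
        ((measurable_seqSplice t S).comp measurable_fst).prodMk measurable_snd
      have h3 := (h.measurable_mixMean (π := π) (t + i)).comp h2
      exact h3
    exact ((h.loss.meas_comp hg).comp measurable_snd).sub
      (h.loss.meas.comp (measurable_snd.prodMk h1))
  adapted i S₁ S₂ hS := by
    ext z
    unfold gainDiff
    rw [mixMean_congr (t + i) (S := seqSplice t S S₁) (S' := seqSplice t S S₂)]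
    intro k hk
    unfold seqSplice
    split_ifs with hkt
    · rfl
    · exact hS _ (by omega)
  bdd i S' z := (h.loss.abs_sub_le_half z (hgD z) (h.mixMean_mem _ _ z)).trans (by norm_num)

/-- After time `t` the noise is that of a fixed predictor `g`, which makes it a sum of independent
variables, plus the noise of `gainDiff`. -/
theorem centSum_mixGain_splice (h : Experts D ℓ f) (ρ : Measure ι) [IsProbabilityMeasure ρ]
    (t : ℕ) (S S' : ℕ → Z) {g : Z → ℝ} (hg : Measurable g) (hgD : ∀ z, g z ∈ D) {t' : ℕ}
    (ht : t ≤ t') :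
    centSum P (mixGain ℓ f π ρ) t' (seqSplice t S S') =
      centSum P (mixGain ℓ f π ρ) t (seqSplice t S S') +
      ∑ s ∈ Finset.range (t' - t), (predGain ℓ f ρ g (S' s) - ∫ z, predGain ℓ f ρ g z ∂P) +
      centSum P (gainDiff ℓ f π t S g) (t' - t) S' := by
  obtain ⟨k, rfl⟩ := Nat.exists_eq_add_of_le ht
  unfold centSum
  rw [Finset.sum_range_add, Nat.add_sub_cancel_left, add_assoc, ← Finset.sum_add_distrib]
  congr 1
  refine Finset.sum_congr rfl fun i _ => ?_
  have hpw : ∀ z, mixGain ℓ f π ρ (t + i) (seqSplice t S S') z =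
      predGain ℓ f ρ g z + gainDiff ℓ f π t S g i S' z := by
    intro z; simp only [mixGain, predGain, gainDiff]; ring
  have hi1 : Integrable (predGain ℓ f ρ g) P :=
    integrable_of_abs_le (h.measurable_predGain ρ hg) (h.abs_predGain_le ρ hgD)
  have hi2 : Integrable (gainDiff ℓ f π t S g i S') P :=
    integrable_of_abs_le ((h.predictable_gainDiff t S hg hgD).meas_section i S')
      ((h.predictable_gainDiff t S hg hgD).bdd i S')
  simp_rw [hpw]
  rw [integral_add hi1 hi2, seqSplice_add]
  ring

theorem quadVar_gainDiff_le (h : Experts D ℓ f) (t : ℕ) (S S' : ℕ → Z) {g : Z → ℝ}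
    (hg : Measurable g) (hgD : ∀ z, g z ∈ D) {k n : ℕ} (hk : t + k ≤ n) :
    quadVar P (gainDiff ℓ f π t S g) k S' ≤
      ∑ s ∈ Finset.range n, sqDist P (mixMean ℓ f π s (seqSplice t S S')) g := by
  have h1 : quadVar P (gainDiff ℓ f π t S g) k S' ≤
      ∑ i ∈ Finset.range k, sqDist P (mixMean ℓ f π (t + i) (seqSplice t S S')) g := by
    refine Finset.sum_le_sum fun i _ => ?_
    refine (centVar_le_integral_sq ((h.predictable_gainDiff (π := π) t S hg hgD).meas_section i S')
      ((h.predictable_gainDiff t S hg hgD).bdd i S')).trans ?_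
    rw [sqDist_comm]
    exact h.integral_loss_sub_sq_le hg hgD (h.measurable_mixMean_section _ _) (h.mixMean_mem _ _)
  refine h1.trans ?_
  have h2 := Finset.sum_range_add (fun s => sqDist P (mixMean ℓ f π s (seqSplice t S S')) g) t k
  have h3 : ∑ s ∈ Finset.range (t + k), sqDist P (mixMean ℓ f π s (seqSplice t S S')) g ≤
      ∑ s ∈ Finset.range n, sqDist P (mixMean ℓ f π s (seqSplice t S S')) g :=
    Finset.sum_le_sum_of_subset_of_nonneg (Finset.range_subset_range.2 hk)
      fun s _ _ => sqDist_nonneg _ _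
  have h4 : 0 ≤ ∑ s ∈ Finset.range t, sqDist P (mixMean ℓ f π s (seqSplice t S S')) g :=
    Finset.sum_nonneg fun s _ => sqDist_nonneg _ _
  linarith

end Experts

/-! ### The regret tail of a single run -/

/-- If the walk `M` has facets at least `s`, and is `N` up to an error at most `b`, then
the facets of `N` are not much below. -/
theorem facet_sub_le {m t₁ t₂ : ℕ} {M N : ℕ → ℝ} {b : ℝ} (hb : 0 ≤ b) (h1 : m + 1 ≤ 2 * t₁)
    (h2 : 4 * (m + 1) ≤ 5 * t₂) (hm : M m ≤ N m + b) (hM1 : M t₁ ≤ N t₁ + b)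
    (hM2 : M t₂ ≤ N t₂ + b) : facet m M t₁ t₂ ≤ facet m N t₁ t₂ + 2 * b := by
  have t1p : (0 : ℝ) < t₁ := by exact_mod_cast (by omega : 0 < t₁)
  have t2p : (0 : ℝ) < t₂ := by exact_mod_cast (by omega : 0 < t₂)
  have ha1 : (m + 1 : ℝ) / t₁ ≤ 2 := by
    rw [div_le_iff₀ t1p]; exact_mod_cast h1
  have ha2 : (m + 1 : ℝ) / t₂ ≤ 5 / 4 := by
    rw [div_le_iff₀ t2p]
    have : (4 : ℝ) * (m + 1) ≤ 5 * t₂ := by exact_mod_cast h2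
    linarith
  have ha1p : 0 ≤ (m + 1 : ℝ) / t₁ := by positivity
  have ha2p : 0 ≤ (m + 1 : ℝ) / t₂ := by positivity
  unfold facet
  have k1 : (m + 1 : ℝ) / t₁ * M t₁ ≤ (m + 1) / t₁ * N t₁ + 2 * b := by
    have := mul_le_mul_of_nonneg_left hM1 ha1p
    have := mul_le_mul_of_nonneg_right ha1 hb
    linarith
  have k2 : (m + 1 : ℝ) / t₂ * M t₂ ≤ (m + 1) / t₂ * N t₂ + 5 / 4 * b := by
    have := mul_le_mul_of_nonneg_left hM2 ha2p
    have := mul_le_mul_of_nonneg_right ha2 hb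
    linarith
  linarith

namespace Experts

variable {Z ι : Type*} [MeasurableSpace Z] [MeasurableSpace ι] [Countable ι]
  [DiscreteMeasurableSpace ι] {D : Set ℝ} {ℓ : Z → ℝ → ℝ} {f : ι → Z → ℝ}
  {π : Measure ι} [IsProbabilityMeasure π] {P : Measure Z} [IsProbabilityMeasure P]

/-- The scale of a path on which the regret is large: the noise at the end is at most of order `θ ^ 9`,
while the variance of the gain of the final predictor, summed over the `m + 1` rounds, is of order
`θ ^ 16`, and the posterior means are spread around the final predictor by at most the noise. -/
structure AtScale (P : Measure Z) (ℓ : Z → ℝ → ℝ) (f : ι → Z → ℝ) (π ρ : Measure ι) (m : ℕ)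
    (θ : ℝ) (S : ℕ → Z) : Prop where
  lower : θ ^ 16 ≤ (m + 1) * centVar P (predGain ℓ f ρ (mixAvg ℓ f π (m + 1) S))
  upper : (m + 1) * centVar P (predGain ℓ f ρ (mixAvg ℓ f π (m + 1) S)) ≤ 2 ^ 16 * θ ^ 16
  noise : centSum P (mixGain ℓ f π ρ) m S ≤ 2 ^ 19 * θ ^ 9
  spread : ∑ t ∈ Finset.range (m + 1), sqDist P (mixMean ℓ f π t S) (mixAvg ℓ f π (m + 1) S) ≤
    2 * centSum P (mixGain ℓ f π ρ) m S

/-- A path with large noise lives at some scale `2 ^ j`. -/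
theorem exists_atScale (h : Experts D ℓ f) (ρ : Measure ι) [IsProbabilityMeasure ρ] {m : ℕ}
    {S : ℕ → Z} {c θ₀ : ℝ} (hc : 0 ≤ c) (h2 : 2 ≤ θ₀) (hcθ : c ≤ θ₀)
    (hgood : FreedmanGood P (mixGain ℓ f π ρ) c m S)
    (hspread : ∑ t ∈ Finset.range (m + 1),
      sqDist P (mixMean ℓ f π t S) (mixAvg ℓ f π (m + 1) S) ≤
        2 * centSum P (mixGain ℓ f π ρ) m S)
    (hbig : (2 * θ₀) ^ 16 + 32 * (c + 3) ≤ 2 * centSum P (mixGain ℓ f π ρ) m S) :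
    ∃ j : ℕ, 1 ≤ j ∧ θ₀ ≤ 2 ^ j ∧ AtScale P ℓ f π ρ m (2 ^ j) S := by
  have hg := h.measurable_mixAvg_section (π := π) (m + 1) S
  have hgD := h.mixAvg_mem (π := π) (Nat.succ_pos m) S
  have hV0 : 0 ≤ centVar P (predGain ℓ f ρ (mixAvg ℓ f π (m + 1) S)) := centVar_nonneg _
  obtain ⟨j, hj, hθ, h3, h4, h5⟩ := exists_scale hc h2 hcθ
    (A := centSum P (mixGain ℓ f π ρ) m S)
    (q := (m + 1) * centVar P (predGain ℓ f ρ (mixAvg ℓ f π (m + 1) S))) (fun k hk => by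
      have h6 := hgood k hk m le_rfl
      have h7 := h.quadVar_mixGain_le (P := P) (π := π) ρ m S hg hgD
      rw [Finset.sum_range_succ] at hspread
      have h8 := sqDist_nonneg (P := P) (mixMean ℓ f π m S) (mixAvg ℓ f π (m + 1) S)
      have h9 : quadVar P (mixGain ℓ f π ρ) m S ≤
          2 * ((m + 1) * centVar P (predGain ℓ f ρ (mixAvg ℓ f π (m + 1) S))) +
          4 * centSum P (mixGain ℓ f π ρ) m S := by linarith
      refine h6.trans ?_
      gcongr) hbig
  exact ⟨j, hj, hθ, h3, h4, h5, hspread⟩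

/-- The variance of the gain of the average predictor at time `t` in terms of the final one. -/
theorem centVar_mixAvg_bounds (h : Experts D ℓ f) (ρ : Measure ι) [IsProbabilityMeasure ρ] {m t : ℕ}
    {S : ℕ → Z} {θ : ℝ} (hs : AtScale P ℓ f π ρ m θ S) (ht : 1 ≤ t) (htm : t ≤ m) :
    (m + 1) * sqDist P (mixAvg ℓ f π t S) (mixAvg ℓ f π (m + 1) S) ≤
      2 * (centSum P (mixGain ℓ f π ρ) m S * ((m + 1) / t)) ∧
    ((m + 1) * centVar P (predGain ℓ f ρ (mixAvg ℓ f π (m + 1) S))) / 2 -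
      2 * (centSum P (mixGain ℓ f π ρ) m S * ((m + 1) / t)) ≤
        (m + 1) * centVar P (predGain ℓ f ρ (mixAvg ℓ f π t S)) ∧
    (m + 1) * centVar P (predGain ℓ f ρ (mixAvg ℓ f π t S)) ≤
      2 * ((m + 1) * centVar P (predGain ℓ f ρ (mixAvg ℓ f π (m + 1) S))) +
      4 * (centSum P (mixGain ℓ f π ρ) m S * ((m + 1) / t)) := by
  have hg := h.measurable_mixAvg_section (π := π) (m + 1) S
  have hgD := h.mixAvg_mem (π := π) (Nat.succ_pos m) S
  have hg' := h.measurable_mixAvg_section (π := π) t S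
  have hgD' := h.mixAvg_mem (π := π) ht S
  have ht0 : (0 : ℝ) < t := by exact_mod_cast ht
  have hm0 : (0 : ℝ) < m + 1 := by positivity
  have h1 := h.sqDist_mixAvg_le (P := P) (π := π) ht S hg hgD
  have h2 : ∑ s ∈ Finset.range t, sqDist P (mixMean ℓ f π s S) (mixAvg ℓ f π (m + 1) S) ≤
      ∑ s ∈ Finset.range (m + 1), sqDist P (mixMean ℓ f π s S) (mixAvg ℓ f π (m + 1) S) :=
    Finset.sum_le_sum_of_subset_of_nonneg (Finset.range_subset_range.2 (by omega))
      fun s _ _ => sqDist_nonneg _ _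
  have h3 : t * sqDist P (mixAvg ℓ f π t S) (mixAvg ℓ f π (m + 1) S) ≤
      2 * centSum P (mixGain ℓ f π ρ) m S := h1.trans (h2.trans hs.spread)
  have h4 : (m + 1) * sqDist P (mixAvg ℓ f π t S) (mixAvg ℓ f π (m + 1) S) ≤
      2 * (centSum P (mixGain ℓ f π ρ) m S * ((m + 1) / t)) := by
    have : 2 * (centSum P (mixGain ℓ f π ρ) m S * (((m : ℝ) + 1) / t)) =
        (m + 1) * (2 * centSum P (mixGain ℓ f π ρ) m S / t) := by ring
    rw [this]
    refine mul_le_mul_of_nonneg_left ?_ hm0.le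
    rw [le_div_iff₀ ht0]; linarith
  have h5 := h.centVar_predGain_le (P := P) ρ hg' hgD' hg hgD
  have h6 := h.centVar_predGain_le (P := P) ρ hg hgD hg' hgD'
  rw [sqDist_comm] at h6
  have h7 := mul_le_mul_of_nonneg_left h5 hm0.le
  have h8 := mul_le_mul_of_nonneg_left h6 hm0.le
  refine ⟨h4, ?_, ?_⟩ <;> linarith

/-- The times at which the variance of the gain of the average predictor allows one to read off the
final scale: after such a time the average predictor hardly changes any more, and before it hardly
any noise has been collected. -/
def scaleTime (P : Measure Z) (ℓ : Z → ℝ → ℝ) (f : ι → Z → ℝ) (π ρ : Measure ι) (m : ℕ) (ε σ : ℝ)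
    (t : ℕ) : Set (ℕ → Z) :=
  {S | 1 ≤ t ∧ m + 1 ≤ t ^ 2 ∧ (t : ℝ) ≤ ε * (m + 1) ∧
    σ ≤ (m + 1) * centVar P (predGain ℓ f ρ (mixAvg ℓ f π t S)) ∧
    ((m + 1) / t : ℝ) ^ 4 ≤ (m + 1) * centVar P (predGain ℓ f ρ (mixAvg ℓ f π t S)) ∧
    (m + 1) * centVar P (predGain ℓ f ρ (mixAvg ℓ f π t S)) ≤ 2 ^ 26 * ((m + 1) / t : ℝ) ^ 4}

/-- A path that lives at a scale has a time at which the scale can be read off. -/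
theorem exists_scaleTime (h : Experts D ℓ f) (ρ : Measure ι) [IsProbabilityMeasure ρ] {m : ℕ}
    {S : ℕ → Z} {θ ε σ : ℝ} (hs : AtScale P ℓ f π ρ m θ S) (hθ : 2 ^ 30 ≤ θ)
    (hε : 0 < ε) (hθε : 3 / ε ≤ θ) (hσ : 4 * |σ| ≤ θ) :
    ∃ t ≤ m, S ∈ scaleTime P ℓ f π ρ m ε σ t := by
  have hg := h.measurable_mixAvg_section (π := π) (m + 1) S
  have hgD := h.mixAvg_mem (π := π) (Nat.succ_pos m) S
  have hm0 : (0 : ℝ) < m + 1 := by positivity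
  have hθ0 : 0 < θ := lt_of_lt_of_le (by norm_num) hθ
  have hθ1 : 1 ≤ θ := le_trans (by norm_num) hθ
  have hn : θ ^ 16 ≤ m + 1 := by
    have := h.centVar_predGain_le_one (P := P) ρ hg hgD
    have := mul_le_mul_of_nonneg_left this hm0.le
    linarith [hs.lower]
  obtain ⟨t, ht1, hw1, hw2, hQ⟩ := exists_time hθ hn hs.lower hs.upper hs.noise
  have ht0 : (0 : ℝ) < t := by exact_mod_cast ht1
  have hθ4 : (4 : ℝ) ≤ θ ^ 4 / 3 := by
    have : θ ≤ θ ^ 4 := le_self_pow₀ hθ1 (by norm_num)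
    norm_num at hθ; linarith
  have htm : t ≤ m := by
    have h1 : (4 : ℝ) ≤ (m + 1) / t := hθ4.trans hw1
    rw [le_div_iff₀ ht0] at h1
    have h2 : 4 * t ≤ m + 1 := by exact_mod_cast h1
    omega
  obtain ⟨-, hb1, hb2⟩ := h.centVar_mixAvg_bounds ρ hs ht1 htm
  obtain ⟨k1, k2, k3⟩ := hQ _ hb1 hb2
  refine ⟨t, htm, ht1, ?_, ?_, ?_, k1, k2⟩
  · have e1 : ((m + 1 : ℝ) / t) ^ 2 ≤ m + 1 := by
      calc ((m + 1 : ℝ) / t) ^ 2 ≤ (θ ^ 4 / 2) ^ 2 := pow_le_pow_left₀ (by positivity) hw2 2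
        _ = θ ^ 8 / 4 := by ring
        _ ≤ θ ^ 8 := by linarith [pow_pos hθ0 8]
        _ ≤ θ ^ 16 := pow_le_pow_right₀ hθ1 (by norm_num)
        _ ≤ m + 1 := hn
    rw [div_pow, div_le_iff₀ (by positivity), sq (m + 1 : ℝ)] at e1
    have e2 := le_of_mul_le_mul_left e1 hm0
    exact_mod_cast e2
  · have h1 : 1 / ε ≤ (m + 1) / t := by
      refine le_trans ?_ hw1
      have : θ ≤ θ ^ 4 := le_self_pow₀ hθ1 (by norm_num)
      have e : 1 / ε = 3 / ε / 3 := by ring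
      rw [e]; gcongr; linarith
    rw [div_le_div_iff₀ hε ht0] at h1
    linarith
  · refine le_trans ?_ k3
    have : θ ≤ θ ^ 16 := le_self_pow₀ hθ1 (by norm_num)
    linarith [le_abs_self σ]

/-- At a scale time, the facets of the walk after that time are not much smaller than those of the
whole walk. -/
theorem facetsGe_of_scaleTime (h : Experts D ℓ f) (ρ : Measure ι) [IsProbabilityMeasure ρ]
    {m t j : ℕ} {S S' : ℕ → Z} {ε σ η c : ℝ} (hε : ε ≤ 1 / 4) (hη : 0 < η)
    (htm : t ≤ m) (hW : S ∈ scaleTime P ℓ f π ρ m ε σ t) (hj : 1 ≤ j)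
    (hs : AtScale P ℓ f π ρ m (2 ^ j) (seqSplice t S S'))
    (hθ : 2 ^ 30 ≤ (2 : ℝ) ^ j) (hcθ : c ≤ 2 ^ j) (hηθ : 2 ^ 31 / η ≤ 2 ^ j)
    (hgood : FreedmanGood P (mixGain ℓ f π ρ) c m (seqSplice t S S'))
    (hgood' : FreedmanGood P (gainDiff ℓ f π t S (mixAvg ℓ f π t S)) c (m - t) S')
    (hfacet : ∀ t₁ t₂, m + 1 ≤ 2 * t₁ → t₁ ≤ m → 4 * (m + 1) ≤ 5 * t₂ → t₂ ≤ m →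
      0 ≤ facet m (fun k => centSum P (mixGain ℓ f π ρ) k (seqSplice t S S')) t₁ t₂) :
    FacetsGe m (fun t' => ∑ s ∈ Finset.range (t' - t),
        (predGain ℓ f ρ (mixAvg ℓ f π t S) (S' s) -
          ∫ z, predGain ℓ f ρ (mixAvg ℓ f π t S) z ∂P))
      (η * √((m + 1) * centVar P (predGain ℓ f ρ (mixAvg ℓ f π t S)))) := by
  obtain ⟨ht1, -, htε, -, hW1, hW2⟩ := hW
  have hg := h.measurable_mixAvg_section (π := π) t S
  have hgD := h.mixAvg_mem (π := π) ht1 S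
  have hcongr : mixAvg ℓ f π t (seqSplice t S S') = mixAvg ℓ f π t S :=
    mixAvg_congr t fun i hi => seqSplice_of_lt hi S S'
  obtain ⟨hδ, hb1, hb2⟩ := h.centVar_mixAvg_bounds ρ hs ht1 htm
  have hF := h.measurable_mixAvg_section (π := π) (m + 1) (seqSplice t S S')
  have hFD := h.mixAvg_mem (π := π) (Nat.succ_pos m) (seqSplice t S S')
  rw [hcongr] at hδ hb1 hb2
  set S₂ := seqSplice t S S' with hS₂
  set g := mixAvg ℓ f π t S with hgdef
  set F := mixAvg ℓ f π (m + 1) S₂ with hFdef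
  set A := centSum P (mixGain ℓ f π ρ) m S₂ with hAdef
  set Q := (m + 1) * centVar P (predGain ℓ f ρ g) with hQdef
  set V := centVar P (predGain ℓ f ρ F) with hVdef
  set θ : ℝ := 2 ^ j with hθdef
  have hθ0 : 0 < θ := by positivity
  have hθ1 : 1 ≤ θ := le_trans (by norm_num) hθ
  have hm0 : (0 : ℝ) < m + 1 := by positivity
  have ht0 : (0 : ℝ) < t := by exact_mod_cast ht1
  obtain ⟨hw1, hw2, hQ⟩ := time_scale hθ hs.lower hs.upper hs.noise (by positivity)
    hb1 hb2 hW1 hW2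
  have hq : (m + 1) * V ≤ 2 ^ 16 * θ ^ 16 := hs.upper
  have hA : A ≤ 2 ^ 19 * θ ^ 9 := hs.noise
  have hspread : ∑ s ∈ Finset.range (m + 1), sqDist P (mixMean ℓ f π s S₂) F ≤ 2 * A := hs.spread
  have hV0 : 0 ≤ V := centVar_nonneg _
  have e6 : (2 : ℝ) ^ (6 * j) = θ ^ 6 := by rw [hθdef, ← pow_mul, mul_comm]
  have hjθ : (j : ℝ) ≤ θ := by rw [hθdef]; exact_mod_cast (Nat.lt_two_pow_self).le
  have hlog : (c + ((6 * j : ℕ) : ℝ)) * θ ^ 6 ≤ 7 * θ ^ 7 := by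
    push_cast
    have : c + 6 * j ≤ 7 * θ := by linarith
    calc (c + 6 * j) * θ ^ 6 ≤ (7 * θ) * θ ^ 6 := by gcongr
      _ = 7 * θ ^ 7 := by ring
  -- the noise collected before the scale time is negligible
  have hMt : centSum P (mixGain ℓ f π ρ) t S₂ ≤ 8 * θ ^ 7 := by
    have h1 := hgood (6 * j) (by omega) t htm
    rw [e6] at h1
    have h2 := h.quadVar_mixGain_le (P := P) (π := π) ρ t S₂ hF hFD
    have h3 : ∑ s ∈ Finset.range t, sqDist P (mixMean ℓ f π s S₂) F ≤
        ∑ s ∈ Finset.range (m + 1), sqDist P (mixMean ℓ f π s S₂) F :=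
      Finset.sum_le_sum_of_subset_of_nonneg (Finset.range_subset_range.2 (by omega))
        fun s _ _ => sqDist_nonneg _ _
    have h4 : t * V ≤ 2 ^ 23 * θ ^ 12 := by
      have h5 : t * θ ^ 4 ≤ 2 ^ 7 * (m + 1) := by
        rw [← mul_div_assoc, le_div_iff₀ ht0] at hw2; linarith
      have h6 : t * V * θ ^ 4 ≤ 2 ^ 23 * θ ^ 12 * θ ^ 4 := by
        calc t * V * θ ^ 4 = t * θ ^ 4 * V := by ring
          _ ≤ 2 ^ 7 * (m + 1) * V := by gcongr
          _ = 2 ^ 7 * ((m + 1) * V) := by ring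
          _ ≤ 2 ^ 7 * (2 ^ 16 * θ ^ 16) := by gcongr
          _ = 2 ^ 23 * θ ^ 12 * θ ^ 4 := by ring
      exact le_of_mul_le_mul_right h6 (by positivity)
    have h7 : A ≤ 2 ^ 19 * θ ^ 12 :=
      hA.trans (mul_le_mul_of_nonneg_left (pow_le_pow_right₀ hθ1 (by norm_num)) (by norm_num))
    have h8 : quadVar P (mixGain ℓ f π ρ) t S₂ / θ ^ 6 ≤ θ ^ 7 := by
      rw [div_le_iff₀ (by positivity)]
      have h9 : (2 : ℝ) ^ 30 * θ ^ 12 ≤ θ * θ ^ 12 := by gcongr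
      have h10 : 0 < θ ^ 12 := by positivity
      have e : θ ^ 7 * θ ^ 6 = θ * θ ^ 12 := by ring
      rw [e]
      norm_num at *
      linarith
    linarith
  -- so is the difference between the gains of the later predictors and that of the average
  have hdif : ∀ k ≤ m - t, centSum P (gainDiff ℓ f π t S g) k S' ≤ 2 ^ 28 * θ ^ 7 := by
    intro k hk
    have h1 := hgood' (6 * j) (by omega) k hk
    rw [e6] at h1
    have h2 := h.quadVar_gainDiff_le (P := P) (π := π) t S S' hg hgD (k := k) (n := m + 1) (by omega)
    have h3 : ∑ s ∈ Finset.range (m + 1), sqDist P (mixMean ℓ f π s S₂) g ≤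
        2 * ∑ s ∈ Finset.range (m + 1), sqDist P (mixMean ℓ f π s S₂) F +
          2 * ((m + 1) * sqDist P g F) := by
      refine (Finset.sum_le_sum fun s _ => h.sqDist_le_two_mul (h.measurable_mixMean_section s S₂)
        (h.mixMean_mem s S₂) hF hFD hg hgD).trans ?_
      rw [Finset.sum_add_distrib, Finset.sum_const, Finset.card_range, nsmul_eq_mul, Finset.mul_sum,
        sqDist_comm F g]
      push_cast
      linarith
    have h4 : A * ((m + 1) / t) ≤ 2 ^ 24 * θ ^ 13 := by
      calc A * ((m + 1) / t) ≤ (2 ^ 19 * θ ^ 9) * (32 * θ ^ 4) := by gcongr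
        _ = 2 ^ 24 * θ ^ 13 := by ring
    have h5 : A ≤ 2 ^ 19 * θ ^ 13 :=
      hA.trans (mul_le_mul_of_nonneg_left (pow_le_pow_right₀ hθ1 (by norm_num)) (by norm_num))
    have h6 : quadVar P (gainDiff ℓ f π t S g) k S' / θ ^ 6 ≤ 2 ^ 27 * θ ^ 7 := by
      rw [div_le_iff₀ (by positivity)]
      have e : 2 ^ 27 * θ ^ 7 * θ ^ 6 = 2 ^ 27 * θ ^ 13 := by ring
      have h10 : 0 < θ ^ 13 := by positivity
      rw [e]
      norm_num at *
      linarith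
    have h7 : 0 < θ ^ 7 := by positivity
    norm_num at *
    linarith
  intro t₁ t₂ h1 h1' h2 h2'
  have htm4 : 4 * t ≤ m + 1 := by
    have h3 : (t : ℝ) ≤ 1 / 4 * (m + 1) := htε.trans (by gcongr)
    have h4 : (4 * t : ℝ) ≤ m + 1 := by linarith
    exact_mod_cast h4
  have hsplit : ∀ t', t ≤ t' → t' ≤ m → centSum P (mixGain ℓ f π ρ) t' S₂ ≤
      ∑ s ∈ Finset.range (t' - t), (predGain ℓ f ρ g (S' s) - ∫ z, predGain ℓ f ρ g z ∂P) +
        2 ^ 29 * θ ^ 7 := by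
    intro t' h3 h4
    rw [hS₂, h.centSum_mixGain_splice ρ t S S' hg hgD h3]
    have h5 := hdif (t' - t) (by omega)
    have h7 : 0 < θ ^ 7 := by positivity
    rw [← hS₂]
    norm_num at *
    linarith
  have hkey := facet_sub_le (m := m) (t₁ := t₁) (t₂ := t₂)
    (M := fun k => centSum P (mixGain ℓ f π ρ) k S₂)
    (N := fun t' => ∑ s ∈ Finset.range (t' - t),
      (predGain ℓ f ρ g (S' s) - ∫ z, predGain ℓ f ρ g z ∂P))
    (b := 2 ^ 29 * θ ^ 7) (by positivity) h1 h2 (hsplit m htm le_rfl)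
    (hsplit t₁ (by omega) h1') (hsplit t₂ (by omega) h2')
  have h0 := hfacet t₁ t₂ h1 h1' h2 h2'
  have hsq : θ ^ 8 / 2 ≤ √Q := by
    apply Real.le_sqrt_of_sq_le
    have : (θ ^ 8 / 2) ^ 2 = θ ^ 16 / 4 := by ring
    rw [this]; exact hQ
  have hlast : 2 * (2 ^ 29 * θ ^ 7) ≤ η * √Q := by
    rw [div_le_iff₀ hη] at hηθ
    calc 2 * (2 ^ 29 * θ ^ 7) = 2 ^ 31 * θ ^ 7 / 2 := by ring
      _ ≤ θ * η * θ ^ 7 / 2 := by gcongr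
      _ = η * (θ ^ 8 / 2) := by ring
      _ ≤ η * √Q := by gcongr
  linarith

/-- The regret bound for a single run of the progressive mixture: with probability at least `1 - 1 / e`,
the regret over any fixed mixing distribution `ρ` is at most `e` times its divergence from the prior,
up to a universal constant. The regret may be negative, so this is not Markov's inequality. -/
theorem exists_regret_tail : ∃ s₀ : ℝ, 0 ≤ s₀ ∧ ∀ {Z : Type u} {ι : Type w} [MeasurableSpace Z]
    [MeasurableSpace ι] [Countable ι] [DiscreteMeasurableSpace ι] {D : Set ℝ} {ℓ : Z → ℝ → ℝ}
    {f : ι → Z → ℝ} (π : Measure ι) [IsProbabilityMeasure π] (P : Measure Z)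
    [IsProbabilityMeasure P] (_ : Experts D ℓ f) (ρ : Measure ι) [IsProbabilityMeasure ρ]
    (_ : InformationTheory.klDiv ρ π ≠ ⊤) (m : ℕ),
    seqLaw P {S | Real.exp 1 * (InformationTheory.klDiv ρ π).toReal + s₀ <
      (m + 1) * (risk P ℓ (mixAvg ℓ f π (m + 1) S) - ∫ z, meanLoss ℓ f ρ z ∂P)} ≤
      ENNReal.ofReal (Real.exp (-1)) := by
  obtain ⟨p, hp0, hp1, ε', hε', η, hη, σ, hfresh⟩ := exists_facetsGe_le
  set ε := min ε' (1 / 4) with hε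
  have hε0 : 0 < ε := by positivity
  -- the room left below `1 / e` is used up by the failure of the martingale inequalities
  set gap := Real.exp (-1) - p with hgap
  have hgap0 : 0 < gap := by rw [hgap]; linarith
  have hgap1 : gap < 1 := by
    have : Real.exp (-1) < 1 := by rw [Real.exp_lt_one_iff]; norm_num
    rw [hgap]; linarith
  set cV := 4 / gap with hcV
  have hcV1 : 1 ≤ cV := by rw [hcV, le_div_iff₀ hgap0]; linarith
  set c := Real.log cV with hc
  have hc0 : 0 ≤ c := Real.log_nonneg hcV1
  have hexpc : Real.exp (-c) = gap / 4 := by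
    rw [hc, Real.exp_neg, Real.exp_log (by linarith), hcV, inv_div]
  set θ₀ : ℝ := 2 ^ 30 + c + 3 / ε + 4 * |σ| + 2 ^ 31 / η with hθ₀
  have hp3 : 0 ≤ 3 / ε := by positivity
  have hp4 : 0 ≤ 4 * |σ| := by positivity
  have hp5 : 0 ≤ 2 ^ 31 / η := by positivity
  have hp6 : (0 : ℝ) ≤ 2 ^ 30 := by positivity
  have hθ2 : (2 : ℝ) ^ 30 ≤ θ₀ := by rw [hθ₀]; linarith
  have hθc : c ≤ θ₀ := by rw [hθ₀]; linarith
  have hθε : 3 / ε ≤ θ₀ := by rw [hθ₀]; linarith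
  have hθσ : 4 * |σ| ≤ θ₀ := by rw [hθ₀]; linarith
  have hθη : 2 ^ 31 / η ≤ θ₀ := by rw [hθ₀]; linarith
  have h2θ : 2 ≤ θ₀ := le_trans (by norm_num) hθ2
  clear_value θ₀
  obtain ⟨s₀, hs₀⟩ : ∃ s₀ : ℝ, s₀ = (2 * θ₀) ^ 16 + 32 * (c + 3) + c + 1 := ⟨_, rfl⟩
  have hθpos : 0 ≤ (2 * θ₀) ^ 16 := by positivity
  refine ⟨s₀, by linarith, ?_⟩
  intro Z ι _ _ _ _ D ℓ f π _ P _ h ρ _ hρ m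
  set lam := (InformationTheory.klDiv ρ π).toReal with hlam
  have hlam0 : 0 ≤ lam := ENNReal.toReal_nonneg
  -- the paths on which one of the martingale inequalities fails
  set U : Set (ℕ → Z) := {S | ∃ t ≤ m, ENNReal.ofReal cV ≤ mixMart P ℓ f π t S} ∪
    {S | ¬ FreedmanGood P (mixGain ℓ f π ρ) c m S} with hU
  have hUp : seqLaw P U ≤ ENNReal.ofReal (gap / 4) + ENNReal.ofReal (gap / 4) := by
    refine (measure_union_le _ _).trans (add_le_add ?_ ?_)
    · refine (h.ville_mixMart (π := π) (P := P) (by linarith : 0 < cV) m).trans ?_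
      rw [hcV, inv_div]
    · rw [← hexpc]
      exact (h.predictable_mixGain ρ).not_freedmanGood_le c m
  set R : Set (ℕ → Z) := {S | Real.exp 1 * lam + s₀ <
      (m + 1) * (risk P ℓ (mixAvg ℓ f π (m + 1) S) - ∫ z, meanLoss ℓ f ρ z ∂P)} with hR
  have hRm : MeasurableSet R := by
    have h1 : Measurable fun S => risk P ℓ (mixAvg ℓ f π (m + 1) S) := by
      have : Measurable fun p : (ℕ → Z) × Z => ℓ p.2 (mixAvg ℓ f π (m + 1) p.1 p.2) :=
        h.loss.meas.comp (measurable_snd.prodMk (h.measurable_mixAvg (m + 1)))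
      exact (this.stronglyMeasurable.integral_prod_right (ν := P)).measurable
    exact measurableSet_lt measurable_const ((h1.sub_const _).const_mul _)
  set B := R \ toMeasurable (seqLaw P) U with hB
  have hBm : MeasurableSet B := hRm.diff (measurableSet_toMeasurable _ _)
  -- what is known about a path in `B`
  have hBfacts : ∀ S ∈ B, FreedmanGood P (mixGain ℓ f π ρ) c m S ∧
      (∀ t₁ t₂, m + 1 ≤ 2 * t₁ → t₁ ≤ m → 4 * (m + 1) ≤ 5 * t₂ → t₂ ≤ m →
        0 ≤ facet m (fun k => centSum P (mixGain ℓ f π ρ) k S) t₁ t₂) ∧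
      ∃ j : ℕ, 1 ≤ j ∧ θ₀ ≤ 2 ^ j ∧ AtScale P ℓ f π ρ m (2 ^ j) S := by
    intro S hS
    have hSU : S ∉ U := fun hh => hS.2 (subset_toMeasurable _ _ hh)
    rw [hU, Set.mem_union, not_or] at hSU
    have hgood : FreedmanGood P (mixGain ℓ f π ρ) c m S := not_not.1 hSU.2
    have hmart : ∀ t ≤ m, mixMart P ℓ f π t S < ENNReal.ofReal cV := fun t ht =>
      not_le.1 fun hh => hSU.1 ⟨t, ht, hh⟩
    have hSR : Real.exp 1 * lam + s₀ <
      (m + 1) * (risk P ℓ (mixAvg ℓ f π (m + 1) S) - ∫ z, meanLoss ℓ f ρ z ∂P) := hS.1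
    obtain ⟨hreg1, hreg2⟩ := h.regret_le ρ hρ hcV1 m S hmart
    have he : 2 * lam ≤ Real.exp 1 * lam :=
      mul_le_mul_of_nonneg_right (by linarith [Real.add_one_le_exp 1]) hlam0
    have hD0 : 0 ≤ ∑ t ∈ Finset.range (m + 1),
        sqDist P (mixMean ℓ f π t S) (mixAvg ℓ f π (m + 1) S) :=
      Finset.sum_nonneg fun _ _ => sqDist_nonneg _ _
    refine ⟨hgood, ?_, ?_⟩
    · intro t₁ t₂ h1 h1' h2 h2'
      have := hreg2 t₁ t₂ h1 h1' h2 h2'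
      unfold facet
      linarith
    · refine h.exists_atScale ρ hc0 ?_ ?_ hgood ?_ ?_
      · exact h2θ
      · exact hθc
      · linarith
      · linarith
  have hθle : ∀ {θ : ℝ}, θ₀ ≤ θ → 2 ^ 30 ≤ θ ∧ c ≤ θ ∧ 3 / ε ≤ θ ∧ 4 * |σ| ≤ θ ∧ 2 ^ 31 / η ≤ θ := by
    intro θ hθ
    exact ⟨hθ2.trans hθ, hθc.trans hθ, hθε.trans hθ, hθσ.trans hθ, hθη.trans hθ⟩
  -- restart at the scale time: given the past, the noise is that of the average predictor at this
  -- time, up to a small error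
  have hBp : seqLaw P B ≤ ENNReal.ofReal p + ENNReal.ofReal (gap / 4) := by
    refine seqLaw_le_of_stopping P _ m (scaleTime P ℓ f π ρ m ε σ) ?_ B hBm ?_ ?_
    · intro t S S' hSS hS
      have e : mixAvg ℓ f π t S' = mixAvg ℓ f π t S :=
        (mixAvg_congr t hSS).symm
      unfold scaleTime at hS ⊢
      rw [Set.mem_ofPred_eq] at hS ⊢
      rw [e]; exact hS
    · intro S hS
      obtain ⟨hgood, -, j, hj, hθ, hsc⟩ := hBfacts S hS
      obtain ⟨k1, k2, k3, k4, k5⟩ := hθle hθ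
      exact h.exists_scaleTime ρ hsc k1 hε0 k3 k4
    · intro t htm S hW
      have ht1 : 1 ≤ t := hW.1
      have hg := h.measurable_mixAvg_section (π := π) t S
      have hgD := h.mixAvg_mem (π := π) ht1 S
      have hsub : {S' | seqSplice t S S' ∈ B} ⊆
          {S' | FacetsGe m (fun t' => ∑ s ∈ Finset.range (t' - t),
            (predGain ℓ f ρ (mixAvg ℓ f π t S) (S' s) -
              ∫ z, predGain ℓ f ρ (mixAvg ℓ f π t S) z ∂P))
            (η * √((m + 1) * centVar P (predGain ℓ f ρ (mixAvg ℓ f π t S))))} ∪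
          {S' | ¬ FreedmanGood P (gainDiff ℓ f π t S (mixAvg ℓ f π t S)) c (m - t) S'} := by
        intro S' hS'
        by_cases hgood' : FreedmanGood P (gainDiff ℓ f π t S (mixAvg ℓ f π t S)) c (m - t) S'
        · left
          obtain ⟨hgood, hfac, j, hj, hθ, hsc⟩ := hBfacts _ hS'
          obtain ⟨k1, k2, k3, k4, k5⟩ := hθle hθ
          exact h.facetsGe_of_scaleTime ρ (min_le_right _ _) hη htm hW hj hsc k1 k2 k5 hgood hgood'
            hfac
        · right; exact hgood'
      refine (measure_mono hsub).trans ((measure_union_le _ _).trans (add_le_add ?_ ?_))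
      · refine seqLaw_facets_le hfresh (h.measurable_predGain ρ hg) (h.abs_predGain_le ρ hgD)
          hW.2.1 ?_ hW.2.2.2.1
        refine hW.2.2.1.trans ?_
        have : ε ≤ ε' := min_le_left _ _
        gcongr
      · rw [← hexpc]
        exact (h.predictable_gainDiff t S hg hgD).not_freedmanGood_le c (m - t)
  have hRsub : R ⊆ B ∪ toMeasurable (seqLaw P) U := by
    intro S hS
    by_cases hh : S ∈ toMeasurable (seqLaw P) U
    · right; exact hh
    · left; exact ⟨hS, hh⟩
  calc seqLaw P R ≤ seqLaw P B + seqLaw P (toMeasurable (seqLaw P) U) :=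
        (measure_mono hRsub).trans (measure_union_le _ _)
    _ ≤ (ENNReal.ofReal p + ENNReal.ofReal (gap / 4)) +
        (ENNReal.ofReal (gap / 4) + ENNReal.ofReal (gap / 4)) := by
        rw [measure_toMeasurable]; exact add_le_add hBp hUp
    _ = ENNReal.ofReal (p + gap / 4 + (gap / 4 + gap / 4)) := by
        rw [ENNReal.ofReal_add (by positivity) (by positivity),
          ENNReal.ofReal_add hp0.le (by positivity),
          ENNReal.ofReal_add (by positivity) (by positivity)]
    _ ≤ ENNReal.ofReal (Real.exp (-1)) := ENNReal.ofReal_le_ofReal (by rw [hgap]; linarith)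

end Experts

/-! ### Normalizing a strongly convex Lipschitz loss -/

/-- A strongly convex Lipschitz function on a convex set of reals has a quadratic minorant at each
point of the set, end points included, with a slope bounded by the Lipschitz constant. -/
theorem StrongConvexOn.exists_tangent {D : Set ℝ} {α : ℝ} {L : NNReal} {φ : ℝ → ℝ} (hα : 0 < α)
    (hφ : StrongConvexOn D α φ) (hL : LipschitzOnWith L φ D) {g : ℝ} (hg : g ∈ D) :
    ∃ q : ℝ, |q| ≤ L ∧ ∀ v ∈ D, φ g + q * (v - g) + α / 2 * (v - g) ^ 2 ≤ φ v := by
  -- the slopes at `g` of the convex function that remains when a parabola is subtracted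
  set s : ℝ → ℝ := fun v => (φ v - φ g) / (v - g) - α / 2 * (v - g) with hs
  have hval : ∀ v, v ≠ g → s v * (v - g) + α / 2 * (v - g) ^ 2 = φ v - φ g := by
    intro v hv
    have : v - g ≠ 0 := sub_ne_zero.2 hv
    simp only [hs]; field_simp; ring
  have hlip : ∀ v ∈ D, |φ v - φ g| ≤ L * |v - g| := fun v hv => by
    simpa [Real.dist_eq] using hL.dist_le_mul v hv g hg
  have hcomb : ∀ v ∈ D, ∀ w ∈ D, ∀ t ∈ Set.Icc (0 : ℝ) 1,
      φ ((1 - t) * v + t * w) ≤ (1 - t) * φ v + t * φ w - (1 - t) * t * (α / 2 * (v - w) ^ 2) := by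
    intro v hv w hw t ht
    have := hφ.2 hv hw (sub_nonneg.2 ht.2) ht.1 (by ring)
    simpa only [smul_eq_mul, Real.norm_eq_abs, sq_abs] using this
  -- moving towards `g` increases the slopes on the left and decreases those on the right, and
  -- close to `g` the parabola is negligible
  have hbound : ∀ v ∈ D, -L * |v - g| ≤ φ v - φ g - α / 2 * (v - g) ^ 2 := by
    intro v hv
    by_contra hc
    push Not at hc
    set e := -L * |v - g| - (φ v - φ g - α / 2 * (v - g) ^ 2) with he
    have he0 : 0 < e := by linarith
    set A := α / 2 * (v - g) ^ 2 with hA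
    have hA0 : 0 ≤ A := by positivity
    set t := e / (e + A + 1) with ht
    have hden : 0 < e + A + 1 := by linarith
    have ht0 : 0 < t := by positivity
    have ht1 : t ≤ 1 := by rw [ht, div_le_one hden]; linarith
    have htA : t * A < e := by
      rw [ht, div_mul_eq_mul_div, div_lt_iff₀ hden]; nlinarith
    have h1 := hcomb g hg v hv t ⟨ht0.le, ht1⟩
    have hmem : (1 - t) * g + t * v ∈ D := hφ.1 hg hv (by linarith) ht0.le (by ring)
    have h2 := (abs_le.1 (hlip _ hmem)).1
    have h3 : |(1 - t) * g + t * v - g| = t * |v - g| := by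
      rw [show (1 - t) * g + t * v - g = t * (v - g) by ring, abs_mul, abs_of_pos ht0]
    have h4 : α / 2 * (g - v) ^ 2 = A := by rw [hA]; ring
    rw [h3] at h2
    rw [h4] at h1
    have h5 : t * (-(L * |v - g|)) ≤ t * (φ v - φ g - (1 - t) * A) := by nlinarith
    have h6 := le_of_mul_le_mul_left h5 ht0
    nlinarith
  have hleft : ∀ v ∈ D, v < g → s v ≤ L := by
    intro v hv hvg
    have h1 := hval v hvg.ne
    have h2 := hbound v hv
    rw [abs_of_neg (by linarith)] at h2
    nlinarith
  have hright : ∀ v ∈ D, g < v → -L ≤ s v := by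
    intro v hv hvg
    have h1 := hval v hvg.ne'
    have h2 := hbound v hv
    rw [abs_of_pos (by linarith)] at h2
    nlinarith
  have hmono : ∀ v ∈ D, ∀ w ∈ D, v < g → g < w → s v ≤ s w := by
    intro v hv w hw h1 h2
    set t := (g - v) / (w - v) with ht
    have hwv : 0 < w - v := by linarith
    have ht0 : 0 ≤ t := div_nonneg (by linarith) hwv.le
    have ht1 : t ≤ 1 := by rw [ht, div_le_one hwv]; linarith
    have htw : t * (w - v) = g - v := by rw [ht]; field_simp
    have h3 := hcomb v hv w hw t ⟨ht0, ht1⟩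
    have h4 : (1 - t) * v + t * w = g := by linarith
    rw [h4] at h3
    have h5 := hval v h1.ne
    have h6 := hval w h2.ne'
    have h7 : (1 - t) * (w - v) = w - g := by linarith
    have h8 : 0 ≤ ((1 - t) * (φ v - φ g) + t * (φ w - φ g) -
        (1 - t) * t * (α / 2 * (v - w) ^ 2)) * (w - v) := mul_nonneg (by linarith) hwv.le
    have h9 : ((1 - t) * (φ v - φ g) + t * (φ w - φ g) -
        (1 - t) * t * (α / 2 * (v - w) ^ 2)) * (w - v) =
        (w - g) * (φ v - φ g) + (g - v) * (φ w - φ g) -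
        (w - g) * (g - v) * (α / 2) * (w - v) := by
      linear_combination (φ v - φ g) * h7 + (φ w - φ g) * htw -
        (α / 2) * (w - v) * ((w - g) * htw + t * (w - v) * h7)
    rw [h9, ← h5, ← h6] at h8
    have h10 : 0 ≤ ((w - g) * (g - v)) * (s w - s v) := by nlinarith
    have := nonneg_of_mul_nonneg_right h10 (mul_pos (by linarith) (by linarith))
    linarith
  set A : Set ℝ := insert (-(L : ℝ)) (s '' {v | v ∈ D ∧ v < g}) with hA
  have hAL : ∀ x ∈ A, x ≤ L := by
    rintro x (rfl | ⟨v, ⟨hv, hvg⟩, rfl⟩)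
    · have := L.coe_nonneg; linarith
    · exact hleft v hv hvg
  have hbdd : BddAbove A := ⟨L, hAL⟩
  have hne : A.Nonempty := ⟨_, Set.mem_insert _ _⟩
  refine ⟨sSup A, abs_le.2 ⟨le_csSup hbdd (Set.mem_insert _ _), csSup_le hne hAL⟩, fun v hv => ?_⟩
  rcases lt_trichotomy v g with h | rfl | h
  · have h1 : s v ≤ sSup A := le_csSup hbdd (Set.mem_insert_of_mem _ ⟨v, ⟨hv, h⟩, rfl⟩)
    have h2 := hval v h.ne
    nlinarith
  · simp
  · have h1 : sSup A ≤ s v := by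
      refine csSup_le hne ?_
      rintro x (rfl | ⟨w, ⟨hw, hwg⟩, rfl⟩)
      · exact hright v hv h
      · exact hmono w hw v hv hwg h
    have h2 := hval v h.ne'
    nlinarith

/-- The loss on the scale on which it is `1`-strongly convex and `1`-Lipschitz in the prediction:
predictions are multiplied by `a`, losses by `η`, and the loss of the predictor `h₀` is
subtracted. -/
noncomputable def scaledLoss {X : Type u} {Y : Type v} (ℓ : Y → ℝ → ℝ) (h₀ : X → ℝ) (a η : ℝ)
    (z : X × Y) (v : ℝ) : ℝ := η * (ℓ z.2 (v / a) - predLoss ℓ h₀ z)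

/-- The predictor `h` on the scale of `scaledLoss`, as a function of the observation. -/
def scaledPred {X : Type u} {Y : Type v} (a : ℝ) : (X → ℝ) →ₗ[ℝ] (X × Y → ℝ) where
  toFun h z := a * h z.1
  map_add' h h' := by ext z; simp [mul_add]
  map_smul' c h := by ext z; simp [mul_left_comm]

/-- On the scale of `scaledLoss`, the loss is the loss difference with `h₀`, multiplied by `η`. -/
theorem scaledLoss_scaledPred {X : Type u} {Y : Type v} {ℓ : Y → ℝ → ℝ} {h₀ : X → ℝ} {a η : ℝ}
    (ha : a ≠ 0) (h : X → ℝ) (z : X × Y) :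
    scaledLoss ℓ h₀ a η z (scaledPred a h z) = η * (predLoss ℓ h z - predLoss ℓ h₀ z) := by
  simp [scaledLoss, scaledPred, predLoss, mul_div_cancel_left₀ _ ha]

section Scaling

variable {X : Type u} {Y : Type v} [MeasurableSpace X] [MeasurableSpace Y] {D : Set ℝ}
  {ℓ : Y → ℝ → ℝ} {h₀ : X → ℝ} {α : ℝ} {L : NNReal}

/-- With `a = α / L` and `η = α / L ^ 2` the scaled loss is normalized. -/
theorem normLoss_scaledLoss (hℓ : Measurable (Function.uncurry ℓ)) (h₀m : Measurable h₀)
    (h₀D : ∀ x, h₀ x ∈ D) (hα : 0 < α) (hL : 0 < L) (hconv : ∀ y, StrongConvexOn D α (ℓ y))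
    (hlip : ∀ y, LipschitzOnWith L (ℓ y) D) (hX : Nonempty (X × Y)) :
    NormLoss ((fun d => α / L * d) '' D)
      (scaledLoss (X := X) ℓ h₀ (α / L) (α / (L : ℝ) ^ 2)) := by
  have hL' : (0 : ℝ) < L := hL
  have ha : 0 < α / (L : ℝ) := by positivity
  have hD : Convex ℝ D := (hconv hX.some.2).1
  have htan : ∀ z : X × Y, ∀ g ∈ (fun d => α / L * d) '' D, ∃ q : ℝ, |q| ≤ 1 ∧
      ∀ v ∈ (fun d => α / L * d) '' D,
        scaledLoss (X := X) ℓ h₀ (α / L) (α / (L : ℝ) ^ 2) z g + q * (v - g) + (v - g) ^ 2 / 2 ≤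
        scaledLoss (X := X) ℓ h₀ (α / L) (α / (L : ℝ) ^ 2) z v := by
    rintro z _ ⟨g, hg, rfl⟩
    obtain ⟨q, hq, hq'⟩ := (hconv z.2).exists_tangent hα (hlip z.2) hg
    refine ⟨q / L, ?_, ?_⟩
    · rw [abs_div, abs_of_pos hL', div_le_one hL']; exact hq
    · rintro _ ⟨v, hv, rfl⟩
      have h1 := mul_le_mul_of_nonneg_left (hq' v hv) (by positivity : 0 ≤ α / (L : ℝ) ^ 2)
      simp only [scaledLoss, mul_div_cancel_left₀ _ ha.ne']
      have h2 : q / L * (α / L * v - α / L * g) + (α / L * v - α / L * g) ^ 2 / 2 =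
          α / (L : ℝ) ^ 2 * (q * (v - g) + α / 2 * (v - g) ^ 2) := by
        field_simp
      rw [mul_add, mul_add] at h1
      rw [mul_add] at h2
      rw [mul_sub, mul_sub]
      linarith
  refine ⟨?_, ?_, htan, ?_⟩
  · exact hD.linear_image (LinearMap.lsmul ℝ ℝ (α / (L : ℝ)))
  · have h1 : Measurable fun p : (X × Y) × ℝ => ℓ p.1.2 (p.2 / (α / L)) :=
      hℓ.comp ((measurable_snd.comp measurable_fst).prodMk (measurable_snd.div_const _))
    have h2 : Measurable fun p : (X × Y) × ℝ => ℓ p.1.2 (h₀ p.1.1) :=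
      hℓ.comp ((measurable_snd.comp measurable_fst).prodMk
        (h₀m.comp (measurable_fst.comp measurable_fst)))
    exact (h1.sub h2).const_mul _
  · intro z v hv
    -- the loss vanishes at the prediction of `h₀`
    have hg : α / L * h₀ z.1 ∈ (fun d => α / L * d) '' D := ⟨_, h₀D _, rfl⟩
    have h0 : scaledLoss (X := X) ℓ h₀ (α / L) (α / (L : ℝ) ^ 2) z (α / L * h₀ z.1) = 0 := by
      simp [scaledLoss, predLoss, mul_div_cancel_left₀ _ ha.ne']
    have key : ∀ b c : ℝ, b ∈ (fun d => α / L * d) '' D → c ∈ (fun d => α / L * d) '' D →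
        scaledLoss (X := X) ℓ h₀ (α / L) (α / (L : ℝ) ^ 2) z b -
          scaledLoss (X := X) ℓ h₀ (α / L) (α / (L : ℝ) ^ 2) z c ≤ 1 / 2 := by
      intro b c hb hc
      obtain ⟨q, hq, hq'⟩ := htan z b hb
      have h1 := hq' c hc
      have h2 : -(q * (c - b)) ≤ |c - b| := by
        refine (neg_le_abs _).trans ?_
        rw [abs_mul]; exact mul_le_of_le_one_left (abs_nonneg _) hq
      nlinarith [sq_nonneg (|c - b| - 1), sq_abs (c - b)]
    have h1 := key v _ hv hg
    have h2 := key _ v hg hv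
    rw [h0] at h1 h2
    exact abs_le.2 ⟨by linarith, by linarith⟩

theorem risk_scaledPred {a η : ℝ} (ha : a ≠ 0) (P : Measure (X × Y)) (h : X → ℝ) :
    risk P (scaledLoss ℓ h₀ a η) (scaledPred a h) = η * excessRisk ℓ P h h₀ := by
  unfold risk excessRisk
  simp_rw [scaledLoss_scaledPred ha]
  exact integral_const_mul _ _

end Scaling

/-! ### Minimization over the convex hull of finitely many predictors -/

theorem convexHull_range_eq_image_stdSimplex {E : Type*} [AddCommGroup E] [Module ℝ E] {K : ℕ}
    (g : Fin K → E) :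
    convexHull ℝ (Set.range g) = (fun w : Fin K → ℝ => ∑ i, w i • g i) '' stdSimplex ℝ (Fin K) := by
  have h1 : (fun w : Fin K → ℝ => ∑ i, w i • g i) = Fintype.linearCombination ℝ g := rfl
  rw [h1, ← convexHull_rangle_single_eq_stdSimplex, LinearMap.image_convexHull, ← Set.range_comp]
  congr 2
  ext i
  simp [Fintype.linearCombination_apply, Pi.single_apply]

namespace NormLoss

variable {Z : Type*} [MeasurableSpace Z] {D : Set ℝ} {ℓ : Z → ℝ → ℝ} {P : Measure Z}
  [IsProbabilityMeasure P] {K : ℕ} {g : Fin K → Z → ℝ}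

theorem hull_mem (h : NormLoss D ℓ) (hgD : ∀ i z, g i z ∈ D) {h' : Z → ℝ}
    (hh : h' ∈ convexHull ℝ (Set.range g)) (z : Z) : h' z ∈ D := by
  have hc : Convex ℝ {h' : Z → ℝ | h' z ∈ D} :=
    h.convex.linear_preimage (LinearMap.proj z : (Z → ℝ) →ₗ[ℝ] ℝ)
  exact convexHull_min (by rintro _ ⟨i, rfl⟩; exact hgD i z) hc hh

theorem hull_measurable (hg : ∀ i, Measurable (g i)) {h' : Z → ℝ}
    (hh : h' ∈ convexHull ℝ (Set.range g)) : Measurable h' := by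
  rw [convexHull_range_eq_image_stdSimplex] at hh
  obtain ⟨w, -, rfl⟩ := hh
  have : (fun z => ∑ i, w i * g i z) = ∑ i, w i • g i := by ext z; simp
  simp only []
  rw [← this]
  exact Finset.measurable_sum _ fun i _ => (hg i).const_mul _

theorem continuousOn (h : NormLoss D ℓ) (z : Z) : ContinuousOn (ℓ z) D := by
  have : LipschitzOnWith 1 (ℓ z) D := LipschitzOnWith.of_dist_le_mul fun v hv w hw => by
    simpa [Real.dist_eq] using h.lip z hv hw
  exact this.continuousOn

/-- Empirical risk minimizers over the convex hull exist. -/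
theorem exists_hull_min_sum (h : NormLoss D ℓ) (hgD : ∀ i z, g i z ∈ D) (hK : 0 < K) {n : ℕ}
    (S : Fin n → Z) : ∃ h₁ ∈ convexHull ℝ (Set.range g), ∀ h₂ ∈ convexHull ℝ (Set.range g),
      ∑ t, ℓ (S t) (h₁ (S t)) ≤ ∑ t, ℓ (S t) (h₂ (S t)) := by
  have : Nonempty (Fin K) := ⟨⟨0, hK⟩⟩
  have hcomp : IsCompact (convexHull ℝ (Set.range g)) :=
    (Set.finite_range g).isCompact_convexHull ℝ
  have hne : (convexHull ℝ (Set.range g)).Nonempty := (Set.range_nonempty g).convexHull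
  refine hcomp.exists_isMinOn hne (f := fun h' : Z → ℝ => ∑ t, ℓ (S t) (h' (S t))) ?_
  refine continuousOn_finsetSum _ fun t _ => ?_
  exact (h.continuousOn (S t)).comp (continuous_apply (S t)).continuousOn
    fun h' hh => h.hull_mem hgD hh _

/-- Strong convexity at a midpoint. -/
theorem midpoint_le (h : NormLoss D ℓ) (z : Z) {v w : ℝ} (hv : v ∈ D) (hw : w ∈ D) :
    ℓ z ((v + w) / 2) + (v - w) ^ 2 / 8 ≤ (ℓ z v + ℓ z w) / 2 := by
  have hm : (v + w) / 2 ∈ D := by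
    have := h.convex hv hw (by norm_num : (0 : ℝ) ≤ 1 / 2) (by norm_num : (0 : ℝ) ≤ 1 / 2)
      (by norm_num)
    simp only [smul_eq_mul] at this
    convert! this using 1; ring
  obtain ⟨q, -, hq⟩ := h.tangent z _ hm
  have h1 := hq v hv
  have h2 := hq w hw
  nlinarith

/-- The minimizer of a sum of losses over a convex class has a quadratic margin. -/
theorem margin_of_min_sum (h : NormLoss D ℓ) {G : Set (Z → ℝ)} (hG : Convex ℝ G)
    (hGD : ∀ h' ∈ G, ∀ z, h' z ∈ D) {n : ℕ} (S : Fin n → Z) {h₁ h₂ : Z → ℝ} (hh₁ : h₁ ∈ G)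
    (hh₂ : h₂ ∈ G) (hmin : ∀ h' ∈ G, ∑ t, ℓ (S t) (h₁ (S t)) ≤ ∑ t, ℓ (S t) (h' (S t))) :
    ∑ t, ℓ (S t) (h₁ (S t)) + (∑ t, (h₁ (S t) - h₂ (S t)) ^ 2) / 4 ≤
      ∑ t, ℓ (S t) (h₂ (S t)) := by
  have hmid : (fun z => (h₁ z + h₂ z) / 2) ∈ G := by
    have := hG hh₁ hh₂ (by norm_num : (0 : ℝ) ≤ 1 / 2) (by norm_num : (0 : ℝ) ≤ 1 / 2)
      (by norm_num)
    convert! this using 1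
    ext z; simp; ring
  have h1 := hmin _ hmid
  have h2 := Finset.sum_le_sum fun t (_ : t ∈ Finset.univ) =>
    h.midpoint_le (S t) (hGD _ hh₁ (S t)) (hGD _ hh₂ (S t))
  rw [Finset.sum_add_distrib, ← Finset.sum_div, ← Finset.sum_div, Finset.sum_add_distrib] at h2
  linarith

/-- The minimizer of the risk over a convex class has a quadratic margin. -/
theorem margin_of_min_risk (h : NormLoss D ℓ) {G : Set (Z → ℝ)} (hG : Convex ℝ G)
    (hGD : ∀ h' ∈ G, ∀ z, h' z ∈ D) (hGm : ∀ h' ∈ G, Measurable h') {h₁ h₂ : Z → ℝ}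
    (hh₁ : h₁ ∈ G) (hh₂ : h₂ ∈ G) (hmin : ∀ h' ∈ G, risk P ℓ h₁ ≤ risk P ℓ h') :
    risk P ℓ h₁ + sqDist P h₁ h₂ / 4 ≤ risk P ℓ h₂ := by
  have hmid : (fun z => (h₁ z + h₂ z) / 2) ∈ G := by
    have := hG hh₁ hh₂ (by norm_num : (0 : ℝ) ≤ 1 / 2) (by norm_num : (0 : ℝ) ≤ 1 / 2)
      (by norm_num)
    convert! this using 1
    ext z; simp; ring
  have h1 := hmin _ hmid
  have i1 : Integrable (fun z => ℓ z (h₁ z)) P := h.integrable (hGm _ hh₁) (hGD _ hh₁)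
  have i2 : Integrable (fun z => ℓ z (h₂ z)) P := h.integrable (hGm _ hh₂) (hGD _ hh₂)
  have i3 : Integrable (fun z => ℓ z ((h₁ z + h₂ z) / 2)) P :=
    h.integrable (hGm _ hmid) (hGD _ hmid)
  have i4 : Integrable (fun z => (h₁ z - h₂ z) ^ 2 / 8) P :=
    (h.integrable_sq_sub (hGm _ hh₁) (hGD _ hh₁) (hGm _ hh₂) (hGD _ hh₂)).div_const 8
  have h2 : ∫ z, (ℓ z ((h₁ z + h₂ z) / 2) + (h₁ z - h₂ z) ^ 2 / 8) ∂P ≤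
      ∫ z, (ℓ z (h₁ z) + ℓ z (h₂ z)) / 2 ∂P :=
    integral_mono (i3.add i4) ((i1.add i2).div_const 2) fun z =>
      h.midpoint_le z (hGD _ hh₁ z) (hGD _ hh₂ z)
  rw [integral_add i3 i4, integral_div, integral_div, integral_add i1 i2] at h2
  unfold risk sqDist at *
  linarith

end NormLoss

/-- The coordinates of the vectors of a subspace of dimension at most `K` are controlled by their
norm, with leverages of total weight at most `K`. -/
theorem exists_leverage {n K : ℕ} (b : Fin K → EuclideanSpace ℝ (Fin n)) :
    ∃ lev : Fin n → ℝ, (∀ i, 0 ≤ lev i) ∧ ∑ i, lev i ≤ K ∧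
      ∀ d ∈ Submodule.span ℝ (Set.range b), ∀ i, d i ^ 2 ≤ lev i * ∑ t, d t ^ 2 := by
  set V := Submodule.span ℝ (Set.range b) with hV
  set e := stdOrthonormalBasis ℝ V with he
  refine ⟨fun i => ∑ j, ((e j : EuclideanSpace ℝ (Fin n)) i) ^ 2,
    fun i => Finset.sum_nonneg fun _ _ => sq_nonneg _, ?_, ?_⟩
  · rw [Finset.sum_comm]
    have h1 : ∀ j, ∑ i, ((e j : EuclideanSpace ℝ (Fin n)) i) ^ 2 = 1 := by
      intro j
      have h2 : ‖(e j : EuclideanSpace ℝ (Fin n))‖ = 1 := e.orthonormal.1 j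
      have h3 := EuclideanSpace.norm_sq_eq (e j : EuclideanSpace ℝ (Fin n))
      rw [h2] at h3
      simpa using h3.symm
    simp only [h1, Finset.sum_const, Finset.card_univ, Fintype.card_fin, nsmul_eq_mul, mul_one]
    have := finrank_range_le_card (R := ℝ) b
    rw [Fintype.card_fin] at this
    exact_mod_cast this
  · intro d hd i
    have h1 : d i = ∑ j, inner ℝ (e j) (⟨d, hd⟩ : V) * (e j : EuclideanSpace ℝ (Fin n)) i := by
      have h2 := e.sum_repr' (⟨d, hd⟩ : V)
      have h3 := congrArg (fun x : V => (x : EuclideanSpace ℝ (Fin n)) i) h2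
      simp at h3
      simpa using h3.symm
    have h4 : ∑ j, inner ℝ (e j) (⟨d, hd⟩ : V) ^ 2 = ∑ t, d t ^ 2 := by
      rw [e.sum_sq_inner_right]
      have := EuclideanSpace.norm_sq_eq d
      simpa using this
    rw [h1, ← h4, mul_comm]
    exact Finset.sum_mul_sq_le_sq_mul_sq _ _ _

namespace NormLoss

variable {Z : Type*} [MeasurableSpace Z] {D : Set ℝ} {ℓ : Z → ℝ → ℝ} {P : Measure Z}
  [IsProbabilityMeasure P] {K : ℕ} {g : Fin K → Z → ℝ}

/-- The leave-one-out bound: replacing the empirical risk minimizer by the minimizers that do not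
see the point on which they are evaluated costs at most twice the number of predictors, because
each of the changes is bounded by the leverage of the point left out. -/
theorem sum_leave_one_out_le (h : NormLoss D ℓ) (hgD : ∀ i z, g i z ∈ D) (hK : 0 < K) {m : ℕ}
    (S : Fin (m + 1) → Z) (A : Fin (m + 1) → Z → ℝ)
    (hA : ∀ i, A i ∈ convexHull ℝ (Set.range g))
    (hmin : ∀ i, ∀ h' ∈ convexHull ℝ (Set.range g),
      ∑ j, ℓ (S (i.succAbove j)) (A i (S (i.succAbove j))) ≤
        ∑ j, ℓ (S (i.succAbove j)) (h' (S (i.succAbove j))))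
    {h₀ : Z → ℝ} (hh₀ : h₀ ∈ convexHull ℝ (Set.range g)) :
    ∑ i, ℓ (S i) (A i (S i)) ≤ ∑ i, ℓ (S i) (h₀ (S i)) + 2 * K := by
  obtain ⟨h₁, hh₁, hmin₁⟩ := h.exists_hull_min_sum hgD hK S
  have hG : Convex ℝ (convexHull ℝ (Set.range g)) := convex_convexHull _ _
  have hGD : ∀ h' ∈ convexHull ℝ (Set.range g), ∀ z, h' z ∈ D := fun h' hh => h.hull_mem hgD hh
  obtain ⟨lev, hlev0, hlevK, hlev⟩ := exists_leverage
    fun k => (WithLp.toLp 2 fun t => g k (S t) : EuclideanSpace ℝ (Fin (m + 1)))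
  -- the values at the sample points depend linearly on the predictor
  have hspan : ∀ h' ∈ convexHull ℝ (Set.range g),
      (WithLp.toLp 2 fun t => h' (S t) : EuclideanSpace ℝ (Fin (m + 1))) ∈
        Submodule.span ℝ (Set.range fun k =>
          (WithLp.toLp 2 fun t => g k (S t) : EuclideanSpace ℝ (Fin (m + 1)))) := by
    intro h' hh
    rw [convexHull_range_eq_image_stdSimplex] at hh
    obtain ⟨w, -, rfl⟩ := hh
    have e : (WithLp.toLp 2 fun t => (∑ i, w i • g i) (S t) : EuclideanSpace ℝ (Fin (m + 1))) =
        ∑ i, w i • (WithLp.toLp 2 fun t => g i (S t) : EuclideanSpace ℝ (Fin (m + 1))) := by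
      ext t; simp
    simp only []
    rw [e]
    exact Submodule.sum_mem _ fun i _ =>
      Submodule.smul_mem _ _ (Submodule.subset_span ⟨i, rfl⟩)
  -- adding the margins of the two minimization problems bounds the squared distance of the minimizers
  -- on the sample by twice their distance `d` at the point left out
  have hstep : ∀ i, ℓ (S i) (A i (S i)) ≤ ℓ (S i) (h₁ (S i)) + 2 * lev i := by
    intro i
    have m1 := h.margin_of_min_sum hG hGD S hh₁ (hA i) hmin₁
    have m2 := h.margin_of_min_sum hG hGD (fun j => S (i.succAbove j)) (hA i) hh₁ (hmin i)
    rw [Fin.sum_univ_succAbove _ i, Fin.sum_univ_succAbove (fun t => ℓ (S t) (A i (S t))) i] at m1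
    have e1 := Fin.sum_univ_succAbove (fun t => (h₁ (S t) - A i (S t)) ^ 2) i
    have e2 : ∑ j, (A i (S (i.succAbove j)) - h₁ (S (i.succAbove j))) ^ 2 =
        ∑ j, (h₁ (S (i.succAbove j)) - A i (S (i.succAbove j))) ^ 2 :=
      Finset.sum_congr rfl fun j _ => by ring
    rw [e2] at m2
    have m3 := h.sub_le (S i) (hGD _ (hA i) (S i)) (hGD _ hh₁ (S i))
    have m4 := hlev _ (Submodule.sub_mem _ (hspan _ hh₁) (hspan _ (hA i))) i
    simp only [PiLp.sub_apply] at m4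
    have e3 : |A i (S i) - h₁ (S i)| = |h₁ (S i) - A i (S i)| := abs_sub_comm _ _
    have e4 : (A i (S i) - h₁ (S i)) ^ 2 = (h₁ (S i) - A i (S i)) ^ 2 := by ring
    rw [e3, e4] at m3
    set d := |h₁ (S i) - A i (S i)| with hd
    have hd0 : 0 ≤ d := abs_nonneg _
    have hdd : (h₁ (S i) - A i (S i)) ^ 2 = d ^ 2 := (sq_abs _).symm
    have hsum : ∑ t, (h₁ (S t) - A i (S t)) ^ 2 ≤ 2 * d := by
      rw [hdd] at m3 e1; linarith [sq_nonneg d]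
    have hle : d ≤ 2 * lev i := by
      rcases eq_or_lt_of_le hd0 with h0 | hpos
      · rw [← h0]; linarith [hlev0 i]
      · rw [hdd] at m4
        have h1 : d * d ≤ d * (2 * lev i) := by
          nlinarith [mul_le_mul_of_nonneg_left hsum (hlev0 i)]
        exact le_of_mul_le_mul_left h1 hpos
    nlinarith [sq_nonneg (h₁ (S i) - A i (S i))]
  calc ∑ i, ℓ (S i) (A i (S i)) ≤ ∑ i, (ℓ (S i) (h₁ (S i)) + 2 * lev i) :=
        Finset.sum_le_sum fun i _ => hstep i
    _ = ∑ i, ℓ (S i) (h₁ (S i)) + 2 * ∑ i, lev i := by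
        rw [Finset.sum_add_distrib, Finset.mul_sum]
    _ ≤ ∑ i, ℓ (S i) (h₀ (S i)) + 2 * K := by
        have := hmin₁ _ hh₀
        linarith

/-- The expected excess risk of empirical risk minimization over the convex hull of `K` predictors
is at most `2 K / (m + 1)`. -/
theorem integral_risk_hull_erm_le (h : NormLoss D ℓ) (hg : ∀ i, Measurable (g i))
    (hgD : ∀ i z, g i z ∈ D) (hK : 0 < K) {m : ℕ} {A : (Fin m → Z) → Z → ℝ}
    (hAm : Measurable fun p : (Fin m → Z) × Z => A p.1 p.2)
    (hA : ∀ S, A S ∈ convexHull ℝ (Set.range g))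
    (hmin : ∀ S, ∀ h' ∈ convexHull ℝ (Set.range g),
      ∑ j, ℓ (S j) (A S (S j)) ≤ ∑ j, ℓ (S j) (h' (S j)))
    {h₀ : Z → ℝ} (hh₀ : h₀ ∈ convexHull ℝ (Set.range g)) :
    ∫ S, risk P ℓ (A S) ∂(Measure.pi fun _ : Fin m => P) ≤ risk P ℓ h₀ + 2 * K / (m + 1) := by
  set μ : Measure (Fin (m + 1) → Z) := Measure.pi fun _ => P with hμ
  have hAD : ∀ S z, A S z ∈ D := fun S z => h.hull_mem hgD (hA S) z
  have hFm : Measurable fun p : Z × (Fin m → Z) => ℓ p.1 (A p.2 p.1) :=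
    h.meas.comp (measurable_fst.prodMk (hAm.comp measurable_swap))
  have hFi : Integrable (fun p : Z × (Fin m → Z) => ℓ p.1 (A p.2 p.1))
      (P.prod (Measure.pi fun _ : Fin m => P)) :=
    integrable_of_abs_le hFm fun p => h.bdd _ _ (hAD _ _)
  -- each point of a sample of size `m + 1` is independent of the minimizer for the other points
  have hterm : ∀ i : Fin (m + 1),
      ∫ S, ℓ (S i) (A (fun j => S (i.succAbove j)) (S i)) ∂μ =
        ∫ S, risk P ℓ (A S) ∂(Measure.pi fun _ : Fin m => P) := by
    intro i
    have h1 := (measurePreserving_piFinSuccAbove (fun _ : Fin (m + 1) => P) i).integral_comp'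
      (fun p : Z × (Fin m → Z) => ℓ p.1 (A p.2 p.1))
    have h2 := integral_prod_symm _ hFi
    exact h1.trans h2
  have hint : ∀ i : Fin (m + 1),
      Integrable (fun S : Fin (m + 1) → Z => ℓ (S i) (A (fun j => S (i.succAbove j)) (S i))) μ := by
    intro i
    refine integrable_of_abs_le ?_ fun S => h.bdd _ _ (hAD _ _)
    have h1 : Measurable fun S : Fin (m + 1) → Z => (S i, fun j => S (i.succAbove j)) := by
      fun_prop
    exact hFm.comp h1
  have h₀m := hull_measurable hg hh₀
  have h₀D := h.hull_mem hgD hh₀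
  have hint₀ : ∀ i : Fin (m + 1),
      Integrable (fun S : Fin (m + 1) → Z => ℓ (S i) (h₀ (S i))) μ := fun i =>
    integrable_of_abs_le ((h.meas_comp h₀m).comp (measurable_pi_apply i))
      fun S => h.bdd _ _ (h₀D _)
  have hterm₀ : ∀ i : Fin (m + 1), ∫ S, ℓ (S i) (h₀ (S i)) ∂μ = risk P ℓ h₀ := by
    intro i
    have h1 := (measurePreserving_eval (fun _ : Fin (m + 1) => P) i).map_eq
    have h2 : ∫ z, ℓ z (h₀ z) ∂(μ.map (Function.eval i)) = ∫ S, ℓ (S i) (h₀ (S i)) ∂μ :=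
      integral_map (measurable_pi_apply i).aemeasurable
        (h.meas_comp h₀m).aestronglyMeasurable
    rw [← h2, hμ, h1]; rfl
  have key : ∫ S, ∑ i, ℓ (S i) (A (fun j => S (i.succAbove j)) (S i)) ∂μ ≤
      ∫ S, (∑ i, ℓ (S i) (h₀ (S i)) + 2 * K) ∂μ := by
    refine integral_mono (integrable_finsetSum _ fun i _ => hint i)
      ((integrable_finsetSum _ fun i _ => hint₀ i).add (integrable_const _)) fun S => ?_
    exact h.sum_leave_one_out_le hgD hK S _ (fun i => hA _) (fun i => hmin _) hh₀
  have hi₀ : Integrable (fun S : Fin (m + 1) → Z => ∑ i, ℓ (S i) (h₀ (S i))) μ :=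
    integrable_finsetSum _ fun i _ => hint₀ i
  rw [integral_finsetSum _ fun i _ => hint i, integral_add hi₀ (integrable_const _),
    integral_finsetSum _ fun i _ => hint₀ i] at key
  simp only [hterm, hterm₀, Finset.sum_const, Finset.card_univ, Fintype.card_fin, nsmul_eq_mul,
    integral_const, probReal_univ, Nat.cast_add, Nat.cast_one, smul_eq_mul,
    one_mul] at key
  have hm : (0 : ℝ) < m + 1 := by positivity
  have e : risk P ℓ h₀ + 2 * K / (m + 1) = ((m + 1) * risk P ℓ h₀ + 2 * K) / (m + 1) := by
    field_simp
  rw [e, le_div_iff₀ hm]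
  linarith

/-- Markov's inequality is available here, since the minimal risk over the convex hull makes the excess
risk nonnegative. -/
theorem hull_erm_tail (h : NormLoss D ℓ) (hg : ∀ i, Measurable (g i))
    (hgD : ∀ i z, g i z ∈ D) (hK : 0 < K) {m : ℕ} {A : (Fin m → Z) → Z → ℝ}
    (hAm : Measurable fun p : (Fin m → Z) × Z => A p.1 p.2)
    (hA : ∀ S, A S ∈ convexHull ℝ (Set.range g))
    (hmin : ∀ S, ∀ h' ∈ convexHull ℝ (Set.range g),
      ∑ j, ℓ (S j) (A S (S j)) ≤ ∑ j, ℓ (S j) (h' (S j)))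
    {h₁ : Z → ℝ} (hh₁ : h₁ ∈ convexHull ℝ (Set.range g))
    (hmin₁ : ∀ h' ∈ convexHull ℝ (Set.range g), risk P ℓ h₁ ≤ risk P ℓ h') :
    (Measure.pi fun _ : Fin m => P)
      {S | risk P ℓ h₁ + Real.exp 1 * (2 * K / (m + 1)) < risk P ℓ (A S)} ≤
      ENNReal.ofReal (Real.exp (-1)) := by
  set μ : Measure (Fin m → Z) := Measure.pi fun _ => P with hμ
  have hRm : Measurable fun S => risk P ℓ (A S) := by
    have : Measurable fun p : (Fin m → Z) × Z => ℓ p.2 (A p.1 p.2) :=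
      h.meas.comp (measurable_snd.prodMk hAm)
    exact (this.stronglyMeasurable.integral_prod_right (ν := P)).measurable
  have hRi : Integrable (fun S => risk P ℓ (A S)) μ :=
    integrable_of_abs_le (c := 1 / 2) hRm fun S =>
      abs_integral_le_of_abs_le fun z => h.bdd z _ (h.hull_mem hgD (hA S) z)
  have hEi := h.integral_risk_hull_erm_le (P := P) hg hgD hK hAm hA hmin hh₁
  set r := 2 * (K : ℝ) / (m + 1) with hr
  have hK' : (0 : ℝ) < K := by exact_mod_cast hK
  have hr0 : 0 < r := by positivity
  have h1 := mul_meas_ge_le_integral_of_nonneg (μ := μ)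
    (f := fun S => risk P ℓ (A S) - risk P ℓ h₁)
    (Filter.Eventually.of_forall fun S => sub_nonneg.2 (hmin₁ _ (hA S)))
    (hRi.sub (integrable_const _)) (Real.exp 1 * r)
  rw [integral_sub hRi (integrable_const _)] at h1
  simp only [integral_const, probReal_univ, one_smul] at h1
  have h2 : μ.real {S | Real.exp 1 * r ≤ risk P ℓ (A S) - risk P ℓ h₁} ≤ Real.exp (-1) := by
    have h3 : (Real.exp 1 * r) *
        μ.real {S | Real.exp 1 * r ≤ risk P ℓ (A S) - risk P ℓ h₁} ≤ r := by linarith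
    have h4 : Real.exp (-1) * Real.exp 1 = 1 := by rw [← Real.exp_add]; simp
    have h5 : 0 < Real.exp 1 * r := by positivity
    rw [mul_comm, ← le_div_iff₀ h5] at h3
    refine h3.trans (le_of_eq ?_)
    rw [div_eq_iff h5.ne', ← mul_assoc, h4, one_mul]
  rw [← ENNReal.ofReal_toReal (measure_ne_top μ {S | _})]
  refine ENNReal.ofReal_le_ofReal (le_trans ?_ h2)
  exact measureReal_mono fun S hS => by
    rw [Set.mem_ofPred_eq] at hS ⊢; linarith

end NormLoss

/-! ### Selection among finitely many predictors -/

/-- Bernstein's inequality for a bounded function whose second moment is at most `4 Δ`. -/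
theorem pi_bernstein_le {Z : Type*} [MeasurableSpace Z] (P : Measure Z) [IsProbabilityMeasure P]
    {X : Z → ℝ} (hX : Measurable X) (hX1 : ∀ z, |X z| ≤ 1) {Δ : ℝ} (hΔ : ∫ z, X z ^ 2 ∂P ≤ 4 * Δ)
    (N : ℕ) (c : ℝ) :
    (Measure.pi fun _ : Fin N => P)
      {T | N * Δ / 2 + 8 * c ≤ ∑ i, X (T i) - N * ∫ z, X z ∂P} ≤
      ENNReal.ofReal (Real.exp (-c)) := by
  have hpred : Predictable (fun _ _ => X : ℕ → (ℕ → Z) → Z → ℝ) :=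
    { meas := fun t => hX.comp measurable_snd
      adapted := fun _ _ _ _ => rfl
      bdd := fun _ _ z => hX1 z }
  have hm : Measurable fun (S : ℕ → Z) (i : Fin N) => S i :=
    measurable_pi_lambda _ fun i => measurable_pi_apply _
  have hE : MeasurableSet {T : Fin N → Z | N * Δ / 2 + 8 * c ≤ ∑ i, X (T i) - N * ∫ z, X z ∂P} :=
    measurableSet_le measurable_const (by fun_prop)
  rw [← seqLaw_map_fin, Measure.map_apply hm hE]
  refine le_trans (measure_mono fun S hS => ?_)
    (hpred.freedman (P := P) (κ := 1 / 8) (by norm_num) (by norm_num) c N)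
  rw [Set.mem_preimage, Set.mem_ofPred_eq] at hS
  refine ⟨N, le_rfl, ?_⟩
  have h1 : centSum P (fun _ _ => X) N S = ∑ i : Fin N, X (S i) - N * ∫ z, X z ∂P := by
    unfold centSum
    rw [Finset.sum_sub_distrib, Finset.sum_range fun s => X (S s)]
    simp
  have h2 : quadVar P (fun _ _ => X) N S ≤ N * (4 * Δ) := by
    have h3 : ∫ z, (X z - ∫ z', X z' ∂P) ^ 2 ∂P ≤ 4 * Δ := by
      refine le_trans ?_ hΔ
      have := variance_le_expectation_sq (μ := P) (X := X) hX.aestronglyMeasurable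
      rw [variance_eq_integral hX.aemeasurable] at this
      exact this
    unfold quadVar
    rw [Finset.sum_const, Finset.card_range, nsmul_eq_mul]
    gcongr
  rw [h1]
  linarith

namespace NormLoss

variable {Z : Type*} [MeasurableSpace Z] {D : Set ℝ} {ℓ : Z → ℝ → ℝ} {P : Measure Z}
  [IsProbabilityMeasure P] {K : ℕ} {g : Fin K → Z → ℝ}

/-- An empirical risk minimizer among finitely many predictors competes with each of them, up to
a factor `3` in the excess risk over a predictor `h₁` that has a quadratic margin over them. -/
theorem selection_tail (h : NormLoss D ℓ) (hg : ∀ i, Measurable (g i))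
    (hgD : ∀ i z, g i z ∈ D) {h₁ : Z → ℝ} (hh₁ : Measurable h₁) (hh₁D : ∀ z, h₁ z ∈ D)
    (hmargin : ∀ i, risk P ℓ h₁ + sqDist P h₁ (g i) / 4 ≤ risk P ℓ (g i)) (N : ℕ) (c : ℝ) :
    (Measure.pi fun _ : Fin N => P) {T | ∃ i j,
      ∑ t, ℓ (T t) (g i (T t)) ≤ ∑ t, ℓ (T t) (g j (T t)) ∧
      3 * (N * (risk P ℓ (g j) - risk P ℓ h₁)) + 32 * c < N * (risk P ℓ (g i) - risk P ℓ h₁)} ≤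
      ENNReal.ofReal (2 * K * Real.exp (-c)) := by
  set X : Fin K → Z → ℝ := fun i z => ℓ z (g i z) - ℓ z (h₁ z) with hX
  have hXm : ∀ i, Measurable (X i) := fun i => (h.meas_comp (hg i)).sub (h.meas_comp hh₁)
  have hX1 : ∀ i z, |X i z| ≤ 1 := fun i z =>
    (h.abs_sub_le_half z (hgD i z) (hh₁D z)).trans (by norm_num)
  have hXi : ∀ i, ∫ z, X i z ∂P = risk P ℓ (g i) - risk P ℓ h₁ := fun i => by
    have i1 : Integrable (fun z => ℓ z (g i z)) P := h.integrable (hg i) (hgD i)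
    have i2 : Integrable (fun z => ℓ z (h₁ z)) P := h.integrable hh₁ hh₁D
    exact integral_sub i1 i2
  have hXsq : ∀ i, ∫ z, X i z ^ 2 ∂P ≤ 4 * (risk P ℓ (g i) - risk P ℓ h₁) := fun i => by
    have h1 : ∫ z, X i z ^ 2 ∂P ≤ sqDist P h₁ (g i) := by
      refine integral_mono (integrable_of_abs_le (c := 1) ((hXm i).pow_const 2) fun z => ?_)
        (h.integrable_sq_sub hh₁ hh₁D (hg i) (hgD i)) fun z => ?_
      · rw [abs_pow]; exact pow_le_one₀ (abs_nonneg _) (hX1 i z)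
      · simp only []
        rw [← sq_abs (X i z), ← sq_abs (h₁ z - g i z), abs_sub_comm (h₁ z)]
        exact pow_le_pow_left₀ (abs_nonneg _) (h.lip z (hgD i z) (hh₁D z)) 2
    linarith [hmargin i]
  set U : Fin K → Set (Fin N → Z) := fun i =>
    {T | N * (risk P ℓ (g i) - risk P ℓ h₁) / 2 + 8 * c ≤ ∑ t, X i (T t) - N * ∫ z, X i z ∂P} with hU
  set V : Fin K → Set (Fin N → Z) := fun i =>
    {T | N * (risk P ℓ (g i) - risk P ℓ h₁) / 2 + 8 * c ≤
      ∑ t, -X i (T t) - N * ∫ z, -X i z ∂P} with hV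
  have hUp : ∀ i, (Measure.pi fun _ : Fin N => P) (U i) ≤ ENNReal.ofReal (Real.exp (-c)) :=
    fun i => pi_bernstein_le P (hXm i) (hX1 i) (hXsq i) N c
  have hVp : ∀ i, (Measure.pi fun _ : Fin N => P) (V i) ≤ ENNReal.ofReal (Real.exp (-c)) :=
    fun i => pi_bernstein_le P (hXm i).neg (fun z => by simpa using hX1 i z)
      (by simpa using hXsq i) N c
  have hsub : {T : Fin N → Z | ∃ i j,
      ∑ t, ℓ (T t) (g i (T t)) ≤ ∑ t, ℓ (T t) (g j (T t)) ∧
      3 * (N * (risk P ℓ (g j) - risk P ℓ h₁)) + 32 * c < N * (risk P ℓ (g i) - risk P ℓ h₁)} ⊆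
      ⋃ i, (U i ∪ V i) := by
    rintro T ⟨i, j, hij, hlt⟩
    by_contra hT
    simp only [Set.mem_iUnion, Set.mem_union, not_exists, not_or] at hT
    have h1 := (hT j).1
    have h2 := (hT i).2
    rw [hU, Set.mem_ofPred_eq, not_le, hXi] at h1
    rw [hV, Set.mem_ofPred_eq, not_le, integral_neg, hXi, Finset.sum_neg_distrib] at h2
    have h3 : ∑ t, X i (T t) ≤ ∑ t, X j (T t) := by
      simp only [hX, Finset.sum_sub_distrib]; linarith
    linarith
  refine (measure_mono hsub).trans ((measure_iUnion_le _).trans ?_)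
  rw [tsum_fintype]
  calc ∑ i, (Measure.pi fun _ : Fin N => P) (U i ∪ V i)
      ≤ ∑ i : Fin K, ENNReal.ofReal (2 * Real.exp (-c)) :=
        Finset.sum_le_sum fun i _ => by
          refine (measure_union_le _ _).trans ((add_le_add (hUp i) (hVp i)).trans ?_)
          rw [← ENNReal.ofReal_add (by positivity) (by positivity), ← two_mul]
    _ = ENNReal.ofReal (2 * K * Real.exp (-c)) := by
        rw [Finset.sum_const, Finset.card_univ, Fintype.card_fin, nsmul_eq_mul,
          ← ENNReal.ofReal_natCast, ← ENNReal.ofReal_mul (by positivity)]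
        congr 1; ring

end NormLoss

/-! ### Confidence boosting -/

/-- A bound for all conditional probabilities given the first variable. -/
theorem prod_le_of_section_le {Ω Ω' : Type*} [MeasurableSpace Ω] [MeasurableSpace Ω']
    (μ : Measure Ω) [IsProbabilityMeasure μ] (ν : Measure Ω') [IsProbabilityMeasure ν]
    {E : Set (Ω × Ω')} (hE : MeasurableSet E) {p : ENNReal} (h : ∀ x, ν (Prod.mk x ⁻¹' E) ≤ p) :
    μ.prod ν E ≤ p := by
  rw [Measure.prod_apply hE]
  calc ∫⁻ x, ν (Prod.mk x ⁻¹' E) ∂μ ≤ ∫⁻ x, p ∂μ := lintegral_mono h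
    _ = p := by simp

/-- The first and the last of `K + L` independent variables are independent. -/
theorem pi_map_split {W : Type*} [MeasurableSpace W] (μ : Measure W) [IsProbabilityMeasure μ]
    (K L : ℕ) :
    (Measure.pi fun _ : Fin (K + L) => μ).map
      (fun S => (fun j => S (Fin.castAdd L j), fun j => S (Fin.natAdd K j))) =
      (Measure.pi fun _ : Fin K => μ).prod (Measure.pi fun _ : Fin L => μ) := by
  have hm : Measurable fun S : Fin (K + L) → W =>
      ((fun j => S (Fin.castAdd L j), fun j => S (Fin.natAdd K j)) :
        (Fin K → W) × (Fin L → W)) := by fun_prop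
  have ha : Measurable fun p : (Fin K → W) × (Fin L → W) => (Fin.append p.1 p.2 : _ → W) := by
    refine measurable_pi_lambda _ fun k => ?_
    refine Fin.addCases (fun i => ?_) (fun i => ?_) k
    · simp only [Fin.append_left]; fun_prop
    · simp only [Fin.append_right]; fun_prop
  have e : Measure.pi (fun _ : Fin (K + L) => μ) =
      ((Measure.pi fun _ : Fin K => μ).prod (Measure.pi fun _ : Fin L => μ)).map
        (fun p => Fin.append p.1 p.2) := by
    refine Measure.pi_eq fun s hs => ?_
    rw [Measure.map_apply ha (MeasurableSet.univ_pi hs)]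
    have : (fun p : (Fin K → W) × (Fin L → W) => (Fin.append p.1 p.2 : _ → W)) ⁻¹' Set.univ.pi s =
        (Set.univ.pi fun i => s (Fin.castAdd L i)) ×ˢ (Set.univ.pi fun i => s (Fin.natAdd K i)) := by
      ext p
      simp only [Set.mem_preimage, Set.mem_pi, Set.mem_univ, true_implies, Set.mem_prod]
      constructor
      · intro hp
        refine ⟨fun i => ?_, fun i => ?_⟩
        · simpa using hp (Fin.castAdd L i)
        · simpa using hp (Fin.natAdd K i)
      · rintro ⟨h1, h2⟩ k
        refine Fin.addCases (fun i => ?_) (fun i => ?_) k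
        · simpa using h1 i
        · simpa using h2 i
    rw [this, Measure.prod_prod, Measure.pi_pi, Measure.pi_pi, Fin.prod_univ_add]
  rw [e, Measure.map_map hm ha]
  convert! Measure.map_id using 2
  ext p
  · simp
  · simp

/-- The probability that all of `K` independent runs fail. -/
theorem pi_forall_mem_le {W : Type*} [MeasurableSpace W] (μ : Measure W) [IsProbabilityMeasure μ]
    (K : ℕ) {B : Set W} (hB : μ B ≤ ENNReal.ofReal (Real.exp (-1))) :
    (Measure.pi fun _ : Fin K => μ) {S | ∀ j, S j ∈ B} ≤ ENNReal.ofReal (Real.exp (-K)) := by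
  have e : {S : Fin K → W | ∀ j, S j ∈ B} = Set.univ.pi fun _ => B := by ext; simp
  rw [e, Measure.pi_pi, Finset.prod_const, Finset.card_univ, Fintype.card_fin]
  refine (pow_le_pow_left₀ (by positivity) hB K).trans (le_of_eq ?_)
  rw [← ENNReal.ofReal_pow (Real.exp_pos _).le, ← Real.exp_nat_mul]
  congr 2; ring

/-- The minimal risk over the convex hull of the predictors `g`, as an infimum over a countable
dense set of mixtures, which makes it measurable in the predictors. -/
noncomputable def hullRisk {Z : Type*} [MeasurableSpace Z] (P : Measure Z) (ℓ : Z → ℝ → ℝ) {K : ℕ}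
    [Nonempty (Fin K)] (g : Fin K → Z → ℝ) : ℝ :=
  ⨅ k : ℕ, risk P ℓ (∑ i, (TopologicalSpace.denseSeq (stdSimplex ℝ (Fin K)) k).1 i • g i)

namespace NormLoss

variable {Z : Type*} [MeasurableSpace Z] {D : Set ℝ} {ℓ : Z → ℝ → ℝ} {P : Measure Z}
  [IsProbabilityMeasure P] {K : ℕ} {g : Fin K → Z → ℝ}

theorem continuousOn_risk_mixture (h : NormLoss D ℓ) (hg : ∀ i, Measurable (g i))
    (hgD : ∀ i z, g i z ∈ D) :
    ContinuousOn (fun w : Fin K → ℝ => risk P ℓ (∑ i, w i • g i)) (stdSimplex ℝ (Fin K)) := by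
  have hmem : ∀ w ∈ stdSimplex ℝ (Fin K), ∑ i, w i • g i ∈ convexHull ℝ (Set.range g) :=
    fun w hw => by rw [convexHull_range_eq_image_stdSimplex]; exact ⟨w, hw, rfl⟩
  refine continuousOn_of_dominated (bound := fun _ => 1 / 2) ?_ ?_ (integrable_const _) ?_
  · intro w hw
    exact (h.meas_comp (hull_measurable hg (hmem w hw))).aestronglyMeasurable
  · intro w hw
    exact Filter.Eventually.of_forall fun z => h.bdd z _ (h.hull_mem hgD (hmem w hw) z)
  · refine Filter.Eventually.of_forall fun z => ?_
    refine (h.continuousOn z).comp (Continuous.continuousOn ?_)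
      fun w hw => h.hull_mem hgD (hmem w hw) z
    simp only [Finset.sum_apply, Pi.smul_apply, smul_eq_mul]
    fun_prop

/-- The infimum in `hullRisk` is attained, and it is the minimum over the whole convex hull. -/
theorem exists_risk_eq_hullRisk [Nonempty (Fin K)] (h : NormLoss D ℓ)
    (hg : ∀ i, Measurable (g i)) (hgD : ∀ i z, g i z ∈ D) :
    ∃ h₁ ∈ convexHull ℝ (Set.range g), risk P ℓ h₁ = hullRisk P ℓ g ∧
      ∀ h₂ ∈ convexHull ℝ (Set.range g), risk P ℓ h₁ ≤ risk P ℓ h₂ := by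
  have hcont := h.continuousOn_risk_mixture (P := P) hg hgD
  have hne : (stdSimplex ℝ (Fin K)).Nonempty :=
    ⟨_, single_mem_stdSimplex ℝ (Classical.arbitrary (Fin K))⟩
  obtain ⟨w, hw, hmin⟩ := (isCompact_stdSimplex ℝ (Fin K)).exists_isMinOn hne hcont
  refine ⟨∑ i, w i • g i, ?_, ?_, ?_⟩
  · rw [convexHull_range_eq_image_stdSimplex]; exact ⟨w, hw, rfl⟩
  · have hbdd : BddBelow (Set.range fun k : ℕ =>
        risk P ℓ (∑ i, (TopologicalSpace.denseSeq (stdSimplex ℝ (Fin K)) k).1 i • g i)) := by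
      refine ⟨risk P ℓ (∑ i, w i • g i), ?_⟩
      rintro _ ⟨k, rfl⟩
      exact hmin (TopologicalSpace.denseSeq (stdSimplex ℝ (Fin K)) k).2
    refine le_antisymm (le_ciInf fun k =>
      hmin (TopologicalSpace.denseSeq (stdSimplex ℝ (Fin K)) k).2) ?_
    have hc : Continuous fun w : stdSimplex ℝ (Fin K) => risk P ℓ (∑ i, w.1 i • g i) :=
      continuousOn_iff_continuous_domRestrict.1 hcont
    have hcl : IsClosed {w : stdSimplex ℝ (Fin K) | hullRisk P ℓ g ≤ risk P ℓ (∑ i, w.1 i • g i)} :=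
      isClosed_le continuous_const hc
    have hd := (TopologicalSpace.denseRange_denseSeq (stdSimplex ℝ (Fin K))).induction_on
      (p := fun w => hullRisk P ℓ g ≤ risk P ℓ (∑ i, w.1 i • g i)) ⟨w, hw⟩ hcl
      fun k => ciInf_le hbdd k
    exact hd
  · intro h₂ hh
    rw [convexHull_range_eq_image_stdSimplex] at hh
    obtain ⟨w', hw', rfl⟩ := hh
    exact hmin hw'

theorem measurable_risk {Ω : Type*} [MeasurableSpace Ω] (h : NormLoss D ℓ) {F : Ω → Z → ℝ}
    (hF : Measurable fun p : Ω × Z => F p.1 p.2) : Measurable fun ω => risk P ℓ (F ω) := by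
  have : Measurable fun p : Ω × Z => ℓ p.2 (F p.1 p.2) := h.meas.comp (measurable_snd.prodMk hF)
  exact (this.stronglyMeasurable.integral_prod_right (ν := P)).measurable

theorem measurable_hullRisk {Ω : Type*} [MeasurableSpace Ω] [Nonempty (Fin K)] (h : NormLoss D ℓ)
    {F : Ω → Fin K → Z → ℝ} (hF : ∀ i, Measurable fun p : Ω × Z => F p.1 i p.2) :
    Measurable fun ω => hullRisk P ℓ (F ω) := by
  refine Measurable.iInf fun k => h.measurable_risk ?_
  simp only [Finset.sum_apply, Pi.smul_apply, smul_eq_mul]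
  exact Finset.measurable_sum _ fun i _ => (hF i).const_mul _

/-- Confidence boosting: `K` runs of a learner `A` whose risk exceeds `b` with probability at most
`1 / e`, `K` runs of empirical risk minimization over the convex hull of their results, and the
selection of one of these. -/
theorem boosting_tail (h : NormLoss D ℓ) (hK : 0 < K) {m : ℕ} {A : (Fin m → Z) → Z → ℝ}
    (hAm : Measurable fun p : (Fin m → Z) × Z => A p.1 p.2) (hAD : ∀ s z, A s z ∈ D)
    {H : (Fin K → Fin m → Z) → (Fin m → Z) → Z → ℝ}
    (hHm : Measurable fun p : ((Fin K → Fin m → Z) × (Fin m → Z)) × Z => H p.1.1 p.1.2 p.2)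
    (hH : ∀ S s, H S s ∈ convexHull ℝ (Set.range fun j => A (S j)))
    (hmin : ∀ S s, ∀ h' ∈ convexHull ℝ (Set.range fun j => A (S j)),
      ∑ t, ℓ (s t) (H S s (s t)) ≤ ∑ t, ℓ (s t) (h' (s t)))
    {b : ℝ} (hb : (Measure.pi fun _ : Fin m => P) {s | b < risk P ℓ (A s)} ≤
      ENNReal.ofReal (Real.exp (-1))) (N : ℕ) (c : ℝ) :
    ((Measure.pi fun _ : Fin (K + K) => Measure.pi fun _ : Fin m => P).prod
      (Measure.pi fun _ : Fin N => P)) {ω | ∃ i,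
        (∀ j, ∑ t, ℓ (ω.2 t) (H (fun j => ω.1 (Fin.castAdd K j)) (ω.1 (Fin.natAdd K i)) (ω.2 t)) ≤
          ∑ t, ℓ (ω.2 t) (H (fun j => ω.1 (Fin.castAdd K j)) (ω.1 (Fin.natAdd K j)) (ω.2 t))) ∧
        N * (b + 3 * (Real.exp 1 * (2 * K / (m + 1)))) + 32 * c <
          N * risk P ℓ (H (fun j => ω.1 (Fin.castAdd K j)) (ω.1 (Fin.natAdd K i)))} ≤
      ENNReal.ofReal (Real.exp (-K)) + ENNReal.ofReal (Real.exp (-K)) +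
        ENNReal.ofReal (2 * K * Real.exp (-c)) := by
  have : Nonempty (Fin K) := ⟨⟨0, hK⟩⟩
  set μ : Measure (Fin m → Z) := Measure.pi fun _ => P with hμ
  have hAm' : ∀ s, Measurable (A s) := fun s => hAm.comp measurable_prodMk_left
  have hHm' : ∀ S s, Measurable (H S s) := fun S s =>
    hHm.comp (measurable_prodMk_left (x := (S, s)))
  have hHD : ∀ S s z, H S s z ∈ D := fun S s z => h.hull_mem (fun j z => hAD _ z) (hH S s) z
  have hex := fun S : Fin K → Fin m → Z => h.exists_risk_eq_hullRisk (P := P)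
    (g := fun j => A (S j)) (fun j => hAm' _) fun j z => hAD _ z
  have hhull : Measurable fun S : Fin K → Fin m → Z => hullRisk P ℓ fun j => A (S j) := by
    refine h.measurable_hullRisk fun i => ?_
    have h1 : Measurable fun p : (Fin K → Fin m → Z) × Z => (p.1 i, p.2) := by fun_prop
    exact hAm.comp h1
  have hpr : Measurable fun S : Fin (K + K) → Fin m → Z =>
      ((fun j => S (Fin.castAdd K j), fun j => S (Fin.natAdd K j)) :
        (Fin K → Fin m → Z) × (Fin K → Fin m → Z)) := by fun_prop
  -- all runs of the learner fail
  set E₁ : Set (Fin K → Fin m → Z) := {S | ∀ j, S j ∈ {s | b < risk P ℓ (A s)}} with hE₁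
  have hE₁m : MeasurableSet E₁ := by
    have : E₁ = ⋂ j, {S | b < risk P ℓ (A (S j))} := by ext S; simp [hE₁]
    rw [this]
    exact MeasurableSet.iInter fun j => measurableSet_lt measurable_const
      ((h.measurable_risk hAm).comp (measurable_pi_apply j))
  -- all runs of the minimization over the convex hull fail
  set r := Real.exp 1 * (2 * (K : ℝ) / (m + 1)) with hr
  set E₂ : Set ((Fin K → Fin m → Z) × (Fin K → Fin m → Z)) :=
    {p | ∀ j, hullRisk P ℓ (fun j => A (p.1 j)) + r < risk P ℓ (H p.1 (p.2 j))} with hE₂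
  have hHr : ∀ j, Measurable fun p : (Fin K → Fin m → Z) × (Fin K → Fin m → Z) =>
      risk P ℓ (H p.1 (p.2 j)) := by
    intro j
    refine h.measurable_risk
      (F := fun (p : (Fin K → Fin m → Z) × (Fin K → Fin m → Z)) z => H p.1 (p.2 j) z) ?_
    have h1 : Measurable fun p : ((Fin K → Fin m → Z) × (Fin K → Fin m → Z)) × Z =>
      ((p.1.1, p.1.2 j), p.2) := by fun_prop
    exact hHm.comp h1
  have hE₂m : MeasurableSet E₂ := by
    have : E₂ = ⋂ j, {p | hullRisk P ℓ (fun j => A (p.1 j)) + r < risk P ℓ (H p.1 (p.2 j))} := by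
      ext S; simp [hE₂]
    rw [this]
    exact MeasurableSet.iInter fun j => measurableSet_lt
      ((hhull.comp measurable_fst).add_const _) (hHr j)
  -- the selection fails
  set E₃ : Set (((Fin K → Fin m → Z) × (Fin K → Fin m → Z)) × (Fin N → Z)) :=
    {q | ∃ i j, ∑ t, ℓ (q.2 t) (H q.1.1 (q.1.2 i) (q.2 t)) ≤
        ∑ t, ℓ (q.2 t) (H q.1.1 (q.1.2 j) (q.2 t)) ∧
      3 * (N * (risk P ℓ (H q.1.1 (q.1.2 j)) - hullRisk P ℓ (fun j => A (q.1.1 j)))) + 32 * c <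
        N * (risk P ℓ (H q.1.1 (q.1.2 i)) - hullRisk P ℓ (fun j => A (q.1.1 j)))} with hE₃
  have hemp : ∀ j, Measurable fun q : ((Fin K → Fin m → Z) × (Fin K → Fin m → Z)) × (Fin N → Z) =>
      ∑ t, ℓ (q.2 t) (H q.1.1 (q.1.2 j) (q.2 t)) := by
    intro j
    refine Finset.measurable_sum _ fun t _ => ?_
    have h1 : Measurable fun q : ((Fin K → Fin m → Z) × (Fin K → Fin m → Z)) × (Fin N → Z) =>
      ((q.1.1, q.1.2 j), q.2 t) := by fun_prop
    have h2 : Measurable fun q : ((Fin K → Fin m → Z) × (Fin K → Fin m → Z)) × (Fin N → Z) =>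
      q.2 t := by fun_prop
    exact h.meas.comp (h2.prodMk (hHm.comp h1))
  have hE₃m : MeasurableSet E₃ := by
    have : E₃ = ⋃ i, ⋃ j, ({q | ∑ t, ℓ (q.2 t) (H q.1.1 (q.1.2 i) (q.2 t)) ≤
        ∑ t, ℓ (q.2 t) (H q.1.1 (q.1.2 j) (q.2 t))} ∩
      {q | 3 * (N * (risk P ℓ (H q.1.1 (q.1.2 j)) - hullRisk P ℓ (fun j => A (q.1.1 j)))) + 32 * c <
        N * (risk P ℓ (H q.1.1 (q.1.2 i)) - hullRisk P ℓ (fun j => A (q.1.1 j)))}) := by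
      ext q; simp [hE₃]
    rw [this]
    refine MeasurableSet.iUnion fun i => MeasurableSet.iUnion fun j =>
      (measurableSet_le (hemp i) (hemp j)).inter (measurableSet_lt ?_ ?_)
    · exact ((((hHr j).comp measurable_fst).sub
        (hhull.comp (measurable_fst.comp measurable_fst))).const_mul _).const_mul _ |>.add_const _
    · exact (((hHr i).comp measurable_fst).sub
        (hhull.comp (measurable_fst.comp measurable_fst))).const_mul _
  have hP₁ : (Measure.pi fun _ : Fin K => μ) E₁ ≤ ENNReal.ofReal (Real.exp (-K)) :=
    pi_forall_mem_le μ K hb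
  have hP₂ : ((Measure.pi fun _ : Fin K => μ).prod (Measure.pi fun _ : Fin K => μ)) E₂ ≤
      ENNReal.ofReal (Real.exp (-K)) := by
    refine prod_le_of_section_le _ _ hE₂m fun S => ?_
    obtain ⟨h₁, hh₁, hrisk, hmin₁⟩ := hex S
    refine pi_forall_mem_le μ K (B := {s | hullRisk P ℓ (fun j => A (S j)) + r <
      risk P ℓ (H S s)}) ?_
    rw [← hrisk]
    exact h.hull_erm_tail (g := fun j => A (S j)) (fun j => hAm' _) (fun j z => hAD _ z) hK
      (hHm.comp ((measurable_const.prodMk measurable_fst).prodMk measurable_snd))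
      (hH S) (hmin S) hh₁ hmin₁
  have hP₃ : (((Measure.pi fun _ : Fin K => μ).prod (Measure.pi fun _ : Fin K => μ)).prod
      (Measure.pi fun _ : Fin N => P)) E₃ ≤ ENNReal.ofReal (2 * K * Real.exp (-c)) := by
    refine prod_le_of_section_le _ _ hE₃m fun p => ?_
    obtain ⟨h₁, hh₁, hrisk, hmin₁⟩ := hex p.1
    have hkey := h.selection_tail (P := P) (g := fun j => H p.1 (p.2 j)) (fun j => hHm' _ _)
      (fun j z => hHD _ _ z) (hull_measurable (fun j => hAm' _) hh₁)
      (h.hull_mem (fun j z => hAD _ z) hh₁)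
      (fun i => h.margin_of_min_risk (convex_convexHull _ _)
        (fun h' hh => h.hull_mem (fun j z => hAD _ z) hh)
        (fun h' hh => hull_measurable (fun j => hAm' _) hh) hh₁ (hH _ _) hmin₁) N c
    rw [hrisk] at hkey
    exact hkey
  set pr := fun S : Fin (K + K) → Fin m → Z =>
      ((fun j => S (Fin.castAdd K j), fun j => S (Fin.natAdd K j)) :
        (Fin K → Fin m → Z) × (Fin K → Fin m → Z)) with hprdef
  have hmap : (Measure.pi fun _ : Fin (K + K) => μ).map pr =
      (Measure.pi fun _ : Fin K => μ).prod (Measure.pi fun _ : Fin K => μ) := pi_map_split μ K K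
  have hpq : Measurable fun ω : (Fin (K + K) → Fin m → Z) × (Fin N → Z) => (pr ω.1, ω.2) :=
    (hpr.comp measurable_fst).prodMk measurable_snd
  have hmap' : ((Measure.pi fun _ : Fin (K + K) => μ).prod (Measure.pi fun _ : Fin N => P)).map
      (fun ω => (pr ω.1, ω.2)) =
      ((Measure.pi fun _ : Fin K => μ).prod (Measure.pi fun _ : Fin K => μ)).prod
        (Measure.pi fun _ : Fin N => P) := by
    rw [← hmap]
    have := Measure.map_prod_map (Measure.pi fun _ : Fin (K + K) => μ)
      (Measure.pi fun _ : Fin N => P) hpr measurable_id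
    rw [Measure.map_id] at this
    exact this.symm
  set F : Set (((Fin K → Fin m → Z) × (Fin K → Fin m → Z)) × (Fin N → Z)) :=
    (E₁ ×ˢ Set.univ) ×ˢ Set.univ ∪ E₂ ×ˢ Set.univ ∪ E₃ with hF
  have hFm : MeasurableSet F :=
    (((hE₁m.prod MeasurableSet.univ).prod MeasurableSet.univ).union
      (hE₂m.prod MeasurableSet.univ)).union hE₃m
  refine (measure_mono (t := (fun ω => (pr ω.1, ω.2)) ⁻¹' F) ?_).trans ?_
  · rintro ⟨S, T⟩ ⟨i, hsel, hlt⟩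
    by_contra hnot
    rw [Set.mem_preimage, hF, Set.mem_union, Set.mem_union, not_or, not_or] at hnot
    obtain ⟨⟨n1, n2⟩, n3⟩ := hnot
    simp only [Set.mem_prod, Set.mem_univ, and_true] at n1 n2
    obtain ⟨h₁, hh₁, hrisk, hmin₁⟩ := hex (pr S).1
    simp only [hE₁, hE₂, hE₃, Set.mem_ofPred_eq, not_forall, not_lt] at n1 n2 n3
    obtain ⟨j₁, hj₁⟩ := n1
    obtain ⟨j₂, hj₂⟩ := n2
    have h3 : ¬ (3 * (N * (risk P ℓ (H (pr S).1 ((pr S).2 j₂)) -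
        hullRisk P ℓ (fun j => A ((pr S).1 j)))) + 32 * c <
        N * (risk P ℓ (H (pr S).1 ((pr S).2 i)) - hullRisk P ℓ (fun j => A ((pr S).1 j)))) :=
      fun hh => n3 ⟨i, j₂, hsel j₂, hh⟩
    rw [not_lt] at h3
    have h4 : hullRisk P ℓ (fun j => A ((pr S).1 j)) ≤ b := by
      rw [← hrisk]
      exact (hmin₁ _ (subset_convexHull ℝ _ ⟨j₁, rfl⟩)).trans hj₁
    have hN : (0 : ℝ) ≤ N := Nat.cast_nonneg N
    have h5 := mul_le_mul_of_nonneg_left h4 hN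
    have h6 := mul_le_mul_of_nonneg_left hj₂ hN
    have hlt' : N * (b + 3 * r) + 32 * c < N * risk P ℓ (H (pr S).1 ((pr S).2 i)) := hlt
    nlinarith
  · rw [← Measure.map_apply hpq hFm, hmap', hF]
    refine (measure_union_le _ _).trans (add_le_add ((measure_union_le _ _).trans
      (add_le_add ?_ ?_)) hP₃)
    · rw [Measure.prod_prod, Measure.prod_prod]; simpa using hP₁
    · rw [Measure.prod_prod]; simpa using hP₂

end NormLoss

/-! ### The progressive mixture rule as a normalized mixture -/

/-- Exponential weights do not see a change of the losses that is the same for all experts. -/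
theorem tilted_add_const {ι : Type*} [MeasurableSpace ι] (μ : Measure ι) (F : ι → ℝ) (c : ℝ) :
    (μ.tilted fun i => F i + c) = μ.tilted F := by
  unfold Measure.tilted
  congr 1
  ext i
  simp only [Real.exp_add, integral_mul_const]
  rw [mul_div_mul_right _ _ (Real.exp_pos c).ne']

section Mixture

variable {X : Type u} {Y : Type v} {ι : Type w} [MeasurableSpace X] [MeasurableSpace Y]
  [MeasurableSpace ι] {ℓ : Y → ℝ → ℝ} {h₀ : X → ℝ} {f : ι → X → ℝ} {prior : Measure ι} {a η : ℝ}

theorem expWeights_eq_tilted (ha : a ≠ 0) {m : ℕ} (T : ℕ → X × Y) {t : ℕ} (ht : t ≤ m) :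
    expWeights ℓ f prior η (fun i : Fin m => T i) t =
      prior.tilted fun i =>
        -cumLoss (scaledLoss ℓ h₀ a η) (fun i => scaledPred a (f i)) t T i := by
  have e : (fun i => -cumLoss (scaledLoss ℓ h₀ a η) (fun i => scaledPred a (f i)) t T i) =
      fun i => (-η * ∑ s : Fin m with s.val < t, predLoss ℓ (f i) (T s)) +
        η * ∑ s ∈ Finset.range t, predLoss ℓ h₀ (T s) := by
    ext i
    have h1 : ∑ s : Fin m with s.val < t, predLoss ℓ (f i) (T s) =
        ∑ s ∈ Finset.range t, predLoss ℓ (f i) (T s) := by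
      rw [Finset.sum_filter, ← Finset.sum_range fun s =>
        if s < t then predLoss ℓ (f i) (T s) else 0, ← Finset.sum_filter]
      congr 1
      ext s
      simp only [Finset.mem_filter, Finset.mem_range]
      omega
    rw [h1]
    simp only [cumLoss, scaledLoss_scaledPred ha, ← Finset.mul_sum, Finset.sum_sub_distrib]
    ring
  rw [e, tilted_add_const]
  rfl

/-- The progressive mixture rule is, up to scaling, the average of the posterior means for the scaled
loss. -/
theorem scaledPred_progMix (ha : a ≠ 0) {m : ℕ} (T : ℕ → X × Y) :
    scaledPred (Y := Y) a (progMix ℓ f prior η fun i : Fin m => T i) =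
      mixAvg (scaledLoss ℓ h₀ a η) (fun i => scaledPred a (f i)) prior (m + 1) T := by
  ext z
  have h1 : ∀ t ∈ Finset.range (m + 1),
      mixMean (scaledLoss ℓ h₀ a η) (fun i => scaledPred a (f i)) prior t T z =
        a * ∫ i, f i z.1 ∂(expWeights ℓ f prior η (fun i : Fin m => T i) t) := by
    intro t ht
    rw [mixMean, expWeights_eq_tilted (h₀ := h₀) ha T
      (Nat.lt_succ_iff.1 (Finset.mem_range.1 ht)), ← integral_const_mul]
    rfl
  rw [mixAvg, Finset.sum_congr rfl h1, ← Finset.mul_sum]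
  simp [scaledPred, progMix, mul_div_assoc]

end Mixture

/-- Extension of a finite sample to a sequence. -/
noncomputable def extendSample {Z : Type*} [Nonempty Z] {m : ℕ} (s : Fin m → Z) (i : ℕ) : Z :=
  if h : i < m then s ⟨i, h⟩ else Classical.arbitrary Z

theorem measurable_extendSample {Z : Type*} [MeasurableSpace Z] [Nonempty Z] {m : ℕ} :
    Measurable (extendSample : (Fin m → Z) → ℕ → Z) := by
  refine measurable_pi_lambda _ fun i => ?_
  unfold extendSample
  split_ifs with h
  · exact measurable_pi_apply _
  · exact measurable_const

theorem extendSample_val {Z : Type*} [Nonempty Z] {m : ℕ} (s : Fin m → Z) :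
    (fun i : Fin m => extendSample s i) = s := by
  ext i; simp [extendSample]

theorem Experts.measurable_mixAvg_extendSample {Z : Type*} {ι : Type*} [MeasurableSpace Z]
    [Nonempty Z] [MeasurableSpace ι] [Countable ι] [DiscreteMeasurableSpace ι] {D : Set ℝ}
    {ℓ : Z → ℝ → ℝ} {f : ι → Z → ℝ} (π : Measure ι) [IsProbabilityMeasure π]
    (h : Experts D ℓ f) (n m : ℕ) :
    Measurable fun p : (Fin m → Z) × Z => mixAvg ℓ f π n (extendSample p.1) p.2 := by
  have h1 : Measurable fun p : (Fin m → Z) × Z => (extendSample p.1, p.2) :=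
    (measurable_extendSample.comp measurable_fst).prodMk measurable_snd
  have h2 := (h.measurable_mixAvg (π := π) n).comp h1
  simpa only [Function.comp_def] using h2

/-- The regret tail of the averaged posterior means, for a finite sample. -/
theorem Experts.exists_sample_regret_tail : ∃ s₀ : ℝ, 0 ≤ s₀ ∧ ∀ {Z : Type u} {ι : Type w}
    [MeasurableSpace Z] [Nonempty Z]
    [MeasurableSpace ι] [Countable ι] [DiscreteMeasurableSpace ι] {D : Set ℝ} {ℓ : Z → ℝ → ℝ}
    {f : ι → Z → ℝ} (π : Measure ι) [IsProbabilityMeasure π] (P : Measure Z)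
    [IsProbabilityMeasure P] (_ : Experts D ℓ f) (ρ : Measure ι) [IsProbabilityMeasure ρ]
    (_ : InformationTheory.klDiv ρ π ≠ ⊤) (m : ℕ),
    (Measure.pi fun _ : Fin m => P) {s | ∫ z, meanLoss ℓ f ρ z ∂P +
        (Real.exp 1 * (InformationTheory.klDiv ρ π).toReal + s₀) / (m + 1) <
      risk P ℓ (mixAvg ℓ f π (m + 1) (extendSample s))} ≤ ENNReal.ofReal (Real.exp (-1)) := by
  obtain ⟨s₀, hs₀, htail⟩ := exists_regret_tail.{u, w}
  refine ⟨s₀, hs₀, ?_⟩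
  intro Z ι _ _ _ _ _ D ℓ f π _ P _ h ρ _ hρ m
  have hr : Measurable fun S => risk P ℓ (mixAvg ℓ f π (m + 1) S) :=
    h.loss.measurable_risk (h.measurable_mixAvg (m + 1))
  have hm : Measurable fun (S : ℕ → Z) (i : Fin m) => S i :=
    measurable_pi_lambda _ fun i => measurable_pi_apply _
  have hE : Measurable fun s : Fin m → Z => risk P ℓ (mixAvg ℓ f π (m + 1) (extendSample s)) :=
    hr.comp measurable_extendSample
  rw [← seqLaw_map_fin, Measure.map_apply hm (measurableSet_lt measurable_const hE)]
  refine le_trans (measure_mono fun S hS => ?_) (htail π P h ρ hρ m)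
  rw [Set.mem_preimage, Set.mem_ofPred_eq] at hS
  rw [Set.mem_ofPred_eq]
  have e : mixAvg ℓ f π (m + 1) (extendSample fun i : Fin m => S i) =
      mixAvg ℓ f π (m + 1) S := by
    ext z
    unfold mixAvg
    congr 1
    refine Finset.sum_congr rfl fun t ht => ?_
    rw [mixMean_congr t fun i hi => ?_]
    have : i < m := lt_of_lt_of_le hi (Nat.lt_succ_iff.1 (Finset.mem_range.1 ht))
    simp [extendSample, this]
  rw [e] at hS
  have hpos : (0 : ℝ) < m + 1 := by positivity
  have h1 := mul_lt_mul_of_pos_left hS hpos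
  rw [mul_add, mul_div_cancel₀ _ hpos.ne'] at h1
  linarith

section Redundancy

variable {X : Type u} {Y : Type v} {ι : Type w} [MeasurableSpace X] [MeasurableSpace Y]
  [MeasurableSpace ι] [Countable ι] [DiscreteMeasurableSpace ι] {D : Set ℝ} {ℓ : Y → ℝ → ℝ}
  {h₀ : X → ℝ} {f : ι → X → ℝ} {a η : ℝ} {P : Measure (X × Y)} [IsProbabilityMeasure P]

theorem integral_meanLoss_scaledLoss (hη : η ≠ 0) (ha : a ≠ 0)
    (h : Experts D (scaledLoss ℓ h₀ a η) fun i => scaledPred (Y := Y) a (f i))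
    (ρ : Measure ι) [IsProbabilityMeasure ρ] :
    ∫ z, meanLoss (scaledLoss ℓ h₀ a η) (fun i => scaledPred a (f i)) ρ z ∂P =
      η * ∫ z, ((∫ i, predLoss ℓ (f i) z ∂ρ) - predLoss ℓ h₀ z) ∂P := by
  rw [← integral_const_mul]
  congr 1
  ext z
  have hb : ∀ i, |η * (predLoss ℓ (f i) z - predLoss ℓ h₀ z)| ≤ 1 / 2 := fun i => by
    rw [← scaledLoss_scaledPred (h₀ := h₀) (η := η) ha]
    exact h.loss.bdd z _ (h.mem i z)
  have hi : Integrable (fun i => η * (predLoss ℓ (f i) z - predLoss ℓ h₀ z)) ρ :=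
    integrable_of_abs_le (measurable_of_countable _) hb
  have hi' : Integrable (fun i => predLoss ℓ (f i) z) ρ := by
    have h1 := (hi.const_mul η⁻¹).add (integrable_const (predLoss ℓ h₀ z))
    refine h1.congr (Filter.Eventually.of_forall fun i => ?_)
    simp [inv_mul_cancel_left₀ hη]
  unfold meanLoss
  simp_rw [scaledLoss_scaledPred ha]
  rw [integral_const_mul, integral_sub hi' (integrable_const _)]
  simp

/-- The mean excess risk of a mixing distribution is nonnegative; this is where `h₀` has to be a risk
minimizer. -/
theorem integral_meanLoss_nonneg (hη : 0 ≤ η) (ha : a ≠ 0)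
    (h : Experts D (scaledLoss ℓ h₀ a η) fun i => scaledPred (Y := Y) a (f i))
    (hmin : ∀ i, 0 ≤ excessRisk ℓ P (f i) h₀) (ρ : Measure ι) [IsProbabilityMeasure ρ] :
    0 ≤ ∫ z, meanLoss (scaledLoss ℓ h₀ a η) (fun i => scaledPred a (f i)) ρ z ∂P := by
  have hm : Measurable fun q : (X × Y) × ι =>
      scaledLoss ℓ h₀ a η q.1 (scaledPred a (f q.2) q.1) :=
    measurable_from_prod_countable_left fun i => h.loss.meas_comp (h.meas i)
  have hi : Integrable (fun q : (X × Y) × ι =>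
      scaledLoss ℓ h₀ a η q.1 (scaledPred a (f q.2) q.1)) (P.prod ρ) :=
    integrable_of_abs_le hm fun q => h.loss.bdd _ _ (h.mem _ _)
  have e := integral_integral_swap (f := fun z i =>
    scaledLoss ℓ h₀ a η z (scaledPred a (f i) z)) hi
  have e' : ∫ z, meanLoss (scaledLoss ℓ h₀ a η) (fun i => scaledPred a (f i)) ρ z ∂P =
      ∫ i, risk P (scaledLoss ℓ h₀ a η) (scaledPred a (f i)) ∂ρ := e
  rw [e']
  refine integral_nonneg fun i => ?_
  simp only [risk_scaledPred ha]
  exact mul_nonneg hη (hmin i)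

/-- Mixing distributions of nearly optimal redundancy exist. -/
theorem exists_near_bayesRedundancy (prior : Measure ι) [IsProbabilityMeasure prior] (m : ℕ)
    {ε : ℝ} (hε : 0 < ε) : ∃ ρ : Measure ι, IsProbabilityMeasure ρ ∧
      InformationTheory.klDiv ρ prior ≠ ⊤ ∧
      ∫ z, ((∫ i, predLoss ℓ (f i) z ∂ρ) - predLoss ℓ h₀ z) ∂P +
        (InformationTheory.klDiv ρ prior).toReal / (η * (m + 1)) <
      bayesRedundancy ℓ P f h₀ prior η m + ε := by
  have : Nonempty {ρ : ProbabilityMeasure ι //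
      InformationTheory.klDiv (ρ : Measure ι) prior ≠ ⊤} :=
    ⟨⟨⟨prior, inferInstance⟩, by simp [InformationTheory.klDiv_self]⟩⟩
  obtain ⟨ρ, hρ⟩ := exists_lt_of_ciInf_lt
    (show bayesRedundancy ℓ P f h₀ prior η m < bayesRedundancy ℓ P f h₀ prior η m + ε by linarith)
  exact ⟨ρ.1, inferInstance, ρ.2, hρ⟩

end Redundancy

/-! ### The confidence bound -/

section Erm

variable {X : Type u} {Y : Type v} {ℓ : Y → ℝ → ℝ} {h₀ : X → ℝ} {a η : ℝ}

theorem sum_scaledLoss_le_iff (ha : a ≠ 0) (hη : 0 < η) {N : ℕ} (S : Fin N → X × Y)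
    (h h' : X → ℝ) :
    ∑ t, scaledLoss ℓ h₀ a η (S t) (scaledPred a h (S t)) ≤
        ∑ t, scaledLoss ℓ h₀ a η (S t) (scaledPred a h' (S t)) ↔
      (∑ t, predLoss ℓ h (S t)) / N ≤ (∑ t, predLoss ℓ h' (S t)) / N := by
  rcases Nat.eq_zero_or_pos N with rfl | hN
  · simp
  have hN' : (0 : ℝ) < N := by exact_mod_cast hN
  simp only [scaledLoss_scaledPred ha, ← Finset.mul_sum, Finset.sum_sub_distrib]
  rw [mul_le_mul_iff_right₀ hη, div_le_div_iff_of_pos_right hN', sub_le_sub_iff_right]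

theorem convexHull_scaledPred {K : ℕ} (g : Fin K → X → ℝ) :
    convexHull ℝ (Set.range fun j => scaledPred (Y := Y) a (g j)) =
      scaledPred (Y := Y) a '' convexHull ℝ (Set.range g) := by
  rw [LinearMap.image_convexHull, ← Set.range_comp]
  rfl

/-- A rule for empirical risk minimization over the convex hull also minimizes the scaled loss. -/
theorem IsERMRule.scaled_hull [MeasurableSpace X] [MeasurableSpace Y] {D : Set ℝ} (ha : a ≠ 0)
    (hη : 0 < η) (h : NormLoss D (scaledLoss (X := X) ℓ h₀ a η)) {K m : ℕ} (hK : 0 < K)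
    {A : (Fin K → X → ℝ) → (Fin m → X × Y) → X → ℝ}
    (hA : IsERMRule ℓ (fun g => convexHull ℝ (Set.range g)) A) {g : Fin K → X → ℝ}
    (hg : ∀ j z, scaledPred (Y := Y) a (g j) z ∈ D) (s : Fin m → X × Y) :
    scaledPred (Y := Y) a (A g s) ∈ convexHull ℝ (Set.range fun j => scaledPred (Y := Y) a (g j)) ∧
    ∀ h' ∈ convexHull ℝ (Set.range fun j => scaledPred (Y := Y) a (g j)),
      ∑ t, scaledLoss ℓ h₀ a η (s t) (scaledPred a (A g s) (s t)) ≤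
        ∑ t, scaledLoss ℓ h₀ a η (s t) (h' (s t)) := by
  have hex : ∃ h₁, IsERM ℓ (convexHull ℝ (Set.range g)) s h₁ := by
    obtain ⟨h₁, hh₁, hmin⟩ := h.exists_hull_min_sum hg hK s
    rw [convexHull_scaledPred] at hh₁ hmin
    obtain ⟨h₁, hh₁, rfl⟩ := hh₁
    exact ⟨h₁, hh₁, fun h₂ hh₂ =>
      (sum_scaledLoss_le_iff ha hη s h₁ h₂).1 (hmin _ ⟨h₂, hh₂, rfl⟩)⟩
  obtain ⟨h1, h2⟩ := hA g s hex
  rw [convexHull_scaledPred]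
  refine ⟨⟨_, h1, rfl⟩, ?_⟩
  rintro _ ⟨h₂, hh₂, rfl⟩
  exact (sum_scaledLoss_le_iff ha hη s _ _).2 (h2 _ hh₂)

/-- A selection rule returns one of the finitely many predictors. -/
theorem IsERMRule.exists_eq {K N : ℕ} (hK : 0 < K)
    {A : (Fin K → X → ℝ) → (Fin N → X × Y) → X → ℝ}
    (hA : IsERMRule ℓ (fun g => Set.range g) A) (g : Fin K → X → ℝ) (T : Fin N → X × Y) :
    ∃ i, A g T = g i ∧
      ∀ j, (∑ t, predLoss ℓ (g i) (T t)) / N ≤ (∑ t, predLoss ℓ (g j) (T t)) / N := by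
  have : Nonempty (Fin K) := ⟨⟨0, hK⟩⟩
  obtain ⟨i₀, hi₀⟩ := Finite.exists_min fun i => (∑ t, predLoss ℓ (g i) (T t)) / (N : ℝ)
  obtain ⟨⟨i, hi⟩, h2⟩ := hA g T ⟨g i₀, ⟨i₀, rfl⟩, by rintro _ ⟨j, rfl⟩; exact hi₀ j⟩
  refine ⟨i, hi.symm, fun j => ?_⟩
  rw [hi]
  exact h2 _ ⟨j, rfl⟩

end Erm

/-- Adding up the errors of the three stages. -/
theorem add_stage_errors {e I Λ η br q s₀ K n c c₁ l l₀ C t x : ℝ} (he : 1 ≤ e)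
    (hI : 0 ≤ η * I) (hη : 0 < η) (hq : 0 ≤ q) (hbr : I + Λ * q / η < br + q / η) (hs₀ : 0 ≤ s₀)
    (hK : 1 ≤ K) (hn : 0 < n) (hqK : q ≤ 4 * K / n) (hKl : K ≤ c₁ * l) (hl₀ : 0 < l₀)
    (hl : l₀ ≤ l) (hc₁ : 0 ≤ c₁) (hc : c ≤ (6 * c₁ + 1) * l)
    (hC : C = 4 * (7 * e + s₀) * c₁ ^ 2 + 64 * (6 * c₁ + 1) / l₀) (ht : 0 ≤ t)
    (hx : e * br + C * (l ^ 2 / (η * n) + t) < x) :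
    η * I + (e * Λ + s₀) * q + 6 * e * K * q + 64 * c / n < η * x := by
  have h1 : η * I + Λ * q < η * br + q := by
    have := mul_lt_mul_of_pos_left hbr hη
    rwa [mul_add, mul_add, mul_div_cancel₀ _ hη.ne', mul_div_cancel₀ _ hη.ne'] at this
  have h2 : e * (η * I + Λ * q) < e * (η * br + q) := mul_lt_mul_of_pos_left h1 (by linarith)
  have h3 : (e + s₀ + 6 * e * K) * q ≤ 4 * (7 * e + s₀) * K ^ 2 / n := by
    calc (e + s₀ + 6 * e * K) * q ≤ ((7 * e + s₀) * K) * (4 * K / n) :=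
          mul_le_mul (by nlinarith) hqK hq (by positivity)
      _ = 4 * (7 * e + s₀) * K ^ 2 / n := by ring
  have h4 : 4 * (7 * e + s₀) * K ^ 2 / n ≤ 4 * (7 * e + s₀) * c₁ ^ 2 * (l ^ 2 / n) := by
    have : K ^ 2 ≤ (c₁ * l) ^ 2 := by gcongr
    calc 4 * (7 * e + s₀) * K ^ 2 / n ≤ 4 * (7 * e + s₀) * (c₁ * l) ^ 2 / n := by gcongr
      _ = _ := by ring
  have h5 : 64 * c / n ≤ 64 * (6 * c₁ + 1) / l₀ * (l ^ 2 / n) := by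
    have h6 : l ≤ l ^ 2 / l₀ := by
      rw [le_div_iff₀ hl₀, sq]
      exact mul_le_mul_of_nonneg_left hl (by linarith)
    calc 64 * c / n ≤ 64 * ((6 * c₁ + 1) * (l ^ 2 / l₀)) / n := by
          gcongr
          exact hc.trans (mul_le_mul_of_nonneg_left h6 (by linarith))
      _ = _ := by ring
  have hC0 : 0 ≤ C := by rw [hC]; positivity
  have h7 := mul_lt_mul_of_pos_left hx hη
  have h8 : η * (e * br + C * (l ^ 2 / (η * n) + t)) =
      e * (η * br) + C * (l ^ 2 / n) + C * (η * t) := by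
    field_simp
    ring
  have h9 : 0 ≤ C * (η * t) := by positivity
  have h10 : C * (l ^ 2 / n) = 4 * (7 * e + s₀) * c₁ ^ 2 * (l ^ 2 / n) +
      64 * (6 * c₁ + 1) / l₀ * (l ^ 2 / n) := by rw [hC]; ring
  have h11 : η * I ≤ e * (η * I) := le_mul_of_one_le_left hI he
  nlinarith

theorem numRuns_pos {δ : ℝ} (hδ : 0 < δ) (hδ1 : δ < 1) : 0 < numRuns δ := by
  refine Nat.ceil_pos.2 (Real.log_pos ?_)
  rw [lt_div_iff₀ hδ]; linarith

theorem exp_neg_numRuns_le {δ : ℝ} (hδ : 0 < δ) : Real.exp (-(numRuns δ : ℝ)) ≤ δ / 3 := by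
  have h1 : Real.log (3 / δ) ≤ numRuns δ := Nat.le_ceil _
  calc Real.exp (-(numRuns δ : ℝ)) ≤ Real.exp (-Real.log (3 / δ)) := by
        rw [Real.exp_le_exp]; linarith
    _ = δ / 3 := by rw [Real.exp_neg, Real.exp_log (by positivity), inv_div]

theorem numRuns_le {δ : ℝ} (hδ : 0 < δ) (hδ1 : δ < 1) :
    (numRuns δ : ℝ) ≤ Real.log (1 / δ) + 3 := by
  have h0 : 0 ≤ Real.log (3 / δ) := Real.log_nonneg (by rw [le_div_iff₀ hδ]; linarith)
  have h1 : (numRuns δ : ℝ) < Real.log (3 / δ) + 1 := Nat.ceil_lt_add_one h0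
  have h2 : Real.log (3 / δ) = Real.log 3 + Real.log (1 / δ) := by
    rw [← Real.log_mul (by norm_num) (by positivity)]; congr 1; ring
  have h3 : Real.log 3 ≤ 3 - 1 := Real.log_le_sub_one_of_pos (by norm_num)
  linarith

theorem mainTheorem6 (δ₀ : ℝ) (hδ₀ : δ₀ < 1) :
    ∃ C : ℝ, ∀ (X : Type u) (Y : Type v) (ι : Type w)
      [MeasurableSpace X] [MeasurableSpace Y]
      [Countable ι] [MeasurableSpace ι] [DiscreteMeasurableSpace ι]
      (P : Measure (X × Y)) [IsProbabilityMeasure P]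
      (D : Set ℝ) (ℓ : Y → ℝ → ℝ) (f : ι → X → ℝ)
      (prior : Measure ι) [IsProbabilityMeasure prior]
      (α : ℝ) (L : NNReal) (B : ℝ) (istar : ι) (δ : ℝ) (n : ℕ)
      (ermHull : (Fin (numRuns δ) → X → ℝ) →
        (Fin (n / (4 * numRuns δ)) → X × Y) → X → ℝ)
      (ermFin : (Fin (numRuns δ) → X → ℝ) → (Fin (n / 2) → X × Y) → X → ℝ),
      -- the loss and the experts
      Measurable (Function.uncurry ℓ) →
      (∀ i, Measurable (f i)) →
      (∀ i x, f i x ∈ D) →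
      0 < α → 0 < L →
      (∀ y, StrongConvexOn D α (ℓ y)) →
      (∀ y, LipschitzOnWith L (ℓ y) D) →
      (∀ᵐ z ∂P, ∀ i j, |predLoss ℓ (f i) z - predLoss ℓ (f j) z| ≤ B) →
      -- `f istar` is a risk minimizer over the experts
      (∀ i, 0 ≤ excessRisk ℓ P (f i) (f istar)) →
      -- the confidence level and the sample size
      0 < δ → δ ≤ δ₀ →
      0 < n → 4 * numRuns δ ∣ n →
      -- the two ERM rules used by the algorithm
      IsERMRule ℓ (fun g => convexHull ℝ (Set.range g)) ermHull →
      IsERMRule ℓ (fun g => Set.range g) ermFin →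
      (Measurable fun p : ((Fin (numRuns δ) → Fin (n / (4 * numRuns δ)) → X × Y) ×
          (Fin (n / (4 * numRuns δ)) → X × Y)) × X =>
        ermHull (fun j => progMix ℓ f prior (α / (L : ℝ) ^ 2) (p.1.1 j)) p.1.2 p.2) →
      sampleLaw P (numRuns δ) (n / (4 * numRuns δ)) (n / 2)
        {ω | ¬ excessRisk ℓ P
              (pmcb ℓ f prior (α / (L : ℝ) ^ 2) ermHull ermFin ω.1 ω.2) (f istar) ≤
            Real.exp 1 * bayesRedundancy ℓ P f (f istar) prior (α / (L : ℝ) ^ 2)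
                (n / (4 * numRuns δ))
              + C * (Real.log (1 / δ) ^ 2 / (α / (L : ℝ) ^ 2 * n)
                + B * Real.log (1 / δ) / n)} ≤ ENNReal.ofReal δ := by
  obtain ⟨s₀, hs₀, htail⟩ := Experts.exists_sample_regret_tail.{max u v, w}
  -- `numRuns δ ≤ c₁ log (1 / δ)` when `δ ≤ δ₀`
  set l₀ := Real.log (1 / δ₀) with hl₀
  set c₁ := 1 + 3 / l₀ with hc₁
  refine ⟨4 * (7 * Real.exp 1 + s₀) * c₁ ^ 2 + 64 * (6 * c₁ + 1) / l₀, ?_⟩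
  intro X Y ι _ _ _ _ _ P _ D ℓ f prior _ α L B istar δ n ermHull ermFin hℓ hf hfD hα hL hconv hlip
    hB hstar hδ hδδ₀ hn hdvd hHull hFin hmeas
  have hδ₀0 : 0 < δ₀ := hδ.trans_le hδδ₀
  have hδ1 : δ < 1 := hδδ₀.trans_lt hδ₀
  have hl₀0 : 0 < l₀ := Real.log_pos (by rw [lt_div_iff₀ hδ₀0]; linarith)
  set l := Real.log (1 / δ) with hl
  have hll : l₀ ≤ l := Real.log_le_log (by positivity) (by gcongr)
  have hl0 : 0 < l := hl₀0.trans_le hll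
  have hK : 0 < numRuns δ := numRuns_pos hδ hδ1
  have hKl : (numRuns δ : ℝ) ≤ c₁ * l := by
    have h1 : 3 ≤ 3 / l₀ * l := by
      rw [div_mul_eq_mul_div, le_div_iff₀ hl₀0]; linarith
    have := numRuns_le hδ hδ1
    rw [hc₁]; linarith
  have hKexp := exp_neg_numRuns_le hδ
  generalize numRuns δ = K at *
  generalize hm : n / (4 * K) = m at *
  generalize hN : n / 2 = N at *
  have hK' : (1 : ℝ) ≤ K := by exact_mod_cast hK
  have hnm : n = 4 * K * m := by rw [← hm, Nat.mul_div_cancel' hdvd]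
  have hnN : n = 2 * N := by
    have : 2 ∣ n := Dvd.dvd.trans ⟨2 * K, by ring⟩ hdvd
    omega
  have hn' : (0 : ℝ) < n := by exact_mod_cast hn
  have hNn : (N : ℝ) = n / 2 := by rw [hnN]; push_cast; ring
  have hmn : 1 / ((m : ℝ) + 1) ≤ 4 * K / n := by
    rw [div_le_div_iff₀ (by positivity) hn', hnm]; push_cast; nlinarith
  set η := α / (L : ℝ) ^ 2 with hη
  set a := α / (L : ℝ) with ha
  have hL' : (0 : ℝ) < L := hL
  have hη0 : 0 < η := by positivity
  have ha0 : a ≠ 0 := by positivity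
  have : Nonempty (X × Y) := nonempty_of_isProbabilityMeasure P
  have hloss : NormLoss ((fun d => a * d) '' D) (scaledLoss (X := X) ℓ (f istar) a η) :=
    normLoss_scaledLoss hℓ (hf istar) (hfD istar) hα hL hconv hlip inferInstance
  have hexp : Experts ((fun d => a * d) '' D) (scaledLoss (X := X) ℓ (f istar) a η)
      fun i => scaledPred (Y := Y) a (f i) :=
    { loss := hloss
      meas := fun i => ((hf i).comp measurable_fst).const_mul a
      mem := fun i z => ⟨f i z.1, hfD i z.1, rfl⟩ }
  -- a nearly optimal mixing distribution
  obtain ⟨ρ, hρ, hkl, hρBR⟩ := exists_near_bayesRedundancy (ℓ := ℓ) (P := P) (f := f)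
    (h₀ := f istar) (η := η) prior m (by positivity : 0 < 1 / (η * (m + 1)))
  have hmean := integral_meanLoss_scaledLoss (P := P) hη0.ne' ha0 hexp ρ
  have hmean0 := integral_meanLoss_nonneg (P := P) hη0.le ha0 hexp hstar ρ
  have hA : ∀ s : Fin m → X × Y, scaledPred (Y := Y) a (progMix ℓ f prior η s) =
      mixAvg (scaledLoss ℓ (f istar) a η) (fun i => scaledPred a (f i)) prior (m + 1)
        (extendSample s) := fun s => by
    rw [← scaledPred_progMix ha0, extendSample_val]
  have hAD : ∀ (s : Fin m → X × Y) z,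
      scaledPred (Y := Y) a (progMix ℓ f prior η s) z ∈ (fun d => a * d) '' D := fun s z => by
    rw [hA]; exact hexp.mixAvg_mem (Nat.succ_pos m) _ z
  have hAm : Measurable fun p : (Fin m → X × Y) × (X × Y) =>
      scaledPred (Y := Y) a (progMix ℓ f prior η p.1) p.2 := by
    simp only [hA]
    exact hexp.measurable_mixAvg_extendSample prior (m + 1) m
  have htail' := htail prior P hexp ρ hkl m
  simp only [← hA] at htail'
  have hHm : Measurable fun p : ((Fin K → Fin m → X × Y) × (Fin m → X × Y)) × (X × Y) =>
      scaledPred (Y := Y) a (ermHull (fun j => progMix ℓ f prior η (p.1.1 j)) p.1.2) p.2 := by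
    have h1 : Measurable fun p : ((Fin K → Fin m → X × Y) × (Fin m → X × Y)) × (X × Y) =>
        (p.1, p.2.1) := by fun_prop
    exact (hmeas.comp h1).const_mul a
  set c := Real.log (6 * K / δ) with hc
  have hboost := hloss.boosting_tail (P := P) hK hAm hAD
    (H := fun S s => scaledPred a (ermHull (fun j => progMix ℓ f prior η (S j)) s)) hHm
    (fun S s => (hHull.scaled_hull ha0 hη0 hloss hK (fun j => hAD (S j)) s).1)
    (fun S s => (hHull.scaled_hull ha0 hη0 hloss hK (fun j => hAD (S j)) s).2) htail' N c
  -- the three failure probabilities are at most `δ / 3` each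
  have hcexp : 2 * K * Real.exp (-c) = δ / 3 := by
    rw [hc, Real.exp_neg, Real.exp_log (by positivity)]
    field_simp; ring
  have hcl : c ≤ (6 * c₁ + 1) * l := by
    have h1 : c = Real.log (6 * K) + l := by
      rw [hc, hl, ← Real.log_mul (by positivity) (by positivity)]; congr 1; ring
    have h2 : Real.log (6 * K) ≤ 6 * K - 1 := Real.log_le_sub_one_of_pos (by positivity)
    linarith
  refine (measure_mono ?_).trans (hboost.trans ?_)
  · intro ω hω
    rw [Set.mem_ofPred_eq, not_le] at hω
    rw [Set.mem_ofPred_eq]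
    obtain ⟨i, hi, hsel⟩ := hFin.exists_eq hK (fun i => ermHull
      (fun j => progMix ℓ f prior η (ω.1 (Fin.castAdd K j))) (ω.1 (Fin.natAdd K i))) ω.2
    refine ⟨i, fun j => (sum_scaledLoss_le_iff ha0 hη0 ω.2 _ _).2 (hsel j), ?_⟩
    have hout : pmcb ℓ f prior η ermHull ermFin ω.1 ω.2 = ermHull
        (fun j => progMix ℓ f prior η (ω.1 (Fin.castAdd K j))) (ω.1 (Fin.natAdd K i)) := hi
    rw [hout] at hω
    have hB0 : 0 ≤ B := by
      obtain ⟨z, hz⟩ := hB.exists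
      exact (abs_nonneg _).trans (hz istar istar)
    have hm0 : (0 : ℝ) < m + 1 := by positivity
    have key := add_stage_errors (Λ := (InformationTheory.klDiv ρ prior).toReal)
      (q := 1 / ((m : ℝ) + 1)) (t := B * l / n)
      (by linarith [Real.add_one_le_exp 1] : 1 ≤ Real.exp 1) (hmean ▸ hmean0) hη0
      (by positivity) (by convert hρBR using 2 <;> field_simp) hs₀ hK' hn' hmn hKl hl₀0 hll
      (by positivity) hcl rfl (by positivity) hω
    rw [risk_scaledPred ha0, hNn, hmean]
    have hhalf := mul_lt_mul_of_pos_left key (by linarith : (0 : ℝ) < n / 2)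
    refine lt_of_eq_of_lt ?_ hhalf
    field_simp
    ring
  · have h1 : ENNReal.ofReal (Real.exp (-(K : ℝ))) ≤ ENNReal.ofReal (δ / 3) :=
      ENNReal.ofReal_le_ofReal hKexp
    rw [hcexp]
    calc _ ≤ ENNReal.ofReal (δ / 3) + ENNReal.ofReal (δ / 3) + ENNReal.ofReal (δ / 3) := by gcongr
      _ = ENNReal.ofReal δ := by
        rw [← ENNReal.ofReal_add (by positivity) (by positivity),
          ← ENNReal.ofReal_add (by positivity) (by positivity)]
        congr 1; ring
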